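/- **Optimal knot number for univariate spline units.** Let $r\ge 1$ and $p\ge r-1$ be integers. Let $\mathcal H^r([0,1])$ be the Sobolev space of functions with $r$ square-integrable derivatives, with norm $(\sum_{j\le r}\|\psi^{(j)}\|_{L^2([0,1])}^2)^{1/2}$, and fix the ball $\mathcal B_R$ of radius $R>0$ in it. Observe $Y_i=\psi(X_i)+\varepsilon_i$, $i=1,\dots,n$, where $X_1,\dots,X_n$ are i.i.d. on $[0,1]$ with a density bounded between two constants $a>0$ and $b<\infty$, and the $\varepsilon_i$ are i.i.d., independent of the $X_i$, with mean zero and finite variance. For $k\ge1$ consider splines $s=\sum_{i=0}^{k+p}c_iB_{i,p}$ of degree $p$ (order $p+1\ge r$) on $[0,1]$ with $k$ interior knots whose $k+1$ knot cells have lengths between $1/(\Lambda(k+1))$ and $\Lambda/(k+1)$ for a fixed $\Lambda\ge1$. Let $\hat\psi$ be the least-squares spline fit. Fix $0<\tau<a$, call the design stable if $\frac1n\sum_i s(X_i)^2\ge\tau\|s\|_{L^2([0,1])}^2$ for all these splines $s$, and let $\tilde\psi$ be $\hat\psi$ if the design is stable and $0$ otherwise. 1. There are constants $C,c>0$, which do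 not depend on $n$, $k$, the knots or $\psi$, such that for all $n\ge2$, $k\ge1$ with $k\log n\le cn$ and all such knots: (a) with probability at least $1-1/n$ the design is stable and, conditionally on the design, for all $\psi\in\mathcal B_R$ the least-squares estimator has squared bias $\|E\hat\psi-\psi\|_{L^2}^2\le Ck^{-2r}$ and variance $E\|\hat\psi-E\hat\psi\|_{L^2}^2\le Ck/n$; (b) unconditionally, for all $\psi\in\mathcal B_R$, $\|E\tilde\psi-\psi\|_{L^2}^2\le Ck^{-2r}$ and $E\|\tilde\psi-E\tilde\psi\|_{L^2}^2\le Ck/n$. In both cases the mean squared error is the sum of squared bias and variance. 2. For positive integers $k=k_n$ one has $k^{-2r}\asymp k/n$ if and only if $k\asymp n^{1/(2r+1)}$. 3. For any positive integers $k=k_n$ and any such knots, if $k\asymp n^{1/(2r+1)}$, then $\sup_{\psi\in\mathcal B_R}E\|\tilde\psi-\psi\|_{L^2}^2=O(n^{-2r/(2r+1)})$. Conversely, if the noise variance is positive, this rate is attained only for $k\asymp n^{1/(2r+1)}$. 4. This rate is minimax optimal: if the noise is $\mathcal N(0,\sigma^2)$ with $\sigma>0$, there is $c>0$ such that for all $n\ge1$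 every measurable estimator $\check\psi$ based on the $n$ observations satisfies $\sup_{\psi\in\mathcal B_R}E\|\check\psi-\psi\|_{L^2}^2\ge c\,n^{-2r/(2r+1)}$. -/

import Mathlib

open MeasureTheory Set Filter Asymptotics

namespace SplineReg

noncomputable section

/-! ### Sobolev functions on the unit interval -/

/-- `D 0, D 1, …, D r` are the derivatives of orders `0, …, r` of `ψ` on `[0,1]` in the sense of
`H^r([0,1])`: each is square integrable and each `D j` with `j < r` is absolutely continuous with
(almost everywhere, hence weak) derivative `D (j + 1)`. Here `ψ` is the continuous representative
of its class. -/
structure HasSobolevDerivs (r : ℕ) (ψ : ℝ → ℝ) (D : ℕ → ℝ → ℝ) : Prop where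
  zero : ∀ x ∈ Icc (0 : ℝ) 1, D 0 x = ψ x
  memLp : ∀ j ≤ r, MemLp (D j) 2 (volume.restrict (Icc (0 : ℝ) 1))
  ftc : ∀ j < r, ∀ x ∈ Icc (0 : ℝ) 1, D j x = D j 0 + ∫ y in (0 : ℝ)..x, D (j + 1) y

/-- The ball of radius `R` in `H^r([0,1])`, for the norm
`(∑_{j ≤ r} ‖ψ^{(j)}‖²_{L²([0,1])})^{1/2}`. -/
def sobolevBall (r : ℕ) (R : ℝ) : Set (ℝ → ℝ) :=
  {ψ | ∃ D : ℕ → ℝ → ℝ, HasSobolevDerivs r ψ D ∧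
    ∑ j ∈ Finset.range (r + 1), (∫ x in (0 : ℝ)..1, (D j x) ^ 2) ≤ R ^ 2}

/-! ### B-splines -/

/-- The B-spline `B_{i,p}` of degree `p` for the knots `t`, by the Cox–de Boor recursion
(a quotient with denominator zero is zero). -/
def bspline (t : ℕ → ℝ) : ℕ → ℕ → ℝ → ℝ
  | 0, i, x => (Ico (t i) (t (i + 1))).indicator (fun _ => (1 : ℝ)) x
  | p + 1, i, x =>
      (x - t i) / (t (i + p + 1) - t i) * bspline t p i x +
        (t (i + p + 2) - x) / (t (i + p + 2) - t (i + 1)) * bspline t p (i + 1) x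

/-- The knots `t 0 ≤ … ≤ t (k + 2 p + 1)` of a spline of degree `p` on `[0,1]` with `k` interior
knots `t (p + 1) < … < t (p + k)`; `t p = 0` and `t (p + k + 1) = 1` are the end points and the
remaining boundary knots are arbitrary (clamped or extended). The `k + 1` cells of `[0,1]` have
lengths comparable to `1 / (k + 1)`, up to the factor `Λ`. -/
structure QuasiUniformKnots (Λ : ℝ) (p k : ℕ) (t : ℕ → ℝ) : Prop where
  mono : MonotoneOn t (Iic (k + 2 * p + 1))
  left : t p = 0
  right : t (p + k + 1) = 1
  lower : ∀ i, p ≤ i → i ≤ p + k → 1 / (Λ * (k + 1)) ≤ t (i + 1) - t i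
  upper : ∀ i, p ≤ i → i ≤ p + k → t (i + 1) - t i ≤ Λ / (k + 1)

/-- The spline `∑_{i=0}^{k+p} c_i B_{i,p}`. -/
def spline (t : ℕ → ℝ) (p k : ℕ) (c : Fin (k + p + 1) → ℝ) (x : ℝ) : ℝ :=
  ∑ i, c i * bspline t p i x

/-! ### Least squares -/

/-- A rule that assigns to the design `x` and the responses `y` the coefficients of a
least-squares spline fit, that is, of a minimizer of the residual sum of squares over all splines. -/
def IsLeastSquares (t : ℕ → ℝ) (p k n : ℕ)
    (cHat : (Fin n → ℝ) → (Fin n → ℝ) → Fin (k + p + 1) → ℝ) : Prop :=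
  ∀ x y c, ∑ i, (y i - spline t p k (cHat x y) (x i)) ^ 2 ≤
    ∑ i, (y i - spline t p k c (x i)) ^ 2

/-- The design `x` is stable: the empirical second moment of every spline is at least `τ` times
its squared `L²([0,1])` norm (so the normal equations are well conditioned). -/
def StableDesign (t : ℕ → ℝ) (p k : ℕ) (τ : ℝ) {n : ℕ} (x : Fin n → ℝ) : Prop :=
  ∀ c : Fin (k + p + 1) → ℝ,
    τ * (∫ u in (0 : ℝ)..1, (spline t p k c u) ^ 2) ≤
      (n : ℝ)⁻¹ * ∑ i, (spline t p k c (x i)) ^ 2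

/-- The least-squares spline estimator with coefficient rule `cHat`, as a function of the design,
the responses and the point. -/
def lse (t : ℕ → ℝ) (p k : ℕ) {n : ℕ}
    (cHat : (Fin n → ℝ) → (Fin n → ℝ) → Fin (k + p + 1) → ℝ) :
    (Fin n → ℝ) → (Fin n → ℝ) → ℝ → ℝ :=
  fun x y => spline t p k (cHat x y)

open Classical in
/-- The least-squares spline estimator, replaced by `0` when the design is not stable. -/
def stableLse (t : ℕ → ℝ) (p k : ℕ) (τ : ℝ) {n : ℕ}
    (cHat : (Fin n → ℝ) → (Fin n → ℝ) → Fin (k + p + 1) → ℝ) :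
    (Fin n → ℝ) → (Fin n → ℝ) → ℝ → ℝ :=
  fun x y => if StableDesign t p k τ x then spline t p k (cHat x y) else 0

/-! ### The regression model, bias, variance and mean squared error -/

/-- The joint law of design points `X_1, …, X_n`, i.i.d. with law `μ`, and noise variables
`ε_1, …, ε_n`, i.i.d. with law `ν` and independent of the design. -/
def sampleLaw (μ ν : Measure ℝ) (n : ℕ) : Measure ((Fin n → ℝ) × (Fin n → ℝ)) :=
  (Measure.pi fun _ => μ).prod (Measure.pi fun _ => ν)

/-- The conditional law of design and noise given that the design is `x`. -/
def givenDesign (ν : Measure ℝ) {n : ℕ} (x : Fin n → ℝ) :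
    Measure ((Fin n → ℝ) × (Fin n → ℝ)) :=
  (Measure.dirac x).prod (Measure.pi fun _ => ν)

/-- The value at `u` of the estimate `T` computed from the data `(X_i, ψ(X_i) + ε_i)`,
where `z = (X, ε)`. -/
def estimate {n : ℕ} (T : (Fin n → ℝ) → (Fin n → ℝ) → ℝ → ℝ) (ψ : ℝ → ℝ)
    (z : (Fin n → ℝ) × (Fin n → ℝ)) (u : ℝ) : ℝ :=
  T z.1 (fun i => ψ (z.1 i) + z.2 i) u

/-- `‖E ψ̂ - ψ‖²` in `L²([0,1])`. -/
def sqBias {n : ℕ} (P : Measure ((Fin n → ℝ) × (Fin n → ℝ)))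
    (T : (Fin n → ℝ) → (Fin n → ℝ) → ℝ → ℝ) (ψ : ℝ → ℝ) : ENNReal :=
  ∫⁻ u in Icc (0 : ℝ) 1, ENNReal.ofReal (((∫ z, estimate T ψ z u ∂P) - ψ u) ^ 2)

/-- `E ‖ψ̂ - E ψ̂‖²` in `L²([0,1])`. -/
def variance {n : ℕ} (P : Measure ((Fin n → ℝ) × (Fin n → ℝ)))
    (T : (Fin n → ℝ) → (Fin n → ℝ) → ℝ → ℝ) (ψ : ℝ → ℝ) : ENNReal :=
  ∫⁻ z, (∫⁻ u in Icc (0 : ℝ) 1,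
    ENNReal.ofReal ((estimate T ψ z u - ∫ z', estimate T ψ z' u ∂P) ^ 2)) ∂P

/-- `E ‖ψ̂ - ψ‖²` in `L²([0,1])`. -/
def mse {n : ℕ} (P : Measure ((Fin n → ℝ) × (Fin n → ℝ)))
    (T : (Fin n → ℝ) → (Fin n → ℝ) → ℝ → ℝ) (ψ : ℝ → ℝ) : ENNReal :=
  ∫⁻ z, (∫⁻ u in Icc (0 : ℝ) 1, ENNReal.ofReal ((estimate T ψ z u - ψ u) ^ 2)) ∂P

/-- The mean `E ψ̂` exists on `[0,1)` (clamped B-splines all vanish at the end point `1`), the mean squared error splits into squared bias and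
variance, the squared bias is at most `B` and the variance is at most `V`. -/
def BiasVarianceBound {n : ℕ} (P : Measure ((Fin n → ℝ) × (Fin n → ℝ)))
    (T : (Fin n → ℝ) → (Fin n → ℝ) → ℝ → ℝ) (ψ : ℝ → ℝ) (B V : ℝ) : Prop :=
  (∀ u ∈ Ico (0 : ℝ) 1, Integrable (fun z => estimate T ψ z u) P) ∧
    mse P T ψ = sqBias P T ψ + variance P T ψ ∧
    sqBias P T ψ ≤ ENNReal.ofReal B ∧ variance P T ψ ≤ ENNReal.ofReal V

end

end SplineReg

namespace SplineReg

/-! ### B-splines: support, sign, Marsden's identity -/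

section BSpline

variable {t : ℕ → ℝ} {N : ℕ}

/-! Stability. On a knot cell a spline is a polynomial of degree at most `p`, and by compactness its
squared `L²` norm dominates the cell length times the sum of the squares of its coefficients in the
local monomials (`exists_monomial_lower_bound`, `exists_local_coords`). In these coordinates the
quadratic forms are block diagonal with blocks of size `p + 1`. Hence a design is stable as soon as
every empirical second moment of the cell monomials is within a small multiple of the cell length of
its expectation (`stableDesign_of_notMem`). A Chernoff bound that uses the variance, itself of the
order of the cell length, and a union bound over the cells make failure polynomially unlikely once
`k log n ≤ c n` (`measure_irregularDesign_le`, `irregular_bound_le_inv_pow`).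

Bias. Marsden's identity yields functionals that give the B-spline coefficients of polynomials and
are bounded by the size of the polynomial on a nearby cell. Applied to Taylor polynomials of the
regression function they give a quasi-interpolant whose squared error on a cell of length of order
`h` is at most a constant times `h^(2r-1)` times the integral of the squared `r`-th derivative
nearby (`exists_spline_approx`). On a stable design least squares is linear and reproduces splines,
so its conditional bias is the fit to this approximation error, minus the error itself.

Variance. `StableDesign.norm_sq_le_moments` bounds the squared norm of a fit by the squared
empirical moments of the responses against the cell monomials, weighted by inverse cell lengths. For
noise the expected sum is of order `k / n`. Unconditionally, the function is split into its
projection in `L²(μ)` and a residual orthogonal to the splines; centring the residual moments then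
costs nothing, and their contribution is of order `k / n` times the squared norm of the residual,
hence within both bounds. Unstable designs cost at most the size of the projection times a
negligible probability. `biasVarianceBound_of_decomposition` puts these terms together.

Necessity of the knot number. Three kinds of test functions suffice. A combination of bumps
orthogonal to all splines forces an error of order `k^(-2r)` (`exists_mse_ge_of_spline`). The
constant `R` shows that a small error makes unstable designs rare. The zero function then isolates
the noise, whose contribution is at least of order `k / n`, since the fit reproduces about `k / (p +
1)` B-splines with disjoint supports (`noise_le_mse_zero`).

Minimax bound. Assouad's method is run on sums of about `n^(1/(2r+1))` disjoint bumps with arbitrary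
signs: changing one sign alters the Gaussian data only by a bounded amount of information, so
neighbouring sign patterns cannot both be estimated well. The comparison is made pointwise in `u`,
where at most one bump is alive, and then integrated (`IsBump.le_pointMse_add`,
`IsBump.exists_le_mse`). -/

theorem bspline_eq_zero (ht : MonotoneOn t (Iic N)) {x : ℝ} :
    ∀ {q i : ℕ}, i + q + 1 ≤ N → x ∉ Ico (t i) (t (i + q + 1)) → bspline t q i x = 0 := by
  intro q
  induction q with
  | zero =>
    intro i _ hx
    simpa [bspline] using hx
  | succ q ih =>
    intro i hi hx
    have h1 : t i ≤ t (i + 1) := ht (by simp; omega) (by simp; omega) (by omega)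
    have h2 : t (i + q + 1) ≤ t (i + q + 2) := ht (by simp; omega) (by simp; omega) (by omega)
    have e1 : bspline t q i x = 0 := by
      refine ih (by omega) fun hm => hx ⟨hm.1, hm.2.trans_le ?_⟩
      exact h2
    have e2 : bspline t q (i + 1) x = 0 := by
      refine ih (by omega) fun hm => hx ⟨h1.trans hm.1, hm.2.trans_le (le_of_eq ?_)⟩
      congr 1; omega
    simp [bspline, e1, e2]

/-- Wherever a weight of the recursion is negative, the B-spline that it multiplies vanishes. -/
theorem bspline_nonneg (ht : MonotoneOn t (Iic N)) {x : ℝ} :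
    ∀ {q i : ℕ}, i + q + 1 ≤ N → 0 ≤ bspline t q i x := by
  intro q
  induction q with
  | zero =>
    intro i _
    exact indicator_nonneg (fun _ _ => zero_le_one) _
  | succ q ih =>
    intro i hi
    have h1 : t i ≤ t (i + q + 1) := ht (by simp; omega) (by simp; omega) (by omega)
    have h2 : t (i + 1) ≤ t (i + q + 2) := ht (by simp; omega) (by simp; omega) (by omega)
    simp only [bspline]
    refine add_nonneg ?_ ?_
    · by_cases hx : t i ≤ x
      · exact mul_nonneg (div_nonneg (by linarith) (by linarith)) (ih (by omega))
      · rw [bspline_eq_zero ht (by omega) (fun h => hx h.1), mul_zero]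
    · by_cases hx : x < t (i + q + 2)
      · exact mul_nonneg (div_nonneg (by linarith) (by linarith)) (ih (by omega))
      · rw [bspline_eq_zero ht (by omega) (fun h => hx ?_), mul_zero]
        have : i + 1 + q + 1 = i + q + 2 := by omega
        exact this ▸ h.2

theorem measurable_bspline (t : ℕ → ℝ) : ∀ q i, Measurable (bspline t q i)
  | 0, i => by
    have : bspline t 0 i = (Ico (t i) (t (i + 1))).indicator (fun _ => (1 : ℝ)) := by
      ext x; rfl
    rw [this]
    exact measurable_const.indicator measurableSet_Ico
  | q + 1, i => by
    have h1 := measurable_bspline t q i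
    have h2 := measurable_bspline t q (i + 1)
    have : bspline t (q + 1) i = fun x => (x - t i) / (t (i + q + 1) - t i) * bspline t q i x +
        (t (i + q + 2) - x) / (t (i + q + 2) - t (i + 1)) * bspline t q (i + 1) x := by
      ext x; rfl
    rw [this]
    fun_prop

/-- Marsden's identity. -/
theorem marsden (ht : MonotoneOn t (Iic N)) (w : ℝ) {x : ℝ} :
    ∀ {q M : ℕ}, M + q ≤ N → q ≤ M → x ∈ Ico (t q) (t M) →
      ∑ i ∈ Finset.range M, bspline t q i x * ∏ m ∈ Finset.range q, (t (i + m + 1) + w) =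
        (x + w) ^ q := by
  intro q
  induction q with
  | zero =>
    intro M hM _ hx
    -- An indicator of a half-open interval is a difference of two step functions, so the sum
    -- telescopes.
    have : ∀ i ∈ Finset.range M, bspline t 0 i x * ∏ m ∈ Finset.range 0, (t (i + m + 1) + w) =
        (if x < t (i + 1) then (1 : ℝ) else 0) - (if x < t i then 1 else 0) := by
      intro i hi
      have hi' := Finset.mem_range.1 hi
      have h1 : t i ≤ t (i + 1) := ht (by simp; omega) (by simp; omega) (by omega)
      simp only [bspline, indicator, mem_Ico, Finset.range_zero, Finset.prod_empty, mul_one]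
      by_cases h2 : x < t (i + 1) <;> by_cases h3 : x < t i
      · simp [h2, h3, not_le.2 h3]
      · simp [h2, h3, not_lt.1 h3]
      · exact absurd (h3.trans_le h1) h2
      · simp [h2, h3]
    rw [Finset.sum_congr rfl this, Finset.sum_range_sub (fun i => if x < t i then (1 : ℝ) else 0)]
    simp [hx.2, hx.1]
  | succ q ih =>
    intro M hM hqM hx
    have hq1 : t q ≤ t (q + 1) := ht (by simp; omega) (by simp; omega) (by omega)
    have hM1 : t M ≤ t (M + 1) := ht (by simp; omega) (by simp; omega) (by omega)
    have key := ih (M := M + 1) (by omega) (by omega) ⟨hq1.trans hx.1, hx.2.trans_le hM1⟩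
    -- After inserting the recursion, each B-spline of degree `q` occurs twice, with the weights in
    -- `F i` and `G i`. The boundary terms `F M` and `G 0` vanish at `x`, so both sums run over `M +
    -- 1` indices, and the two weights of one B-spline combine linearly to its weight in degree `q`
    -- times `x + w`.
    set F : ℕ → ℝ := fun i => (x - t i) / (t (i + q + 1) - t i) * bspline t q i x *
      ∏ m ∈ Finset.range (q + 1), (t (i + m + 1) + w) with hF
    set G : ℕ → ℝ := fun i => (t (i + q + 1) - x) / (t (i + q + 1) - t i) * bspline t q i x *
      ∏ m ∈ Finset.range (q + 1), (t (i + m) + w) with hG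
    have e1 : ∀ i ∈ Finset.range M, bspline t (q + 1) i x *
        ∏ m ∈ Finset.range (q + 1), (t (i + m + 1) + w) = F i + G (i + 1) := by
      intro i _
      simp only [hF, hG, bspline]
      have a2 : ∀ m, i + 1 + m = i + m + 1 := by intro m; omega
      simp only [a2]
      ring
    have FM : F M = 0 := by
      simp only [hF]
      rw [bspline_eq_zero ht (by omega) (fun h => absurd hx.2 (not_lt.2 h.1))]
      simp
    have G0 : G 0 = 0 := by
      simp only [hG]
      rw [bspline_eq_zero ht (by omega) (fun h => absurd hx.1 (not_le.2 ?_))]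
      · simp
      · simpa using h.2
    rw [Finset.sum_congr rfl e1, Finset.sum_add_distrib]
    have s1 : ∑ i ∈ Finset.range M, F i = ∑ i ∈ Finset.range (M + 1), F i := by
      rw [Finset.sum_range_succ, FM, add_zero]
    have s2 : ∑ i ∈ Finset.range M, G (i + 1) = ∑ i ∈ Finset.range (M + 1), G i := by
      rw [Finset.sum_range_succ', G0, add_zero]
    rw [s1, s2, ← Finset.sum_add_distrib, pow_succ, ← key, Finset.sum_mul]
    refine Finset.sum_congr rfl fun i hi => ?_
    have hi' := Finset.mem_range.1 hi
    by_cases hxi : x ∈ Ico (t i) (t (i + q + 1))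
    · have hpos : t (i + q + 1) - t i ≠ 0 := by
        have := hxi.1.trans_lt hxi.2
        linarith
      simp only [hF, hG]
      rw [Finset.prod_range_succ (fun m => t (i + m + 1) + w),
        Finset.prod_range_succ' (fun m => t (i + m) + w)]
      have a2 : ∀ m, i + (m + 1) = i + m + 1 := by intro m; omega
      simp only [a2, add_zero]
      field_simp
      ring
    · have := bspline_eq_zero ht (by omega) hxi
      simp [hF, hG, this]

/-- The coefficients of the polynomials `x ↦ (p choose l) x ^ l` in terms of B-splines. -/
theorem sum_bspline_mul_coeff (ht : MonotoneOn t (Iic N)) {x : ℝ} {q M : ℕ} (hM : M + q ≤ N)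
    (hq : q ≤ M) (hx : x ∈ Ico (t q) (t M)) (l : ℕ) :
    ∑ i ∈ Finset.range M, bspline t q i x *
        (∏ m ∈ Finset.range q, (Polynomial.X + Polynomial.C (t (i + m + 1)))).coeff l =
      x ^ (q - l) * (q.choose l) := by
  -- With `x` fixed, Marsden's identity is an identity of polynomials in `w`, whose coefficients may
  -- be compared.
  have h : ∑ i ∈ Finset.range M, Polynomial.C (bspline t q i x) *
        ∏ m ∈ Finset.range q, (Polynomial.X + Polynomial.C (t (i + m + 1))) =
      (Polynomial.X + Polynomial.C x) ^ q := by
    refine Polynomial.funext fun w => ?_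
    have := marsden ht w hM hq hx
    simp only [Polynomial.eval_finsetSum, Polynomial.eval_mul, Polynomial.eval_C,
      Polynomial.eval_prod, Polynomial.eval_add, Polynomial.eval_X, Polynomial.eval_pow]
    rw [add_comm w x, ← this]
    simp only [add_comm w]
  have := congrArg (fun P => Polynomial.coeff P l) h
  simpa [Polynomial.coeff_X_add_C_pow, Polynomial.finsetSum_coeff] using this

theorem bspline_eq_poly (ht : MonotoneOn t (Iic N)) {j : ℕ} (hj : j + 1 ≤ N) :
    ∀ {q i : ℕ}, i + q + 1 ≤ N → ∃ P : Polynomial ℝ, P.natDegree ≤ q ∧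
      ∀ x ∈ Ico (t j) (t (j + 1)), bspline t q i x = P.eval x := by
  intro q
  induction q with
  | zero =>
    intro i hi
    by_cases hij : i = j
    · subst hij
      exact ⟨1, by simp, fun x hx => by simp [bspline, indicator, hx.1, hx.2]⟩
    · refine ⟨0, by simp, fun x hx => ?_⟩
      rw [bspline_eq_zero ht hi]
      · simp
      · intro hx'
        rcases lt_or_gt_of_ne hij with h | h
        · have : t (i + 1) ≤ t j := ht (by simp; omega) (by simp; omega) (by omega)
          exact absurd hx'.2 (not_lt.2 (this.trans hx.1))
        · have : t (j + 1) ≤ t i := ht (by simp; omega) (by simp; omega) (by omega)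
          exact absurd hx.2 (not_lt.2 (this.trans hx'.1))
  | succ q ih =>
    intro i hi
    obtain ⟨P, hP, hPe⟩ := ih (i := i) (by omega)
    obtain ⟨Q, hQ, hQe⟩ := ih (i := i + 1) (by omega)
    refine ⟨Polynomial.C (t (i + q + 1) - t i)⁻¹ * ((Polynomial.X - Polynomial.C (t i)) * P) +
      Polynomial.C (-(t (i + q + 2) - t (i + 1))⁻¹) *
        ((Polynomial.X - Polynomial.C (t (i + q + 2))) * Q), ?_, ?_⟩
    · refine Polynomial.natDegree_add_le_of_degree_le ?_ ?_
      · refine (Polynomial.natDegree_C_mul_le _ _).trans (Polynomial.natDegree_mul_le.trans ?_)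
        rw [Polynomial.natDegree_X_sub_C]; omega
      · refine (Polynomial.natDegree_C_mul_le _ _).trans (Polynomial.natDegree_mul_le.trans ?_)
        rw [Polynomial.natDegree_X_sub_C]; omega
    · intro x hx
      simp only [bspline, hPe x hx, hQe x hx, Polynomial.eval_add, Polynomial.eval_mul,
        Polynomial.eval_sub, Polynomial.eval_X, Polynomial.eval_C]
      ring

end BSpline

/-! ### Cells of a quasi-uniform knot sequence -/

theorem poly_eq_zero_of_Ico {P : Polynomial ℝ} {a b : ℝ} (hab : a < b)
    (h : ∀ x ∈ Ico a b, P.eval x = 0) : P = 0 :=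
  Polynomial.eq_zero_of_infinite_isRoot P ((Ico_infinite hab).mono fun x hx => h x hx)

namespace QuasiUniformKnots

variable {Λ : ℝ} {p k : ℕ} {t : ℕ → ℝ}

theorem cell_lt (hΛ : 1 ≤ Λ) (ht : QuasiUniformKnots Λ p k t) {j : ℕ} (hj : j ≤ k) :
    t (p + j) < t (p + j + 1) := by
  have := ht.lower (p + j) (by omega) (by omega)
  have h : 0 < 1 / (Λ * (k + 1)) := by positivity
  linarith

theorem cell_subset (ht : QuasiUniformKnots Λ p k t) {j : ℕ} (hj : j ≤ k) :
    Ico (t (p + j)) (t (p + j + 1)) ⊆ Ico 0 1 := by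
  intro x hx
  have h1 : t p ≤ t (p + j) := ht.mono (by simp; omega) (by simp; omega) (by omega)
  have h2 : t (p + j + 1) ≤ t (p + k + 1) := ht.mono (by simp; omega) (by simp; omega) (by omega)
  rw [ht.left] at h1
  rw [ht.right] at h2
  exact ⟨h1.trans hx.1, hx.2.trans_le h2⟩

theorem exists_cell (ht : QuasiUniformKnots Λ p k t) {x : ℝ} (hx : x ∈ Ico (0 : ℝ) 1) :
    ∃ j ≤ k, x ∈ Ico (t (p + j)) (t (p + j + 1)) := by
  have hex : ∃ j, x < t (p + j + 1) := ⟨k, by rw [ht.right]; exact hx.2⟩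
  classical
  have hle : Nat.find hex ≤ k := Nat.find_min' hex (by rw [ht.right]; exact hx.2)
  refine ⟨Nat.find hex, hle, ?_, Nat.find_spec hex⟩
  rcases h : Nat.find hex with _ | m
  · simpa [ht.left] using hx.1
  · have := Nat.find_min hex (m := m) (by omega)
    exact not_lt.1 this

/-- Locality: only the B-splines with indices `j, …, j + p` are alive on the cell with number `j`,
which turns global sums into sums over `Fin (p + 1)`. -/
theorem bspline_zero_of_cell (ht : QuasiUniformKnots Λ p k t) {j i : ℕ} (hj : j ≤ k)
    (hi : i < k + p + 1) {x : ℝ} (hx : x ∈ Ico (t (p + j)) (t (p + j + 1)))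
    (h : i < j ∨ j + p < i) : bspline t p i x = 0 := by
  refine bspline_eq_zero ht.mono (by omega) fun hx' => ?_
  rcases h with h | h
  · have : t (i + p + 1) ≤ t (p + j) := ht.mono (by simp; omega) (by simp; omega) (by omega)
    exact absurd hx'.2 (not_lt.2 (this.trans hx.1))
  · have : t (p + j + 1) ≤ t i := ht.mono (by simp; omega) (by simp; omega) (by omega)
    exact absurd hx.2 (not_lt.2 (this.trans hx'.1))

theorem sum_eq_sum_cell {j : ℕ} (hj : j ≤ k) {f : ℕ → ℝ}
    (hf : ∀ i < k + p + 1, i < j ∨ j + p < i → f i = 0) :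
    ∑ i ∈ Finset.range (k + p + 1), f i = ∑ m : Fin (p + 1), f (j + m) := by
  rw [Fin.sum_univ_eq_sum_range (fun m => f (j + m)) (p + 1),
    ← Finset.sum_image (s := Finset.range (p + 1)) (g := fun m => j + m) (f := f)
      (fun a _ b _ h => by simpa using h)]
  symm
  refine Finset.sum_subset ?_ ?_
  · intro i hi
    simp only [Finset.mem_image, Finset.mem_range] at hi ⊢
    omega
  · intro i hi hi'
    simp only [Finset.mem_image, Finset.mem_range, not_exists, not_and] at hi hi'
    refine hf i hi ?_
    by_contra hcon
    push Not at hcon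
    exact hi' (i - j) (by omega) (by omega)

/-- The B-splines that do not vanish on a cell are linearly independent there. -/
theorem coeff_eq_zero_of_cell (hΛ : 1 ≤ Λ) (ht : QuasiUniformKnots Λ p k t) {j : ℕ} (hj : j ≤ k)
    {c : Fin (p + 1) → ℝ}
    (hc : ∀ x ∈ Ico (t (p + j)) (t (p + j + 1)), ∑ m : Fin (p + 1), c m * bspline t p (j + m) x = 0) :
    c = 0 := by
  classical
  set e : ℕ → ℕ → ℝ := fun i l =>
    (∏ m ∈ Finset.range p, (Polynomial.X + Polynomial.C (t (i + m + 1)))).coeff l with he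
  have hid : ∀ l, ∀ x ∈ Ico (t (p + j)) (t (p + j + 1)),
      ∑ m : Fin (p + 1), e (j + m) l * bspline t p (j + m) x = x ^ (p - l) * (p.choose l) := by
    intro l x hx
    have hx01 := ht.cell_subset hj hx
    have h := sum_bspline_mul_coeff ht.mono (x := x) (q := p) (M := k + p + 1) (by omega) (by omega)
      (by rw [ht.left, show k + p + 1 = p + k + 1 by omega, ht.right]; exact hx01) l
    rw [← h, sum_eq_sum_cell (p := p) hj]
    · exact Finset.sum_congr rfl fun m _ => mul_comm _ _
    · intro i hi hi'
      rw [ht.bspline_zero_of_cell hj hi hx hi', zero_mul]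
  -- By Marsden's identity `E` maps the vector of B-spline values to the monomials up to binomial
  -- factors; the argument `p - l` makes row `l` correspond to `x ^ l`. Independence of the
  -- monomials on the cell leaves `E` with a trivial left kernel, so it is invertible and
  -- independence passes to the B-splines.
  set E : Matrix (Fin (p + 1)) (Fin (p + 1)) ℝ := fun l m => e (j + m) (p - l) with hE
  -- a combination of monomials that vanishes on the cell is trivial
  have hmono : ∀ d : Fin (p + 1) → ℝ, (∀ x ∈ Ico (t (p + j)) (t (p + j + 1)),
      ∑ l, d l * (x ^ (l : ℕ) * (p.choose l)) = 0) → d = 0 := by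
    intro d hd
    have hP := poly_eq_zero_of_Ico
      (P := ∑ l : Fin (p + 1), Polynomial.monomial (l : ℕ) (d l * (p.choose l)))
      (ht.cell_lt hΛ hj) (fun x hx => by
        rw [Polynomial.eval_finsetSum, ← hd x hx]
        refine Finset.sum_congr rfl fun l _ => ?_
        rw [Polynomial.eval_monomial]; ring)
    ext l
    have := congrArg (fun P => Polynomial.coeff P (l : ℕ)) hP
    simp only [Polynomial.finsetSum_coeff, Polynomial.coeff_monomial, Polynomial.coeff_zero] at this
    rw [Finset.sum_eq_single l] at this
    · have hch : (p.choose l : ℝ) ≠ 0 := by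
        exact_mod_cast (Nat.choose_pos (by have := l.2; omega)).ne'
      simpa [hch] using this
    · intro b _ hb
      rw [if_neg (fun h => hb (Fin.ext h))]
    · simp
  have hEb : ∀ x ∈ Ico (t (p + j)) (t (p + j + 1)),
      Matrix.mulVec E (fun m => bspline t p (j + m) x) =
        fun l : Fin (p + 1) => x ^ (l : ℕ) * (p.choose l) := by
    intro x hx
    ext l
    have h := hid (p - l) x hx
    have hl : (l : ℕ) ≤ p := by have := l.2; omega
    rw [Nat.choose_symm hl, Nat.sub_sub_self hl] at h
    rw [← h]
    rfl
  have hinj : ∀ d : Fin (p + 1) → ℝ, Matrix.vecMul d E = 0 → d = 0 := by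
    intro d hd
    refine hmono d fun x hx => ?_
    have : dotProduct d (Matrix.mulVec E (fun m => bspline t p (j + m) x)) = 0 := by
      rw [Matrix.dotProduct_mulVec, hd, zero_dotProduct]
    rw [hEb x hx] at this
    exact this
  have hdet : IsUnit E.det := by
    rw [isUnit_iff_ne_zero]
    intro h0
    obtain ⟨v, hv, hv0⟩ := Matrix.exists_vecMul_eq_zero_iff.2 h0
    exact hv (hinj v hv0)
  have hd : Matrix.vecMul c E⁻¹ = 0 := by
    refine hmono _ fun x hx => ?_
    have h1 : dotProduct (Matrix.vecMul c E⁻¹) (Matrix.mulVec E (fun m => bspline t p (j + m) x))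
        = 0 := by
      rw [← Matrix.dotProduct_mulVec, Matrix.mulVec_mulVec, Matrix.nonsing_inv_mul _ hdet,
        Matrix.one_mulVec]
      exact hc x hx
    rw [hEb x hx] at h1
    exact h1
  have := congrArg (fun v => Matrix.vecMul v E) hd
  simpa [Matrix.vecMul_vecMul, Matrix.nonsing_inv_mul _ hdet] using this

/-- The B-splines are linearly independent on `[0,1)`. -/
theorem coeff_eq_zero (hΛ : 1 ≤ Λ) (ht : QuasiUniformKnots Λ p k t) {c : Fin (k + p + 1) → ℝ}
    (hc : ∀ x ∈ Ico (0 : ℝ) 1, spline t p k c x = 0) : c = 0 := by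
  set c' : ℕ → ℝ := fun i => if h : i < k + p + 1 then c ⟨i, h⟩ else 0 with hc'
  have hci : ∀ i : Fin (k + p + 1), c' i = c i := fun i => dif_pos i.2
  have hsp : ∀ x, spline t p k c x = ∑ i ∈ Finset.range (k + p + 1), c' i * bspline t p i x := by
    intro x
    rw [spline, ← Fin.sum_univ_eq_sum_range (fun i => c' i * bspline t p i x)]
    exact Finset.sum_congr rfl fun i _ => by rw [hci]
  have main : ∀ j ≤ k, ∀ m : Fin (p + 1), c' (j + m) = 0 := by
    intro j hj m
    have := ht.coeff_eq_zero_of_cell hΛ hj (c := fun m => c' (j + m)) (fun x hx => by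
      have h0 := hc x (ht.cell_subset hj hx)
      rw [hsp, sum_eq_sum_cell (p := p) hj] at h0
      · exact h0
      · intro i hi hi'
        rw [ht.bspline_zero_of_cell hj hi hx hi', mul_zero])
    exact congrFun this m
  ext i
  have hi := i.2
  -- Every index lies in the window of some cell: it starts the window of cell `i` if `i ≤ k`, and
  -- otherwise it lies in the window of the last cell.
  by_cases h : (i : ℕ) ≤ k
  · rw [← hci]
    exact main i h 0
  · have := main k le_rfl ⟨i - k, by omega⟩
    rw [← hci, Pi.zero_apply, ← this]
    congr 1
    simp; omega

/-- This is the top coefficient in Marsden's identity, since the products of linear factors are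
monic. -/
theorem sum_bspline (ht : QuasiUniformKnots Λ p k t) {x : ℝ} (hx : x ∈ Ico (0 : ℝ) 1) :
    ∑ i ∈ Finset.range (k + p + 1), bspline t p i x = 1 := by
  have h := sum_bspline_mul_coeff ht.mono (x := x) (q := p) (M := k + p + 1) (by omega) (by omega)
      (by rw [ht.left, show k + p + 1 = p + k + 1 by omega, ht.right]; exact hx) p
  have hc : ∀ i, (∏ m ∈ Finset.range p,
      (Polynomial.X + Polynomial.C (t (i + m + 1)))).coeff p = 1 := by
    intro i
    have hm : (∏ m ∈ Finset.range p, (Polynomial.X + Polynomial.C (t (i + m + 1)))).Monic :=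
      Polynomial.monic_prod_of_monic _ _ fun m _ => Polynomial.monic_X_add_C _
    have hd : (∏ m ∈ Finset.range p,
        (Polynomial.X + Polynomial.C (t (i + m + 1)))).natDegree = p := by
      rw [Polynomial.natDegree_prod_of_monic _ _ fun m _ => Polynomial.monic_X_add_C _]
      simp
    have := hm.coeff_natDegree
    rwa [hd] at this
  simpa [hc] using h

/-- On a cell a spline is a polynomial in the local variable. -/
theorem spline_eq_local (hΛ : 1 ≤ Λ) (ht : QuasiUniformKnots Λ p k t) {j : ℕ} (hj : j ≤ k)
    (c : Fin (k + p + 1) → ℝ) :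
    ∃ a : Fin (p + 1) → ℝ, ∀ x ∈ Ico (t (p + j)) (t (p + j + 1)), spline t p k c x =
      ∑ l, a l * ((x - t (p + j)) / (t (p + j + 1) - t (p + j))) ^ (l : ℕ) := by
  have hlt := ht.cell_lt hΛ hj
  choose P hPd hPe using fun i : Fin (k + p + 1) =>
    bspline_eq_poly ht.mono (j := p + j) (by omega) (q := p) (i := i) (by have := i.2; omega)
  set Q : Polynomial ℝ := (∑ i, Polynomial.C (c i) * P i).comp
    (Polynomial.C (t (p + j)) + Polynomial.C (t (p + j + 1) - t (p + j)) * Polynomial.X) with hQ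
  have hQd : Q.natDegree < p + 1 := by
    have h1 : (∑ i, Polynomial.C (c i) * P i).natDegree ≤ p :=
      Polynomial.natDegree_sum_le_of_forall_le _ _ fun i _ =>
        (Polynomial.natDegree_C_mul_le _ _).trans (hPd i)
    have h2 : (Polynomial.C (t (p + j)) +
        Polynomial.C (t (p + j + 1) - t (p + j)) * Polynomial.X).natDegree ≤ 1 := by
      compute_degree
    have h3 := Polynomial.natDegree_comp_le (p := ∑ i, Polynomial.C (c i) * P i)
      (q := Polynomial.C (t (p + j)) + Polynomial.C (t (p + j + 1) - t (p + j)) * Polynomial.X)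
    have := Nat.mul_le_mul h1 h2
    rw [hQ]
    omega
  refine ⟨fun l => Q.coeff l, fun x hx => ?_⟩
  have h := Polynomial.eval_eq_sum_range' hQd ((x - t (p + j)) / (t (p + j + 1) - t (p + j)))
  rw [Fin.sum_univ_eq_sum_range (fun l => Q.coeff l *
    ((x - t (p + j)) / (t (p + j + 1) - t (p + j))) ^ l), ← h, hQ, Polynomial.eval_comp]
  have hne : t (p + j + 1) - t (p + j) ≠ 0 := by linarith
  have hxx : Polynomial.eval ((x - t (p + j)) / (t (p + j + 1) - t (p + j)))
      (Polynomial.C (t (p + j)) + Polynomial.C (t (p + j + 1) - t (p + j)) * Polynomial.X) = x := by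
    simp only [Polynomial.eval_add, Polynomial.eval_C, Polynomial.eval_mul, Polynomial.eval_X]
    field_simp
    ring
  rw [hxx, Polynomial.eval_finsetSum, spline]
  refine Finset.sum_congr rfl fun i _ => ?_
  rw [Polynomial.eval_mul, Polynomial.eval_C, hPe i x hx]

end QuasiUniformKnots

theorem measurable_spline (t : ℕ → ℝ) (p k : ℕ) (c : Fin (k + p + 1) → ℝ) :
    Measurable (spline t p k c) :=
  Finset.measurable_sum _ fun i _ => (measurable_bspline t p i).const_mul _

/-! ### Polynomials on an interval -/

/-- The integral is continuous and positive on the compact unit sphere of coefficients; homogeneity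
does the rest. The constant depends on `p` only, and rescaling transports it to every cell, which is
the source of all uniformity in the knots. -/
theorem exists_monomial_lower_bound (p : ℕ) : ∃ lam : ℝ, 0 < lam ∧ ∀ a : Fin (p + 1) → ℝ,
    lam * ∑ l, a l ^ 2 ≤ ∫ u in (0 : ℝ)..1, (∑ l, a l * u ^ (l : ℕ)) ^ 2 := by
  set f : (Fin (p + 1) → ℝ) → ℝ := fun a => ∫ u in (0 : ℝ)..1, (∑ l, a l * u ^ (l : ℕ)) ^ 2 with hf
  have hcont : Continuous f := by
    refine intervalIntegral.continuous_parametric_intervalIntegral_of_continuous' ?_ 0 1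
    fun_prop
  set S : Set (Fin (p + 1) → ℝ) := {a | ∑ l, a l ^ 2 = 1} with hS
  have hScl : IsClosed S := isClosed_eq (by fun_prop) continuous_const
  have hSb : S ⊆ Metric.closedBall 0 1 := by
    intro a ha
    rw [mem_closedBall_zero_iff, pi_norm_le_iff_of_nonneg zero_le_one]
    intro l
    have h1 : a l ^ 2 ≤ ∑ l, a l ^ 2 :=
      Finset.single_le_sum (f := fun l => a l ^ 2) (fun _ _ => sq_nonneg _) (Finset.mem_univ l)
    rw [show ∑ l, a l ^ 2 = 1 from ha] at h1
    rw [Real.norm_eq_abs]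
    exact (sq_le_one_iff_abs_le_one _).1 h1
  have hScomp : IsCompact S :=
    Metric.isCompact_of_isClosed_isBounded hScl (Metric.isBounded_closedBall.subset hSb)
  have hSne : S.Nonempty := ⟨Pi.single 0 1, by
    rw [hS, mem_ofPred_eq, Finset.sum_eq_single 0] <;> simp +contextual⟩
  obtain ⟨a₀, ha₀, hmin⟩ := hScomp.exists_isMinOn hSne hcont.continuousOn
  have hpos : ∀ a, 0 ≤ f a := fun a =>
    intervalIntegral.integral_nonneg zero_le_one fun _ _ => sq_nonneg _
  have h0 : 0 < f a₀ := by
    refine lt_of_le_of_ne (hpos _) fun h => ?_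
    have hz : ∀ u ∈ Ico (0 : ℝ) 1, ∑ l, a₀ l * u ^ (l : ℕ) = 0 := by
      intro u hu
      by_contra hne
      have : 0 < f a₀ := by
        refine intervalIntegral.integral_pos zero_lt_one (by fun_prop) (fun _ _ => sq_nonneg _)
          ⟨u, ⟨hu.1, hu.2.le⟩, by positivity⟩
      exact absurd h this.ne
    have hP := poly_eq_zero_of_Ico (P := ∑ l : Fin (p + 1), Polynomial.monomial (l : ℕ) (a₀ l))
      zero_lt_one (fun x hx => by
        rw [Polynomial.eval_finsetSum, ← hz x hx]
        exact Finset.sum_congr rfl fun l _ => by rw [Polynomial.eval_monomial])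
    have ha : a₀ = 0 := by
      ext l
      have := congrArg (fun P => Polynomial.coeff P (l : ℕ)) hP
      simp only [Polynomial.finsetSum_coeff, Polynomial.coeff_monomial,
        Polynomial.coeff_zero] at this
      rw [Finset.sum_eq_single l] at this
      · simpa using this
      · intro b _ hb
        rw [if_neg (fun h => hb (Fin.ext h))]
      · simp
    rw [hS, mem_ofPred_eq, ha] at ha₀
    simp at ha₀
  refine ⟨f a₀, h0, fun a => ?_⟩
  set q := ∑ l, a l ^ 2 with hq
  have hq0 : 0 ≤ q := Finset.sum_nonneg fun _ _ => sq_nonneg _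
  rcases hq0.eq_or_lt with h | h
  · rw [← h, mul_zero]; exact hpos a
  · have hs : (Real.sqrt q) ^ 2 = q := Real.sq_sqrt hq0
    have hs0 : 0 < Real.sqrt q := Real.sqrt_pos.2 h
    have hmem : (fun l => (Real.sqrt q)⁻¹ * a l) ∈ S := by
      simp only [hS, mem_ofPred_eq, mul_pow, ← Finset.mul_sum, inv_pow, hs]
      exact inv_mul_cancel₀ h.ne'
    have h1 : f a₀ ≤ f (fun l => (Real.sqrt q)⁻¹ * a l) := hmin hmem
    have h2 : f (fun l => (Real.sqrt q)⁻¹ * a l) = q⁻¹ * f a := by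
      simp only [hf]
      rw [← intervalIntegral.integral_const_mul]
      refine intervalIntegral.integral_congr fun u _ => ?_
      simp only [mul_assoc, ← Finset.mul_sum, mul_pow, inv_pow, hs]
    rw [h2] at h1
    calc f a₀ * q ≤ q⁻¹ * f a * q := mul_le_mul_of_nonneg_right h1 hq0
      _ = f a := by field_simp

theorem integral_local_poly_sq {n : ℕ} (a : Fin n → ℝ) {x y : ℝ} (h : x < y) :
    ∫ u in x..y, (∑ l, a l * ((u - x) / (y - x)) ^ (l : ℕ)) ^ 2 =
      (y - x) * ∫ u in (0 : ℝ)..1, (∑ l, a l * u ^ (l : ℕ)) ^ 2 := by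
  have hne : y - x ≠ 0 := by linarith
  have := intervalIntegral.integral_comp_div_sub (a := x) (b := y)
    (fun u => (∑ l, a l * u ^ (l : ℕ)) ^ 2) hne (x / (y - x))
  rw [sub_self, ← sub_div, div_self hne, smul_eq_mul] at this
  simpa only [sub_div] using this

/-! ### Taylor polynomials of Sobolev functions -/

/-- Cauchy–Schwarz, obtained from the nonnegative integral of the squared deviation of `f` from its
mean. The right side refers to the enclosing interval so that it does not depend on the two end
points. -/
theorem sq_intervalIntegral_le {f : ℝ → ℝ} {A B x y : ℝ} (hx : x ∈ Icc A B) (hy : y ∈ Icc A B)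
    (hf : MemLp f 2 (volume.restrict (Icc A B))) :
    (∫ u in x..y, f u) ^ 2 ≤ (B - A) * ∫ u in A..B, f u ^ 2 := by
  have hAB : A ≤ B := hx.1.trans hx.2
  wlog hxy : x ≤ y generalizing x y
  · rw [intervalIntegral.integral_symm, neg_sq]
    exact this hy hx (le_of_not_ge hxy)
  have hsub : Icc x y ⊆ Icc A B := Icc_subset_Icc hx.1 hy.2
  have hf' : MemLp f 2 (volume.restrict (Icc x y)) :=
    hf.mono_measure (Measure.restrict_mono hsub le_rfl)
  have hsq : IntervalIntegrable (fun u => f u ^ 2) volume A B := by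
    rw [intervalIntegrable_iff_integrableOn_Icc_of_le hAB]
    exact hf.integrable_sq
  have hsq' : IntervalIntegrable (fun u => f u ^ 2) volume x y := by
    rw [intervalIntegrable_iff_integrableOn_Icc_of_le hxy]
    exact hf'.integrable_sq
  have hi : IntervalIntegrable f volume x y := by
    rw [intervalIntegrable_iff_integrableOn_Icc_of_le hxy]
    exact hf'.integrable one_le_two
  have h1 : (∫ u in x..y, f u) ^ 2 ≤ (y - x) * ∫ u in x..y, f u ^ 2 := by
    set I := ∫ u in x..y, f u
    rcases hxy.eq_or_lt with h | h
    · have : I = 0 := by simp [I, h]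
      simp [this, h]
    · have h2 : 0 ≤ ∫ u in x..y, (f u - I / (y - x)) ^ 2 :=
        intervalIntegral.integral_nonneg hxy fun _ _ => sq_nonneg _
      have h3 : ∫ u in x..y, (f u - I / (y - x)) ^ 2 =
          (∫ u in x..y, f u ^ 2) - 2 * (I / (y - x)) * I + (y - x) * (I / (y - x)) ^ 2 := by
        have : ∀ u, (f u - I / (y - x)) ^ 2 =
            f u ^ 2 - 2 * (I / (y - x)) * f u + (I / (y - x)) ^ 2 := fun u => by ring
        simp only [this]
        rw [intervalIntegral.integral_add (hsq'.sub (hi.const_mul _)) (by simp),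
          intervalIntegral.integral_sub hsq' (hi.const_mul _),
          intervalIntegral.integral_const_mul, intervalIntegral.integral_const, smul_eq_mul]
      rw [h3] at h2
      have hd : 0 < y - x := by linarith
      have h4 : -(2 * (I / (y - x)) * I) + (y - x) * (I / (y - x)) ^ 2 = - (I ^ 2 / (y - x)) := by
        field_simp; ring
      have h5 : I ^ 2 / (y - x) ≤ ∫ u in x..y, f u ^ 2 := by linarith
      rw [div_le_iff₀ hd] at h5
      linarith
  refine h1.trans (mul_le_mul (by linarith [hx.1, hy.2]) ?_ ?_ (by linarith))
  · exact intervalIntegral.integral_mono_interval hx.1 hxy hy.2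
      (Eventually.of_forall fun _ => sq_nonneg _) hsq
  · exact intervalIntegral.integral_nonneg hxy fun _ _ => sq_nonneg _

theorem HasSobolevDerivs.intervalIntegrable {r : ℕ} {ψ : ℝ → ℝ} {D : ℕ → ℝ → ℝ}
    (h : HasSobolevDerivs r ψ D) {j : ℕ} (hj : j ≤ r) {x y : ℝ} (hx : x ∈ Icc (0 : ℝ) 1)
    (hy : y ∈ Icc (0 : ℝ) 1) : IntervalIntegrable (D j) volume x y := by
  have hi : IntegrableOn (D j) (Icc 0 1) := (h.memLp j hj).integrable one_le_two
  refine (hi.mono_set ?_).intervalIntegrable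
  exact uIcc_subset_Icc hx hy

theorem HasSobolevDerivs.sub_eq {r : ℕ} {ψ : ℝ → ℝ} {D : ℕ → ℝ → ℝ}
    (h : HasSobolevDerivs r ψ D) {j : ℕ} (hj : j < r) {x y : ℝ} (hx : x ∈ Icc (0 : ℝ) 1)
    (hy : y ∈ Icc (0 : ℝ) 1) : D j y - D j x = ∫ u in x..y, D (j + 1) u := by
  have h0 : (0 : ℝ) ∈ Icc (0 : ℝ) 1 := by simp
  rw [h.ftc j hj y hy, h.ftc j hj x hx, ← intervalIntegral.integral_interval_sub_left
    (h.intervalIntegrable hj h0 hy) (h.intervalIntegrable hj h0 hx)]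
  ring

theorem HasSobolevDerivs.shift {r : ℕ} {ψ : ℝ → ℝ} {D : ℕ → ℝ → ℝ}
    (h : HasSobolevDerivs (r + 1) ψ D) : HasSobolevDerivs r (D 1) (fun j => D (j + 1)) where
  zero := fun _ _ => rfl
  memLp := fun j hj => h.memLp (j + 1) (by omega)
  ftc := fun j hj => h.ftc (j + 1) (by omega)

/-- Induction on the order: the Taylor remainder of a function is the integral of the Taylor
remainder of its derivative, and each integration costs a factor `B - A`. The last derivative enters
only through its `L²` norm, by Cauchy–Schwarz. -/
theorem abs_sub_taylor_le {A B : ℝ} (hA : 0 ≤ A) (hB : B ≤ 1) {x ξ : ℝ} (hx : x ∈ Icc A B)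
    (hξ : ξ ∈ Icc A B) : ∀ {m : ℕ} {ψ : ℝ → ℝ} {D : ℕ → ℝ → ℝ}, HasSobolevDerivs (m + 1) ψ D →
    |D 0 x - ∑ l ∈ Finset.range (m + 1), D l ξ / l.factorial * (x - ξ) ^ l| ≤
      (B - A) ^ m * √((B - A) * ∫ u in A..B, D (m + 1) u ^ 2) := by
  have hsub : Icc A B ⊆ Icc (0 : ℝ) 1 := Icc_subset_Icc hA hB
  have hAB : A ≤ B := hx.1.trans hx.2
  intro m
  induction m generalizing x with
  | zero =>
    intro ψ D h
    simp only [zero_add, Finset.sum_range_one, Nat.factorial_zero, Nat.cast_one, div_one, pow_zero,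
      mul_one, one_mul]
    rw [h.sub_eq (by omega) (hsub hξ) (hsub hx)]
    refine Real.abs_le_sqrt (sq_intervalIntegral_le hξ hx ?_)
    exact (h.memLp 1 le_rfl).mono_measure (Measure.restrict_mono hsub le_rfl)
  | succ m ih =>
    intro ψ D h
    have hint : D 0 x - ∑ l ∈ Finset.range (m + 1 + 1), D l ξ / l.factorial * (x - ξ) ^ l =
        ∫ y in ξ..x, (D 1 y - ∑ l ∈ Finset.range (m + 1),
          D (l + 1) ξ / l.factorial * (y - ξ) ^ l) := by
      rw [intervalIntegral.integral_sub (h.intervalIntegrable (by omega) (hsub hξ) (hsub hx))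
        (Continuous.intervalIntegrable (by fun_prop) _ _), ← h.sub_eq (by omega) (hsub hξ) (hsub hx),
        intervalIntegral.integral_finsetSum
          (fun l _ => Continuous.intervalIntegrable (by fun_prop) _ _), Finset.sum_range_succ']
      simp only [pow_zero, Nat.factorial_zero, Nat.cast_one, div_one, mul_one]
      rw [sub_add_eq_sub_sub_swap]
      congr 1
      refine Finset.sum_congr rfl fun l _ => ?_
      rw [intervalIntegral.integral_const_mul, intervalIntegral.integral_comp_sub_right
        (fun y => y ^ l), integral_pow, sub_self, Nat.factorial_succ]
      push_cast
      have : (l.factorial : ℝ) ≠ 0 := by positivity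
      have : (l + 1 : ℝ) ≠ 0 := by positivity
      field_simp
      simp
    rw [hint]
    have hb := intervalIntegral.norm_integral_le_of_norm_le_const (a := ξ) (b := x)
      (f := fun y => D 1 y - ∑ l ∈ Finset.range (m + 1),
          D (l + 1) ξ / l.factorial * (y - ξ) ^ l)
      (C := (B - A) ^ m * √((B - A) * ∫ u in A..B, D (m + 1 + 1) u ^ 2)) (fun y hy => by
        have hy' : y ∈ Icc A B := uIcc_subset_Icc hξ hx (uIoc_subset_uIcc hy)
        exact ih hy' h.shift)
    rw [Real.norm_eq_abs] at hb
    refine hb.trans ?_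
    have hxξ : |x - ξ| ≤ B - A := by
      rw [abs_le]; constructor <;> linarith [hx.1, hx.2, hξ.1, hξ.2]
    calc _ ≤ (B - A) ^ m * √((B - A) * ∫ u in A..B, D (m + 1 + 1) u ^ 2) * (B - A) :=
          mul_le_mul_of_nonneg_left hxξ
            (mul_nonneg (pow_nonneg (by linarith) _) (Real.sqrt_nonneg _))
      _ = _ := by ring

/-! ### Dual functionals -/

/-- The coefficients are elementary symmetric functions; the induction is Pascal's rule. -/
theorem abs_coeff_prod_X_add_C_le {a : ℕ → ℝ} {H : ℝ} :
    ∀ {q : ℕ}, (∀ m < q, |a m| ≤ H) → ∀ l,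
    |(∏ m ∈ Finset.range q, (Polynomial.X + Polynomial.C (a m))).coeff l| ≤
      q.choose l * H ^ (q - l) := by
  intro q
  induction q with
  | zero =>
    intro _ l
    rcases l with _ | l <;> simp [Polynomial.coeff_one]
  | succ q ih =>
    intro ha l
    have hH : 0 ≤ H := (abs_nonneg _).trans (ha q (by omega))
    have ih' := ih fun m hm => ha m (by omega)
    rw [Finset.prod_range_succ, mul_add]
    rcases l with _ | l
    · have := ih' 0
      simp only [Polynomial.coeff_add, Polynomial.coeff_mul_X_zero, Polynomial.coeff_mul_C, zero_add,
        abs_mul, Nat.choose_zero_right, Nat.cast_one, one_mul, Nat.sub_zero] at this ⊢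
      rw [pow_succ]
      exact mul_le_mul this (ha q (by omega)) (abs_nonneg _) (by positivity)
    · simp only [Polynomial.coeff_add, Polynomial.coeff_mul_X, Polynomial.coeff_mul_C]
      refine (abs_add_le _ _).trans ?_
      have h1 := ih' l
      have h2 : |(∏ m ∈ Finset.range q, (Polynomial.X + Polynomial.C (a m))).coeff (l + 1) * a q| ≤
          q.choose (l + 1) * H ^ (q - l) := by
        rw [abs_mul]
        refine (mul_le_mul (ih' (l + 1)) (ha q (by omega)) (abs_nonneg _) (by positivity)).trans ?_
        rcases Nat.lt_or_ge l q with hl | hl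
        · rw [mul_assoc, ← pow_succ]
          have : q - (l + 1) + 1 = q - l := by omega
          rw [this]
        · rw [Nat.choose_eq_zero_of_lt (by omega)]; simp
      rw [Nat.choose_succ_succ, Nat.add_sub_add_right]
      push_cast
      linarith

/-- The functional that assigns to a polynomial of degree at most `p` its coefficient with respect
to the `i`-th B-spline. -/
noncomputable def dualCoeff (t : ℕ → ℝ) (p i : ℕ) : Polynomial ℝ →ₗ[ℝ] ℝ :=
  ∑ l ∈ Finset.range (p + 1),
    ((∏ m ∈ Finset.range p, (Polynomial.X + Polynomial.C (t (i + m + 1)))).coeff (p - l) /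
      (p.choose l : ℝ)) • Polynomial.lcoeff ℝ l

theorem choose_cast_ne_zero {p l : ℕ} (h : l ≤ p) : (p.choose l : ℝ) ≠ 0 := by
  exact_mod_cast (Nat.choose_pos h).ne'

theorem dualCoeff_apply (t : ℕ → ℝ) (p i : ℕ) (q : Polynomial ℝ) :
    dualCoeff t p i q = ∑ l ∈ Finset.range (p + 1),
      ((∏ m ∈ Finset.range p, (Polynomial.X + Polynomial.C (t (i + m + 1)))).coeff (p - l) /
      (p.choose l : ℝ)) * q.coeff l := by
  simp [dualCoeff]

/-- The weights in `dualCoeff` are those of Marsden's expansion of the monomials, so linearity gives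
reproduction of all polynomials of degree at most `p`. -/
theorem QuasiUniformKnots.sum_dualCoeff {Λ : ℝ} {p k : ℕ} {t : ℕ → ℝ}
    (ht : QuasiUniformKnots Λ p k t) {q : Polynomial ℝ} (hq : q.natDegree ≤ p) {x : ℝ}
    (hx : x ∈ Ico (0 : ℝ) 1) :
    ∑ i ∈ Finset.range (k + p + 1), dualCoeff t p i q * bspline t p i x = q.eval x := by
  simp only [dualCoeff_apply, Finset.sum_mul]
  rw [Finset.sum_comm, Polynomial.eval_eq_sum_range' (Nat.lt_succ_of_le hq)]
  refine Finset.sum_congr rfl fun l hl => ?_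
  have hl' : l ≤ p := Nat.lt_succ_iff.1 (Finset.mem_range.1 hl)
  have h := sum_bspline_mul_coeff ht.mono (x := x) (q := p) (M := k + p + 1) (by omega) (by omega)
      (by rw [ht.left, show k + p + 1 = p + k + 1 by omega, ht.right]; exact hx) (p - l)
  rw [Nat.choose_symm hl', Nat.sub_sub_self hl'] at h
  have hne := choose_cast_ne_zero hl'
  rw [← mul_div_cancel_right₀ (x ^ l) hne, ← h, Finset.sum_div, Finset.mul_sum]
  refine Finset.sum_congr rfl fun i _ => ?_
  ring

/-- Marsden's identity read on the coefficient side: these values are a generating function in `w`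
for the functional, and they show its behaviour under translations. -/
theorem dualCoeff_X_add_C_pow (t : ℕ → ℝ) (p i : ℕ) (w : ℝ) :
    dualCoeff t p i ((Polynomial.X + Polynomial.C w) ^ p) =
      ∏ m ∈ Finset.range p, (t (i + m + 1) + w) := by
  rw [dualCoeff_apply]
  set P := ∏ m ∈ Finset.range p, (Polynomial.X + Polynomial.C (t (i + m + 1))) with hP
  have hd : P.natDegree = p := by
    rw [hP, Polynomial.natDegree_prod_of_monic _ _ fun m _ => Polynomial.monic_X_add_C _]
    simp
  have h1 : P.eval w = ∏ m ∈ Finset.range p, (t (i + m + 1) + w) := by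
    simp [hP, Polynomial.eval_prod, add_comm]
  rw [← h1, Polynomial.eval_eq_sum_range, hd, ← Finset.sum_range_reflect]
  refine Finset.sum_congr rfl fun l hl => ?_
  have hl' : l ≤ p := Nat.lt_succ_iff.1 (Finset.mem_range.1 hl)
  have e : p + 1 - 1 - l = p - l := by omega
  rw [e, Polynomial.coeff_X_add_C_pow, Nat.sub_sub_self hl', Nat.choose_symm hl']
  have hne := choose_cast_ne_zero hl'
  field_simp

/-- The value is the mean of the products of `l` distinct differences `t (i + m + 1) - ξ`, as
comparing coefficients in the generating function shows. Centring at `ξ` is essential: the bound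
scales with the distance of the knots from `ξ`, not with the size of the knots. -/
theorem abs_dualCoeff_X_sub_C_pow_le {t : ℕ → ℝ} {p i : ℕ} {ξ H : ℝ}
    (h : ∀ m < p, |t (i + m + 1) - ξ| ≤ H) {l : ℕ} (hl : l ≤ p) :
    |dualCoeff t p i ((Polynomial.X - Polynomial.C ξ) ^ l)| ≤ H ^ l := by
  have key : ∑ l ∈ Finset.range (p + 1), Polynomial.monomial (p - l)
      ((p.choose l : ℝ) * dualCoeff t p i ((Polynomial.X - Polynomial.C ξ) ^ l)) =
      ∏ m ∈ Finset.range p, (Polynomial.X + Polynomial.C (t (i + m + 1) - ξ)) := by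
    refine Polynomial.funext fun z => ?_
    have h1 := dualCoeff_X_add_C_pow t p i (z - ξ)
    have h2 : (Polynomial.X + Polynomial.C (z - ξ)) ^ p = ∑ l ∈ Finset.range (p + 1),
        (z ^ (p - l) * (p.choose l : ℝ)) • (Polynomial.X - Polynomial.C ξ) ^ l := by
      have : Polynomial.X + Polynomial.C (z - ξ) =
          (Polynomial.X - Polynomial.C ξ) + Polynomial.C z := by
        rw [Polynomial.C_sub]; ring
      rw [this, add_pow]
      refine Finset.sum_congr rfl fun l _ => ?_
      rw [Polynomial.smul_eq_C_mul, Polynomial.C_mul, Polynomial.C_pow]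
      simp only [map_natCast]
      ring
    rw [h2, map_sum] at h1
    simp only [map_smul, smul_eq_mul] at h1
    rw [Polynomial.eval_finsetSum, Polynomial.eval_prod]
    simp only [Polynomial.eval_monomial, Polynomial.eval_add, Polynomial.eval_X, Polynomial.eval_C]
    have h3 : ∏ m ∈ Finset.range p, (z + (t (i + m + 1) - ξ)) =
        ∏ m ∈ Finset.range p, (t (i + m + 1) + (z - ξ)) :=
      Finset.prod_congr rfl fun m _ => by ring
    rw [h3, ← h1]
    exact Finset.sum_congr rfl fun l _ => by ring
  have hc := congrArg (fun P => Polynomial.coeff P (p - l)) key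
  simp only [Polynomial.finsetSum_coeff, Polynomial.coeff_monomial] at hc
  rw [Finset.sum_eq_single l] at hc
  · rw [if_pos rfl] at hc
    have hb := abs_coeff_prod_X_add_C_le (a := fun m => t (i + m + 1) - ξ) h (p - l)
    rw [← hc, abs_mul, Nat.choose_symm hl, Nat.sub_sub_self hl, abs_of_nonneg (by positivity)] at hb
    have hpos : (0 : ℝ) < p.choose l := by exact_mod_cast Nat.choose_pos hl
    exact le_of_mul_le_mul_left hb hpos
  · intro b hb hbl
    rw [if_neg]
    have := Finset.mem_range.1 hb
    omega
  · intro hn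
    exact absurd (Finset.mem_range.2 (by omega)) hn

/-- The dual functionals are bounded with respect to the maximum norm on a nearby cell. -/
theorem exists_abs_dualCoeff_le (p : ℕ) : ∃ K : ℝ, 0 < K ∧ ∀ (t : ℕ → ℝ) (i : ℕ) (x y H ε : ℝ)
    (q : Polynomial ℝ), x < y → y - x ≤ H → (∀ m < p, |t (i + m + 1) - x| ≤ H) →
    q.natDegree ≤ p → (∀ u ∈ Icc x y, |q.eval u| ≤ ε) →
    |dualCoeff t p i q| ≤ K * (H / (y - x)) ^ p * ε := by
  obtain ⟨lam, hlam, hlow⟩ := exists_monomial_lower_bound p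
  refine ⟨(p + 1) * (√lam)⁻¹, by positivity, fun t i x y H ε q hxy hH hm hq hε => ?_⟩
  have hd : 0 < y - x := by linarith
  have hε0 : 0 ≤ ε := (abs_nonneg _).trans (hε x ⟨le_rfl, hxy.le⟩)
  -- Taylor coefficients at the left end of the cell. In the variable rescaled to the unit interval
  -- they become `b l * (y - x) ^ l`, and `exists_monomial_lower_bound` bounds these by a multiple
  -- of `ε`.
  set b : ℕ → ℝ := fun l => (Polynomial.taylor x q).coeff l with hb
  have hqs : q = ∑ l ∈ Finset.range (p + 1),
      b l • (Polynomial.X - Polynomial.C x) ^ l := by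
    have h1 := Polynomial.sum_taylor_eq q x
    rw [Polynomial.sum_over_range' _ (by simp) (p + 1)
      (by rw [Polynomial.natDegree_taylor]; omega)] at h1
    rw [← h1]
    refine Finset.sum_congr rfl fun l _ => ?_
    rw [Polynomial.smul_eq_C_mul]
  have heval : ∀ u, q.eval u = ∑ l : Fin (p + 1),
      (b l * (y - x) ^ (l : ℕ)) * ((u - x) / (y - x)) ^ (l : ℕ) := by
    intro u
    rw [Fin.sum_univ_eq_sum_range (fun l => (b l * (y - x) ^ l) * ((u - x) / (y - x)) ^ l)]
    conv_lhs => rw [hqs]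
    rw [Polynomial.eval_finsetSum]
    refine Finset.sum_congr rfl fun l _ => ?_
    simp only [Polynomial.eval_smul, Polynomial.eval_pow, Polynomial.eval_sub, Polynomial.eval_X,
      Polynomial.eval_C, smul_eq_mul, div_pow]
    field_simp
  have h1 := hlow (fun l => b l * (y - x) ^ (l : ℕ))
  have h2 := integral_local_poly_sq (fun l : Fin (p + 1) => b l * (y - x) ^ (l : ℕ)) hxy
  simp only [← heval] at h2
  have h3 : ∫ u in x..y, q.eval u ^ 2 ≤ (y - x) * ε ^ 2 := by
    have : ∫ u in x..y, q.eval u ^ 2 ≤ ∫ _ in x..y, ε ^ 2 := by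
      refine intervalIntegral.integral_mono_on hxy.le
        (Continuous.intervalIntegrable (by fun_prop) _ _) (by simp) fun u hu => ?_
      exact sq_le_sq' (abs_le.1 (hε u hu)).1 (abs_le.1 (hε u hu)).2
    simpa using this
  rw [h2] at h3
  have h4 := h1.trans (le_of_mul_le_mul_left h3 hd)
  have h5 : ∀ l < p + 1, |b l| * (y - x) ^ l ≤ (√lam)⁻¹ * ε := by
    intro l hl
    have : (b l * (y - x) ^ l) ^ 2 ≤ ((√lam)⁻¹ * ε) ^ 2 := by
      have hs : (b l * (y - x) ^ l) ^ 2 ≤ ∑ l : Fin (p + 1), (b l * (y - x) ^ (l : ℕ)) ^ 2 :=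
        Finset.single_le_sum (f := fun l : Fin (p + 1) => (b l * (y - x) ^ (l : ℕ)) ^ 2)
          (fun _ _ => sq_nonneg _) (Finset.mem_univ (⟨l, hl⟩ : Fin (p + 1)))
      rw [mul_pow _ ε, inv_pow, Real.sq_sqrt hlam.le, inv_mul_eq_div, le_div_iff₀ hlam]
      calc _ ≤ _ := mul_le_mul_of_nonneg_right hs hlam.le
        _ ≤ ε ^ 2 := by rw [mul_comm]; exact h4
    have := abs_le_of_sq_le_sq this (by positivity)
    rwa [abs_mul, abs_of_nonneg (pow_nonneg hd.le l)] at this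
  conv_lhs => rw [hqs]
  rw [map_sum]
  simp only [map_smul, smul_eq_mul]
  have hratio : 1 ≤ H / (y - x) := by rwa [one_le_div hd]
  calc _ ≤ ∑ l ∈ Finset.range (p + 1),
        |b l * dualCoeff t p i ((Polynomial.X - Polynomial.C x) ^ l)| :=
          Finset.abs_sum_le_sum_abs _ _
    _ ≤ ∑ l ∈ Finset.range (p + 1), (√lam)⁻¹ * ε * (H / (y - x)) ^ p := by
        refine Finset.sum_le_sum fun l hl => ?_
        have hl' := Finset.mem_range.1 hl
        rw [abs_mul]
        calc _ ≤ |b l| * H ^ l :=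
              mul_le_mul_of_nonneg_left (abs_dualCoeff_X_sub_C_pow_le hm (by omega)) (abs_nonneg _)
          _ = |b l| * (y - x) ^ l * (H / (y - x)) ^ l := by rw [div_pow]; field_simp
          _ ≤ (√lam)⁻¹ * ε * (H / (y - x)) ^ l :=
              mul_le_mul_of_nonneg_right (h5 l hl') (by positivity)
          _ ≤ _ := mul_le_mul_of_nonneg_left (pow_le_pow_right₀ hratio (by omega)) (by positivity)
    _ = _ := by simp; ring

/-! ### Spline approximation of Sobolev functions -/

/-- The Taylor polynomial of degree less than `r` at `ξ`. -/
noncomputable def taylorPoly (D : ℕ → ℝ → ℝ) (r : ℕ) (ξ : ℝ) : Polynomial ℝ :=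
  ∑ l ∈ Finset.range r, Polynomial.C (D l ξ / l.factorial) * (Polynomial.X - Polynomial.C ξ) ^ l

theorem eval_taylorPoly (D : ℕ → ℝ → ℝ) (r : ℕ) (ξ x : ℝ) :
    (taylorPoly D r ξ).eval x = ∑ l ∈ Finset.range r, D l ξ / l.factorial * (x - ξ) ^ l := by
  simp [taylorPoly, Polynomial.eval_finsetSum]

theorem natDegree_taylorPoly_le (D : ℕ → ℝ → ℝ) {r p : ℕ} (hp : r ≤ p + 1) (ξ : ℝ) :
    (taylorPoly D r ξ).natDegree ≤ p := by
  refine Polynomial.natDegree_sum_le_of_forall_le _ _ fun l hl => ?_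
  refine (Polynomial.natDegree_C_mul_le _ _).trans ?_
  rw [Polynomial.natDegree_pow, Polynomial.natDegree_X_sub_C]
  have := Finset.mem_range.1 hl
  omega

/-- The index of the knot at which the function is expanded to obtain the `i`-th coefficient. Near
the boundary it is constant, so that the coefficients never depend on the outer knots. -/
def nodeIndex (p k i : ℕ) : ℕ :=
  if k ≤ 3 * p ∨ i ≤ 2 * p then p else if k + 2 ≤ i + p then p + k + 1 else i

/-- The expansion points of all coefficients alive on cell `j` stay within `3 * p + 1` cells of it,
and inside the unit interval. -/
theorem nodeIndex_near {p k i j : ℕ} (hj : j ≤ k) (hi : j ≤ i) (hi' : i ≤ j + p) :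
    p + (j - (3 * p + 1)) ≤ nodeIndex p k i ∧
      nodeIndex p k i ≤ p + min (k + 1) (j + (3 * p + 1)) := by
  unfold nodeIndex
  split_ifs <;> omega

/-- The second alternative says that the knots `t (i + 1), …, t (i + p)` on which the dual
functional depends all lie in the unit interval. The outer knots are arbitrary, so otherwise the
Taylor polynomial must agree with the reference one. -/
theorem nodeIndex_eq_or {p k i j : ℕ} (hj : j ≤ k) (hi : j ≤ i) (hi' : i ≤ j + p) :
    nodeIndex p k i = nodeIndex p k (j + p) ∨
      (p ≤ i + 1 ∧ i ≤ k + 1) := by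
  unfold nodeIndex
  split_ifs <;> omega

namespace QuasiUniformKnots

variable {Λ : ℝ} {p k : ℕ} {t : ℕ → ℝ}

theorem sub_le_of_le (ht : QuasiUniformKnots Λ p k t) {i j : ℕ} (hij : i ≤ j) (hj : j ≤ k + 1) :
    t (p + j) - t (p + i) ≤ (j - i : ℕ) * (Λ / (k + 1)) := by
  induction j, hij using Nat.le_induction with
  | base => simp
  | succ j hij ih =>
    have h1 := ih (by omega)
    have h2 := ht.upper (p + j) (by omega) (by omega)
    have : ((j + 1 - i : ℕ) : ℝ) = ((j - i : ℕ) : ℝ) + 1 := by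
      rw [Nat.sub_add_comm hij]; push_cast; ring
    rw [this, show p + (j + 1) = p + j + 1 by omega]
    linarith

theorem mono_cell (ht : QuasiUniformKnots Λ p k t) {i j : ℕ} (hij : i ≤ j) (hj : j ≤ k + 1) :
    t (p + i) ≤ t (p + j) :=
  ht.mono (by simp; omega) (by simp; omega) (by omega)

theorem knot_mem (ht : QuasiUniformKnots Λ p k t) {j : ℕ} (hj : j ≤ k + 1) :
    t (p + j) ∈ Icc (0 : ℝ) 1 := by
  have h1 := ht.mono_cell (Nat.zero_le j) hj
  have h2 := ht.mono_cell hj le_rfl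
  rw [add_zero, ht.left] at h1
  rw [← add_assoc, ht.right] at h2
  exact ⟨h1, h2⟩

/-- The integrals over neighbourhoods of the cells overlap boundedly often. -/
theorem sum_integral_near_le (ht : QuasiUniformKnots Λ p k t) {f : ℝ → ℝ} (hf : ∀ x, 0 ≤ f x)
    (hfi : IntegrableOn f (Icc 0 1)) (W : ℕ) :
    ∑ j ∈ Finset.range (k + 1), ∫ u in t (p + (j - W))..t (p + min (k + 1) (j + W)), f u ≤
      (2 * W : ℕ) * ∫ u in (0 : ℝ)..1, f u := by
  have hint : ∀ i ≤ k + 1, ∀ j ≤ k + 1, IntervalIntegrable f volume (t (p + i)) (t (p + j)) :=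
    fun i hi j hj => (hfi.mono_set (uIcc_subset_Icc (ht.knot_mem hi) (ht.knot_mem hj))).intervalIntegrable
  have hsum : ∀ i j, i ≤ j → j ≤ k + 1 → ∫ u in t (p + i)..t (p + j), f u =
      ∑ m ∈ Finset.Ico i j, ∫ u in t (p + m)..t (p + (m + 1)), f u := by
    intro i j hij hj
    refine (intervalIntegral.sum_integral_adjacent_intervals_Ico (a := fun m => t (p + m)) hij
      fun m hm => ?_).symm
    exact hint _ (by have := hm.2; omega) _ (by have := hm.2; omega)
  have h01 : ∫ u in (0 : ℝ)..1, f u =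
      ∑ m ∈ Finset.range (k + 1), ∫ u in t (p + m)..t (p + (m + 1)), f u := by
    have := hsum 0 (k + 1) (by omega) le_rfl
    rw [add_zero, ht.left, ← add_assoc, ht.right] at this
    rw [this, Nat.Ico_zero_eq_range]
  have hpos : ∀ m ∈ Finset.range (k + 1), 0 ≤ ∫ u in t (p + m)..t (p + (m + 1)), f u :=
    fun m hm => intervalIntegral.integral_nonneg
      (ht.mono_cell (by omega) (by have := Finset.mem_range.1 hm; omega)) fun _ _ => hf _
  rw [h01, Finset.mul_sum]
  have h2 : ∀ j ∈ Finset.range (k + 1),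
      ∫ u in t (p + (j - W))..t (p + min (k + 1) (j + W)), f u =
      ∑ m ∈ Finset.range (k + 1), if j - W ≤ m ∧ m < j + W then
        ∫ u in t (p + m)..t (p + (m + 1)), f u else 0 := by
    intro j hj
    have hj' := Finset.mem_range.1 hj
    rw [hsum _ _ (by omega) (by omega), ← Finset.sum_filter]
    refine Finset.sum_congr ?_ fun _ _ => rfl
    ext m
    simp only [Finset.mem_Ico, Finset.mem_filter, Finset.mem_range]
    omega
  rw [Finset.sum_congr rfl h2, Finset.sum_comm]
  refine Finset.sum_le_sum fun m hm => ?_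
  rw [← Finset.sum_filter, Finset.sum_const, nsmul_eq_mul]
  refine mul_le_mul_of_nonneg_right ?_ (hpos m hm)
  have hsub : (Finset.range (k + 1)).filter (fun j => j - W ≤ m ∧ m < j + W) ⊆
      Finset.Ico (m + 1 - W) (m + W + 1) := by
    intro j hj
    simp only [Finset.mem_filter, Finset.mem_range, Finset.mem_Ico] at hj ⊢
    omega
  have h3 := Finset.card_le_card hsub
  rw [Nat.card_Ico] at h3
  have h4 : m + W + 1 - (m + 1 - W) ≤ 2 * W := by omega
  exact_mod_cast h3.trans h4

end QuasiUniformKnots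

/-- Local form of the Jackson estimate for splines. -/
theorem exists_spline_approx (r p : ℕ) (hr : 1 ≤ r) (hp : r ≤ p + 1) (Λ : ℝ) (hΛ : 1 ≤ Λ) :
    ∃ K : ℝ, 0 < K ∧ ∀ (k : ℕ) (t : ℕ → ℝ) (ψ : ℝ → ℝ) (D : ℕ → ℝ → ℝ),
      QuasiUniformKnots Λ p k t → HasSobolevDerivs r ψ D →
      ∃ (c : Fin (k + p + 1) → ℝ) (E : ℕ → ℝ), (∀ j ≤ k, 0 ≤ E j) ∧
        ∑ j ∈ Finset.range (k + 1), E j ≤ K * ∫ u in (0 : ℝ)..1, D r u ^ 2 ∧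
        ∀ j ≤ k, ∀ x ∈ Ico (t (p + j)) (t (p + j + 1)),
          (ψ x - spline t p k c x) ^ 2 ≤ ((k + 1 : ℝ) ^ (2 * r - 1))⁻¹ * E j := by
  obtain ⟨K₁, hK₁, hdual⟩ := exists_abs_dualCoeff_le p
  obtain ⟨m, rfl⟩ : ∃ m, r = m + 1 := ⟨r - 1, by omega⟩
  set W : ℕ := 3 * p + 1 with hW
  -- The summand `1` is for the Taylor error of a reference polynomial, the rest for the deviation
  -- of the other coefficients from it; the final factor `2` comes from comparing two Taylor
  -- polynomials.
  set K₀ : ℝ := 1 + K₁ * (2 * W * Λ ^ 2) ^ p * 2 with hK₀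
  set K₂ : ℝ := K₀ ^ 2 * (2 * W * Λ) ^ (2 * m + 1) with hK₂
  have hWpos : (0 : ℝ) < W := by rw [hW]; positivity
  have hΛ0 : 0 < Λ := by linarith
  have hK₂pos : 0 < K₂ := by positivity
  refine ⟨K₂ * (2 * W : ℕ), by positivity, fun k t ψ D ht hD => ?_⟩
  set ξ : ℕ → ℝ := fun i => t (nodeIndex p k i) with hξ
  set A : ℕ → ℝ := fun j => t (p + (j - W)) with hA
  set B : ℕ → ℝ := fun j => t (p + min (k + 1) (j + W)) with hB
  set F : ℕ → ℝ := fun j => ∫ u in A j..B j, D (m + 1) u ^ 2 with hF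
  have hAB : ∀ j ≤ k, A j ≤ B j := fun j hj => ht.mono_cell (by omega) (by omega)
  have hF0 : ∀ j ≤ k, 0 ≤ F j := fun j hj =>
    intervalIntegral.integral_nonneg (hAB j hj) fun _ _ => sq_nonneg _
  have hH : ∀ j ≤ k, B j - A j ≤ 2 * W * (Λ / (k + 1)) := by
    intro j hj
    refine (ht.sub_le_of_le (i := j - W) (j := min (k + 1) (j + W)) (by omega) (by omega)).trans ?_
    refine mul_le_mul_of_nonneg_right ?_ (by positivity)
    have : min (k + 1) (j + W) - (j - W) ≤ 2 * W := by omega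
    exact_mod_cast this
  -- The quasi-interpolant: the coefficient with index `i` is the one of the Taylor polynomial at a
  -- knot near the `i`-th B-spline.
  refine ⟨fun i => dualCoeff t p i (taylorPoly D (m + 1) (ξ i)), fun j => K₂ * F j,
    fun j hj => mul_nonneg hK₂pos.le (hF0 j hj), ?_, ?_⟩
  · rw [← Finset.mul_sum, mul_assoc K₂]
    refine mul_le_mul_of_nonneg_left ?_ hK₂pos.le
    exact ht.sum_integral_near_le (fun _ => sq_nonneg _) (hD.memLp (m + 1) le_rfl).integrable_sq W
  intro j hj x hx
  have hx01 := ht.cell_subset hj hx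
  have hcell : Icc (t (p + j)) (t (p + j + 1)) ⊆ Icc (A j) (B j) :=
    Icc_subset_Icc (ht.mono_cell (by omega) (by omega))
      (ht.mono_cell (i := j + 1) (by omega) (by omega))
  have hA0 : 0 ≤ A j := (ht.knot_mem (by omega)).1
  have hB1 : B j ≤ 1 := (ht.knot_mem (by omega)).2
  have hξm : ∀ i, j ≤ i → i ≤ j + p → ξ i ∈ Icc (A j) (B j) := by
    intro i hi hi'
    have := nodeIndex_near hj hi hi'
    obtain ⟨s, hs⟩ : ∃ s, nodeIndex p k i = p + s := ⟨nodeIndex p k i - p, by omega⟩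
    simp only [hξ, hs]
    exact ⟨ht.mono_cell (by omega) (by omega), ht.mono_cell (by omega) (by omega)⟩
  set ε : ℝ := (B j - A j) ^ m * √((B j - A j) * F j) with hε
  have hε0 : 0 ≤ ε := mul_nonneg (pow_nonneg (sub_nonneg.2 (hAB j hj)) _) (Real.sqrt_nonneg _)
  have hT : ∀ i, j ≤ i → i ≤ j + p → ∀ u ∈ Icc (A j) (B j),
      |ψ u - (taylorPoly D (m + 1) (ξ i)).eval u| ≤ ε := by
    intro i hi hi' u hu
    rw [eval_taylorPoly, ← hD.zero u ⟨hA0.trans hu.1, hu.2.trans hB1⟩]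
    exact abs_sub_taylor_le hA0 hB1 hu (hξm i hi hi') hD
  -- The reference on cell `j` is the Taylor polynomial belonging to the last B-spline alive there.
  -- It is reproduced exactly, so only the differences `q i` contribute to the error beyond its own.
  set q : ℕ → Polynomial ℝ := fun i =>
    taylorPoly D (m + 1) (ξ i) - taylorPoly D (m + 1) (ξ (j + p)) with hq
  have hqd : ∀ i, (q i).natDegree ≤ p := fun i =>
    (Polynomial.natDegree_sub_le_of_le (natDegree_taylorPoly_le D hp _)
      (natDegree_taylorPoly_le D hp _)).trans (max_self p).le
  have hlow := ht.lower (p + j) (by omega) (by omega)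
  have hcl := ht.cell_lt hΛ hj
  have hqb : ∀ i, j ≤ i → i ≤ j + p →
      |dualCoeff t p i (q i)| ≤ K₁ * (2 * W * Λ ^ 2) ^ p * (2 * ε) := by
    intro i hi hi'
    rcases nodeIndex_eq_or hj hi hi' with h | h
    · have : q i = 0 := by simp [hq, hξ, h]
      rw [this, map_zero, abs_zero]
      positivity
    -- All knots involved are now genuine ones within the neighbourhood of the cell, so the dual
    -- functional is bounded. Quasi-uniformity bounds the ratio of the neighbourhood to the cell by
    -- `2 * W * Λ ^ 2`.
    · have h1 := hdual t i (t (p + j)) (t (p + j + 1)) (B j - A j) (2 * ε) (q i) hcl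
        (by have := hcell ⟨hcl.le, le_rfl⟩; have := hcell ⟨le_rfl, hcl.le⟩; grind)
        (fun l hl => by
          have a1 : t (i + l + 1) ∈ Icc (A j) (B j) := by
            obtain ⟨s, hs⟩ : ∃ s, i + l + 1 = p + s := ⟨i + l + 1 - p, by omega⟩
            rw [hs]
            exact ⟨ht.mono_cell (by omega) (by omega), ht.mono_cell (by omega) (by omega)⟩
          have a2 := hcell ⟨le_rfl, hcl.le⟩
          rw [abs_le]
          constructor <;> linarith [a1.1, a1.2, a2.1, a2.2])
        (hqd i) (fun u hu => by
          have b1 := hT i hi hi' u (hcell hu)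
          have b2 := hT (j + p) (by omega) le_rfl u (hcell hu)
          simp only [hq, Polynomial.eval_sub]
          rw [abs_le] at b1 b2 ⊢
          constructor <;> linarith [b1.1, b1.2, b2.1, b2.2])
      refine h1.trans (mul_le_mul_of_nonneg_right (mul_le_mul_of_nonneg_left
        (pow_le_pow_left₀ ?_ ?_ p) hK₁.le) (by positivity))
      · exact div_nonneg (sub_nonneg.2 (hAB j hj)) (by linarith)
      · rw [div_le_iff₀ (by linarith)]
        refine (hH j hj).trans ?_
        calc 2 * W * (Λ / (k + 1)) = 2 * W * Λ ^ 2 * (1 / (Λ * (k + 1))) := by field_simp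
          _ ≤ _ := mul_le_mul_of_nonneg_left hlow (by positivity)
  have hsplit : spline t p k (fun i => dualCoeff t p i (taylorPoly D (m + 1) (ξ i))) x =
      (taylorPoly D (m + 1) (ξ (j + p))).eval x +
        ∑ i ∈ Finset.range (k + p + 1), dualCoeff t p i (q i) * bspline t p i x := by
    rw [← ht.sum_dualCoeff (natDegree_taylorPoly_le D hp _) hx01, ← Finset.sum_add_distrib, spline,
      ← Fin.sum_univ_eq_sum_range (fun i => dualCoeff t p i (taylorPoly D (m + 1) (ξ (j + p))) *
        bspline t p i x + dualCoeff t p i (q i) * bspline t p i x)]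
    refine Finset.sum_congr rfl fun i _ => ?_
    simp only [hq, map_sub]
    ring
  have hsum : |∑ i ∈ Finset.range (k + p + 1), dualCoeff t p i (q i) * bspline t p i x| ≤
      K₁ * (2 * W * Λ ^ 2) ^ p * (2 * ε) := by
    calc _ ≤ ∑ i ∈ Finset.range (k + p + 1), |dualCoeff t p i (q i) * bspline t p i x| :=
          Finset.abs_sum_le_sum_abs _ _
      _ ≤ ∑ i ∈ Finset.range (k + p + 1),
          K₁ * (2 * W * Λ ^ 2) ^ p * (2 * ε) * bspline t p i x := by
          refine Finset.sum_le_sum fun i hi => ?_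
          have hi' := Finset.mem_range.1 hi
          have hb : 0 ≤ bspline t p i x := bspline_nonneg ht.mono (by omega)
          by_cases h : j ≤ i ∧ i ≤ j + p
          · rw [abs_mul, abs_of_nonneg hb]
            exact mul_le_mul_of_nonneg_right (hqb i h.1 h.2) hb
          · rw [ht.bspline_zero_of_cell hj hi' hx (by omega)]
            simp
      _ = _ := by rw [← Finset.mul_sum, ht.sum_bspline hx01, mul_one]
  have habs : |ψ x - spline t p k (fun i => dualCoeff t p i (taylorPoly D (m + 1) (ξ i))) x| ≤
      K₀ * ε := by
    have h1 := hT (j + p) (by omega) le_rfl x (hcell ⟨hx.1, hx.2.le⟩)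
    rw [hsplit, hK₀]
    rw [abs_le] at h1 hsum ⊢
    constructor <;> linarith [h1.1, h1.2, hsum.1, hsum.2]
  have hHF : 0 ≤ (B j - A j) * F j := mul_nonneg (sub_nonneg.2 (hAB j hj)) (hF0 j hj)
  calc (ψ x - spline t p k (fun i => dualCoeff t p i (taylorPoly D (m + 1) (ξ i))) x) ^ 2
      ≤ (K₀ * ε) ^ 2 := sq_le_sq' (abs_le.1 habs).1 (abs_le.1 habs).2
    _ = K₀ ^ 2 * (B j - A j) ^ (2 * m + 1) * F j := by
        rw [hε, mul_pow, mul_pow, Real.sq_sqrt hHF]; ring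
    _ ≤ K₀ ^ 2 * (2 * W * (Λ / (k + 1))) ^ (2 * m + 1) * F j := by
        refine mul_le_mul_of_nonneg_right (mul_le_mul_of_nonneg_left
          (pow_le_pow_left₀ (sub_nonneg.2 (hAB j hj)) (hH j hj) _) (sq_nonneg _)) (hF0 j hj)
    _ = _ := by
        have : 2 * (m + 1) - 1 = 2 * m + 1 := by omega
        rw [this, hK₂, ← mul_div_assoc, div_pow]
        ring

/-! ### Splines as a finite-dimensional function space -/

theorem spline_add (t : ℕ → ℝ) (p k : ℕ) (c d : Fin (k + p + 1) → ℝ) (x : ℝ) :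
    spline t p k (c + d) x = spline t p k c x + spline t p k d x := by
  simp [spline, add_mul, Finset.sum_add_distrib]

theorem spline_sub (t : ℕ → ℝ) (p k : ℕ) (c d : Fin (k + p + 1) → ℝ) (x : ℝ) :
    spline t p k (c - d) x = spline t p k c x - spline t p k d x := by
  simp [spline, sub_mul, Finset.sum_sub_distrib]

theorem spline_smul (t : ℕ → ℝ) (p k : ℕ) (s : ℝ) (c : Fin (k + p + 1) → ℝ) (x : ℝ) :
    spline t p k (s • c) x = s * spline t p k c x := by
  simp [spline, Finset.mul_sum, mul_assoc]

/-- The monomial of degree `b.2` in the local variable of the cell with number `b.1`. -/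
noncomputable def cellMonomial (t : ℕ → ℝ) (p : ℕ) (b : ℕ × Fin (p + 1)) : ℝ → ℝ :=
  (Ico (t (p + b.1)) (t (p + b.1 + 1))).indicator
    fun x => ((x - t (p + b.1)) / (t (p + b.1 + 1) - t (p + b.1))) ^ (b.2 : ℕ)

/-- The indices of all cell monomials. -/
def cellIndex (p k : ℕ) : Finset (ℕ × Fin (p + 1)) := Finset.range (k + 1) ×ˢ Finset.univ

/-- The length of the cell with number `j`. -/
def cellLength (t : ℕ → ℝ) (p j : ℕ) : ℝ := t (p + j + 1) - t (p + j)

theorem measurable_cellMonomial (t : ℕ → ℝ) (p : ℕ) (b : ℕ × Fin (p + 1)) :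
    Measurable (cellMonomial t p b) :=
  Measurable.indicator (by fun_prop) measurableSet_Ico

theorem cellMonomial_mem_Icc (t : ℕ → ℝ) (p : ℕ) (b : ℕ × Fin (p + 1)) (x : ℝ) :
    cellMonomial t p b x ∈ Icc (0 : ℝ) 1 := by
  unfold cellMonomial
  by_cases hx : x ∈ Ico (t (p + b.1)) (t (p + b.1 + 1))
  · rw [indicator_of_mem hx]
    have h1 : 0 < t (p + b.1 + 1) - t (p + b.1) := by linarith [hx.1, hx.2]
    have h2 : 0 ≤ (x - t (p + b.1)) / (t (p + b.1 + 1) - t (p + b.1)) :=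
      div_nonneg (by linarith [hx.1]) h1.le
    refine ⟨pow_nonneg h2 _, pow_le_one₀ h2 ?_⟩
    rw [div_le_one h1]
    linarith [hx.2]
  · rw [indicator_of_notMem hx]
    simp

/-- B-splines have half-open supports, so their identities can fail at the right end point;
integrals do not see it. -/
theorem ae_mem_Ico : ∀ᵐ u ∂(volume.restrict (Icc (0 : ℝ) 1)), u ∈ Ico (0 : ℝ) 1 := by
  rw [← Measure.restrict_congr_set Ico_ae_eq_Icc]
  exact ae_restrict_mem measurableSet_Ico

namespace QuasiUniformKnots

variable {Λ : ℝ} {p k : ℕ} {t : ℕ → ℝ}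

theorem abs_spline_le (ht : QuasiUniformKnots Λ p k t) (c : Fin (k + p + 1) → ℝ) {x : ℝ}
    (hx : x ∈ Ico (0 : ℝ) 1) : |spline t p k c x| ≤ ∑ i, |c i| := by
  refine (Finset.abs_sum_le_sum_abs _ _).trans (Finset.sum_le_sum fun i _ => ?_)
  have h0 : ∀ i ∈ Finset.range (k + p + 1), 0 ≤ bspline t p i x := fun i hi =>
    bspline_nonneg ht.mono (by have := Finset.mem_range.1 hi; omega)
  have h1 := Finset.single_le_sum h0 (Finset.mem_range.2 i.2)
  rw [ht.sum_bspline hx] at h1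
  rw [abs_mul, abs_of_nonneg (h0 i (Finset.mem_range.2 i.2))]
  exact mul_le_of_le_one_right (abs_nonneg _) h1

theorem memLp_spline (ht : QuasiUniformKnots Λ p k t) (c : Fin (k + p + 1) → ℝ) :
    MemLp (spline t p k c) 2 (volume.restrict (Icc (0 : ℝ) 1)) := by
  refine MemLp.of_bound (measurable_spline t p k c).aestronglyMeasurable (∑ i, |c i|) ?_
  filter_upwards [ae_mem_Ico] with x hx
  exact ht.abs_spline_le c hx

theorem integrableOn_spline_sq (ht : QuasiUniformKnots Λ p k t) (c : Fin (k + p + 1) → ℝ) :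
    IntegrableOn (fun u => spline t p k c u ^ 2) (Icc 0 1) :=
  (ht.memLp_spline c).integrable_sq

theorem cellLength_pos (hΛ : 1 ≤ Λ) (ht : QuasiUniformKnots Λ p k t) {j : ℕ} (hj : j ≤ k) :
    0 < cellLength t p j := sub_pos.2 (ht.cell_lt hΛ hj)

theorem sum_integral_cells (ht : QuasiUniformKnots Λ p k t) {f : ℝ → ℝ}
    (hf : IntegrableOn f (Icc 0 1)) :
    ∑ j ∈ Finset.range (k + 1), ∫ u in t (p + j)..t (p + j + 1), f u = ∫ u in (0 : ℝ)..1, f u := by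
  have := intervalIntegral.sum_integral_adjacent_intervals (a := fun m => t (p + m)) (n := k + 1)
    (f := f) (μ := volume) fun m hm => (hf.mono_set (uIcc_subset_Icc (ht.knot_mem (by omega))
      (ht.knot_mem (by omega)))).intervalIntegrable
  simp only [add_zero, ht.left] at this
  rw [← add_assoc, ht.right] at this
  exact this

/-- Local coordinates of a spline, with a lower bound of its norm. -/
theorem exists_local_coords (hΛ : 1 ≤ Λ) (ht : QuasiUniformKnots Λ p k t) {lam : ℝ}
    (hlam : ∀ a : Fin (p + 1) → ℝ,
      lam * ∑ l, a l ^ 2 ≤ ∫ u in (0 : ℝ)..1, (∑ l, a l * u ^ (l : ℕ)) ^ 2)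
    (c : Fin (k + p + 1) → ℝ) :
    ∃ a : ℕ × Fin (p + 1) → ℝ,
      (∀ x ∈ Ico (0 : ℝ) 1, spline t p k c x =
        ∑ b ∈ cellIndex p k, a b * cellMonomial t p b x) ∧
      (∀ j ≤ k, ∀ x ∈ Ico (t (p + j)) (t (p + j + 1)), spline t p k c x =
        ∑ l : Fin (p + 1), a (j, l) * ((x - t (p + j)) / cellLength t p j) ^ (l : ℕ)) ∧
      (∀ j ≤ k, lam * (cellLength t p j * ∑ l : Fin (p + 1), a (j, l) ^ 2) ≤
        ∫ u in t (p + j)..t (p + j + 1), spline t p k c u ^ 2) ∧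
      lam * ∑ b ∈ cellIndex p k, cellLength t p b.1 * a b ^ 2 ≤
        ∫ u in (0 : ℝ)..1, spline t p k c u ^ 2 := by
  classical
  have hex : ∀ j, ∃ a : Fin (p + 1) → ℝ, j ≤ k → ∀ x ∈ Ico (t (p + j)) (t (p + j + 1)),
      spline t p k c x = ∑ l, a l * ((x - t (p + j)) / (t (p + j + 1) - t (p + j))) ^ (l : ℕ) := by
    intro j
    by_cases hj : j ≤ k
    · obtain ⟨a, ha⟩ := ht.spline_eq_local hΛ hj c
      exact ⟨a, fun _ => ha⟩
    · exact ⟨0, fun h => absurd h hj⟩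
  choose a ha using hex
  have hcell : ∀ j ≤ k, lam * (cellLength t p j * ∑ l : Fin (p + 1), a j l ^ 2) ≤
      ∫ u in t (p + j)..t (p + j + 1), spline t p k c u ^ 2 := by
    intro j hj
    have h1 : ∫ u in t (p + j)..t (p + j + 1), spline t p k c u ^ 2 =
        ∫ u in t (p + j)..t (p + j + 1),
          (∑ l, a j l * ((u - t (p + j)) / (t (p + j + 1) - t (p + j))) ^ (l : ℕ)) ^ 2 := by
      refine intervalIntegral.integral_congr_ae ?_
      have hne : ∀ᵐ u : ℝ, u ≠ t (p + j + 1) := by simp [ae_iff, measure_singleton]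
      filter_upwards [hne] with u hu1 hu
      rw [uIoc_of_le (ht.cell_lt hΛ hj).le] at hu
      rw [ha j hj u ⟨hu.1.le, lt_of_le_of_ne hu.2 hu1⟩]
    rw [h1, integral_local_poly_sq _ (ht.cell_lt hΛ hj)]
    calc _ = cellLength t p j * (lam * ∑ l : Fin (p + 1), a j l ^ 2) := by ring
      _ ≤ _ := mul_le_mul_of_nonneg_left (hlam _) (ht.cellLength_pos hΛ hj).le
  refine ⟨fun b => a b.1 b.2, fun x hx => ?_, fun j hj x hx => ha j hj x hx, hcell, ?_⟩
  · obtain ⟨j, hj, hxj⟩ := ht.exists_cell hx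
    rw [ha j hj x hxj, cellIndex, Finset.sum_product, Finset.sum_eq_single j]
    · refine Finset.sum_congr rfl fun l _ => ?_
      simp only [cellMonomial]
      rw [indicator_of_mem hxj]
    · intro i hi hij
      refine Finset.sum_eq_zero fun l _ => ?_
      simp only [cellMonomial]
      have hi' := Finset.mem_range.1 hi
      rw [indicator_of_notMem, mul_zero]
      intro hxi
      rcases lt_or_gt_of_ne hij with h | h
      · have : t (p + i + 1) ≤ t (p + j) := ht.mono_cell (i := i + 1) (by omega) (by omega)
        exact absurd hxi.2 (not_lt.2 (this.trans hxj.1))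
      · have : t (p + j + 1) ≤ t (p + i) := ht.mono_cell (i := j + 1) (by omega) (by omega)
        exact absurd hxj.2 (not_lt.2 (this.trans hxi.1))
    · intro hn
      exact absurd (Finset.mem_range.2 (by omega)) hn
  · rw [← ht.sum_integral_cells (ht.integrableOn_spline_sq c), cellIndex, Finset.sum_product,
      Finset.mul_sum]
    refine Finset.sum_le_sum fun j hj => ?_
    change lam * ∑ l, cellLength t p j * a j l ^ 2 ≤ _
    rw [← Finset.mul_sum]
    exact hcell j (by have := Finset.mem_range.1 hj; omega)

theorem integral_spline_sq_pos (hΛ : 1 ≤ Λ) (ht : QuasiUniformKnots Λ p k t)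
    {c : Fin (k + p + 1) → ℝ} (hc : c ≠ 0) : 0 < ∫ u in (0 : ℝ)..1, spline t p k c u ^ 2 := by
  obtain ⟨lam, hlam0, hlam⟩ := exists_monomial_lower_bound p
  obtain ⟨a, ha, -, -, hle⟩ := ht.exists_local_coords hΛ hlam c
  by_contra hcon
  refine hc (ht.coeff_eq_zero hΛ fun x hx => ?_)
  have hpos : ∀ b ∈ cellIndex p k, 0 < cellLength t p b.1 := fun b hb =>
    ht.cellLength_pos hΛ (by
      have := (Finset.mem_product.1 hb).1
      have := Finset.mem_range.1 this
      omega)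
  have h0 : ∑ b ∈ cellIndex p k, cellLength t p b.1 * a b ^ 2 = 0 := by
    refine le_antisymm ?_ (Finset.sum_nonneg fun b hb => by have := hpos b hb; positivity)
    have := hle.trans (not_lt.1 hcon)
    by_contra h
    exact absurd this (not_le.2 (mul_pos hlam0 (not_le.1 h)))
  rw [Finset.sum_eq_zero_iff_of_nonneg fun b hb => by have := hpos b hb; positivity] at h0
  rw [ha x hx]
  refine Finset.sum_eq_zero fun b hb => ?_
  have h1 := h0 b hb
  have h2 : a b = 0 := by
    rcases mul_eq_zero.1 h1 with h | h
    · exact absurd h (hpos b hb).ne'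
    · exact pow_eq_zero_iff two_ne_zero |>.1 h
  rw [h2, zero_mul]

/-- An inverse estimate: a point value is bounded by the local coefficients, hence by the `L²` norm
on its cell. The constant may depend on `k`, since this only serves to establish integrability. -/
theorem spline_sq_le (hΛ : 1 ≤ Λ) (ht : QuasiUniformKnots Λ p k t) : ∃ C : ℝ, 0 < C ∧
    ∀ c : Fin (k + p + 1) → ℝ, ∀ x ∈ Ico (0 : ℝ) 1,
      spline t p k c x ^ 2 ≤ C * ∫ u in (0 : ℝ)..1, spline t p k c u ^ 2 := by
  obtain ⟨lam, hlam0, hlam⟩ := exists_monomial_lower_bound p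
  have hΛ0 : 0 < Λ := by linarith
  refine ⟨Λ * (k + 1) / lam * (p + 1), by positivity, fun c x hx => ?_⟩
  obtain ⟨a, -, ha, hcell, -⟩ := ht.exists_local_coords hΛ hlam c
  obtain ⟨j, hj, hxj⟩ := ht.exists_cell hx
  have hpos := ht.cellLength_pos hΛ hj
  have h1 : ∫ u in t (p + j)..t (p + j + 1), spline t p k c u ^ 2 ≤
      ∫ u in (0 : ℝ)..1, spline t p k c u ^ 2 := by
    refine intervalIntegral.integral_mono_interval (ht.knot_mem (by omega)).1 (ht.cell_lt hΛ hj).le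
      (ht.knot_mem (j := j + 1) (by omega)).2 (Eventually.of_forall fun _ => sq_nonneg _) ?_
    rw [intervalIntegrable_iff_integrableOn_Icc_of_le zero_le_one]
    exact ht.integrableOn_spline_sq c
  have h2 := (hcell j hj).trans h1
  have hq0 : 0 ≤ (x - t (p + j)) / cellLength t p j := div_nonneg (by linarith [hxj.1]) hpos.le
  have hq1 : (x - t (p + j)) / cellLength t p j ≤ 1 := by
    rw [div_le_one hpos]; unfold cellLength; linarith [hxj.2]
  have h3 : spline t p k c x ^ 2 ≤ (p + 1) * ∑ l : Fin (p + 1), a (j, l) ^ 2 := by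
    rw [ha j hj x hxj]
    have := sq_sum_le_card_mul_sum_sq (s := Finset.univ) (f := fun l : Fin (p + 1) =>
      a (j, l) * ((x - t (p + j)) / cellLength t p j) ^ (l : ℕ))
    rw [Finset.card_univ, Fintype.card_fin] at this
    push_cast at this
    refine this.trans (mul_le_mul_of_nonneg_left (Finset.sum_le_sum fun l _ => ?_) (by positivity))
    rw [mul_pow]
    exact mul_le_of_le_one_right (sq_nonneg _) (pow_le_one₀ (by positivity) (pow_le_one₀ hq0 hq1))
  have hlow : 1 / (Λ * (k + 1)) ≤ cellLength t p j := ht.lower (p + j) (by omega) (by omega)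
  set S := ∑ l : Fin (p + 1), a (j, l) ^ 2 with hS
  have hS0 : 0 ≤ S := Finset.sum_nonneg fun _ _ => sq_nonneg _
  have h4 : S ≤ Λ * (k + 1) / lam * ∫ u in (0 : ℝ)..1, spline t p k c u ^ 2 := by
    have h5 : lam * (1 / (Λ * (k + 1)) * S) ≤ ∫ u in (0 : ℝ)..1, spline t p k c u ^ 2 :=
      (mul_le_mul_of_nonneg_left (mul_le_mul_of_nonneg_right hlow hS0) hlam0.le).trans h2
    calc S = Λ * (k + 1) / lam * (lam * (1 / (Λ * (k + 1)) * S)) := by field_simp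
      _ ≤ _ := mul_le_mul_of_nonneg_left h5 (by positivity)
  calc _ ≤ _ := h3
    _ ≤ (p + 1) * (Λ * (k + 1) / lam * ∫ u in (0 : ℝ)..1, spline t p k c u ^ 2) :=
        mul_le_mul_of_nonneg_left h4 (by positivity)
    _ = _ := by ring

end QuasiUniformKnots

/-! ### Single B-splines as splines -/

section SingleBSpline

variable {Λ : ℝ} {p k : ℕ} {t : ℕ → ℝ}

theorem spline_single (t : ℕ → ℝ) (p k : ℕ) {i : ℕ} (hi : i < k + p + 1) :
    spline t p k (Pi.single ⟨i, hi⟩ 1) = bspline t p i := by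
  ext u
  simp [spline, Pi.single_apply]

theorem QuasiUniformKnots.memLp_bspline (ht : QuasiUniformKnots Λ p k t) {i : ℕ}
    (hi : i < k + p + 1) : MemLp (bspline t p i) 2 (volume.restrict (Icc (0 : ℝ) 1)) := by
  rw [← spline_single t p k hi]
  exact ht.memLp_spline _

theorem QuasiUniformKnots.integral_bspline_sq_pos (hΛ : 1 ≤ Λ) (ht : QuasiUniformKnots Λ p k t)
    {i : ℕ} (hi : i < k + p + 1) : 0 < ∫ u in (0 : ℝ)..1, bspline t p i u ^ 2 := by
  rw [← spline_single t p k hi]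
  refine ht.integral_spline_sq_pos hΛ fun h => ?_
  have := congrFun h ⟨i, hi⟩
  simp at this

end SingleBSpline

/-! ### The least-squares coefficients on a stable design -/

/-- The matrix of the values of the B-splines at the design points. -/
noncomputable def designMatrix (t : ℕ → ℝ) (p k : ℕ) {n : ℕ} (x : Fin n → ℝ) :
    Matrix (Fin n) (Fin (k + p + 1)) ℝ :=
  Matrix.of fun i a => bspline t p a (x i)

open Matrix in
/-- The solution of the normal equations. -/
noncomputable def lsCoeff (t : ℕ → ℝ) (p k : ℕ) {n : ℕ} (x y : Fin n → ℝ) : Fin (k + p + 1) → ℝ :=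
  ((designMatrix t p k x)ᵀ * designMatrix t p k x)⁻¹ *ᵥ ((designMatrix t p k x)ᵀ *ᵥ y)

section LeastSquares

open Matrix

variable {Λ τ : ℝ} {p k n : ℕ} {t : ℕ → ℝ} {x : Fin n → ℝ}

theorem designMatrix_mulVec (t : ℕ → ℝ) (p k : ℕ) (x : Fin n → ℝ) (c : Fin (k + p + 1) → ℝ)
    (i : Fin n) : (designMatrix t p k x *ᵥ c) i = spline t p k c (x i) := by
  simp [designMatrix, Matrix.mulVec, dotProduct, spline, mul_comm]

theorem lsCoeff_add (t : ℕ → ℝ) (p k : ℕ) (x y z : Fin n → ℝ) :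
    lsCoeff t p k x (y + z) = lsCoeff t p k x y + lsCoeff t p k x z := by
  simp [lsCoeff, Matrix.mulVec_add]

theorem lsCoeff_smul (t : ℕ → ℝ) (p k : ℕ) (s : ℝ) (x y : Fin n → ℝ) :
    lsCoeff t p k x (s • y) = s • lsCoeff t p k x y := by
  simp [lsCoeff, Matrix.mulVec_smul]

theorem StableDesign.sum_sq_pos (hΛ : 1 ≤ Λ) (ht : QuasiUniformKnots Λ p k t) (hτ : 0 < τ)
    (hx : StableDesign t p k τ x) {c : Fin (k + p + 1) → ℝ} (hc : c ≠ 0) :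
    0 < ∑ i, spline t p k c (x i) ^ 2 := by
  have h1 := ht.integral_spline_sq_pos hΛ hc
  have h2 := (mul_pos hτ h1).trans_le (hx c)
  exact pos_of_mul_pos_right h2 (by positivity)

/-- A kernel vector would give a spline that vanishes at all design points, which stability forbids.
-/
theorem StableDesign.isUnit_det (hΛ : 1 ≤ Λ) (ht : QuasiUniformKnots Λ p k t) (hτ : 0 < τ)
    (hx : StableDesign t p k τ x) :
    IsUnit ((designMatrix t p k x)ᵀ * designMatrix t p k x).det := by
  rw [isUnit_iff_ne_zero]
  intro h
  obtain ⟨v, hv, hv0⟩ := Matrix.exists_mulVec_eq_zero_iff.2 h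
  have h1 := hx.sum_sq_pos hΛ ht hτ hv
  have h2 : v ⬝ᵥ (((designMatrix t p k x)ᵀ * designMatrix t p k x) *ᵥ v) =
      ∑ i, spline t p k v (x i) ^ 2 := by
    rw [← Matrix.mulVec_mulVec, Matrix.dotProduct_mulVec, Matrix.vecMul_transpose]
    simp only [dotProduct, designMatrix_mulVec, sq]
  rw [hv0, dotProduct_zero] at h2
  exact h1.ne h2

theorem StableDesign.normal_eq (hΛ : 1 ≤ Λ) (ht : QuasiUniformKnots Λ p k t) (hτ : 0 < τ)
    (hx : StableDesign t p k τ x) (y : Fin n → ℝ) (d : Fin (k + p + 1) → ℝ) :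
    ∑ i, spline t p k (lsCoeff t p k x y) (x i) * spline t p k d (x i) =
      ∑ i, y i * spline t p k d (x i) := by
  have hu := hx.isUnit_det hΛ ht hτ
  have h1 : ((designMatrix t p k x)ᵀ * designMatrix t p k x) *ᵥ lsCoeff t p k x y =
      (designMatrix t p k x)ᵀ *ᵥ y := by
    rw [lsCoeff, Matrix.mulVec_mulVec, Matrix.mul_nonsing_inv _ hu, Matrix.one_mulVec]
  have h2 := congrArg (fun v => d ⬝ᵥ v) h1
  rw [← Matrix.mulVec_mulVec,
    Matrix.dotProduct_mulVec d _ (designMatrix t p k x *ᵥ lsCoeff t p k x y),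
    Matrix.dotProduct_mulVec d _ y, Matrix.vecMul_transpose] at h2
  simp only [dotProduct, designMatrix_mulVec] at h2
  simpa only [mul_comm] using h2

theorem StableDesign.eq_lsCoeff (hΛ : 1 ≤ Λ) (ht : QuasiUniformKnots Λ p k t) (hτ : 0 < τ)
    (hx : StableDesign t p k τ x) {y : Fin n → ℝ} {c : Fin (k + p + 1) → ℝ}
    (hc : ∀ d : Fin (k + p + 1) → ℝ, ∑ i, spline t p k c (x i) * spline t p k d (x i) =
      ∑ i, y i * spline t p k d (x i)) : c = lsCoeff t p k x y := by
  by_contra hne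
  have h1 := hx.sum_sq_pos hΛ ht hτ (sub_ne_zero.2 hne)
  have h2 := hc (c - lsCoeff t p k x y)
  have h3 := hx.normal_eq hΛ ht hτ y (c - lsCoeff t p k x y)
  have h4 : ∑ i, spline t p k (c - lsCoeff t p k x y) (x i) ^ 2 =
      ∑ i, spline t p k c (x i) * spline t p k (c - lsCoeff t p k x y) (x i) -
      ∑ i, spline t p k (lsCoeff t p k x y) (x i) *
        spline t p k (c - lsCoeff t p k x y) (x i) := by
    rw [← Finset.sum_sub_distrib]
    refine Finset.sum_congr rfl fun i _ => ?_
    rw [sq, ← sub_mul, ← spline_sub]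
  rw [h4, h2, h3, sub_self] at h1
  exact lt_irrefl _ h1

theorem StableDesign.lsCoeff_spline (hΛ : 1 ≤ Λ) (ht : QuasiUniformKnots Λ p k t) (hτ : 0 < τ)
    (hx : StableDesign t p k τ x) (c : Fin (k + p + 1) → ℝ) :
    lsCoeff t p k x (fun i => spline t p k c (x i)) = c :=
  (hx.eq_lsCoeff hΛ ht hτ fun _ => rfl).symm

/-- A minimizer satisfies the normal equations, and on a stable design these have one solution. The
arbitrary rule `cHat`, which need not be measurable, is thereby replaced by an explicit expression
that is linear in the responses. -/
theorem StableDesign.leastSquares_eq (hΛ : 1 ≤ Λ) (ht : QuasiUniformKnots Λ p k t) (hτ : 0 < τ)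
    (hx : StableDesign t p k τ x) {cHat : (Fin n → ℝ) → (Fin n → ℝ) → Fin (k + p + 1) → ℝ}
    (hc : IsLeastSquares t p k n cHat) (y : Fin n → ℝ) : cHat x y = lsCoeff t p k x y := by
  refine hx.eq_lsCoeff hΛ ht hτ fun d => ?_
  -- first variation of the residual sum of squares
  set A := ∑ i, (y i - spline t p k (cHat x y) (x i)) * spline t p k d (x i) with hA
  set Q := ∑ i, spline t p k d (x i) ^ 2 with hQ
  have hvar : ∀ s : ℝ, 0 ≤ -2 * s * A + s ^ 2 * Q := by
    intro s
    have h1 := hc x y (cHat x y + s • d)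
    have h2 : ∑ i, (y i - spline t p k (cHat x y + s • d) (x i)) ^ 2 =
        ∑ i, (y i - spline t p k (cHat x y) (x i)) ^ 2 + (-2 * s * A + s ^ 2 * Q) := by
      rw [hA, hQ, Finset.mul_sum, Finset.mul_sum, ← Finset.sum_add_distrib,
        ← Finset.sum_add_distrib]
      refine Finset.sum_congr rfl fun i _ => ?_
      rw [spline_add, spline_smul]
      ring
    linarith
  have hQ0 : 0 ≤ Q := Finset.sum_nonneg fun _ _ => sq_nonneg _
  have hA0 : A = 0 := by
    -- The minimizing step would be `A / Q`; adding `1` avoids the case `Q = 0` and still gives a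
    -- negative value unless `A = 0`.
    have h1 := hvar (A / (Q + 1))
    have h2 : -2 * (A / (Q + 1)) * A + (A / (Q + 1)) ^ 2 * Q =
        - (A / (Q + 1)) ^ 2 * (Q + 2) := by
      field_simp
      ring
    rw [h2] at h1
    have h3 : (A / (Q + 1)) ^ 2 * (Q + 2) ≤ 0 := by linarith
    have h4 : (A / (Q + 1)) ^ 2 ≤ 0 := by
      by_contra h
      exact absurd h3 (not_le.2 (mul_pos (not_le.1 h) (by linarith)))
    have h5 : A / (Q + 1) = 0 := by
      rw [← sq_eq_zero_iff]; exact le_antisymm h4 (sq_nonneg _)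
    rcases div_eq_zero_iff.1 h5 with h | h
    · exact h
    · linarith
  simp only [hA, sub_mul, Finset.sum_sub_distrib] at hA0
  linarith

/-- The fit is an orthogonal projection in the empirical inner product, hence a contraction there,
and stability turns the empirical norm into the `L²` norm. This handles the approximation error; for
noise it would lose the factor `k / n`. -/
theorem StableDesign.norm_sq_le (hΛ : 1 ≤ Λ) (ht : QuasiUniformKnots Λ p k t) (hτ : 0 < τ)
    (hx : StableDesign t p k τ x) (y : Fin n → ℝ) :
    τ * ∫ u in (0 : ℝ)..1, spline t p k (lsCoeff t p k x y) u ^ 2 ≤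
      (n : ℝ)⁻¹ * ∑ i, y i ^ 2 := by
  refine (hx _).trans (mul_le_mul_of_nonneg_left ?_ (by positivity))
  have h := hx.normal_eq hΛ ht hτ y (lsCoeff t p k x y)
  have h2 : 0 ≤ ∑ i, (y i - spline t p k (lsCoeff t p k x y) (x i)) ^ 2 :=
    Finset.sum_nonneg fun _ _ => sq_nonneg _
  have h3 : ∑ i, (y i - spline t p k (lsCoeff t p k x y) (x i)) ^ 2 =
      ∑ i, y i ^ 2 - 2 * ∑ i, y i * spline t p k (lsCoeff t p k x y) (x i) +
        ∑ i, spline t p k (lsCoeff t p k x y) (x i) * spline t p k (lsCoeff t p k x y) (x i) := by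
    rw [Finset.mul_sum, ← Finset.sum_sub_distrib, ← Finset.sum_add_distrib]
    exact Finset.sum_congr rfl fun i _ => by ring
  simp only [sq] at h2 h3 ⊢
  linarith

/-- The norm of the least-squares fit in terms of the empirical moments of the responses against
the cell monomials; these may be centred by a functional that vanishes on splines. -/
theorem StableDesign.norm_sq_le_moments (hΛ : 1 ≤ Λ) (ht : QuasiUniformKnots Λ p k t) (hτ : 0 < τ)
    (hx : StableDesign t p k τ x) {lam : ℝ} (hlam0 : 0 < lam) (hlam : ∀ a : Fin (p + 1) → ℝ,
      lam * ∑ l, a l ^ 2 ≤ ∫ u in (0 : ℝ)..1, (∑ l, a l * u ^ (l : ℕ)) ^ 2)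
    (hx01 : ∀ i, x i ∈ Ico (0 : ℝ) 1) (y : Fin n → ℝ) (M : ℕ × Fin (p + 1) → ℝ)
    (hM : ∀ (a : ℕ × Fin (p + 1) → ℝ) (c : Fin (k + p + 1) → ℝ),
      (∀ x ∈ Ico (0 : ℝ) 1, spline t p k c x = ∑ b ∈ cellIndex p k, a b * cellMonomial t p b x) →
      ∑ b ∈ cellIndex p k, a b * M b = 0) :
    ∫ u in (0 : ℝ)..1, spline t p k (lsCoeff t p k x y) u ^ 2 ≤
      (τ ^ 2 * lam)⁻¹ * ∑ b ∈ cellIndex p k, (cellLength t p b.1)⁻¹ *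
        ((n : ℝ)⁻¹ * ∑ i, y i * cellMonomial t p b (x i) - M b) ^ 2 := by
  set c := lsCoeff t p k x y with hc
  obtain ⟨a, ha, -, -, hle⟩ := ht.exists_local_coords hΛ hlam c
  set N := ∫ u in (0 : ℝ)..1, spline t p k c u ^ 2 with hN
  set ℓ : ℕ × Fin (p + 1) → ℝ := fun b =>
    (n : ℝ)⁻¹ * ∑ i, y i * cellMonomial t p b (x i) - M b with hℓ
  set Q := ∑ b ∈ cellIndex p k, (cellLength t p b.1)⁻¹ * ℓ b ^ 2 with hQ
  have hpos : ∀ b ∈ cellIndex p k, 0 < cellLength t p b.1 := fun b hb =>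
    ht.cellLength_pos hΛ (by
      have := (Finset.mem_product.1 hb).1
      have := Finset.mem_range.1 this
      omega)
  have hN0 : 0 ≤ N := intervalIntegral.integral_nonneg zero_le_one fun _ _ => sq_nonneg _
  have hQ0 : 0 ≤ Q := Finset.sum_nonneg fun b hb => by have := hpos b hb; positivity
  -- Stability applied to the fit, followed by the normal equations tested with the fit itself. The
  -- centring `M` drops out by `hM`.
  have h1 : τ * N ≤ ∑ b ∈ cellIndex p k, a b * ℓ b := by
    refine (hx c).trans (le_of_eq ?_)
    have h := hx.normal_eq hΛ ht hτ y c
    simp only [sq]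
    rw [h]
    have h2 : ∀ i, y i * spline t p k c (x i) =
        ∑ b ∈ cellIndex p k, a b * (y i * cellMonomial t p b (x i)) := by
      intro i
      rw [ha (x i) (hx01 i), Finset.mul_sum]
      exact Finset.sum_congr rfl fun b _ => by ring
    simp only [h2]
    rw [Finset.sum_comm, Finset.mul_sum]
    simp only [hℓ, mul_sub, Finset.sum_sub_distrib]
    rw [hM a c ha, sub_zero]
    refine Finset.sum_congr rfl fun b _ => ?_
    rw [← Finset.mul_sum]
    ring
  -- Cauchy–Schwarz with the cell lengths as weights, chosen so that the first factor is controlled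
  -- by `N / lam`; one factor `N` then cancels.
  have h2 : (∑ b ∈ cellIndex p k, a b * ℓ b) ^ 2 ≤
      (∑ b ∈ cellIndex p k, cellLength t p b.1 * a b ^ 2) * Q := by
    refine Finset.sum_sq_le_sum_mul_sum_of_sq_le_mul _ (fun b hb => ?_) (fun b hb => ?_)
      fun b hb => ?_
    · have := hpos b hb; positivity
    · have := hpos b hb; positivity
    · have := hpos b hb
      refine le_of_eq ?_
      field_simp
  have h3 : (τ * N) ^ 2 ≤ N / lam * Q := by
    refine (pow_le_pow_left₀ (mul_nonneg hτ.le hN0) h1 2).trans (h2.trans ?_)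
    refine mul_le_mul_of_nonneg_right ?_ hQ0
    rw [le_div_iff₀ hlam0, mul_comm]
    exact hle
  rcases hN0.eq_or_lt with h | h
  · rw [← h]; positivity
  · have h4 : τ ^ 2 * lam * N ≤ Q := by
      have : N * (τ ^ 2 * lam * N) ≤ N * Q := by
        calc N * (τ ^ 2 * lam * N) = lam * (τ * N) ^ 2 := by ring
          _ ≤ lam * (N / lam * Q) := mul_le_mul_of_nonneg_left h3 hlam0.le
          _ = N * Q := by field_simp
      exact le_of_mul_le_mul_left this h
    rw [inv_mul_eq_div, le_div_iff₀ (by positivity)]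
    linarith

end LeastSquares

/-! ### Measurability -/

/-- The matrix inverse is the adjugate times the inverse of the determinant, a measurable expression
even on singular matrices, where it is zero. -/
theorem measurable_lsCoeff (t : ℕ → ℝ) (p k n : ℕ) :
    Measurable fun q : (Fin n → ℝ) × (Fin n → ℝ) => lsCoeff t p k q.1 q.2 := by
  have hB : ∀ i a, Measurable fun q : (Fin n → ℝ) × (Fin n → ℝ) => designMatrix t p k q.1 i a := by
    intro i a
    exact (measurable_bspline t p a).comp ((measurable_pi_apply i).comp measurable_fst)
  set G : (Fin n → ℝ) × (Fin n → ℝ) → Matrix (Fin (k + p + 1)) (Fin (k + p + 1)) ℝ := fun q =>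
    (designMatrix t p k q.1).transpose * designMatrix t p k q.1 with hG
  have hGm : ∀ a b, Measurable fun q => G q a b := by
    intro a b
    simp only [hG, Matrix.mul_apply, Matrix.transpose_apply]
    exact Finset.measurable_sum _ fun i _ => (hB i a).mul (hB i b)
  have hdet : ∀ H : (Fin n → ℝ) × (Fin n → ℝ) → Matrix (Fin (k + p + 1)) (Fin (k + p + 1)) ℝ,
      (∀ a b, Measurable fun q => H q a b) → Measurable fun q => (H q).det := by
    intro H hH
    simp only [Matrix.det_apply]
    refine Finset.measurable_sum _ fun σ _ => ?_
    exact (Finset.measurable_prod _ fun i _ => hH _ _).const_smul _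
  have hinv : ∀ a b, Measurable fun q => (G q)⁻¹ a b := by
    intro a b
    simp only [Matrix.inv_def, Matrix.smul_apply, smul_eq_mul, Ring.inverse_eq_inv',
      Matrix.adjugate_apply]
    refine (hdet G hGm).inv.mul (hdet _ fun c d => ?_)
    by_cases h : c = b
    · subst h
      simp only [Matrix.updateRow_self]
      exact measurable_const
    · simp only [Matrix.updateRow_ne h]
      exact hGm c d
  refine measurable_pi_lambda _ fun a => ?_
  simp only [lsCoeff, Matrix.mulVec, dotProduct, Matrix.transpose_apply]
  refine Finset.measurable_sum _ fun b _ => (hinv a b).mul (Finset.measurable_sum _ fun i _ => ?_)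
  exact (hB i b).mul ((measurable_pi_apply i).comp measurable_snd)

theorem measurable_spline_lsCoeff (t : ℕ → ℝ) (p k n : ℕ) :
    Measurable fun q : ((Fin n → ℝ) × (Fin n → ℝ)) × ℝ =>
      spline t p k (lsCoeff t p k q.1.1 q.1.2) q.2 := by
  refine Finset.measurable_sum _ fun i _ => Measurable.mul ?_ ?_
  · exact (measurable_pi_apply i).comp ((measurable_lsCoeff t p k n).comp measurable_fst)
  · exact (measurable_bspline t p i).comp measurable_snd

/-- Both sides of the stability condition are continuous in the coefficients, so a countable dense
set of splines decides it. -/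
theorem measurableSet_stableDesign (t : ℕ → ℝ) {Λ : ℝ} {p k : ℕ} (ht : QuasiUniformKnots Λ p k t)
    (n : ℕ) (τ : ℝ) : MeasurableSet {x : Fin n → ℝ | StableDesign t p k τ x} := by
  have hcont : ∀ x : Fin n → ℝ, Continuous fun c : Fin (k + p + 1) → ℝ =>
      (n : ℝ)⁻¹ * ∑ i, spline t p k c (x i) ^ 2 - τ * ∫ u in (0 : ℝ)..1, spline t p k c u ^ 2 := by
    intro x
    have h1 : ∀ c : Fin (k + p + 1) → ℝ, ∫ u in (0 : ℝ)..1, spline t p k c u ^ 2 =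
        ∑ a, ∑ b, c a * c b * ∫ u in (0 : ℝ)..1, bspline t p a u * bspline t p b u := by
      intro c
      have hB : ∀ a : Fin (k + p + 1), MemLp (bspline t p a) 2 (volume.restrict (Icc (0 : ℝ) 1)) := by
        intro a
        have := ht.memLp_spline (Pi.single a 1)
        have he : spline t p k (Pi.single a 1) = bspline t p a := by
          ext u
          simp [spline, Pi.single_apply]
        rwa [he] at this
      have hBi : ∀ a b : Fin (k + p + 1), IntervalIntegrable
          (fun u => bspline t p a u * bspline t p b u) volume 0 1 := by
        intro a b
        rw [intervalIntegrable_iff_integrableOn_Icc_of_le zero_le_one]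
        exact (hB a).integrable_mul (hB b)
      have h2 : ∀ u, spline t p k c u ^ 2 =
          ∑ a, ∑ b, c a * c b * (bspline t p a u * bspline t p b u) := by
        intro u
        rw [sq, spline, Finset.sum_mul_sum]
        exact Finset.sum_congr rfl fun a _ => Finset.sum_congr rfl fun b _ => by ring
      have hs : ∀ a : Fin (k + p + 1), IntervalIntegrable (fun u => ∑ b : Fin (k + p + 1),
          c a * c b * (bspline t p a u * bspline t p b u)) volume 0 1 := by
        intro a
        rw [intervalIntegrable_iff_integrableOn_Icc_of_le zero_le_one]
        exact integrable_finsetSum _ fun b _ => ((hB a).integrable_mul (hB b)).const_mul _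
      simp only [h2]
      rw [intervalIntegral.integral_finsetSum fun a _ => hs a]
      refine Finset.sum_congr rfl fun a _ => ?_
      rw [intervalIntegral.integral_finsetSum fun b _ => (hBi a b).const_mul _]
      exact Finset.sum_congr rfl fun b _ => intervalIntegral.integral_const_mul _ _
    simp only [h1]
    simp only [spline]
    fun_prop
  have heq : {x : Fin n → ℝ | StableDesign t p k τ x} =
      ⋂ c ∈ (TopologicalSpace.exists_countable_dense (Fin (k + p + 1) → ℝ)).choose,
        {x : Fin n → ℝ | τ * (∫ u in (0 : ℝ)..1, (spline t p k c u) ^ 2) ≤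
          (n : ℝ)⁻¹ * ∑ i, (spline t p k c (x i)) ^ 2} := by
    obtain ⟨-, hd⟩ := (TopologicalSpace.exists_countable_dense (Fin (k + p + 1) → ℝ)).choose_spec
    ext x
    simp only [mem_iInter]
    constructor
    · intro h c _
      exact h c
    · intro h c
      have hcl : IsClosed {c : Fin (k + p + 1) → ℝ | 0 ≤ (n : ℝ)⁻¹ * ∑ i, spline t p k c (x i) ^ 2 -
          τ * ∫ u in (0 : ℝ)..1, spline t p k c u ^ 2} :=
        isClosed_le continuous_const (hcont x)
      have hsub := hd.closure_eq ▸ hcl.closure_subset_iff.2 (fun c hc => show (0 : ℝ) ≤ _ from sub_nonneg.2 (h c hc))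
      exact sub_nonneg.1 (hsub (mem_univ c))
  rw [heq]
  obtain ⟨hcount, -⟩ := (TopologicalSpace.exists_countable_dense (Fin (k + p + 1) → ℝ)).choose_spec
  refine MeasurableSet.biInter hcount fun c _ => measurableSet_le measurable_const ?_
  refine Measurable.const_mul (Finset.measurable_sum _ fun i _ => ?_) _
  exact ((measurable_spline t p k c).comp (measurable_pi_apply i)).pow_const 2

/-! ### Laws with a density bounded above and below -/

section DesignLaw

variable {μ : Measure ℝ} {a b : ℝ}

theorem ae_mem_Ico_of_le (hμb : μ ≤ ENNReal.ofReal b • volume.restrict (Icc (0 : ℝ) 1)) :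
    ∀ᵐ x ∂μ, x ∈ Ico (0 : ℝ) 1 :=
  (Measure.absolutelyContinuous_of_le_smul hμb).ae_le ae_mem_Ico

/-- Comparison of total masses; this is where the positivity of `b` comes from. -/
theorem one_le_of_le [IsProbabilityMeasure μ]
    (hμb : μ ≤ ENNReal.ofReal b • volume.restrict (Icc (0 : ℝ) 1)) : 1 ≤ b := by
  have h := hμb univ
  simp only [measure_univ, Measure.smul_apply, Measure.restrict_apply MeasurableSet.univ,
    univ_inter, Real.volume_Icc, sub_zero, ENNReal.ofReal_one, smul_eq_mul, mul_one] at h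
  exact ENNReal.one_le_ofReal.1 h

theorem integrable_of_le (hμb : μ ≤ ENNReal.ofReal b • volume.restrict (Icc (0 : ℝ) 1))
    {f : ℝ → ℝ} (hf : IntegrableOn f (Icc 0 1)) : Integrable f μ :=
  (hf.smul_measure ENNReal.ofReal_ne_top).mono_measure hμb

theorem memLp_of_le (hμb : μ ≤ ENNReal.ofReal b • volume.restrict (Icc (0 : ℝ) 1))
    {f : ℝ → ℝ} (hf : MemLp f 2 (volume.restrict (Icc 0 1))) : MemLp f 2 μ :=
  (hf.smul_measure ENNReal.ofReal_ne_top).mono_measure hμb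

theorem integral_le_of_le (hb : 0 ≤ b)
    (hμb : μ ≤ ENNReal.ofReal b • volume.restrict (Icc (0 : ℝ) 1))
    {f : ℝ → ℝ} (hf0 : ∀ x, 0 ≤ f x) (hf : IntegrableOn f (Icc 0 1)) :
    ∫ x, f x ∂μ ≤ b * ∫ x in (0 : ℝ)..1, f x := by
  refine (integral_mono_measure hμb (Eventually.of_forall hf0)
    (hf.smul_measure ENNReal.ofReal_ne_top)).trans (le_of_eq ?_)
  rw [integral_smul_measure, ENNReal.toReal_ofReal hb, smul_eq_mul, integral_Icc_eq_integral_Ioc,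
    intervalIntegral.integral_of_le zero_le_one]

theorem mul_integral_le_of_le (ha : 0 ≤ a)
    (hμa : ENNReal.ofReal a • volume.restrict (Icc (0 : ℝ) 1) ≤ μ)
    {f : ℝ → ℝ} (hf0 : ∀ x, 0 ≤ f x) (hf : Integrable f μ) :
    a * ∫ x in (0 : ℝ)..1, f x ≤ ∫ x, f x ∂μ := by
  refine (le_of_eq ?_).trans (integral_mono_measure hμa (Eventually.of_forall hf0) hf)
  rw [integral_smul_measure, ENNReal.toReal_ofReal ha, smul_eq_mul, integral_Icc_eq_integral_Ioc,
    intervalIntegral.integral_of_le zero_le_one]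

theorem ae_pi_mem [IsProbabilityMeasure μ] {s : Set ℝ} (hs : ∀ᵐ x ∂μ, x ∈ s) (n : ℕ) :
    ∀ᵐ x ∂(Measure.pi fun _ : Fin n => μ), ∀ i, x i ∈ s :=
  ae_all_iff.2 fun i => (measurePreserving_eval (fun _ : Fin n => μ) i).quasiMeasurePreserving.ae hs

end DesignLaw

/-! ### Concentration of the local moments -/

/-- A Chernoff bound that takes the variance into account. -/
theorem measure_pi_sum_ge_le {μ : Measure ℝ} [IsProbabilityMeasure μ] {n : ℕ} {f : ℝ → ℝ}
    (hf : Measurable f) (hf1 : ∀ x, |f x| ≤ 1) (hf0 : ∫ x, f x ∂μ = 0) {V θ : ℝ}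
    (hV : ∫ x, f x ^ 2 ∂μ ≤ V) (hθ0 : 0 ≤ θ) (hθ1 : θ ≤ 1) (s : ℝ) :
    (Measure.pi fun _ : Fin n => μ) {x | s ≤ ∑ i, f (x i)} ≤
      ENNReal.ofReal (Real.exp (-θ * s + n * (θ ^ 2 * V))) := by
  have hexp : Integrable (fun x => Real.exp (θ * f x)) μ := by
    refine Integrable.of_bound (by fun_prop) (Real.exp 1) (Eventually.of_forall fun x => ?_)
    rw [Real.norm_eq_abs, Real.abs_exp]
    refine Real.exp_le_exp.2 ?_
    have := (abs_le.1 (hf1 x)).2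
    nlinarith
  have hmgf1 : ∫ x, Real.exp (θ * f x) ∂μ ≤ Real.exp (θ ^ 2 * V) := by
    have hfi : Integrable f μ :=
      Integrable.of_bound hf.aestronglyMeasurable 1 (Eventually.of_forall hf1)
    have hfi2 : Integrable (fun x => f x ^ 2) μ :=
      Integrable.of_bound (hf.pow_const 2).aestronglyMeasurable 1 (Eventually.of_forall fun x => by
        rw [Real.norm_eq_abs, abs_pow]
        exact pow_le_one₀ (abs_nonneg _) (hf1 x))
    -- The exponential is at most `1 + y + y ^ 2` for `|y| ≤ 1`, and the linear term has mean zero,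
    -- so only the variance remains.
    calc ∫ x, Real.exp (θ * f x) ∂μ ≤ ∫ x, (1 + θ * f x + θ ^ 2 * f x ^ 2) ∂μ := by
          refine integral_mono hexp (((integrable_const 1).add (hfi.const_mul θ)).add
            (hfi2.const_mul _)) fun x => ?_
          have h1 : |θ * f x| ≤ 1 := by
            rw [abs_mul, abs_of_nonneg hθ0]
            exact mul_le_one₀ hθ1 (abs_nonneg _) (hf1 x)
          have h2 := (abs_le.1 (Real.abs_exp_sub_one_sub_id_le h1)).2
          simp only
          nlinarith
      _ = 1 + θ ^ 2 * ∫ x, f x ^ 2 ∂μ := by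
          have hA : Integrable (fun x => 1 + θ * f x) μ :=
            (integrable_const 1).add (hfi.const_mul θ)
          rw [integral_add hA (hfi2.const_mul _),
            integral_add (integrable_const 1) (hfi.const_mul θ), integral_const_mul,
            integral_const_mul, hf0]
          simp
      _ ≤ θ ^ 2 * V + 1 := by nlinarith [sq_nonneg θ]
      _ ≤ _ := Real.add_one_le_exp _
  have hprod : ∀ x : Fin n → ℝ, Real.exp (θ * ∑ i, f (x i)) = ∏ i, Real.exp (θ * f (x i)) := by
    intro x
    rw [Finset.mul_sum, Real.exp_sum]
  have hint : Integrable (fun x : Fin n → ℝ => Real.exp (θ * ∑ i, f (x i)))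
      (Measure.pi fun _ : Fin n => μ) := by
    simp only [hprod]
    exact Integrable.fintype_prod (f := fun _ x => Real.exp (θ * f x)) fun _ => hexp
  have h := ProbabilityTheory.measure_ge_le_exp_mul_mgf (X := fun x : Fin n → ℝ => ∑ i, f (x i))
    (μ := Measure.pi fun _ : Fin n => μ) s hθ0 hint
  rw [← ofReal_measureReal]
  refine ENNReal.ofReal_le_ofReal (h.trans ?_)
  rw [Real.exp_add, Real.exp_nat_mul]
  refine mul_le_mul_of_nonneg_left ?_ (Real.exp_pos _).le
  rw [ProbabilityTheory.mgf]
  simp only [hprod]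
  rw [integral_fintype_prod_eq_pow (fun x => Real.exp (θ * f x)), Fintype.card_fin]
  exact pow_le_pow_left₀ (integral_nonneg fun _ => (Real.exp_pos _).le) hmgf1 n

/-- The designs for which some empirical moment of second order of the cell monomials is far from
its expectation. -/
def irregularDesign (μ : Measure ℝ) (t : ℕ → ℝ) (p k : ℕ) (δ : ℝ) (n : ℕ) : Set (Fin n → ℝ) :=
  {x | ∃ j ≤ k, ∃ l l' : Fin (p + 1), δ * cellLength t p j <
    |(n : ℝ)⁻¹ * ∑ i, cellMonomial t p (j, l) (x i) * cellMonomial t p (j, l') (x i) -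
      ∫ x, cellMonomial t p (j, l) x * cellMonomial t p (j, l') x ∂μ|}

section Concentration

variable {μ : Measure ℝ} {a b Λ : ℝ} {p k : ℕ} {t : ℕ → ℝ}

theorem cellMonomial_le_indicator (t : ℕ → ℝ) (p : ℕ) (b : ℕ × Fin (p + 1)) (x : ℝ) :
    cellMonomial t p b x ≤ (Ico (t (p + b.1)) (t (p + b.1 + 1))).indicator 1 x := by
  by_cases hx : x ∈ Ico (t (p + b.1)) (t (p + b.1 + 1))
  · rw [indicator_of_mem hx]
    exact (cellMonomial_mem_Icc t p b x).2
  · rw [indicator_of_notMem hx, cellMonomial, indicator_of_notMem hx]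

theorem measureReal_cell_le (hb : 0 ≤ b)
    (hμb : μ ≤ ENNReal.ofReal b • volume.restrict (Icc (0 : ℝ) 1)) (hΛ : 1 ≤ Λ)
    (ht : QuasiUniformKnots Λ p k t) {j : ℕ} (hj : j ≤ k) :
    ∫ x, (Ico (t (p + j)) (t (p + j + 1))).indicator 1 x ∂μ ≤ b * cellLength t p j := by
  have hpos := ht.cellLength_pos hΛ hj
  have hfi : IntegrableOn ((Ico (t (p + j)) (t (p + j + 1))).indicator (1 : ℝ → ℝ)) (Icc 0 1) := by
    refine Integrable.indicator ?_ measurableSet_Ico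
    exact (integrable_const (1 : ℝ))
  refine (integral_mono_measure hμb (Eventually.of_forall fun x =>
    indicator_nonneg (fun _ _ => zero_le_one) _) (hfi.smul_measure ENNReal.ofReal_ne_top)).trans ?_
  change ∫ x, (Ico (t (p + j)) (t (p + j + 1))).indicator 1 x ∂_ ≤ _
  rw [integral_smul_measure, ENNReal.toReal_ofReal hb, smul_eq_mul,
    integral_indicator_one measurableSet_Ico]
  refine mul_le_mul_of_nonneg_left ?_ hb
  rw [measureReal_restrict_apply measurableSet_Ico]
  refine (measureReal_mono (s₂ := Ico (t (p + j)) (t (p + j + 1))) inter_subset_left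
    (by simp)).trans (le_of_eq ?_)
  rw [Real.volume_real_Ico, max_eq_left]
  · rfl
  · exact hpos.le

/-- A union bound over the cells, the pairs of local degrees and the two signs. The tolerated
deviation and the variance are both of the order of the cell length, so the exponent is of order `n
/ (k + 1)`; Hoeffding's inequality, which ignores the variance, would only give `n / (k + 1) ^ 2`.
-/
theorem measure_irregularDesign_le [IsProbabilityMeasure μ]
    (hμb : μ ≤ ENNReal.ofReal b • volume.restrict (Icc (0 : ℝ) 1)) (hΛ : 1 ≤ Λ)
    (ht : QuasiUniformKnots Λ p k t) {δ θ : ℝ} (hδ : 0 < δ) (hθ0 : 0 < θ) (hθ1 : θ ≤ 1)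
    (hθb : 2 * b * θ ≤ δ) {n : ℕ} (hn : 0 < n) :
    (Measure.pi fun _ : Fin n => μ) (irregularDesign μ t p k δ n) ≤
      ENNReal.ofReal ((k + 1) * (p + 1) ^ 2 * 2 *
        Real.exp (-(θ * δ / (2 * Λ)) * (n / (k + 1)))) := by
  have hb : 1 ≤ b := one_le_of_le hμb
  have hΛ0 : 0 < Λ := by linarith
  have hn' : (0 : ℝ) < n := by exact_mod_cast hn
  set e := ENNReal.ofReal (Real.exp (-(θ * δ / (2 * Λ)) * (n / (k + 1)))) with he
  set Z : ℕ → Fin (p + 1) × Fin (p + 1) → ℝ → ℝ := fun j l x =>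
    cellMonomial t p (j, l.1) x * cellMonomial t p (j, l.2) x with hZ
  have hZm : ∀ j l, Measurable (Z j l) := fun j l =>
    (measurable_cellMonomial t p _).mul (measurable_cellMonomial t p _)
  have hZ01 : ∀ j l x, Z j l x ∈ Icc (0 : ℝ) 1 := fun j l x => by
    have h1 := cellMonomial_mem_Icc t p (j, l.1) x
    have h2 := cellMonomial_mem_Icc t p (j, l.2) x
    exact ⟨mul_nonneg h1.1 h2.1, mul_le_one₀ h1.2 h2.1 h2.2⟩
  have hZi : ∀ j l, Integrable (Z j l) μ := fun j l =>
    Integrable.of_bound (hZm j l).aestronglyMeasurable 1 (Eventually.of_forall fun x => by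
      rw [Real.norm_eq_abs, abs_of_nonneg (hZ01 j l x).1]; exact (hZ01 j l x).2)
  have hone : ∀ j ≤ k, ∀ l, ∀ σ : ℝ, |σ| = 1 → (Measure.pi fun _ : Fin n => μ)
      {x | n * (δ * cellLength t p j) ≤ ∑ i, σ * (Z j l (x i) - ∫ x, Z j l x ∂μ)} ≤ e := by
    intro j hj l σ hσ
    have hpos := ht.cellLength_pos hΛ hj
    set m := ∫ x, Z j l x ∂μ with hm
    have hm0 : 0 ≤ m := integral_nonneg fun x => (hZ01 j l x).1
    have hm1 : m ≤ 1 := by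
      refine (integral_mono (hZi j l) (integrable_const 1) fun x => (hZ01 j l x).2).trans ?_
      simp
    have hmb : m ≤ b * cellLength t p j := by
      refine le_trans (integral_mono (hZi j l) ?_ fun x => ?_) (measureReal_cell_le (by linarith)
        hμb hΛ ht hj)
      · refine Integrable.indicator ?_ measurableSet_Ico
        exact (integrable_const (1 : ℝ))
      · have h2 := cellMonomial_mem_Icc t p (j, l.2) x
        have h1 := cellMonomial_mem_Icc t p (j, l.1) x
        exact (mul_le_of_le_one_right h1.1 h2.2).trans (cellMonomial_le_indicator t p (j, l.1) x)
    have hσ2 : σ ^ 2 = 1 := by rw [← sq_abs, hσ, one_pow]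
    have hZ2 : Integrable (fun x => Z j l x ^ 2) μ :=
      Integrable.of_bound ((hZm j l).pow_const 2).aestronglyMeasurable 1
        (Eventually.of_forall fun x => by
          rw [Real.norm_eq_abs, abs_of_nonneg (sq_nonneg _)]
          exact pow_le_one₀ (hZ01 j l x).1 (hZ01 j l x).2)
    have h := measure_pi_sum_ge_le (μ := μ) (n := n) (f := fun x => σ * (Z j l x - m))
      (((hZm j l).sub_const _).const_mul _) (fun x => by
        rw [abs_mul, hσ, one_mul, abs_le]
        constructor <;> linarith [(hZ01 j l x).1, (hZ01 j l x).2])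
      (by rw [integral_const_mul, integral_sub (hZi j l) (integrable_const _)]; simp [hm])
      (V := b * cellLength t p j) (by
        have h1 : ∀ x, (σ * (Z j l x - m)) ^ 2 = Z j l x ^ 2 - 2 * m * Z j l x + m ^ 2 := by
          intro x; rw [mul_pow, hσ2]; ring
        simp only [h1]
        have hA : Integrable (fun x => Z j l x ^ 2 - 2 * m * Z j l x) μ :=
          hZ2.sub ((hZi j l).const_mul _)
        rw [integral_add hA (integrable_const _),
          integral_sub hZ2 ((hZi j l).const_mul _), integral_const_mul]
        have h2 : ∫ x, Z j l x ^ 2 ∂μ ≤ m := integral_mono hZ2 (hZi j l) fun x => by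
          have := hZ01 j l x
          simp only [sq]
          exact mul_le_of_le_one_right this.1 this.2
        simp only [integral_const, probReal_univ, one_smul, ← hm]
        nlinarith [sq_nonneg m]) hθ0.le hθ1 (n * (δ * cellLength t p j))
    refine h.trans (ENNReal.ofReal_le_ofReal (Real.exp_le_exp.2 ?_))
    have hlow : 1 / (Λ * (k + 1)) ≤ cellLength t p j := ht.lower (p + j) (by omega) (by omega)
    -- The condition `2 * b * θ ≤ δ` lets the variance term use up at most half of the gain `n θ δ`
    -- times the cell length. The remaining half is at least the asserted exponent, by the lower
    -- bound for the cell length.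
    have h3 : θ * δ / (2 * Λ) * (n / (k + 1)) ≤ n * (θ * δ / 2) * cellLength t p j := by
      calc _ = n * (θ * δ / 2) * (1 / (Λ * (k + 1))) := by field_simp
        _ ≤ _ := mul_le_mul_of_nonneg_left hlow (by positivity)
    have h4 : n * (θ ^ 2 * (b * cellLength t p j)) ≤ n * (θ * δ / 2) * cellLength t p j := by
      calc _ = n * (θ / 2 * cellLength t p j) * (2 * b * θ) := by ring
        _ ≤ n * (θ / 2 * cellLength t p j) * δ := mul_le_mul_of_nonneg_left hθb (by positivity)
        _ = _ := by ring
    nlinarith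
  have hsub : irregularDesign μ t p k δ n ⊆
      ⋃ jl ∈ Finset.range (k + 1) ×ˢ (Finset.univ : Finset (Fin (p + 1) × Fin (p + 1))),
        ({x | n * (δ * cellLength t p jl.1) ≤
            ∑ i, 1 * (Z jl.1 jl.2 (x i) - ∫ x, Z jl.1 jl.2 x ∂μ)} ∪
         {x | n * (δ * cellLength t p jl.1) ≤
            ∑ i, (-1) * (Z jl.1 jl.2 (x i) - ∫ x, Z jl.1 jl.2 x ∂μ)}) := by
    rintro x ⟨j, hj, l, l', hlt⟩
    simp only [mem_iUnion]
    refine ⟨(j, (l, l')), by simp; omega, ?_⟩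
    have hs : ∀ σ : ℝ, ∑ i, σ * (Z j (l, l') (x i) - ∫ x, Z j (l, l') x ∂μ) =
        n * (σ * ((n : ℝ)⁻¹ * ∑ i, Z j (l, l') (x i) - ∫ x, Z j (l, l') x ∂μ)) := by
      intro σ
      rw [← Finset.mul_sum, Finset.sum_sub_distrib]
      simp only [Finset.sum_const, Finset.card_univ, Fintype.card_fin, nsmul_eq_mul]
      field_simp
    simp only [mem_union, mem_ofPred_eq, hs]
    rcases lt_abs.1 hlt with h | h
    · left
      rw [one_mul]
      exact mul_le_mul_of_nonneg_left h.le hn'.le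
    · right
      rw [neg_one_mul]
      exact mul_le_mul_of_nonneg_left h.le hn'.le
  refine (measure_mono hsub).trans ((measure_biUnion_finset_le _ _).trans ?_)
  calc _ ≤ ∑ jl ∈ Finset.range (k + 1) ×ˢ (Finset.univ : Finset (Fin (p + 1) × Fin (p + 1))),
        (e + e) := by
        refine Finset.sum_le_sum fun jl hjl => (measure_union_le _ _).trans ?_
        have hj : jl.1 ≤ k := by
          have := Finset.mem_range.1 (Finset.mem_product.1 hjl).1
          omega
        exact add_le_add (hone _ hj _ 1 (by simp)) (hone _ hj _ (-1) (by simp))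
    _ = _ := by
        rw [Finset.sum_const, he, ← ENNReal.ofReal_add (Real.exp_pos _).le (Real.exp_pos _).le,
          nsmul_eq_mul, ← ENNReal.ofReal_natCast, ← ENNReal.ofReal_mul (by positivity)]
        congr 1
        simp only [Finset.card_product, Finset.card_range, Finset.card_univ, Fintype.card_prod,
          Fintype.card_fin]
        push_cast
        ring

theorem cellMonomial_eq_zero (hm : QuasiUniformKnots Λ p k t) {i j : ℕ} (hi : i ≤ k) (hj : j ≤ k)
    (hij : i ≠ j) {x : ℝ} (hx : x ∈ Ico (t (p + j)) (t (p + j + 1))) (l : Fin (p + 1)) :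
    cellMonomial t p (i, l) x = 0 := by
  refine indicator_of_notMem (fun hxi => ?_) _
  rcases lt_or_gt_of_ne hij with h | h
  · have : t (p + i + 1) ≤ t (p + j) := hm.mono_cell (i := i + 1) (by omega) (by omega)
    exact absurd hxi.2 (not_lt.2 (this.trans hx.1))
  · have : t (p + j + 1) ≤ t (p + i) := hm.mono_cell (i := j + 1) (by omega) (by omega)
    exact absurd hx.2 (not_lt.2 (this.trans hxi.1))

theorem sq_sum_cellMonomial (ht : QuasiUniformKnots Λ p k t) (c : ℕ × Fin (p + 1) → ℝ) {x : ℝ}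
    (hx : x ∈ Ico (0 : ℝ) 1) :
    (∑ b ∈ cellIndex p k, c b * cellMonomial t p b x) ^ 2 =
      ∑ j ∈ Finset.range (k + 1), ∑ l, ∑ l', c (j, l) * c (j, l') *
        (cellMonomial t p (j, l) x * cellMonomial t p (j, l') x) := by
  obtain ⟨j, hj, hxj⟩ := ht.exists_cell hx
  rw [cellIndex, Finset.sum_product, Finset.sum_eq_single j, Finset.sum_eq_single j, sq,
    Finset.sum_mul_sum]
  · exact Finset.sum_congr rfl fun l _ => Finset.sum_congr rfl fun l' _ => by ring
  · intro i hi hij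
    refine Finset.sum_eq_zero fun l _ => Finset.sum_eq_zero fun l' _ => ?_
    rw [cellMonomial_eq_zero ht (by have := Finset.mem_range.1 hi; omega) hj hij hxj]
    simp
  · intro hn; exact absurd (Finset.mem_range.2 (by omega)) hn
  · intro i hi hij
    refine Finset.sum_eq_zero fun l _ => ?_
    rw [cellMonomial_eq_zero ht (by have := Finset.mem_range.1 hi; omega) hj hij hxj]
    simp
  · intro hn; exact absurd (Finset.mem_range.2 (by omega)) hn

/-- The difference of the population and the empirical norm is a block-diagonal form in the local
coordinates with entries at most `δ` times the cell length. On blocks of size `p + 1` this is at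
most `δ * (p + 1)` times the weighted sum of squares, hence at most `(a - τ)` times the squared
norm, the gap between the density bound and the threshold. -/
theorem stableDesign_of_notMem [IsProbabilityMeasure μ] (ha : 0 ≤ a)
    (hμa : ENNReal.ofReal a • volume.restrict (Icc (0 : ℝ) 1) ≤ μ)
    (hμb : μ ≤ ENNReal.ofReal b • volume.restrict (Icc (0 : ℝ) 1)) (hΛ : 1 ≤ Λ)
    (ht : QuasiUniformKnots Λ p k t) {lam : ℝ} (hlam0 : 0 < lam)
    (hlam : ∀ a : Fin (p + 1) → ℝ,
      lam * ∑ l, a l ^ 2 ≤ ∫ u in (0 : ℝ)..1, (∑ l, a l * u ^ (l : ℕ)) ^ 2)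
    {δ τ : ℝ} (hδ0 : 0 ≤ δ) (hδ : δ * (p + 1) ≤ (a - τ) * lam) {n : ℕ} {x : Fin n → ℝ}
    (hx : x ∉ irregularDesign μ t p k δ n) (hx01 : ∀ i, x i ∈ Ico (0 : ℝ) 1) :
    StableDesign t p k τ x := by
  intro c
  obtain ⟨d, hd, -, -, hle⟩ := ht.exists_local_coords hΛ hlam c
  set N := ∫ u in (0 : ℝ)..1, spline t p k c u ^ 2 with hN
  have hx' : ∀ j ≤ k, ∀ l l' : Fin (p + 1),
      |(n : ℝ)⁻¹ * ∑ i, cellMonomial t p (j, l) (x i) * cellMonomial t p (j, l') (x i) -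
        ∫ x, cellMonomial t p (j, l) x * cellMonomial t p (j, l') x ∂μ| ≤ δ * cellLength t p j := by
    intro j hj l l'
    by_contra hcon
    exact hx ⟨j, hj, l, l', not_le.1 hcon⟩
  have hZi : ∀ j l l', Integrable (fun x => cellMonomial t p (j, l) x * cellMonomial t p (j, l') x)
      μ := fun j l l' => by
    refine Integrable.of_bound ((measurable_cellMonomial t p _).mul
      (measurable_cellMonomial t p _)).aestronglyMeasurable 1 (Eventually.of_forall fun x => ?_)
    have h1 := cellMonomial_mem_Icc t p (j, l) x
    have h2 := cellMonomial_mem_Icc t p (j, l') x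
    rw [Real.norm_eq_abs, abs_of_nonneg (mul_nonneg h1.1 h2.1)]
    exact mul_le_one₀ h1.2 h2.1 h2.2
  have hemp : (n : ℝ)⁻¹ * ∑ i, spline t p k c (x i) ^ 2 =
      ∑ j ∈ Finset.range (k + 1), ∑ l, ∑ l', d (j, l) * d (j, l') * ((n : ℝ)⁻¹ *
        ∑ i, cellMonomial t p (j, l) (x i) * cellMonomial t p (j, l') (x i)) := by
    have h1 : ∀ i, spline t p k c (x i) ^ 2 =
        ∑ j ∈ Finset.range (k + 1), ∑ l, ∑ l', d (j, l) * d (j, l') *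
        (cellMonomial t p (j, l) (x i) * cellMonomial t p (j, l') (x i)) := by
      intro i
      rw [hd _ (hx01 i), sq_sum_cellMonomial ht _ (hx01 i)]
    simp only [h1]
    rw [Finset.sum_comm, Finset.mul_sum]
    refine Finset.sum_congr rfl fun j _ => ?_
    rw [Finset.sum_comm, Finset.mul_sum]
    refine Finset.sum_congr rfl fun l _ => ?_
    rw [Finset.sum_comm, Finset.mul_sum]
    refine Finset.sum_congr rfl fun l' _ => ?_
    rw [← Finset.mul_sum]
    ring
  have hpop : ∫ u, spline t p k c u ^ 2 ∂μ =
      ∑ j ∈ Finset.range (k + 1), ∑ l, ∑ l', d (j, l) * d (j, l') *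
        ∫ x, cellMonomial t p (j, l) x * cellMonomial t p (j, l') x ∂μ := by
    have h1 : ∫ u, spline t p k c u ^ 2 ∂μ =
        ∫ u, ∑ j ∈ Finset.range (k + 1), ∑ l, ∑ l', d (j, l) * d (j, l') *
        (cellMonomial t p (j, l) u * cellMonomial t p (j, l') u) ∂μ := by
      refine integral_congr_ae ?_
      filter_upwards [ae_mem_Ico_of_le hμb] with u hu
      rw [hd _ hu, sq_sum_cellMonomial ht _ hu]
    rw [h1, integral_finsetSum _ fun j _ => integrable_finsetSum _ fun l _ =>
      integrable_finsetSum _ fun l' _ => (hZi j l l').const_mul _]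
    refine Finset.sum_congr rfl fun j _ => ?_
    rw [integral_finsetSum _ fun l _ =>
      integrable_finsetSum _ fun l' _ => (hZi j l l').const_mul _]
    refine Finset.sum_congr rfl fun l _ => ?_
    rw [integral_finsetSum _ fun l' _ => (hZi j l l').const_mul _]
    exact Finset.sum_congr rfl fun l' _ => integral_const_mul _ _
  have hlow : a * N ≤ ∫ u, spline t p k c u ^ 2 ∂μ :=
    mul_integral_le_of_le ha hμa (fun _ => sq_nonneg _)
      (integrable_of_le hμb (ht.integrableOn_spline_sq c))
  have hdiff : ∫ u, spline t p k c u ^ 2 ∂μ - (n : ℝ)⁻¹ * ∑ i, spline t p k c (x i) ^ 2 ≤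
      δ * (p + 1) * ∑ b ∈ cellIndex p k, cellLength t p b.1 * d b ^ 2 := by
    rw [hemp, hpop, ← Finset.sum_sub_distrib, cellIndex, Finset.sum_product, Finset.mul_sum]
    refine Finset.sum_le_sum fun j hj => ?_
    have hj' : j ≤ k := by have := Finset.mem_range.1 hj; omega
    have hpos := ht.cellLength_pos hΛ hj'
    calc _ = ∑ l, ∑ l', d (j, l) * d (j, l') *
          (∫ x, cellMonomial t p (j, l) x * cellMonomial t p (j, l') x ∂μ - (n : ℝ)⁻¹ *
            ∑ i, cellMonomial t p (j, l) (x i) * cellMonomial t p (j, l') (x i)) := by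
          rw [← Finset.sum_sub_distrib]
          refine Finset.sum_congr rfl fun l _ => ?_
          rw [← Finset.sum_sub_distrib]
          exact Finset.sum_congr rfl fun l' _ => by ring
      _ ≤ ∑ l, ∑ l', |d (j, l)| * |d (j, l')| * (δ * cellLength t p j) := by
          refine Finset.sum_le_sum fun l _ => Finset.sum_le_sum fun l' _ => ?_
          refine (le_abs_self _).trans ?_
          rw [abs_mul, abs_mul]
          refine mul_le_mul_of_nonneg_left ?_ (by positivity)
          rw [abs_sub_comm]
          exact hx' j hj' l l'
      _ = (∑ l, |d (j, l)|) ^ 2 * (δ * cellLength t p j) := by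
          rw [sq, Finset.sum_mul_sum]
          simp only [Finset.sum_mul]
      _ ≤ ((p + 1) * ∑ l, |d (j, l)| ^ 2) * (δ * cellLength t p j) := by
          refine mul_le_mul_of_nonneg_right ?_ (by positivity)
          have := sq_sum_le_card_mul_sum_sq (s := Finset.univ) (f := fun l : Fin (p + 1) =>
            |d (j, l)|)
          rw [Finset.card_univ, Fintype.card_fin] at this
          exact_mod_cast this
      _ = _ := by
          simp only [sq_abs]
          rw [← Finset.mul_sum]
          ring
  have hN0 : 0 ≤ N := intervalIntegral.integral_nonneg zero_le_one fun _ _ => sq_nonneg _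
  have h5 : δ * (p + 1) * ∑ b ∈ cellIndex p k, cellLength t p b.1 * d b ^ 2 ≤ (a - τ) * N := by
    have hS0 : 0 ≤ ∑ b ∈ cellIndex p k, cellLength t p b.1 * d b ^ 2 := by
      refine Finset.sum_nonneg fun b hb => ?_
      have := ht.cellLength_pos hΛ (j := b.1) (by
        have := Finset.mem_range.1 (Finset.mem_product.1 hb).1
        omega)
      positivity
    have haτ : 0 ≤ a - τ := by
      have : 0 ≤ (a - τ) * lam := le_trans (by positivity) hδ
      exact nonneg_of_mul_nonneg_left this hlam0
    calc _ ≤ (a - τ) * lam * ∑ b ∈ cellIndex p k, cellLength t p b.1 * d b ^ 2 :=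
          mul_le_mul_of_nonneg_right hδ hS0
      _ = (a - τ) * (lam * ∑ b ∈ cellIndex p k, cellLength t p b.1 * d b ^ 2) := by ring
      _ ≤ _ := mul_le_mul_of_nonneg_left hle haτ
  linarith

/-- The second moment for the local degrees `0, 0` is the relative frequency of design points in the
cell. Its control transfers cellwise error bounds to the empirical norm. -/
theorem card_cell_le_of_notMem [IsProbabilityMeasure μ]
    (hμb : μ ≤ ENNReal.ofReal b • volume.restrict (Icc (0 : ℝ) 1)) (hΛ : 1 ≤ Λ)
    (ht : QuasiUniformKnots Λ p k t) {δ : ℝ} {n : ℕ} {x : Fin n → ℝ}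
    (hx : x ∉ irregularDesign μ t p k δ n) {j : ℕ} (hj : j ≤ k) :
    (n : ℝ)⁻¹ * ∑ i, (Ico (t (p + j)) (t (p + j + 1))).indicator (1 : ℝ → ℝ) (x i) ≤
      (b + δ) * cellLength t p j := by
  have hx' : |(n : ℝ)⁻¹ * ∑ i, cellMonomial t p (j, 0) (x i) * cellMonomial t p (j, 0) (x i) -
        ∫ x, cellMonomial t p (j, 0) x * cellMonomial t p (j, 0) x ∂μ| ≤ δ * cellLength t p j := by
    by_contra hcon
    exact hx ⟨j, hj, 0, 0, not_le.1 hcon⟩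
  have he : ∀ u, cellMonomial t p (j, 0) u * cellMonomial t p (j, 0) u =
      (Ico (t (p + j)) (t (p + j + 1))).indicator (1 : ℝ → ℝ) u := by
    intro u
    simp only [cellMonomial]
    by_cases hu : u ∈ Ico (t (p + j)) (t (p + j + 1))
    · simp [indicator_of_mem hu]
    · simp [indicator_of_notMem hu]
  simp only [he] at hx'
  have h1 := measureReal_cell_le (by linarith [one_le_of_le hμb]) hμb hΛ ht hj
  have := (abs_le.1 hx').2
  linarith

end Concentration

/-! ### Second moments of sums of independent variables -/

theorem memLp_comp_eval {μ : Measure ℝ} [IsProbabilityMeasure μ] {n : ℕ} {f : ℝ → ℝ}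
    (hf : MemLp f 2 μ) (i : Fin n) :
    MemLp (fun x : Fin n → ℝ => f (x i)) 2 (Measure.pi fun _ : Fin n => μ) :=
  hf.comp_measurePreserving (measurePreserving_eval (fun _ : Fin n => μ) i)

theorem integral_comp_eval_eq {μ : Measure ℝ} [IsProbabilityMeasure μ] {n : ℕ} {f : ℝ → ℝ}
    (hf : AEStronglyMeasurable f μ) (i : Fin n) :
    ∫ x, f (x i) ∂(Measure.pi fun _ : Fin n => μ) = ∫ x, f x ∂μ :=
  integral_comp_eval (μ := fun _ : Fin n => μ) (i := i) hf

theorem integral_sq_sum_pi {μ : Measure ℝ} [IsProbabilityMeasure μ] {n : ℕ} {f : Fin n → ℝ → ℝ}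
    (hf : ∀ i, MemLp (f i) 2 μ) (hf0 : ∀ i, ∫ x, f i x ∂μ = 0) :
    ∫ x, (∑ i, f i (x i)) ^ 2 ∂(Measure.pi fun _ : Fin n => μ) = ∑ i, ∫ x, f i x ^ 2 ∂μ := by
  have h := ProbabilityTheory.variance_sum_pi (μ := fun _ : Fin n => μ) (X := f) hf
  have hint : ∀ i, Integrable (fun x : Fin n → ℝ => f i (x i)) (Measure.pi fun _ : Fin n => μ) :=
    fun i => (memLp_comp_eval (hf i) i).integrable one_le_two
  have hm : ∫ x, (∑ i, fun x : Fin n → ℝ => f i (x i)) x ∂(Measure.pi fun _ : Fin n => μ) = 0 := by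
    simp only [Finset.sum_apply]
    rw [integral_finsetSum _ fun i _ => hint i]
    exact Finset.sum_eq_zero fun i _ => by rw [integral_comp_eval_eq (hf i).1 i, hf0 i]
  rw [ProbabilityTheory.variance_of_integral_eq_zero _ hm] at h
  · simp only [Finset.sum_apply] at h
    rw [h]
    exact Finset.sum_congr rfl fun i _ =>
      ProbabilityTheory.variance_of_integral_eq_zero (hf i).1.aemeasurable (hf0 i)
  · exact (memLp_finsetSum' _ fun i _ => memLp_comp_eval (hf i) i).1.aemeasurable

theorem memLp_sum_pi {μ : Measure ℝ} [IsProbabilityMeasure μ] {n : ℕ} {f : Fin n → ℝ → ℝ}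
    (hf : ∀ i, MemLp (f i) 2 μ) :
    MemLp (fun x => ∑ i, f i (x i)) 2 (Measure.pi fun _ : Fin n => μ) :=
  memLp_finsetSum _ fun i _ => memLp_comp_eval (hf i) i

/-- The mean of `n` independent copies deviates from the expectation by `1 / n` in mean square. -/
theorem integral_sq_mean_sub_le {μ : Measure ℝ} [IsProbabilityMeasure μ] {n : ℕ} (hn : 0 < n)
    {f : ℝ → ℝ} (hf : MemLp f 2 μ) :
    ∫ x, ((n : ℝ)⁻¹ * ∑ i, f (x i) - ∫ y, f y ∂μ) ^ 2 ∂(Measure.pi fun _ : Fin n => μ) ≤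
      (n : ℝ)⁻¹ * ∫ y, f y ^ 2 ∂μ := by
  set m := ∫ y, f y ∂μ with hm
  have hn' : (0 : ℝ) < n := by exact_mod_cast hn
  have hfi := hf.integrable one_le_two
  have h := integral_sq_sum_pi (n := n) (f := fun _ y => f y - m) (fun _ => hf.sub (memLp_const m))
    (fun _ => by rw [integral_sub hfi (integrable_const _)]; simp [hm])
  have h1 : ∀ x : Fin n → ℝ, ((n : ℝ)⁻¹ * ∑ i, f (x i) - m) ^ 2 =
      ((n : ℝ)⁻¹) ^ 2 * (∑ i, (f (x i) - m)) ^ 2 := by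
    intro x
    rw [← mul_pow, Finset.sum_sub_distrib]
    congr 1
    simp only [Finset.sum_const, Finset.card_univ, Fintype.card_fin, nsmul_eq_mul]
    field_simp
  simp only [h1]
  rw [integral_const_mul, h, Finset.sum_const, Finset.card_univ, Fintype.card_fin, nsmul_eq_mul]
  have h2 : ∫ x, (f x - m) ^ 2 ∂μ ≤ ∫ y, f y ^ 2 ∂μ := by
    have h3 : ∀ x, (f x - m) ^ 2 = f x ^ 2 - 2 * m * f x + m ^ 2 := fun x => by ring
    simp only [h3]
    have hA : Integrable (fun x => f x ^ 2 - 2 * m * f x) μ := hf.integrable_sq.sub (hfi.const_mul _)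
    rw [integral_add hA (integrable_const _), integral_sub hf.integrable_sq (hfi.const_mul _),
      integral_const_mul]
    simp only [integral_const, probReal_univ, one_smul, ← hm]
    nlinarith [sq_nonneg m]
  calc _ = (n : ℝ)⁻¹ * ∫ x, (f x - m) ^ 2 ∂μ := by field_simp
    _ ≤ _ := mul_le_mul_of_nonneg_left h2 (by positivity)

/-! ### Bias and variance of a decomposed estimator -/

theorem lintegral_sq_eq_ofReal {α : Type*} [MeasurableSpace α] {P : Measure α} {f : α → ℝ}
    (hf : MemLp f 2 P) :
    ∫⁻ z, ENNReal.ofReal (f z ^ 2) ∂P = ENNReal.ofReal (∫ z, f z ^ 2 ∂P) :=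
  (ofReal_integral_eq_lintegral_ofReal hf.integrable_sq
    (Eventually.of_forall fun _ => sq_nonneg _)).symm

theorem lintegral_sub_const_sq_eq_ofReal {α : Type*} [MeasurableSpace α] {P : Measure α}
    [IsFiniteMeasure P] {f : α → ℝ} (hf : MemLp f 2 P) (c : ℝ) :
    ∫⁻ z, ENNReal.ofReal ((f z - c) ^ 2) ∂P = ENNReal.ofReal (∫ z, (f z - c) ^ 2 ∂P) :=
  lintegral_sq_eq_ofReal (f := fun z => f z - c) (hf.sub (memLp_const c))

theorem lintegral_unit_sq_eq_ofReal {f : ℝ → ℝ} (hf : MemLp f 2 (volume.restrict (Icc (0 : ℝ) 1))) :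
    ∫⁻ u in Icc (0 : ℝ) 1, ENNReal.ofReal (f u ^ 2) = ENNReal.ofReal (∫ u in (0 : ℝ)..1, f u ^ 2) := by
  rw [lintegral_sq_eq_ofReal hf, integral_Icc_eq_integral_Ioc,
    intervalIntegral.integral_of_le zero_le_one]

/-- The bias-variance decomposition at a single point; integration over the point gives the one for
functions. -/
theorem integral_sub_const_sq {α : Type*} [MeasurableSpace α] {P : Measure α}
    [IsProbabilityMeasure P] {f : α → ℝ} (hf : MemLp f 2 P) (c : ℝ) :
    ∫ z, (f z - c) ^ 2 ∂P = (∫ z, f z ∂P - c) ^ 2 + ∫ z, (f z - ∫ z', f z' ∂P) ^ 2 ∂P := by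
  have hfi := hf.integrable one_le_two
  have key : ∀ c : ℝ, ∫ z, (f z - c) ^ 2 ∂P = ∫ z, f z ^ 2 ∂P - 2 * c * ∫ z, f z ∂P + c ^ 2 := by
    intro c
    have h3 : ∀ x, (f x - c) ^ 2 = f x ^ 2 - 2 * c * f x + c ^ 2 := fun x => by ring
    simp only [h3]
    have hA : Integrable (fun x => f x ^ 2 - 2 * c * f x) P := hf.integrable_sq.sub (hfi.const_mul _)
    rw [integral_add hA (integrable_const _), integral_sub hf.integrable_sq (hfi.const_mul _),
      integral_const_mul]
    simp
  rw [key, key]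
  ring

theorem ofReal_sq_integral_le {α : Type*} [MeasurableSpace α] {P : Measure α}
    [IsProbabilityMeasure P] {f : α → ℝ} (hf : MemLp f 2 P) :
    ENNReal.ofReal ((∫ z, f z ∂P) ^ 2) ≤ ∫⁻ z, ENNReal.ofReal (f z ^ 2) ∂P := by
  rw [lintegral_sq_eq_ofReal hf]
  refine ENNReal.ofReal_le_ofReal ?_
  have h := integral_sub_const_sq hf 0
  simp only [sub_zero] at h
  rw [h]
  have : 0 ≤ ∫ z, (f z - ∫ z', f z' ∂P) ^ 2 ∂P := integral_nonneg fun _ => sq_nonneg _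
  linarith

theorem ofReal_add_three_sq_le (x y z : ℝ) :
    ENNReal.ofReal ((x + y + z) ^ 2) ≤
      3 * (ENNReal.ofReal (x ^ 2) + ENNReal.ofReal (y ^ 2) + ENNReal.ofReal (z ^ 2)) := by
  rw [← ENNReal.ofReal_add (sq_nonneg _) (sq_nonneg _), ← ENNReal.ofReal_add (by positivity)
    (sq_nonneg _), show (3 : ENNReal) = ENNReal.ofReal 3 by simp, ← ENNReal.ofReal_mul (by norm_num)]
  refine ENNReal.ofReal_le_ofReal ?_
  nlinarith [sq_nonneg (x - y), sq_nonneg (y - z), sq_nonneg (x - z)]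

/-! ### Passage from the estimator to a jointly measurable version -/

section Decomposition

variable {n : ℕ} {P : Measure ((Fin n → ℝ) × (Fin n → ℝ))}
  {T : (Fin n → ℝ) → (Fin n → ℝ) → ℝ → ℝ} {ψ : ℝ → ℝ}
  {e : (Fin n → ℝ) × (Fin n → ℝ) → ℝ → ℝ}

theorem ae_lintegral_unit_congr (hes : ∀ᵐ z ∂P, ∀ u ∈ Ico (0 : ℝ) 1, estimate T ψ z u = e z u)
    (m : ℝ → ℝ) :
    ∫⁻ z, (∫⁻ u in Icc (0 : ℝ) 1, ENNReal.ofReal ((estimate T ψ z u - m u) ^ 2)) ∂P =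
      ∫⁻ z, (∫⁻ u in Icc (0 : ℝ) 1, ENNReal.ofReal ((e z u - m u) ^ 2)) ∂P := by
  refine lintegral_congr_ae ?_
  filter_upwards [hes] with z hz
  refine lintegral_congr_ae ?_
  filter_upwards [ae_mem_Ico] with u hu
  rw [hz u hu]

theorem integral_estimate_congr
    (hes : ∀ᵐ z ∂P, ∀ u ∈ Ico (0 : ℝ) 1, estimate T ψ z u = e z u) {u : ℝ}
    (hu : u ∈ Ico (0 : ℝ) 1) : ∫ z, estimate T ψ z u ∂P = ∫ z, e z u ∂P := by
  refine integral_congr_ae ?_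
  filter_upwards [hes] with z hz
  exact hz u hu

variable [IsProbabilityMeasure P]

theorem measurable_integral_left (he : Measurable (Function.uncurry e)) :
    Measurable fun u => ∫ z, e z u ∂P :=
  (he.stronglyMeasurable.integral_prod_left).measurable

theorem lintegral_unit_swap (he : Measurable (Function.uncurry e)) {m : ℝ → ℝ}
    (hm : AEMeasurable m (volume.restrict (Icc (0 : ℝ) 1))) :
    ∫⁻ z, (∫⁻ u in Icc (0 : ℝ) 1, ENNReal.ofReal ((e z u - m u) ^ 2)) ∂P =
      ∫⁻ u in Icc (0 : ℝ) 1, (∫⁻ z, ENNReal.ofReal ((e z u - m u) ^ 2) ∂P) := by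
  refine lintegral_lintegral_swap ?_
  exact ((he.aemeasurable.sub (hm.comp_snd)).pow_const 2).ennreal_ofReal

/-- The estimator itself need not be measurable, since the coefficient rule is arbitrary. It agrees
almost surely on `[0,1)` with a jointly measurable `e`, for which Tonelli's theorem exchanges the
sample and the point, and the decomposition is applied pointwise. -/
theorem biasVarianceBound_of_ae (he : Measurable (Function.uncurry e))
    (hes : ∀ᵐ z ∂P, ∀ u ∈ Ico (0 : ℝ) 1, estimate T ψ z u = e z u)
    (heL : ∀ u ∈ Ico (0 : ℝ) 1, MemLp (fun z => e z u) 2 P)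
    (hψ : AEMeasurable ψ (volume.restrict (Icc (0 : ℝ) 1))) {B V : ℝ}
    (hB : ∫⁻ u in Icc (0 : ℝ) 1, ENNReal.ofReal ((∫ z, e z u ∂P - ψ u) ^ 2) ≤ ENNReal.ofReal B)
    (hV : ∫⁻ u in Icc (0 : ℝ) 1, (∫⁻ z, ENNReal.ofReal ((e z u - ∫ z', e z' u ∂P) ^ 2) ∂P) ≤
      ENNReal.ofReal V) : BiasVarianceBound P T ψ B V := by
  have hbias : sqBias P T ψ =
      ∫⁻ u in Icc (0 : ℝ) 1, ENNReal.ofReal ((∫ z, e z u ∂P - ψ u) ^ 2) := by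
    refine lintegral_congr_ae ?_
    filter_upwards [ae_mem_Ico] with u hu
    rw [integral_estimate_congr hes hu]
  have hvar : variance P T ψ =
      ∫⁻ u in Icc (0 : ℝ) 1, (∫⁻ z, ENNReal.ofReal ((e z u - ∫ z', e z' u ∂P) ^ 2) ∂P) := by
    rw [← lintegral_unit_swap he (measurable_integral_left he).aemeasurable, variance,
      ae_lintegral_unit_congr hes]
    refine lintegral_congr fun z => lintegral_congr_ae ?_
    filter_upwards [ae_mem_Ico] with u hu
    rw [integral_estimate_congr hes hu]
  refine ⟨fun u hu => ?_, ?_, hbias ▸ hB, hvar ▸ hV⟩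
  · refine ((heL u hu).integrable one_le_two).congr ?_
    filter_upwards [hes] with z hz
    exact (hz u hu).symm
  · rw [hbias, hvar, mse, ae_lintegral_unit_congr hes, lintegral_unit_swap he hψ,
      ← lintegral_add_left']
    · refine lintegral_congr_ae ?_
      filter_upwards [ae_mem_Ico] with u hu
      have h := integral_sub_const_sq (heL u hu) (ψ u)
      rw [lintegral_sub_const_sq_eq_ofReal (heL u hu),
        lintegral_sub_const_sq_eq_ofReal (heL u hu), h,
        ENNReal.ofReal_add (sq_nonneg _) (integral_nonneg fun _ => sq_nonneg _)]
    · exact (((measurable_integral_left he).aemeasurable.sub hψ).pow_const 2).ennreal_ofReal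

/-- An estimator that deviates from a fixed function `s` by a small term, a centred term and, on
an exceptional set, the term `-s`. -/
theorem biasVarianceBound_of_decomposition {s : ℝ → ℝ} {A N : (Fin n → ℝ) × (Fin n → ℝ) → ℝ → ℝ}
    {S : Set ((Fin n → ℝ) × (Fin n → ℝ))} (hS : MeasurableSet S) (hs : Measurable s)
    (hA : Measurable (Function.uncurry A)) (hN : Measurable (Function.uncurry N))
    (hes : ∀ᵐ z ∂P, ∀ u ∈ Ico (0 : ℝ) 1, estimate T ψ z u =
      s u + A z u + N z u - S.indicator (fun _ => s u) z)
    (hAL : ∀ u ∈ Ico (0 : ℝ) 1, MemLp (fun z => A z u) 2 P)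
    (hNL : ∀ u ∈ Ico (0 : ℝ) 1, MemLp (fun z => N z u) 2 P)
    (hN0 : ∀ u ∈ Ico (0 : ℝ) 1, ∫ z, N z u ∂P = 0)
    (hψ : MemLp ψ 2 (volume.restrict (Icc (0 : ℝ) 1)))
    (hsL : MemLp s 2 (volume.restrict (Icc (0 : ℝ) 1))) {α η ρ M β : ℝ}
    (hα : ∫⁻ z, (∫⁻ u in Icc (0 : ℝ) 1, ENNReal.ofReal (A z u ^ 2)) ∂P ≤ ENNReal.ofReal α)
    (hη : ∫⁻ z, (∫⁻ u in Icc (0 : ℝ) 1, ENNReal.ofReal (N z u ^ 2)) ∂P ≤ ENNReal.ofReal η)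
    (hρ : P.real S ≤ ρ) (hM : ∫ u in (0 : ℝ)..1, s u ^ 2 ≤ M)
    (hβ : ∫ u in (0 : ℝ)..1, (s u - ψ u) ^ 2 ≤ β) (hα0 : 0 ≤ α) (hη0 : 0 ≤ η) :
    BiasVarianceBound P T ψ (3 * (α + ρ ^ 2 * M + β)) (3 * (α + η + ρ * M)) := by
  set e : (Fin n → ℝ) × (Fin n → ℝ) → ℝ → ℝ := fun z u =>
    s u + A z u + N z u - S.indicator (fun _ => s u) z with he
  have hUm : Measurable (Function.uncurry fun z u => S.indicator (fun _ => s u) z) := by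
    have : (Function.uncurry fun z u => S.indicator (fun _ => s u) z) =
        (Prod.fst ⁻¹' S).indicator fun q : ((Fin n → ℝ) × (Fin n → ℝ)) × ℝ => s q.2 := by
      ext q
      by_cases h : q.1 ∈ S
      · simp [Function.uncurry, indicator, h]
      · simp [Function.uncurry, indicator, h]
    rw [this]
    exact (hs.comp measurable_snd).indicator (measurable_fst hS)
  have hem : Measurable (Function.uncurry e) :=
    (((hs.comp measurable_snd).add hA).add hN).sub hUm
  have hUL : ∀ u, MemLp (fun z => S.indicator (fun _ => s u) z) 2 P := fun u =>
    (memLp_const (s u)).indicator hS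
  have heL : ∀ u ∈ Ico (0 : ℝ) 1, MemLp (fun z => e z u) 2 P := fun u hu =>
    ((((memLp_const (s u)).add (hAL u hu)).add (hNL u hu)).sub (hUL u))
  have hρ0 : 0 ≤ ρ := measureReal_nonneg.trans hρ
  have hM0 : 0 ≤ M := le_trans (intervalIntegral.integral_nonneg zero_le_one fun _ _ => sq_nonneg _) hM
  have hβ0 : 0 ≤ β := le_trans (intervalIntegral.integral_nonneg zero_le_one fun _ _ => sq_nonneg _) hβ
  -- The centred term drops out of the mean, and the exceptional set enters through its probability.
  -- This is why the bias bound contains `ρ ^ 2` and the variance bound only `ρ`.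
  have hmean : ∀ u ∈ Ico (0 : ℝ) 1, ∫ z, e z u ∂P - ψ u =
      ∫ z, A z u ∂P + (-(P.real S * s u)) + (s u - ψ u) := by
    intro u hu
    have i1 := (hAL u hu).integrable one_le_two
    have i2 := (hNL u hu).integrable one_le_two
    have i3 := (hUL u).integrable one_le_two
    have j1 : Integrable (fun z => s u + A z u) P := (integrable_const _).add i1
    have j2 : Integrable (fun z => s u + A z u + N z u) P := j1.add i2
    simp only [he]
    rw [integral_sub j2 i3, integral_add j1 i2, integral_add (integrable_const _) i1, hN0 u hu,
      integral_indicator_const _ hS]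
    simp
    ring
  have hswapA : ∫⁻ u in Icc (0 : ℝ) 1, (∫⁻ z, ENNReal.ofReal (A z u ^ 2) ∂P) ≤ ENNReal.ofReal α := by
    have := lintegral_unit_swap (P := P) hA (m := fun _ => 0) aemeasurable_const
    simp only [sub_zero] at this
    exact this ▸ hα
  have hswapN : ∫⁻ u in Icc (0 : ℝ) 1, (∫⁻ z, ENNReal.ofReal (N z u ^ 2) ∂P) ≤ ENNReal.ofReal η := by
    have := lintegral_unit_swap (P := P) hN (m := fun _ => 0) aemeasurable_const
    simp only [sub_zero] at this
    exact this ▸ hη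
  have hsq : Measurable fun u => ENNReal.ofReal (s u ^ 2) := (hs.pow_const 2).ennreal_ofReal
  have hAm : Measurable fun u => ∫⁻ z, ENNReal.ofReal (A z u ^ 2) ∂P :=
    Measurable.lintegral_prod_left' ((hA.pow_const 2).ennreal_ofReal)
  have hNm : Measurable fun u => ∫⁻ z, ENNReal.ofReal (N z u ^ 2) ∂P :=
    Measurable.lintegral_prod_left' ((hN.pow_const 2).ennreal_ofReal)
  refine biasVarianceBound_of_ae hem hes heL hψ.1.aemeasurable ?_ ?_
  · calc _ ≤ ∫⁻ u in Icc (0 : ℝ) 1, 3 * ((∫⁻ z, ENNReal.ofReal (A z u ^ 2) ∂P) +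
          ENNReal.ofReal (P.real S ^ 2) * ENNReal.ofReal (s u ^ 2) +
          ENNReal.ofReal ((s u - ψ u) ^ 2)) := by
          refine lintegral_mono_ae ?_
          filter_upwards [ae_mem_Ico] with u hu
          rw [hmean u hu]
          refine (ofReal_add_three_sq_le _ _ _).trans ?_
          gcongr
          · exact ofReal_sq_integral_le (hAL u hu)
          · rw [neg_sq, mul_pow, ENNReal.ofReal_mul (sq_nonneg _)]
      _ = 3 * ((∫⁻ u in Icc (0 : ℝ) 1, (∫⁻ z, ENNReal.ofReal (A z u ^ 2) ∂P)) +
          ENNReal.ofReal (P.real S ^ 2) * ENNReal.ofReal (∫ u in (0 : ℝ)..1, s u ^ 2) +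
          ENNReal.ofReal (∫ u in (0 : ℝ)..1, (s u - ψ u) ^ 2)) := by
          have h1 := lintegral_unit_sq_eq_ofReal (hsL.sub hψ)
          have hAS : Measurable fun u => (∫⁻ z, ENNReal.ofReal (A z u ^ 2) ∂P) +
              ENNReal.ofReal (P.real S ^ 2) * ENNReal.ofReal (s u ^ 2) := hAm.add (hsq.const_mul _)
          simp only [Pi.sub_apply] at h1
          rw [← lintegral_unit_sq_eq_ofReal hsL, ← h1, ← lintegral_const_mul _ hsq,
            ← lintegral_add_left hAm, ← lintegral_add_left hAS,
            lintegral_const_mul' _ _ (by simp)]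
      _ ≤ 3 * (ENNReal.ofReal α + ENNReal.ofReal (ρ ^ 2) * ENNReal.ofReal M +
          ENNReal.ofReal β) := by gcongr
      _ = _ := by
          rw [← ENNReal.ofReal_mul (by positivity), ← ENNReal.ofReal_add hα0 (by positivity),
            ← ENNReal.ofReal_add (by positivity) hβ0, show (3 : ENNReal) = ENNReal.ofReal 3 by simp,
            ← ENNReal.ofReal_mul (by norm_num)]
  · calc _ ≤ ∫⁻ u in Icc (0 : ℝ) 1, 3 * ((∫⁻ z, ENNReal.ofReal (A z u ^ 2) ∂P) +
          (∫⁻ z, ENNReal.ofReal (N z u ^ 2) ∂P) + P S * ENNReal.ofReal (s u ^ 2)) := by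
          refine lintegral_mono_ae ?_
          filter_upwards [ae_mem_Ico] with u hu
          -- The mean minimizes the mean square deviation, so it may be replaced by the fixed value
          -- `s u`.
          have h1 : ∫⁻ z, ENNReal.ofReal ((e z u - ∫ z', e z' u ∂P) ^ 2) ∂P ≤
              ∫⁻ z, ENNReal.ofReal ((e z u - s u) ^ 2) ∂P := by
            rw [lintegral_sub_const_sq_eq_ofReal (heL u hu),
              lintegral_sub_const_sq_eq_ofReal (heL u hu)]
            refine ENNReal.ofReal_le_ofReal ?_
            rw [integral_sub_const_sq (heL u hu) (s u)]
            exact le_add_of_nonneg_left (sq_nonneg _)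
          refine h1.trans ?_
          have hAu : Measurable fun z => ENNReal.ofReal (A z u ^ 2) :=
            ((hA.comp (measurable_id.prodMk measurable_const)).pow_const 2).ennreal_ofReal
          have hNu : Measurable fun z => ENNReal.ofReal (N z u ^ 2) :=
            ((hN.comp (measurable_id.prodMk measurable_const)).pow_const 2).ennreal_ofReal
          have h2 : ∫⁻ z, S.indicator (fun _ => ENNReal.ofReal (s u ^ 2)) z ∂P =
              P S * ENNReal.ofReal (s u ^ 2) := by
            rw [lintegral_indicator_const hS, mul_comm]
          have hANu : Measurable fun z => ENNReal.ofReal (A z u ^ 2) + ENNReal.ofReal (N z u ^ 2) :=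
            hAu.add hNu
          rw [← h2, ← lintegral_add_left hAu, ← lintegral_add_left hANu,
            ← lintegral_const_mul' _ _ (by simp)]
          refine lintegral_mono fun z => ?_
          have h3 : e z u - s u = A z u + N z u + (- S.indicator (fun _ => s u) z) := by
            simp only [he]; ring
          simp only [h3]
          refine (ofReal_add_three_sq_le _ _ _).trans ?_
          gcongr
          by_cases hz : z ∈ S
          · simp [indicator, hz]
          · simp [indicator, hz]
      _ = 3 * ((∫⁻ u in Icc (0 : ℝ) 1, (∫⁻ z, ENNReal.ofReal (A z u ^ 2) ∂P)) +
          (∫⁻ u in Icc (0 : ℝ) 1, (∫⁻ z, ENNReal.ofReal (N z u ^ 2) ∂P)) +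
          P S * ENNReal.ofReal (∫ u in (0 : ℝ)..1, s u ^ 2)) := by
          have hAN : Measurable fun u => (∫⁻ z, ENNReal.ofReal (A z u ^ 2) ∂P) +
              ∫⁻ z, ENNReal.ofReal (N z u ^ 2) ∂P := hAm.add hNm
          rw [← lintegral_unit_sq_eq_ofReal hsL, ← lintegral_const_mul _ hsq,
            ← lintegral_add_left hAm, ← lintegral_add_left hAN,
            lintegral_const_mul' _ _ (by simp)]
      _ ≤ 3 * (ENNReal.ofReal α + ENNReal.ofReal η + ENNReal.ofReal ρ * ENNReal.ofReal M) := by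
          gcongr
          rw [← ofReal_measureReal]
          exact ENNReal.ofReal_le_ofReal hρ
      _ = _ := by
          rw [← ENNReal.ofReal_mul (by positivity), ← ENNReal.ofReal_add hα0 hη0,
            ← ENNReal.ofReal_add (by positivity) (by positivity),
            show (3 : ENNReal) = ENNReal.ofReal 3 by simp, ← ENNReal.ofReal_mul (by norm_num)]

end Decomposition

/-! ### The least-squares fit as a linear function of the responses -/

/-- The weight of the `i`-th response in the value of the least-squares fit at `u`. -/
noncomputable def lsWeight (t : ℕ → ℝ) (p k : ℕ) {n : ℕ} (x : Fin n → ℝ) (i : Fin n) (u : ℝ) : ℝ :=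
  spline t p k (lsCoeff t p k x (Pi.single i 1)) u

theorem spline_lsCoeff_eq_sum (t : ℕ → ℝ) (p k : ℕ) {n : ℕ} (x y : Fin n → ℝ) (u : ℝ) :
    spline t p k (lsCoeff t p k x y) u = ∑ i, y i * lsWeight t p k x i u := by
  let L : (Fin n → ℝ) →ₗ[ℝ] ℝ :=
    { toFun := fun y => spline t p k (lsCoeff t p k x y) u
      map_add' := fun y z => by rw [lsCoeff_add, spline_add]
      map_smul' := fun s y => by rw [lsCoeff_smul, spline_smul]; rfl }
  have h := L.pi_apply_eq_sum_univ y
  refine h.trans (Finset.sum_congr rfl fun i _ => ?_)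
  have h1 : (fun j => if i = j then (1 : ℝ) else 0) = Pi.single i 1 := by
    ext j; simp [Pi.single_apply, eq_comm]
  rw [h1]
  rfl

theorem integral_spline_lsCoeff_noise {ν : Measure ℝ} [IsProbabilityMeasure ν] (hν : MemLp id 2 ν)
    (hν0 : ∫ e, e ∂ν = 0) (t : ℕ → ℝ) (p k : ℕ) {n : ℕ} (x : Fin n → ℝ) (u : ℝ) :
    ∫ ε, spline t p k (lsCoeff t p k x ε) u ∂(Measure.pi fun _ : Fin n => ν) = 0 := by
  simp only [spline_lsCoeff_eq_sum]
  have hint : ∀ i, Integrable (fun ε : Fin n → ℝ => ε i * lsWeight t p k x i u)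
      (Measure.pi fun _ : Fin n => ν) := fun i =>
    ((memLp_comp_eval hν i).integrable one_le_two).mul_const _
  rw [integral_finsetSum _ fun i _ => hint i]
  refine Finset.sum_eq_zero fun i _ => ?_
  have h0 : ∫ ε : Fin n → ℝ, ε i ∂(Measure.pi fun _ : Fin n => ν) = 0 :=
    (integral_comp_eval_eq (f := id) hν.1 i).trans hν0
  rw [integral_mul_const, h0, zero_mul]

theorem memLp_spline_lsCoeff_noise {ν : Measure ℝ} [IsProbabilityMeasure ν] (hν : MemLp id 2 ν)
    (t : ℕ → ℝ) (p k : ℕ) {n : ℕ} (x : Fin n → ℝ) (u : ℝ) :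
    MemLp (fun ε => spline t p k (lsCoeff t p k x ε) u) 2 (Measure.pi fun _ : Fin n => ν) := by
  simp only [spline_lsCoeff_eq_sum]
  exact memLp_finsetSum _ fun i _ => (memLp_comp_eval hν i).mul_const _

theorem integral_sq_linear_noise {ν : Measure ℝ} [IsProbabilityMeasure ν] (hν : MemLp id 2 ν)
    (hν0 : ∫ e, e ∂ν = 0) {n : ℕ} (w : Fin n → ℝ) :
    ∫ ε, (∑ i, ε i * w i) ^ 2 ∂(Measure.pi fun _ : Fin n => ν) =
      (∫ e, e ^ 2 ∂ν) * ∑ i, w i ^ 2 := by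
  rw [integral_sq_sum_pi (f := fun i e => e * w i) (fun i => hν.mul_const _) fun i => by
    rw [integral_mul_const, hν0, zero_mul], Finset.mul_sum]
  refine Finset.sum_congr rfl fun i _ => ?_
  simp only [mul_pow]
  rw [integral_mul_const]

section Noise

variable {Λ τ lam : ℝ} {p k n : ℕ} {t : ℕ → ℝ}

theorem le_of_mem_cellIndex {b : ℕ × Fin (p + 1)} (hb : b ∈ cellIndex p k) : b.1 ≤ k := by
  have := Finset.mem_range.1 (Finset.mem_product.1 hb).1
  omega

theorem inv_cellLength_le (hΛ : 1 ≤ Λ) (ht : QuasiUniformKnots Λ p k t) {j : ℕ} (hj : j ≤ k) :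
    (cellLength t p j)⁻¹ ≤ Λ * (k + 1) := by
  have hΛ0 : 0 < Λ := by linarith
  have h := ht.lower (p + j) (by omega) (by omega)
  have hpos : 0 < 1 / (Λ * (k + 1)) := by positivity
  have := inv_anti₀ hpos h
  simpa [cellLength] using this

/-- Only the `p + 1` monomials of one cell are alive at a point. The total variance of all empirical
moments is thus of order `1 / n`, and a factor `k + 1` enters only through the inverse cell lengths.
-/
theorem sum_cellMonomial_sq_le (ht : QuasiUniformKnots Λ p k t) {x : ℝ} (hx : x ∈ Ico (0 : ℝ) 1) :
    ∑ b ∈ cellIndex p k, cellMonomial t p b x ^ 2 ≤ p + 1 := by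
  obtain ⟨j, hj, hxj⟩ := ht.exists_cell hx
  rw [cellIndex, Finset.sum_product, Finset.sum_eq_single j]
  · calc _ ≤ ∑ _ : Fin (p + 1), (1 : ℝ) := Finset.sum_le_sum fun l _ =>
          pow_le_one₀ (cellMonomial_mem_Icc t p _ x).1 (cellMonomial_mem_Icc t p _ x).2
      _ = _ := by simp
  · intro i hi hij
    refine Finset.sum_eq_zero fun l _ => ?_
    rw [cellMonomial_eq_zero ht (by have := Finset.mem_range.1 hi; omega) hj hij hxj]
    simp
  · intro hn; exact absurd (Finset.mem_range.2 (by omega)) hn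

/-- The noise contributes at most `O(k / n)` to the mean squared error on a stable design. -/
theorem StableDesign.noise_le {ν : Measure ℝ} [IsProbabilityMeasure ν] (hν : MemLp id 2 ν)
    (hν0 : ∫ e, e ∂ν = 0) (hΛ : 1 ≤ Λ) (ht : QuasiUniformKnots Λ p k t) (hτ : 0 < τ)
    (hlam0 : 0 < lam) (hlam : ∀ a : Fin (p + 1) → ℝ,
      lam * ∑ l, a l ^ 2 ≤ ∫ u in (0 : ℝ)..1, (∑ l, a l * u ^ (l : ℕ)) ^ 2)
    {x : Fin n → ℝ} (hx : StableDesign t p k τ x) (hn : 0 < n) (hx01 : ∀ i, x i ∈ Ico (0 : ℝ) 1) :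
    ∫⁻ ε, (∫⁻ u in Icc (0 : ℝ) 1, ENNReal.ofReal (spline t p k (lsCoeff t p k x ε) u ^ 2))
        ∂(Measure.pi fun _ : Fin n => ν) ≤
      ENNReal.ofReal ((τ ^ 2 * lam)⁻¹ * (Λ * (k + 1)) * ((∫ e, e ^ 2 ∂ν) * (p + 1)) * (n : ℝ)⁻¹) := by
  set σ2 := ∫ e, e ^ 2 ∂ν with hσ2
  have hσ0 : 0 ≤ σ2 := integral_nonneg fun _ => sq_nonneg _
  have hn' : (0 : ℝ) < n := by exact_mod_cast hn
  have hΛ0 : 0 < Λ := by linarith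
  set ℓ : ℕ × Fin (p + 1) → (Fin n → ℝ) → ℝ := fun b ε =>
    ∑ i, ε i * ((n : ℝ)⁻¹ * cellMonomial t p b (x i)) with hℓ
  have hℓL : ∀ b, MemLp (ℓ b) 2 (Measure.pi fun _ : Fin n => ν) := fun b =>
    memLp_finsetSum _ fun i _ => (memLp_comp_eval hν i).mul_const _
  set F : (Fin n → ℝ) → ℝ := fun ε => (τ ^ 2 * lam)⁻¹ *
    ∑ b ∈ cellIndex p k, (cellLength t p b.1)⁻¹ * ℓ b ε ^ 2 with hF
  have hFi : Integrable F (Measure.pi fun _ : Fin n => ν) :=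
    (integrable_finsetSum _ fun b _ => (hℓL b).integrable_sq.const_mul _).const_mul _
  have hpos : ∀ b ∈ cellIndex p k, 0 < cellLength t p b.1 := fun b hb =>
    ht.cellLength_pos hΛ (le_of_mem_cellIndex hb)
  have hF0 : ∀ ε, 0 ≤ F ε := fun ε => mul_nonneg (by positivity) (Finset.sum_nonneg fun b hb => by
    have := hpos b hb; positivity)
  have h1 : ∀ ε, ∫⁻ u in Icc (0 : ℝ) 1, ENNReal.ofReal (spline t p k (lsCoeff t p k x ε) u ^ 2) ≤
      ENNReal.ofReal (F ε) := by
    intro ε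
    rw [lintegral_unit_sq_eq_ofReal (ht.memLp_spline _)]
    refine ENNReal.ofReal_le_ofReal ((hx.norm_sq_le_moments hΛ ht hτ hlam0 hlam hx01 ε 0
      (fun a c _ => by simp)).trans (le_of_eq ?_))
    simp only [hF, hℓ, Pi.zero_apply, sub_zero]
    congr 1
    refine Finset.sum_congr rfl fun b _ => ?_
    congr 2
    rw [Finset.mul_sum]
    exact Finset.sum_congr rfl fun i _ => by ring
  refine (lintegral_mono h1).trans ?_
  rw [← ofReal_integral_eq_lintegral_ofReal hFi (Eventually.of_forall hF0)]
  refine ENNReal.ofReal_le_ofReal ?_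
  simp only [hF]
  rw [integral_const_mul, integral_finsetSum _ fun b _ => (hℓL b).integrable_sq.const_mul _]
  simp only [integral_const_mul, hℓ, integral_sq_linear_noise hν hν0, ← hσ2]
  rw [mul_assoc, mul_assoc]
  refine mul_le_mul_of_nonneg_left ?_ (by positivity)
  calc _ ≤ ∑ b ∈ cellIndex p k, Λ * (k + 1) *
        (σ2 * ∑ i, ((n : ℝ)⁻¹ * cellMonomial t p b (x i)) ^ 2) := by
        refine Finset.sum_le_sum fun b hb => mul_le_mul_of_nonneg_right
          (inv_cellLength_le hΛ ht (le_of_mem_cellIndex hb)) ?_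
        exact mul_nonneg hσ0 (Finset.sum_nonneg fun _ _ => sq_nonneg _)
    _ = Λ * (k + 1) * (σ2 * ((n : ℝ)⁻¹ ^ 2 *
        ∑ i, ∑ b ∈ cellIndex p k, cellMonomial t p b (x i) ^ 2)) := by
        rw [← Finset.mul_sum, ← Finset.mul_sum, Finset.sum_comm]
        simp only [mul_pow, Finset.mul_sum]
    _ ≤ Λ * (k + 1) * (σ2 * ((n : ℝ)⁻¹ ^ 2 * ∑ _ : Fin n, ((p : ℝ) + 1))) := by
        gcongr with i
        exact sum_cellMonomial_sq_le ht (hx01 i)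
    _ = _ := by
        simp only [Finset.sum_const, Finset.card_univ, Fintype.card_fin, nsmul_eq_mul]
        field_simp

/-- Pointwise bound of the least-squares fit in terms of the responses. -/
theorem exists_lsCoeff_sq_le (hΛ : 1 ≤ Λ) (ht : QuasiUniformKnots Λ p k t) (hτ : 0 < τ) (n : ℕ) :
    ∃ C : ℝ, 0 ≤ C ∧ ∀ x : Fin n → ℝ, StableDesign t p k τ x → ∀ y : Fin n → ℝ,
      ∀ u ∈ Ico (0 : ℝ) 1, spline t p k (lsCoeff t p k x y) u ^ 2 ≤ C * ∑ i, y i ^ 2 := by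
  obtain ⟨C, hC, h⟩ := ht.spline_sq_le hΛ
  refine ⟨C * (τ⁻¹ * (n : ℝ)⁻¹), by positivity, fun x hx y u hu => ?_⟩
  refine (h _ u hu).trans ?_
  rw [mul_assoc]
  refine mul_le_mul_of_nonneg_left ?_ hC.le
  have h1 := hx.norm_sq_le hΛ ht hτ y
  calc _ = τ⁻¹ * (τ * ∫ u in (0 : ℝ)..1, spline t p k (lsCoeff t p k x y) u ^ 2) := by field_simp
    _ ≤ τ⁻¹ * ((n : ℝ)⁻¹ * ∑ i, y i ^ 2) := mul_le_mul_of_nonneg_left h1 (by positivity)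
    _ = _ := by ring

end Noise

/-! ### The conditional bias and variance -/

theorem ae_givenDesign {ν : Measure ℝ} [IsProbabilityMeasure ν] {n : ℕ} (x : Fin n → ℝ) :
    ∀ᵐ z ∂(givenDesign ν x), z.1 = x := by
  rw [givenDesign, Measure.dirac_prod]
  rw [ae_map_iff (by fun_prop) (measurableSet_eq_fun measurable_fst measurable_const)]
  simp

theorem integral_givenDesign {ν : Measure ℝ} [IsProbabilityMeasure ν] {n : ℕ} (x : Fin n → ℝ)
    {f : (Fin n → ℝ) → ℝ} (hf : AEStronglyMeasurable f (Measure.pi fun _ : Fin n => ν)) :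
    ∫ z, f z.2 ∂(givenDesign ν x) = ∫ ε, f ε ∂(Measure.pi fun _ : Fin n => ν) := by
  have h : MeasurePreserving (Prod.snd : (Fin n → ℝ) × (Fin n → ℝ) → (Fin n → ℝ))
      (givenDesign ν x) (Measure.pi fun _ : Fin n => ν) :=
    measurePreserving_snd
  have h2 := h.map_eq
  rw [← h2, integral_map h.measurable.aemeasurable]
  rwa [h2]

instance {ν : Measure ℝ} [IsProbabilityMeasure ν] {n : ℕ} (x : Fin n → ℝ) :
    IsProbabilityMeasure (givenDesign ν x) := by
  unfold givenDesign; infer_instance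

instance {μ ν : Measure ℝ} [IsProbabilityMeasure μ] [IsProbabilityMeasure ν] {n : ℕ} :
    IsProbabilityMeasure (sampleLaw μ ν n) := by
  unfold sampleLaw; infer_instance

theorem HasSobolevDerivs.memLp_self {r : ℕ} {ψ : ℝ → ℝ} {D : ℕ → ℝ → ℝ}
    (h : HasSobolevDerivs r ψ D) : MemLp ψ 2 (volume.restrict (Icc (0 : ℝ) 1)) := by
  refine (h.memLp 0 (Nat.zero_le _)).ae_eq ?_
  filter_upwards [ae_restrict_mem measurableSet_Icc] with x hx
  exact h.zero x hx

theorem integral_sq_le_of_mem_ball {r : ℕ} {R : ℝ} {D : ℕ → ℝ → ℝ}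
    (hR : ∑ j ∈ Finset.range (r + 1), (∫ x in (0 : ℝ)..1, (D j x) ^ 2) ≤ R ^ 2) {j : ℕ}
    (hj : j ≤ r) : ∫ x in (0 : ℝ)..1, D j x ^ 2 ≤ R ^ 2 :=
  (Finset.single_le_sum (f := fun j => ∫ x in (0 : ℝ)..1, D j x ^ 2)
    (fun _ _ => intervalIntegral.integral_nonneg zero_le_one fun _ _ => sq_nonneg _)
    (Finset.mem_range.2 (by omega))).trans hR

theorem HasSobolevDerivs.integral_sq_eq {r : ℕ} {ψ : ℝ → ℝ} {D : ℕ → ℝ → ℝ}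
    (h : HasSobolevDerivs r ψ D) :
    ∫ x in (0 : ℝ)..1, ψ x ^ 2 = ∫ x in (0 : ℝ)..1, D 0 x ^ 2 := by
  refine intervalIntegral.integral_congr fun x hx => ?_
  rw [uIcc_of_le zero_le_one] at hx
  simp only [h.zero x hx]

section Conditional

variable {Λ τ lam : ℝ} {p k n : ℕ} {t : ℕ → ℝ}

/-- Writing the cellwise bound as a step function makes its empirical mean a combination of cell
frequencies. -/
theorem sq_sub_le_sum_indicator (ht : QuasiUniformKnots Λ p k t) {g : ℝ → ℝ} {q : ℕ → ℝ}
    (h : ∀ j ≤ k, ∀ x ∈ Ico (t (p + j)) (t (p + j + 1)), g x ^ 2 ≤ q j) (hq : ∀ j ≤ k, 0 ≤ q j)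
    {x : ℝ} (hx : x ∈ Ico (0 : ℝ) 1) :
    g x ^ 2 ≤ ∑ j ∈ Finset.range (k + 1),
      q j * (Ico (t (p + j)) (t (p + j + 1))).indicator (1 : ℝ → ℝ) x := by
  obtain ⟨j, hj, hxj⟩ := ht.exists_cell hx
  have h1 := Finset.single_le_sum (s := Finset.range (k + 1))
    (f := fun j => q j * (Ico (t (p + j)) (t (p + j + 1))).indicator (1 : ℝ → ℝ) x)
    (fun i hi => mul_nonneg (hq i (by have := Finset.mem_range.1 hi; omega))
      (indicator_nonneg (fun _ _ => zero_le_one) _)) (Finset.mem_range.2 (Nat.lt_succ_of_le hj))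
  refine (h j hj x hxj).trans (le_trans (le_of_eq ?_) h1)
  simp [indicator_of_mem hxj]

/-- The best spline approximation in `L²`. -/
theorem integral_sq_le_of_local (hΛ : 1 ≤ Λ) (ht : QuasiUniformKnots Λ p k t) {g : ℝ → ℝ}
    {E : ℕ → ℝ} {κ S : ℝ} (hκ : 0 ≤ κ)
    (h : ∀ j ≤ k, ∀ x ∈ Ico (t (p + j)) (t (p + j + 1)), g x ^ 2 ≤ κ * E j)
    (hE : ∀ j ≤ k, 0 ≤ E j) (hS : ∑ j ∈ Finset.range (k + 1), E j ≤ S)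
    (hg : MemLp g 2 (volume.restrict (Icc (0 : ℝ) 1))) :
    ∫ u in (0 : ℝ)..1, g u ^ 2 ≤ κ * (Λ / (k + 1)) * S := by
  have hΛ0 : 0 < Λ := by linarith
  rw [← ht.sum_integral_cells hg.integrable_sq]
  calc _ ≤ ∑ j ∈ Finset.range (k + 1), κ * (Λ / (k + 1)) * E j := by
        refine Finset.sum_le_sum fun j hj => ?_
        have hj' : j ≤ k := by have := Finset.mem_range.1 hj; omega
        have hlt := ht.cell_lt hΛ hj'
        have hne : ∀ᵐ u : ℝ, u ≠ t (p + j + 1) := by simp [ae_iff, measure_singleton]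
        have h1 : ∫ u in t (p + j)..t (p + j + 1), g u ^ 2 ≤
            ∫ _ in t (p + j)..t (p + j + 1), κ * E j := by
          refine intervalIntegral.integral_mono_ae_restrict hlt.le ?_ (by simp) ?_
          · exact (IntegrableOn.mono_set hg.integrable_sq (uIcc_subset_Icc (ht.knot_mem (by omega))
              (ht.knot_mem (j := j + 1) (by omega)))).intervalIntegrable
          · filter_upwards [ae_restrict_mem measurableSet_Icc, ae_restrict_of_ae hne] with u hu hu1
            exact h j hj' u ⟨hu.1, lt_of_le_of_ne hu.2 hu1⟩
        refine h1.trans ?_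
        rw [intervalIntegral.integral_const, smul_eq_mul]
        have h2 := ht.upper (p + j) (by omega) (by omega)
        calc _ ≤ Λ / (k + 1) * (κ * E j) :=
              mul_le_mul_of_nonneg_right h2 (mul_nonneg hκ (hE j hj'))
          _ = _ := by ring
    _ = κ * (Λ / (k + 1)) * ∑ j ∈ Finset.range (k + 1), E j := by rw [Finset.mul_sum]
    _ ≤ _ := mul_le_mul_of_nonneg_left hS (by positivity)

theorem inv_pow_mul_div (r k : ℕ) (hr : 1 ≤ r) (Λ S : ℝ) :
    ((k + 1 : ℝ) ^ (2 * r - 1))⁻¹ * (Λ / (k + 1)) * S = Λ * S * ((k + 1 : ℝ) ^ (2 * r))⁻¹ := by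
  obtain ⟨m, hm⟩ : ∃ m, 2 * r = m + 1 := ⟨2 * r - 1, by omega⟩
  rw [hm, Nat.add_sub_cancel, pow_succ]
  have : (k + 1 : ℝ) ≠ 0 := by positivity
  field_simp

theorem inv_succ_pow_le (r : ℕ) {k : ℕ} (hk : 1 ≤ k) :
    ((k + 1 : ℝ) ^ (2 * r))⁻¹ ≤ ((k : ℝ) ^ (2 * r))⁻¹ := by
  have hk' : (0 : ℝ) < k := by exact_mod_cast hk
  refine inv_anti₀ (by positivity) (pow_le_pow_left₀ hk'.le (by linarith) _)

/-- Bias and variance of the least-squares estimator given a regular design. -/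
theorem biasVarianceBound_givenDesign {μ ν : Measure ℝ} [IsProbabilityMeasure μ]
    [IsProbabilityMeasure ν] (hν : MemLp id 2 ν) (hν0 : ∫ e, e ∂ν = 0) {b δ : ℝ} (hδ : 0 ≤ δ)
    (hμb : μ ≤ ENNReal.ofReal b • volume.restrict (Icc (0 : ℝ) 1))
    (hΛ : 1 ≤ Λ) (ht : QuasiUniformKnots Λ p k t) (hτ : 0 < τ)
    (hlam0 : 0 < lam) (hlam : ∀ a : Fin (p + 1) → ℝ,
      lam * ∑ l, a l ^ 2 ≤ ∫ u in (0 : ℝ)..1, (∑ l, a l * u ^ (l : ℕ)) ^ 2)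
    {x : Fin n → ℝ} (hn : 0 < n) (hx01 : ∀ i, x i ∈ Ico (0 : ℝ) 1)
    (hx : StableDesign t p k τ x) (hreg : x ∉ irregularDesign μ t p k δ n)
    {cHat : (Fin n → ℝ) → (Fin n → ℝ) → Fin (k + p + 1) → ℝ} (hc : IsLeastSquares t p k n cHat)
    {r : ℕ} (hr : 1 ≤ r) {ψ : ℝ → ℝ} {D : ℕ → ℝ → ℝ} (hD : HasSobolevDerivs r ψ D)
    {c : Fin (k + p + 1) → ℝ} {E : ℕ → ℝ} {S : ℝ} (hE : ∀ j ≤ k, 0 ≤ E j)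
    (hS : ∑ j ∈ Finset.range (k + 1), E j ≤ S)
    (happ : ∀ j ≤ k, ∀ x ∈ Ico (t (p + j)) (t (p + j + 1)),
          (ψ x - spline t p k c x) ^ 2 ≤ ((k + 1 : ℝ) ^ (2 * r - 1))⁻¹ * E j) :
    BiasVarianceBound (givenDesign ν x) (lse t p k cHat) ψ
      (6 * (τ⁻¹ * (b + δ) + 1) * (Λ * S) * ((k + 1 : ℝ) ^ (2 * r))⁻¹)
      (3 * ((τ ^ 2 * lam)⁻¹ * (Λ * (k + 1)) * ((∫ e, e ^ 2 ∂ν) * (p + 1)) * (n : ℝ)⁻¹)) := by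
  have hb : 1 ≤ b := one_le_of_le hμb
  have hΛ0 : 0 < Λ := by linarith
  have hn' : (0 : ℝ) < n := by exact_mod_cast hn
  set κ : ℝ := ((k + 1 : ℝ) ^ (2 * r - 1))⁻¹ with hκ
  have hκ0 : 0 ≤ κ := by positivity
  set g : ℝ → ℝ := fun u => ψ u - spline t p k c u with hg
  have hgL : MemLp g 2 (volume.restrict (Icc (0 : ℝ) 1)) := hD.memLp_self.sub (ht.memLp_spline c)
  have hS0 : 0 ≤ S := (Finset.sum_nonneg fun j hj =>
    hE j (by have := Finset.mem_range.1 hj; omega)).trans hS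
  have hσ0 : 0 ≤ ∫ e, e ^ 2 ∂ν := integral_nonneg fun _ => sq_nonneg _
  -- empirical norm of the approximation error
  have hemp : (n : ℝ)⁻¹ * ∑ i, g (x i) ^ 2 ≤ (b + δ) * (κ * (Λ / (k + 1)) * S) := by
    calc (n : ℝ)⁻¹ * ∑ i, g (x i) ^ 2
        ≤ (n : ℝ)⁻¹ * ∑ i, ∑ j ∈ Finset.range (k + 1),
          (κ * E j) * (Ico (t (p + j)) (t (p + j + 1))).indicator (1 : ℝ → ℝ) (x i) := by
          gcongr with i
          exact sq_sub_le_sum_indicator ht happ (fun j hj => mul_nonneg hκ0 (hE j hj)) (hx01 i)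
      _ = ∑ j ∈ Finset.range (k + 1), (κ * E j) * ((n : ℝ)⁻¹ * ∑ i,
          (Ico (t (p + j)) (t (p + j + 1))).indicator (1 : ℝ → ℝ) (x i)) := by
          rw [Finset.sum_comm, Finset.mul_sum]
          refine Finset.sum_congr rfl fun j _ => ?_
          rw [← Finset.mul_sum]; ring
      _ ≤ ∑ j ∈ Finset.range (k + 1), (κ * E j) * ((b + δ) * (Λ / (k + 1))) := by
          refine Finset.sum_le_sum fun j hj => ?_
          have hj' : j ≤ k := by have := Finset.mem_range.1 hj; omega
          refine mul_le_mul_of_nonneg_left ((card_cell_le_of_notMem hμb hΛ ht hreg hj').trans ?_)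
            (mul_nonneg hκ0 (hE j hj'))
          exact mul_le_mul_of_nonneg_left (ht.upper (p + j) (by omega) (by omega)) (by linarith)
      _ = (b + δ) * (κ * (Λ / (k + 1)) * ∑ j ∈ Finset.range (k + 1), E j) := by
          rw [← Finset.sum_mul, ← Finset.mul_sum]; ring
      _ ≤ _ := by gcongr
  set s : ℝ → ℝ := spline t p k (lsCoeff t p k x fun i => ψ (x i)) with hs
  -- Least squares reproduces the approximating spline, so the noiseless error is the fit to `g`
  -- minus `g`.
  have hsplit : ∀ u, s u - ψ u = spline t p k (lsCoeff t p k x fun i => g (x i)) u - g u := by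
    intro u
    have h1 : (fun i => ψ (x i)) = (fun i => g (x i)) + fun i => spline t p k c (x i) := by
      ext i; simp [hg]
    simp only [hs]
    rw [h1, lsCoeff_add, spline_add, hx.lsCoeff_spline hΛ ht hτ]
    simp only [hg]; ring
  have hbias : ∫ u in (0 : ℝ)..1, (s u - ψ u) ^ 2 ≤
      2 * (τ⁻¹ * (b + δ) + 1) * (κ * (Λ / (k + 1)) * S) := by
    have hL := ht.memLp_spline (lsCoeff t p k x fun i => g (x i))
    have h1 : ∫ u in (0 : ℝ)..1, (s u - ψ u) ^ 2 ≤
        ∫ u in (0 : ℝ)..1, (2 * spline t p k (lsCoeff t p k x fun i => g (x i)) u ^ 2 +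
          2 * g u ^ 2) := by
      have i1 : IntervalIntegrable (fun u => (s u - ψ u) ^ 2) volume 0 1 := by
        rw [intervalIntegrable_iff_integrableOn_Icc_of_le zero_le_one]
        exact ((ht.memLp_spline _).sub hD.memLp_self).integrable_sq
      have i2 : IntervalIntegrable (fun u =>
          2 * spline t p k (lsCoeff t p k x fun i => g (x i)) u ^ 2 + 2 * g u ^ 2) volume 0 1 := by
        rw [intervalIntegrable_iff_integrableOn_Icc_of_le zero_le_one]
        exact (hL.integrable_sq.const_mul 2).add (hgL.integrable_sq.const_mul 2)
      refine intervalIntegral.integral_mono_on zero_le_one i1 i2 fun u _ => ?_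
      rw [hsplit u]
      nlinarith [sq_nonneg (spline t p k (lsCoeff t p k x fun i => g (x i)) u + g u)]
    have h2 : ∫ u in (0 : ℝ)..1, (2 * spline t p k (lsCoeff t p k x fun i => g (x i)) u ^ 2 +
          2 * g u ^ 2) =
        2 * (∫ u in (0 : ℝ)..1, spline t p k (lsCoeff t p k x fun i => g (x i)) u ^ 2) +
        2 * ∫ u in (0 : ℝ)..1, g u ^ 2 := by
      rw [intervalIntegral.integral_add, intervalIntegral.integral_const_mul,
        intervalIntegral.integral_const_mul]
      · rw [intervalIntegrable_iff_integrableOn_Icc_of_le zero_le_one]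
        exact hL.integrable_sq.const_mul 2
      · rw [intervalIntegrable_iff_integrableOn_Icc_of_le zero_le_one]
        exact hgL.integrable_sq.const_mul 2
    have h3 := hx.norm_sq_le hΛ ht hτ fun i => g (x i)
    have h4 : ∫ u in (0 : ℝ)..1, spline t p k (lsCoeff t p k x fun i => g (x i)) u ^ 2 ≤
        τ⁻¹ * ((b + δ) * (κ * (Λ / (k + 1)) * S)) := by
      rw [inv_mul_eq_div, le_div_iff₀ hτ, mul_comm]
      exact h3.trans hemp
    have h5 := integral_sq_le_of_local hΛ ht hκ0 happ hE hS hgL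
    rw [h2] at h1
    change ∫ u in (0 : ℝ)..1, g u ^ 2 ≤ _ at h5
    linarith
  have hmN : Measurable (Function.uncurry fun (z : (Fin n → ℝ) × (Fin n → ℝ)) u =>
      spline t p k (lsCoeff t p k x z.2) u) := by
    have := (measurable_spline_lsCoeff t p k n).comp
      (show Measurable fun q : ((Fin n → ℝ) × (Fin n → ℝ)) × ℝ => ((x, q.1.2), q.2) by fun_prop)
    exact this
  -- Given the design, the noiseless fit `s` is deterministic and the design stable, so there is
  -- neither a fluctuation of the design nor an exceptional set.
  have key := biasVarianceBound_of_decomposition (P := givenDesign ν x) (T := lse t p k cHat) (ψ := ψ)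
    (s := s) (A := fun _ _ => 0) (N := fun z u => spline t p k (lsCoeff t p k x z.2) u) (S := ∅)
    MeasurableSet.empty (measurable_spline t p k _) measurable_const hmN ?_ ?_ ?_ ?_ hD.memLp_self
    (ht.memLp_spline _) (α := 0)
    (η := (τ ^ 2 * lam)⁻¹ * (Λ * (k + 1)) * ((∫ e, e ^ 2 ∂ν) * (p + 1)) * (n : ℝ)⁻¹) (ρ := 0)
    (M := ∫ u in (0 : ℝ)..1, s u ^ 2) (by simp) ?_ (by simp) le_rfl hbias le_rfl (by positivity)
  · convert key using 1
    · rw [hκ, inv_pow_mul_div r k hr]; ring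
    · ring
  · filter_upwards [ae_givenDesign (ν := ν) x] with z hz u _
    have h1 : (fun i => ψ (x i) + z.2 i) = (fun i => ψ (x i)) + z.2 := rfl
    simp only [estimate, lse, hz, hx.leastSquares_eq hΛ ht hτ hc]
    rw [h1, lsCoeff_add, spline_add]
    simp [hs]
  · exact fun u _ => memLp_const 0
  · intro u _
    exact (memLp_spline_lsCoeff_noise hν t p k x u).comp_measurePreserving measurePreserving_snd
  · intro u _
    rw [integral_givenDesign x (f := fun ε => spline t p k (lsCoeff t p k x ε) u)
      (memLp_spline_lsCoeff_noise hν t p k x u).1]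
    exact integral_spline_lsCoeff_noise hν hν0 t p k x u
  · have hmp : MeasurePreserving (Prod.snd : (Fin n → ℝ) × (Fin n → ℝ) → (Fin n → ℝ))
      (givenDesign ν x) (Measure.pi fun _ : Fin n => ν) := measurePreserving_snd
    have h1 := hmp.lintegral_comp (f := fun ε => ∫⁻ u in Icc (0 : ℝ) 1,
      ENNReal.ofReal (spline t p k (lsCoeff t p k x ε) u ^ 2)) (by
        refine Measurable.lintegral_prod_right' (f := fun q : (Fin n → ℝ) × ℝ =>
          ENNReal.ofReal (spline t p k (lsCoeff t p k x q.1) q.2 ^ 2)) ?_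
        have := (measurable_spline_lsCoeff t p k n).comp
          (show Measurable fun q : (Fin n → ℝ) × ℝ => ((x, q.1), q.2) by fun_prop)
        exact (this.pow_const 2).ennreal_ofReal)
    rw [h1]
    exact hx.noise_le hν hν0 hΛ ht hτ hlam0 hlam hn hx01

end Conditional

/-! ### Projection onto the splines with respect to the design law -/

section Projection

variable {μ : Measure ℝ} {a b Λ : ℝ} {p k : ℕ} {t : ℕ → ℝ}

open Matrix in
-- The Gram matrix in `L²(μ)` is nonsingular because `μ` dominates a multiple of Lebesgue measure.
-- The projection is taken with respect to the design law, not Lebesgue measure, so that the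
-- empirical moments of the residual against splines have mean zero.
theorem exists_projection (ha : 0 < a)
    (hμa : ENNReal.ofReal a • volume.restrict (Icc (0 : ℝ) 1) ≤ μ)
    (hμb : μ ≤ ENNReal.ofReal b • volume.restrict (Icc (0 : ℝ) 1)) (hΛ : 1 ≤ Λ)
    (ht : QuasiUniformKnots Λ p k t) {ψ : ℝ → ℝ} (hψ : MemLp ψ 2 μ) :
    ∃ c : Fin (k + p + 1) → ℝ, ∀ d : Fin (k + p + 1) → ℝ,
      ∫ u, (ψ u - spline t p k c u) * spline t p k d u ∂μ = 0 := by
  have hB : ∀ i : Fin (k + p + 1), MemLp (bspline t p i) 2 μ := fun i =>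
    memLp_of_le hμb (ht.memLp_bspline i.2)
  have hBB : ∀ i j : Fin (k + p + 1), Integrable (fun u => bspline t p i u * bspline t p j u) μ :=
    fun i j => (hB i).integrable_mul (hB j)
  set H : Matrix (Fin (k + p + 1)) (Fin (k + p + 1)) ℝ :=
    Matrix.of fun i j => ∫ u, bspline t p i u * bspline t p j u ∂μ with hH
  set v : Fin (k + p + 1) → ℝ := fun i => ∫ u, ψ u * bspline t p i u ∂μ with hv
  have hquad : ∀ c d : Fin (k + p + 1) → ℝ, d ⬝ᵥ (H *ᵥ c) =
      ∫ u, spline t p k c u * spline t p k d u ∂μ := by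
    intro c d
    have h1 : ∀ u, spline t p k c u * spline t p k d u =
        ∑ i : Fin (k + p + 1), ∑ j : Fin (k + p + 1),
          d i * (bspline t p i u * bspline t p j u * c j) := by
      intro u
      rw [mul_comm, spline, spline, Finset.sum_mul_sum]
      exact Finset.sum_congr rfl fun i _ => Finset.sum_congr rfl fun j _ => by ring
    simp only [h1]
    rw [integral_finsetSum _ fun i _ => integrable_finsetSum _ fun j _ =>
      ((hBB i j).mul_const _).const_mul _]
    simp only [dotProduct, Matrix.mulVec, Finset.mul_sum]
    refine Finset.sum_congr rfl fun i _ => ?_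
    rw [integral_finsetSum _ fun j _ => ((hBB i j).mul_const _).const_mul _]
    refine Finset.sum_congr rfl fun j _ => ?_
    rw [integral_const_mul, integral_mul_const]
    rfl
  have hdet : IsUnit H.det := by
    rw [isUnit_iff_ne_zero]
    intro h
    obtain ⟨w, hw, hw0⟩ := Matrix.exists_mulVec_eq_zero_iff.2 h
    have h2 := hquad w w
    rw [hw0, dotProduct_zero] at h2
    have h3 := ht.integral_spline_sq_pos hΛ hw
    have h4 := mul_integral_le_of_le ha.le hμa (f := fun u => spline t p k w u ^ 2)
      (fun _ => sq_nonneg _) (integrable_of_le hμb (ht.integrableOn_spline_sq w))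
    simp only [sq] at h3 h4
    rw [← h2] at h4
    exact absurd h4 (not_le.2 (mul_pos ha h3))
  refine ⟨H⁻¹ *ᵥ v, fun d => ?_⟩
  have hs : ∀ c, MemLp (spline t p k c) 2 μ := fun c => memLp_of_le hμb (ht.memLp_spline c)
  simp only [sub_mul]
  have i1 : Integrable (fun u => ψ u * spline t p k d u) μ := hψ.integrable_mul (hs d)
  have i2 : Integrable (fun u => spline t p k (H⁻¹ *ᵥ v) u * spline t p k d u) μ :=
    (hs _).integrable_mul (hs d)
  have i3 : ∀ i : Fin (k + p + 1), Integrable (fun u => ψ u * bspline t p i u) μ :=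
    fun i => hψ.integrable_mul (hB i)
  rw [integral_sub i1 i2, ← hquad,
    Matrix.mulVec_mulVec, Matrix.mul_nonsing_inv _ hdet, Matrix.one_mulVec]
  have h5 : ∀ u, ψ u * spline t p k d u = ∑ i : Fin (k + p + 1), d i * (ψ u * bspline t p i u) := by
    intro u
    rw [spline, Finset.mul_sum]
    exact Finset.sum_congr rfl fun i _ => by ring
  simp only [h5]
  rw [integral_finsetSum _ fun i _ => (i3 i).const_mul _]
  simp only [integral_const_mul, dotProduct, hv, sub_self]

/-- Pythagoras. Comparing with a good approximation `d` bounds the residual, and `d = 0` bounds the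
projection itself. -/
theorem integral_sq_sub_le_of_orthogonal
    (hμb : μ ≤ ENNReal.ofReal b • volume.restrict (Icc (0 : ℝ) 1))
    (ht : QuasiUniformKnots Λ p k t) {ψ : ℝ → ℝ} (hψ : MemLp ψ 2 μ) {c : Fin (k + p + 1) → ℝ}
    (hc : ∀ d : Fin (k + p + 1) → ℝ,
      ∫ u, (ψ u - spline t p k c u) * spline t p k d u ∂μ = 0) (d : Fin (k + p + 1) → ℝ) :
    ∫ u, (ψ u - spline t p k c u) ^ 2 ∂μ + ∫ u, (spline t p k (c - d) u) ^ 2 ∂μ =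
      ∫ u, (ψ u - spline t p k d u) ^ 2 ∂μ := by
  have hs : ∀ c, MemLp (spline t p k c) 2 μ := fun c => memLp_of_le hμb (ht.memLp_spline c)
  have hg : MemLp (fun u => ψ u - spline t p k c u) 2 μ := hψ.sub (hs c)
  have h1 : ∀ u, (ψ u - spline t p k d u) ^ 2 = (ψ u - spline t p k c u) ^ 2 +
      (spline t p k (c - d) u) ^ 2 + 2 * ((ψ u - spline t p k c u) * spline t p k (c - d) u) := by
    intro u
    rw [spline_sub]
    ring
  simp only [h1]
  have i1 : Integrable (fun u => (ψ u - spline t p k c u) ^ 2 + (spline t p k (c - d) u) ^ 2) μ :=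
    hg.integrable_sq.add (hs _).integrable_sq
  have i2 : Integrable (fun u => (ψ u - spline t p k c u) * spline t p k (c - d) u) μ :=
    hg.integrable_mul (hs _)
  rw [integral_add i1 (i2.const_mul 2),
    integral_add hg.integrable_sq (hs _).integrable_sq, integral_const_mul]
  simp only [hc, mul_zero, add_zero]

end Projection

/-! ### The unconditional bias and variance -/

section Unconditional

variable {Λ τ lam a b : ℝ} {p k n : ℕ} {t : ℕ → ℝ} {μ ν : Measure ℝ}

/-- The fluctuation of the projection of a function that is orthogonal to the splines. -/
theorem lintegral_stable_fit_le [IsProbabilityMeasure μ]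
    (hμb : μ ≤ ENNReal.ofReal b • volume.restrict (Icc (0 : ℝ) 1))
    (hΛ : 1 ≤ Λ) (ht : QuasiUniformKnots Λ p k t) (hτ : 0 < τ)
    (hlam0 : 0 < lam) (hlam : ∀ a : Fin (p + 1) → ℝ,
      lam * ∑ l, a l ^ 2 ≤ ∫ u in (0 : ℝ)..1, (∑ l, a l * u ^ (l : ℕ)) ^ 2)
    (hn : 0 < n) {g : ℝ → ℝ} (hg : MemLp g 2 μ)
    (hgo : ∀ d : Fin (k + p + 1) → ℝ, ∫ u, g u * spline t p k d u ∂μ = 0) :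
    ∫⁻ x, {x : Fin n → ℝ | StableDesign t p k τ x}.indicator (fun x => ∫⁻ u in Icc (0 : ℝ) 1,
      ENNReal.ofReal (spline t p k (lsCoeff t p k x fun i => g (x i)) u ^ 2)) x
        ∂(Measure.pi fun _ : Fin n => μ) ≤
      ENNReal.ofReal ((τ ^ 2 * lam)⁻¹ * (Λ * (k + 1)) * ((p + 1) * ∫ u, g u ^ 2 ∂μ) *
        (n : ℝ)⁻¹) := by
  have hn' : (0 : ℝ) < n := by exact_mod_cast hn
  have hΛ0 : 0 < Λ := by linarith
  set M : ℕ × Fin (p + 1) → ℝ := fun b => ∫ u, g u * cellMonomial t p b u ∂μ with hM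
  have hgm : ∀ b, MemLp (fun u => g u * cellMonomial t p b u) 2 μ := fun b => by
    refine MemLp.of_le hg (hg.1.mul (measurable_cellMonomial t p b).aestronglyMeasurable)
      (Eventually.of_forall fun u => ?_)
    have := cellMonomial_mem_Icc t p b u
    rw [norm_mul, Real.norm_eq_abs (cellMonomial t p b u), abs_of_nonneg this.1]
    exact mul_le_of_le_one_right (norm_nonneg _) this.2
  -- A cell monomial need not be a spline, so its moment against `g` may be nonzero. Only the
  -- combinations that represent splines vanish, and these are the ones that occur in the bound for
  -- the fit.
  have hM0 : ∀ (a : ℕ × Fin (p + 1) → ℝ) (c : Fin (k + p + 1) → ℝ),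
      (∀ x ∈ Ico (0 : ℝ) 1, spline t p k c x = ∑ b ∈ cellIndex p k, a b * cellMonomial t p b x) →
      ∑ b ∈ cellIndex p k, a b * M b = 0 := by
    intro a c hac
    rw [← hgo c]
    have h1 : ∫ u, g u * spline t p k c u ∂μ =
        ∫ u, ∑ b ∈ cellIndex p k, a b * (g u * cellMonomial t p b u) ∂μ := by
      refine integral_congr_ae ?_
      filter_upwards [ae_mem_Ico_of_le hμb] with u hu
      rw [hac u hu, Finset.mul_sum]
      exact Finset.sum_congr rfl fun b _ => by ring
    rw [h1, integral_finsetSum _ fun b _ => ((hgm b).integrable one_le_two).const_mul _]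
    simp only [integral_const_mul, hM]
  set ℓ : ℕ × Fin (p + 1) → (Fin n → ℝ) → ℝ := fun b x =>
    (n : ℝ)⁻¹ * ∑ i, g (x i) * cellMonomial t p b (x i) - M b with hℓ
  have hℓL : ∀ b, MemLp (ℓ b) 2 (Measure.pi fun _ : Fin n => μ) := fun b =>
    ((memLp_sum_pi fun _ => hgm b).const_mul _).sub (memLp_const _)
  set F : (Fin n → ℝ) → ℝ := fun x => (τ ^ 2 * lam)⁻¹ *
    ∑ b ∈ cellIndex p k, (cellLength t p b.1)⁻¹ * ℓ b x ^ 2 with hF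
  have hFi : Integrable F (Measure.pi fun _ : Fin n => μ) :=
    (integrable_finsetSum _ fun b _ => (hℓL b).integrable_sq.const_mul _).const_mul _
  have hpos : ∀ b ∈ cellIndex p k, 0 < cellLength t p b.1 := fun b hb =>
    ht.cellLength_pos hΛ (le_of_mem_cellIndex hb)
  have hF0 : ∀ x, 0 ≤ F x := fun x => mul_nonneg (by positivity) (Finset.sum_nonneg fun b hb => by
    have := hpos b hb; positivity)
  calc _ ≤ ∫⁻ x, ENNReal.ofReal (F x) ∂(Measure.pi fun _ : Fin n => μ) := by
        refine lintegral_mono_ae ?_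
        filter_upwards [ae_pi_mem (ae_mem_Ico_of_le hμb) n] with x hx01
        -- The inner `if` removes the null set of designs with a point outside `[0,1)`, so that the
        -- comparison holds at every design.
        refine indicator_le' (s := {x : Fin n → ℝ | StableDesign t p k τ x})
          (f := fun x => if ∀ i, x i ∈ Ico (0 : ℝ) 1 then ∫⁻ u in Icc (0 : ℝ) 1,
            ENNReal.ofReal (spline t p k (lsCoeff t p k x fun i => g (x i)) u ^ 2) else 0)
          (g := fun x => ENNReal.ofReal (F x)) ?_ ?_ x |>.trans' (le_of_eq ?_)
        · intro x hx
          split_ifs with hx01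
          · rw [lintegral_unit_sq_eq_ofReal (ht.memLp_spline _)]
            exact ENNReal.ofReal_le_ofReal
              (StableDesign.norm_sq_le_moments hΛ ht hτ hx hlam0 hlam hx01 _ M hM0)
          · exact zero_le
        · intro x _
          exact zero_le
        · simp only [indicator]
          rw [if_pos hx01]
    _ = ENNReal.ofReal (∫ x, F x ∂(Measure.pi fun _ : Fin n => μ)) :=
        (ofReal_integral_eq_lintegral_ofReal hFi (Eventually.of_forall hF0)).symm
    _ ≤ _ := by
        refine ENNReal.ofReal_le_ofReal ?_
        simp only [hF]
        rw [integral_const_mul, integral_finsetSum _ fun b _ => (hℓL b).integrable_sq.const_mul _]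
        simp only [integral_const_mul]
        rw [mul_assoc, mul_assoc]
        refine mul_le_mul_of_nonneg_left ?_ (by positivity)
        calc _ ≤ ∑ b ∈ cellIndex p k, Λ * (k + 1) *
              ((n : ℝ)⁻¹ * ∫ u, (g u * cellMonomial t p b u) ^ 2 ∂μ) := by
              refine Finset.sum_le_sum fun b hb => ?_
              exact mul_le_mul (inv_cellLength_le hΛ ht (le_of_mem_cellIndex hb))
                (integral_sq_mean_sub_le hn (hgm b)) (integral_nonneg fun _ => sq_nonneg _)
                (by positivity)
          _ = Λ * (k + 1) * ((n : ℝ)⁻¹ *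
              ∫ u, ∑ b ∈ cellIndex p k, (g u * cellMonomial t p b u) ^ 2 ∂μ) := by
              rw [integral_finsetSum _ fun b _ => (hgm b).integrable_sq, Finset.mul_sum,
                Finset.mul_sum]
          _ ≤ Λ * (k + 1) * ((n : ℝ)⁻¹ * ∫ u, (p + 1) * g u ^ 2 ∂μ) := by
              refine mul_le_mul_of_nonneg_left (mul_le_mul_of_nonneg_left ?_ (by positivity))
                (by positivity)
              refine integral_mono_ae (integrable_finsetSum _ fun b _ => (hgm b).integrable_sq)
                (hg.integrable_sq.const_mul _) ?_
              filter_upwards [ae_mem_Ico_of_le hμb] with u hu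
              simp only [mul_pow, ← Finset.mul_sum]
              rw [mul_comm]
              exact mul_le_mul_of_nonneg_right (sum_cellMonomial_sq_le ht hu) (sq_nonneg _)
          _ = _ := by rw [integral_const_mul]; ring

theorem ae_sampleLaw_fst [IsProbabilityMeasure μ] [IsProbabilityMeasure ν] {q : (Fin n → ℝ) → Prop}
    (h : ∀ᵐ x ∂(Measure.pi fun _ : Fin n => μ), q x) : ∀ᵐ z ∂(sampleLaw μ ν n), q z.1 :=
  (measurePreserving_fst (μ := Measure.pi fun _ : Fin n => μ)
    (ν := Measure.pi fun _ : Fin n => ν)).quasiMeasurePreserving.ae h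

/-! ### The fit restricted to stable designs, for design residuals and for noise -/

section StableFit

/-- The fit to `w z` for a stable design, as a function of `z = (X, ε)` and the point. -/
noncomputable def stableFit (t : ℕ → ℝ) (p k : ℕ) (τ : ℝ) {n : ℕ}
    (w : (Fin n → ℝ) × (Fin n → ℝ) → Fin n → ℝ) (z : (Fin n → ℝ) × (Fin n → ℝ)) (u : ℝ) : ℝ :=
  {x : Fin n → ℝ | StableDesign t p k τ x}.indicator (fun x => spline t p k (lsCoeff t p k x (w z)) u) z.1

theorem stableFit_of_stable {w : (Fin n → ℝ) × (Fin n → ℝ) → Fin n → ℝ}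
    {z : (Fin n → ℝ) × (Fin n → ℝ)} (hz : StableDesign t p k τ z.1) (u : ℝ) :
    stableFit t p k τ w z u = spline t p k (lsCoeff t p k z.1 (w z)) u :=
  indicator_of_mem (s := {x : Fin n → ℝ | StableDesign t p k τ x}) hz _

theorem stableFit_of_not_stable {w : (Fin n → ℝ) × (Fin n → ℝ) → Fin n → ℝ}
    {z : (Fin n → ℝ) × (Fin n → ℝ)} (hz : ¬ StableDesign t p k τ z.1) (u : ℝ) :
    stableFit t p k τ w z u = 0 :=
  indicator_of_notMem (s := {x : Fin n → ℝ | StableDesign t p k τ x}) hz _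

theorem measurable_stableFit (ht : QuasiUniformKnots Λ p k t)
    {w : (Fin n → ℝ) × (Fin n → ℝ) → Fin n → ℝ} (hw : Measurable w) :
    Measurable (Function.uncurry (stableFit t p k τ w)) := by
  have h1 := (measurable_spline_lsCoeff t p k n).comp
    (show Measurable fun q : ((Fin n → ℝ) × (Fin n → ℝ)) × ℝ => ((q.1.1, w q.1), q.2) by fun_prop)
  have h2 : Function.uncurry (stableFit t p k τ w) =
      ((fun q : ((Fin n → ℝ) × (Fin n → ℝ)) × ℝ => q.1.1) ⁻¹'
        {x : Fin n → ℝ | StableDesign t p k τ x}).indicator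
      fun q => spline t p k (lsCoeff t p k q.1.1 (w q.1)) q.2 := by
    ext q
    by_cases h : StableDesign t p k τ q.1.1
    · rw [indicator_of_mem (by simpa using h)]
      exact stableFit_of_stable h q.2
    · rw [indicator_of_notMem (by simpa using h)]
      exact stableFit_of_not_stable h q.2
  rw [h2]
  exact Measurable.indicator h1
    ((measurable_fst.comp measurable_fst) (measurableSet_stableDesign t ht n τ))

/-- Stability bounds the fit at a point by a fixed multiple of the Euclidean norm of the responses.
Without the truncation an ill-conditioned design could destroy integrability. -/
theorem memLp_stableFit (hΛ : 1 ≤ Λ) (ht : QuasiUniformKnots Λ p k t) (hτ : 0 < τ)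
    {P : Measure ((Fin n → ℝ) × (Fin n → ℝ))}
    {w : (Fin n → ℝ) × (Fin n → ℝ) → Fin n → ℝ} (hw : Measurable w)
    (hwL : ∀ i, MemLp (fun z => w z i) 2 P) {u : ℝ} (hu : u ∈ Ico (0 : ℝ) 1) :
    MemLp (fun z => stableFit t p k τ w z u) 2 P := by
  have hm : Measurable fun z => stableFit t p k τ w z u :=
    (measurable_stableFit ht hw).of_uncurry_right
  obtain ⟨C, hC0, hC⟩ := exists_lsCoeff_sq_le hΛ ht hτ n
  rw [memLp_two_iff_integrable_sq hm.aestronglyMeasurable]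
  have h1 : Integrable (fun z => C * ∑ i, w z i ^ 2) P :=
    (integrable_finsetSum _ fun i _ => (hwL i).integrable_sq).const_mul C
  refine h1.mono' (hm.pow_const 2).aestronglyMeasurable (Eventually.of_forall fun z => ?_)
  rw [Real.norm_eq_abs, abs_of_nonneg (sq_nonneg _)]
  by_cases hz : StableDesign t p k τ z.1
  · rw [stableFit_of_stable hz]
    exact hC _ hz _ u hu
  · rw [stableFit_of_not_stable hz]
    have : 0 ≤ ∑ i, w z i ^ 2 := Finset.sum_nonneg fun _ _ => sq_nonneg _
    rw [zero_pow two_ne_zero]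
    positivity

/-- Given the design the fit is linear in the centred noise; stability depends on the design alone,
so Fubini's theorem applies. -/
theorem integral_stableFit_noise [IsProbabilityMeasure μ] [IsProbabilityMeasure ν]
    (hν : MemLp id 2 ν) (hν0 : ∫ e, e ∂ν = 0)
    (hΛ : 1 ≤ Λ) (ht : QuasiUniformKnots Λ p k t) (hτ : 0 < τ) {u : ℝ} (hu : u ∈ Ico (0 : ℝ) 1) :
    ∫ z, stableFit t p k τ (fun z => z.2) z u ∂(sampleLaw μ ν n) = 0 := by
  have hi : Integrable (fun z => stableFit t p k τ (fun z => z.2) z u) (sampleLaw μ ν n) :=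
    (memLp_stableFit hΛ ht hτ measurable_snd (fun i => (memLp_comp_eval hν i).comp_measurePreserving
      measurePreserving_snd) hu).integrable one_le_two
  rw [sampleLaw] at hi ⊢
  rw [integral_prod _ hi]
  refine integral_eq_zero_of_ae (Eventually.of_forall fun x => ?_)
  rw [Pi.zero_apply]
  by_cases hx : StableDesign t p k τ x
  · have h1 : ∀ y, stableFit t p k τ (fun z => z.2) (x, y) u =
        spline t p k (lsCoeff t p k x y) u := fun y => stableFit_of_stable (z := (x, y)) hx u
    simp only [h1]
    exact integral_spline_lsCoeff_noise hν hν0 t p k x u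
  · have h1 : ∀ y, stableFit t p k τ (fun z => z.2) (x, y) u = 0 :=
      fun y => stableFit_of_not_stable (z := (x, y)) hx u
    simp only [h1, integral_zero]

theorem lintegral_stableFit_noise_le [IsProbabilityMeasure μ] [IsProbabilityMeasure ν]
    (hν : MemLp id 2 ν) (hν0 : ∫ e, e ∂ν = 0)
    (hμb : μ ≤ ENNReal.ofReal b • volume.restrict (Icc (0 : ℝ) 1))
    (hΛ : 1 ≤ Λ) (ht : QuasiUniformKnots Λ p k t) (hτ : 0 < τ)
    (hlam0 : 0 < lam) (hlam : ∀ a : Fin (p + 1) → ℝ,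
      lam * ∑ l, a l ^ 2 ≤ ∫ u in (0 : ℝ)..1, (∑ l, a l * u ^ (l : ℕ)) ^ 2) (hn : 0 < n) :
    ∫⁻ z, (∫⁻ u in Icc (0 : ℝ) 1,
        ENNReal.ofReal (stableFit t p k τ (fun z => z.2) z u ^ 2)) ∂(sampleLaw μ ν n) ≤
      ENNReal.ofReal ((τ ^ 2 * lam)⁻¹ * (Λ * (k + 1)) *
          ((∫ e, e ^ 2 ∂ν) * (p + 1)) * (n : ℝ)⁻¹) := by
  have hm := measurable_stableFit (τ := τ) (n := n) ht
    (w := fun z : (Fin n → ℝ) × (Fin n → ℝ) => z.2) measurable_snd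
  rw [sampleLaw, lintegral_prod _ (Measurable.aemeasurable (Measurable.lintegral_prod_right'
    (f := fun q : ((Fin n → ℝ) × (Fin n → ℝ)) × ℝ =>
      ENNReal.ofReal (stableFit t p k τ (fun z => z.2) q.1 q.2 ^ 2))
    ((hm.pow_const 2).ennreal_ofReal)))]
  calc _ ≤ ∫⁻ _, ENNReal.ofReal ((τ ^ 2 * lam)⁻¹ * (Λ * (k + 1)) *
        ((∫ e, e ^ 2 ∂ν) * (p + 1)) * (n : ℝ)⁻¹) ∂(Measure.pi fun _ : Fin n => μ) := by
        refine lintegral_mono_ae ?_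
        filter_upwards [ae_pi_mem (ae_mem_Ico_of_le hμb) n] with x hx01
        by_cases hx : StableDesign t p k τ x
        · simp only [stableFit_of_stable (z := (x, _)) hx]
          exact StableDesign.noise_le hν hν0 hΛ ht hτ hlam0 hlam hx hn hx01
        · simp only [stableFit_of_not_stable (z := (x, _)) hx]
          simp
    _ = _ := by simp

theorem lintegral_stableFit_design_le [IsProbabilityMeasure μ] [IsProbabilityMeasure ν]
    (hμb : μ ≤ ENNReal.ofReal b • volume.restrict (Icc (0 : ℝ) 1))
    (hΛ : 1 ≤ Λ) (ht : QuasiUniformKnots Λ p k t) (hτ : 0 < τ)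
    (hlam0 : 0 < lam) (hlam : ∀ a : Fin (p + 1) → ℝ,
      lam * ∑ l, a l ^ 2 ≤ ∫ u in (0 : ℝ)..1, (∑ l, a l * u ^ (l : ℕ)) ^ 2)
    (hn : 0 < n) {g : ℝ → ℝ} (hgm : Measurable g) (hg : MemLp g 2 μ)
    (hgo : ∀ d : Fin (k + p + 1) → ℝ, ∫ u, g u * spline t p k d u ∂μ = 0) :
    ∫⁻ z, (∫⁻ u in Icc (0 : ℝ) 1,
        ENNReal.ofReal (stableFit t p k τ (fun z i => g (z.1 i)) z u ^ 2)) ∂(sampleLaw μ ν n) ≤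
      ENNReal.ofReal ((τ ^ 2 * lam)⁻¹ * (Λ * (k + 1)) * ((p + 1) * ∫ u, g u ^ 2 ∂μ) *
        (n : ℝ)⁻¹) := by
  have hmp1 : MeasurePreserving (Prod.fst : (Fin n → ℝ) × (Fin n → ℝ) → (Fin n → ℝ))
      (sampleLaw μ ν n) (Measure.pi fun _ : Fin n => μ) := measurePreserving_fst
  have h1 : ∀ z : (Fin n → ℝ) × (Fin n → ℝ), ∫⁻ u in Icc (0 : ℝ) 1,
      ENNReal.ofReal (stableFit t p k τ (fun z i => g (z.1 i)) z u ^ 2) =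
      {x : Fin n → ℝ | StableDesign t p k τ x}.indicator (fun x => ∫⁻ u in Icc (0 : ℝ) 1,
        ENNReal.ofReal (spline t p k (lsCoeff t p k x fun i => g (x i)) u ^ 2)) z.1 := by
    intro z
    by_cases hz : StableDesign t p k τ z.1
    · rw [indicator_of_mem (by simpa using hz)]
      simp only [stableFit_of_stable hz]
    · rw [indicator_of_notMem (by simpa using hz)]
      simp [stableFit_of_not_stable hz]
  simp only [h1]
  rw [hmp1.lintegral_comp (f := {x : Fin n → ℝ | StableDesign t p k τ x}.indicator
    (fun x => ∫⁻ u in Icc (0 : ℝ) 1,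
        ENNReal.ofReal (spline t p k (lsCoeff t p k x fun i => g (x i)) u ^ 2)))]
  · exact lintegral_stable_fit_le hμb hΛ ht hτ hlam0 hlam hn hg hgo
  · refine Measurable.indicator (Measurable.lintegral_prod_right'
      (f := fun q : (Fin n → ℝ) × ℝ => ENNReal.ofReal
        (spline t p k (lsCoeff t p k q.1 fun i => g (q.1 i)) q.2 ^ 2)) ?_)
      (measurableSet_stableDesign t ht n τ)
    have h1 := (measurable_spline_lsCoeff t p k n).comp
      (show Measurable fun q : (Fin n → ℝ) × ℝ => ((q.1, fun i => g (q.1 i)), q.2) by fun_prop)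
    exact (h1.pow_const 2).ennreal_ofReal

end StableFit

/-- Bias and variance of the truncated least-squares estimator, in terms of the probability of an
unstable design and the error of the projection. -/
theorem biasVarianceBound_sampleLaw [IsProbabilityMeasure μ] [IsProbabilityMeasure ν]
    (hν : MemLp id 2 ν) (hν0 : ∫ e, e ∂ν = 0)
    (hμb : μ ≤ ENNReal.ofReal b • volume.restrict (Icc (0 : ℝ) 1))
    (hΛ : 1 ≤ Λ) (ht : QuasiUniformKnots Λ p k t) (hτ : 0 < τ)
    (hlam0 : 0 < lam) (hlam : ∀ a : Fin (p + 1) → ℝ,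
      lam * ∑ l, a l ^ 2 ≤ ∫ u in (0 : ℝ)..1, (∑ l, a l * u ^ (l : ℕ)) ^ 2)
    (hn : 0 < n) {cHat : (Fin n → ℝ) → (Fin n → ℝ) → Fin (k + p + 1) → ℝ}
    (hc : IsLeastSquares t p k n cHat) {ψ : ℝ → ℝ}
    (hψ : MemLp ψ 2 (volume.restrict (Icc (0 : ℝ) 1))) {c : Fin (k + p + 1) → ℝ}
    (hco : ∀ d : Fin (k + p + 1) → ℝ,
      ∫ u, (ψ u - spline t p k c u) * spline t p k d u ∂μ = 0) {G ρ M β : ℝ}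
    (hG : ∫ u, (ψ u - spline t p k c u) ^ 2 ∂μ ≤ G)
    (hρ : (Measure.pi fun _ : Fin n => μ) {x | ¬ StableDesign t p k τ x} ≤ ENNReal.ofReal ρ)
    (hρ0 : 0 ≤ ρ)
    (hM : ∫ u in (0 : ℝ)..1, spline t p k c u ^ 2 ≤ M)
    (hβ : ∫ u in (0 : ℝ)..1, (spline t p k c u - ψ u) ^ 2 ≤ β) :
    BiasVarianceBound (sampleLaw μ ν n) (stableLse t p k τ cHat) ψ
      (3 * ((τ ^ 2 * lam)⁻¹ * (Λ * (k + 1)) * ((p + 1) * G) * (n : ℝ)⁻¹ + ρ ^ 2 * M + β))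
      (3 * ((τ ^ 2 * lam)⁻¹ * (Λ * (k + 1)) * ((p + 1) * G) * (n : ℝ)⁻¹ +
        (τ ^ 2 * lam)⁻¹ * (Λ * (k + 1)) * ((∫ e, e ^ 2 ∂ν) * (p + 1)) * (n : ℝ)⁻¹ + ρ * M)) := by
  have hΛ0 : 0 < Λ := by linarith
  have hn' : (0 : ℝ) < n := by exact_mod_cast hn
  have hG0 : 0 ≤ G := (integral_nonneg fun _ => sq_nonneg _).trans hG
  have hσ0 : 0 ≤ ∫ e, e ^ 2 ∂ν := integral_nonneg fun _ => sq_nonneg _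
  have hψμ : MemLp ψ 2 μ := memLp_of_le hμb hψ
  have hSm : MeasurableSet {x : Fin n → ℝ | StableDesign t p k τ x} :=
    measurableSet_stableDesign t ht n τ
  have hg'L : MemLp (fun u => ψ u - spline t p k c u) 2 μ := hψμ.sub (memLp_of_le hμb (ht.memLp_spline c))
  -- A function of the Sobolev ball is arbitrary outside the unit interval, so the residual is
  -- replaced by a measurable version. Almost surely both agree at all design points.
  obtain ⟨g, hgm, hgg'⟩ : ∃ g : ℝ → ℝ, Measurable g ∧ (fun u => ψ u - spline t p k c u) =ᵐ[μ] g :=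
    ⟨hg'L.1.mk _, hg'L.1.stronglyMeasurable_mk.measurable, hg'L.1.ae_eq_mk⟩
  have hgL : MemLp g 2 μ := hg'L.ae_eq hgg'
  have hgo : ∀ d : Fin (k + p + 1) → ℝ, ∫ u, g u * spline t p k d u ∂μ = 0 := by
    intro d
    rw [← hco d]
    refine integral_congr_ae ?_
    filter_upwards [hgg'] with u hu
    rw [← hu]
  have hg2 : ∫ u, g u ^ 2 ∂μ ≤ G := by
    refine le_trans (le_of_eq (integral_congr_ae ?_)) hG
    filter_upwards [hgg'] with u hu
    rw [← hu]
  have hmp1 : MeasurePreserving (Prod.fst : (Fin n → ℝ) × (Fin n → ℝ) → (Fin n → ℝ))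
      (sampleLaw μ ν n) (Measure.pi fun _ : Fin n => μ) := measurePreserving_fst
  have hw : Measurable fun (z : (Fin n → ℝ) × (Fin n → ℝ)) (i : Fin n) => g (z.1 i) := by fun_prop
  refine biasVarianceBound_of_decomposition (P := sampleLaw μ ν n) (s := spline t p k c)
    (A := stableFit t p k τ fun z i => g (z.1 i)) (N := stableFit t p k τ fun z => z.2)
    (S := Prod.fst ⁻¹' {x : Fin n → ℝ | StableDesign t p k τ x}ᶜ)
    (measurable_fst hSm.compl) (measurable_spline t p k c) (measurable_stableFit ht hw)
    (measurable_stableFit ht measurable_snd) ?_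
    (fun u hu => memLp_stableFit hΛ ht hτ hw
      (fun i => (memLp_comp_eval hgL i).comp_measurePreserving hmp1) hu)
    (fun u hu => memLp_stableFit hΛ ht hτ measurable_snd
      (fun i => (memLp_comp_eval hν i).comp_measurePreserving measurePreserving_snd) hu)
    (fun u hu => integral_stableFit_noise hν hν0 hΛ ht hτ hu) hψ (ht.memLp_spline c)
    ?_ (lintegral_stableFit_noise_le hν hν0 hμb hΛ ht hτ hlam0 hlam hn) ?_ hM hβ
    (by positivity) (by positivity)
  · have h1 : ∀ᵐ x ∂(Measure.pi fun _ : Fin n => μ),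
        ∀ i, x i ∈ {u | ψ u - spline t p k c u = g u} := ae_pi_mem hgg' n
    filter_upwards [ae_sampleLaw_fst (ν := ν) h1] with z hz u _
    simp only [estimate, stableLse]
    by_cases hst : StableDesign t p k τ z.1
    · rw [if_pos hst, hst.leastSquares_eq hΛ ht hτ hc, indicator_of_notMem (by simpa using hst),
        sub_zero, stableFit_of_stable hst, stableFit_of_stable hst]
      -- The responses are values of the projection, plus residual, plus noise; the fit is linear
      -- and reproduces the first part.
      have h2 : (fun i => ψ (z.1 i) + z.2 i) =
          (fun i => spline t p k c (z.1 i)) + (fun i => g (z.1 i)) + z.2 := by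
        ext i
        have h3 : ψ (z.1 i) - spline t p k c (z.1 i) = g (z.1 i) := hz i
        simp only [Pi.add_apply, ← h3]
        ring
      rw [h2, lsCoeff_add, lsCoeff_add, spline_add, spline_add, hst.lsCoeff_spline hΛ ht hτ]
    · rw [if_neg hst, indicator_of_mem (by simpa using hst), stableFit_of_not_stable hst,
        stableFit_of_not_stable hst]
      simp only [Pi.zero_apply]
      ring
  · refine (lintegral_stableFit_design_le hμb hΛ ht hτ hlam0 hlam hn hgm hgL hgo).trans
      (ENNReal.ofReal_le_ofReal ?_)
    gcongr
  · rw [measureReal_def, hmp1.measure_preimage hSm.compl.nullMeasurableSet]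
    exact ENNReal.toReal_le_of_le_ofReal hρ0 hρ

end Unconditional

/-! ### Uniform bias and variance bounds -/

theorem BiasVarianceBound.mono {n : ℕ} {P : Measure ((Fin n → ℝ) × (Fin n → ℝ))}
    {T : (Fin n → ℝ) → (Fin n → ℝ) → ℝ → ℝ} {ψ : ℝ → ℝ} {B B' V V' : ℝ}
    (h : BiasVarianceBound P T ψ B V) (hB : B ≤ B') (hV : V ≤ V') :
    BiasVarianceBound P T ψ B' V' :=
  ⟨h.1, h.2.1, h.2.2.1.trans (ENNReal.ofReal_le_ofReal hB),
    h.2.2.2.trans (ENNReal.ofReal_le_ofReal hV)⟩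

theorem BiasVarianceBound.mse_le {n : ℕ} {P : Measure ((Fin n → ℝ) × (Fin n → ℝ))}
    {T : (Fin n → ℝ) → (Fin n → ℝ) → ℝ → ℝ} {ψ : ℝ → ℝ} {B V : ℝ}
    (h : BiasVarianceBound P T ψ B V) (hB : 0 ≤ B) (hV : 0 ≤ V) :
    mse P T ψ ≤ ENNReal.ofReal (B + V) := by
  rw [h.2.1, ENNReal.ofReal_add hB hV]
  exact add_le_add h.2.2.1 h.2.2.2

theorem le_of_mul_log_le {n k : ℕ} (hn : 2 ≤ n) {c : ℝ} (hc : c ≤ Real.log 2)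
    (h : (k : ℝ) * Real.log n ≤ c * n) : k ≤ n := by
  have hn' : (2 : ℝ) ≤ n := by exact_mod_cast hn
  have h1 : Real.log 2 ≤ Real.log n := Real.log_le_log (by norm_num) hn'
  have h2 : (0 : ℝ) < Real.log 2 := Real.log_pos (by norm_num)
  have h3 : (k : ℝ) * Real.log 2 ≤ n * Real.log 2 := by
    calc _ ≤ (k : ℝ) * Real.log n := by gcongr
      _ ≤ c * n := h
      _ ≤ _ := by rw [mul_comm]; gcongr
  exact_mod_cast le_of_mul_le_mul_right h3 h2

/-- The exponent `2 * p + 3 + r` pays for the union bound: `n ^ 3` absorbs `2 (k + 1)`, and `n ^ (2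
p)` absorbs `(p + 1) ^ 2`, since `p + 1 ≤ 2 ^ p`. What remains is `n ^ (-r)`, small enough for
unstable designs to be negligible in bias and variance. -/
theorem irregular_bound_le_inv_pow (p r : ℕ) {κ : ℝ} {n k : ℕ} (hn : 2 ≤ n)
    (hk : 1 ≤ k) (hkn : k ≤ n)
    (h : (k : ℝ) * Real.log n ≤ κ / (2 * (2 * p + 3 + r)) * n) :
    (k + 1) * (p + 1) ^ 2 * 2 * Real.exp (-κ * (n / (k + 1))) ≤ ((n : ℝ) ^ r)⁻¹ := by
  have hn' : (2 : ℝ) ≤ n := by exact_mod_cast hn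
  have hn0 : (0 : ℝ) < n := by linarith
  have hk' : (1 : ℝ) ≤ k := by exact_mod_cast hk
  have hkn' : (k : ℝ) ≤ n := by exact_mod_cast hkn
  have hm : (0 : ℝ) < 2 * p + 3 + r := by positivity
  have h1 : ((2 * p + 3 + r : ℕ) : ℝ) * Real.log n ≤ κ * (n / (k + 1)) := by
    push_cast
    rw [mul_div_assoc', le_div_iff₀ (by positivity)]
    rw [div_mul_eq_mul_div, le_div_iff₀ (by positivity)] at h
    have hlog : 0 ≤ Real.log n := Real.log_nonneg (by linarith)
    nlinarith [mul_nonneg hm.le hlog]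
  have h2 : Real.exp (-κ * (n / (k + 1))) ≤ ((n : ℝ) ^ (2 * p + 3 + r))⁻¹ := by
    calc _ ≤ Real.exp (-(((2 * p + 3 + r : ℕ) : ℝ) * Real.log n)) :=
          Real.exp_le_exp.2 (by linarith)
      _ = _ := by rw [Real.exp_neg, Real.exp_nat_mul, Real.exp_log hn0]
  have h3 : ((p : ℝ) + 1) ^ 2 ≤ (n : ℝ) ^ (2 * p) := by
    have h4 : ((p : ℝ) + 1) ≤ 2 ^ p := by
      have := Nat.lt_two_pow_self (n := p)
      exact_mod_cast this
    calc ((p : ℝ) + 1) ^ 2 ≤ ((2 : ℝ) ^ p) ^ 2 := by gcongr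
      _ ≤ ((n : ℝ) ^ p) ^ 2 := by gcongr
      _ = _ := by rw [← pow_mul, mul_comm]
  have h5 : ((k : ℝ) + 1) * 2 ≤ (n : ℝ) ^ 3 := by
    have : (n : ℝ) ^ 3 = n * n * n := by ring
    nlinarith
  calc _ = ((k + 1) * 2) * ((p + 1) ^ 2) * Real.exp (-κ * (n / (k + 1))) := by ring
    _ ≤ (n : ℝ) ^ 3 * n ^ (2 * p) * ((n : ℝ) ^ (2 * p + 3 + r))⁻¹ := by gcongr
    _ = _ := by
        rw [pow_add, pow_add, mul_inv, mul_inv]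
        field_simp

/-- The squared distance from the projection of `ψ`, with respect to the design law, and the size
of the projection. -/
theorem projection_bounds {μ : Measure ℝ} [IsProbabilityMeasure μ] {a b Λ R : ℝ} {p k r : ℕ}
    {t : ℕ → ℝ} (ha : 0 < a)
    (hμa : ENNReal.ofReal a • volume.restrict (Icc (0 : ℝ) 1) ≤ μ)
    (hμb : μ ≤ ENNReal.ofReal b • volume.restrict (Icc (0 : ℝ) 1)) (hΛ : 1 ≤ Λ)
    (ht : QuasiUniformKnots Λ p k t) (hr : 1 ≤ r) {ψ : ℝ → ℝ} {D : ℕ → ℝ → ℝ}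
    (hD : HasSobolevDerivs r ψ D)
    (hDR : ∑ j ∈ Finset.range (r + 1), (∫ x in (0 : ℝ)..1, (D j x) ^ 2) ≤ R ^ 2)
    {d : Fin (k + p + 1) → ℝ} {E : ℕ → ℝ} {S : ℝ} (hE : ∀ j ≤ k, 0 ≤ E j)
    (hS : ∑ j ∈ Finset.range (k + 1), E j ≤ S)
    (happ : ∀ j ≤ k, ∀ x ∈ Ico (t (p + j)) (t (p + j + 1)),
          (ψ x - spline t p k d x) ^ 2 ≤ ((k + 1 : ℝ) ^ (2 * r - 1))⁻¹ * E j)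
    {c : Fin (k + p + 1) → ℝ} (hc : ∀ d : Fin (k + p + 1) → ℝ,
      ∫ u, (ψ u - spline t p k c u) * spline t p k d u ∂μ = 0) :
    ∫ u, (ψ u - spline t p k c u) ^ 2 ∂μ ≤ b * (Λ * S) * ((k + 1 : ℝ) ^ (2 * r))⁻¹ ∧
    ∫ u in (0 : ℝ)..1, (spline t p k c u - ψ u) ^ 2 ≤
      a⁻¹ * (b * (Λ * S) * ((k + 1 : ℝ) ^ (2 * r))⁻¹) ∧
    ∫ u in (0 : ℝ)..1, spline t p k c u ^ 2 ≤ a⁻¹ * (b * R ^ 2) := by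
  have hb : 1 ≤ b := one_le_of_le hμb
  have hψL := hD.memLp_self
  have hψμ : MemLp ψ 2 μ := memLp_of_le hμb hψL
  have hs : ∀ c, MemLp (spline t p k c) 2 (volume.restrict (Icc (0 : ℝ) 1)) := ht.memLp_spline
  have h1 : ∫ u, (ψ u - spline t p k c u) ^ 2 ∂μ ≤ b * (Λ * S) * ((k + 1 : ℝ) ^ (2 * r))⁻¹ := by
    have h2 := integral_sq_sub_le_of_orthogonal hμb ht hψμ hc d
    have h3 : 0 ≤ ∫ u, (spline t p k (c - d) u) ^ 2 ∂μ := integral_nonneg fun _ => sq_nonneg _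
    have h4 := integral_le_of_le (by linarith : 0 ≤ b) hμb
      (f := fun u => (ψ u - spline t p k d u) ^ 2) (fun _ => sq_nonneg _)
      (hψL.sub (hs d)).integrable_sq
    have h5 := integral_sq_le_of_local hΛ ht (g := fun u => ψ u - spline t p k d u)
      (by positivity) happ hE hS (hψL.sub (hs d))
    rw [inv_pow_mul_div r k hr] at h5
    calc _ ≤ b * ∫ u in (0 : ℝ)..1, (ψ u - spline t p k d u) ^ 2 := by linarith
      _ ≤ b * (Λ * S * ((k + 1 : ℝ) ^ (2 * r))⁻¹) := by gcongr
      _ = _ := by ring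
  refine ⟨h1, ?_, ?_⟩
  · rw [inv_mul_eq_div, le_div_iff₀' ha]
    refine le_trans ?_ h1
    have h2 : ∀ u, (spline t p k c u - ψ u) ^ 2 = (ψ u - spline t p k c u) ^ 2 := fun u => by ring
    simp only [h2]
    exact mul_integral_le_of_le ha.le hμa (fun _ => sq_nonneg _)
      (hψμ.sub (memLp_of_le hμb (hs c))).integrable_sq
  · rw [inv_mul_eq_div, le_div_iff₀' ha]
    have h2 := integral_sq_sub_le_of_orthogonal hμb ht hψμ hc 0
    rw [sub_zero] at h2
    have h3 : 0 ≤ ∫ u, (ψ u - spline t p k c u) ^ 2 ∂μ := integral_nonneg fun _ => sq_nonneg _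
    have h4 := integral_le_of_le (by linarith : 0 ≤ b) hμb
      (f := fun u => (ψ u - spline t p k 0 u) ^ 2) (fun _ => sq_nonneg _)
      (hψL.sub (hs 0)).integrable_sq
    have h5 := mul_integral_le_of_le ha.le hμa (f := fun u => spline t p k c u ^ 2)
      (fun _ => sq_nonneg _) (memLp_of_le hμb (hs c)).integrable_sq
    have h6 : ∀ u, spline t p k 0 u = 0 := fun u => by simp [spline]
    simp only [h6, sub_zero] at h2 h4
    rw [hD.integral_sq_eq] at h4
    calc _ ≤ b * ∫ x in (0 : ℝ)..1, D 0 x ^ 2 := by linarith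
      _ ≤ _ := mul_le_mul_of_nonneg_left (integral_sq_le_of_mem_ball hDR (Nat.zero_le _))
        (by linarith)

/-- Assembly of the estimates; the point is that every constant depends only on `r, p, R, Λ, a, b,
τ` and the noise variance. `C₁` is for the conditional bias, `C₂` for the noise, and `C₃` for the
remaining unconditional terms. -/
theorem exists_biasVariance_const (r p : ℕ) (hr : 1 ≤ r) (hp : r ≤ p + 1) (R Λ : ℝ) (hΛ : 1 ≤ Λ)
    (μ : Measure ℝ) [IsProbabilityMeasure μ] (a b : ℝ) (ha : 0 < a)
    (hμa : ENNReal.ofReal a • volume.restrict (Icc (0 : ℝ) 1) ≤ μ)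
    (hμb : μ ≤ ENNReal.ofReal b • volume.restrict (Icc (0 : ℝ) 1))
    (ν : Measure ℝ) [IsProbabilityMeasure ν] (hν : MemLp id 2 ν) (hν0 : ∫ e, e ∂ν = 0)
    (τ : ℝ) (hτ0 : 0 < τ) (hτa : τ < a) :
    ∃ C c : ℝ, 0 < C ∧ 0 < c ∧
      ∀ n k : ℕ, 2 ≤ n → 1 ≤ k → (k : ℝ) * Real.log n ≤ c * n →
      ∀ t : ℕ → ℝ, QuasiUniformKnots Λ p k t →
      ∀ cHat : (Fin n → ℝ) → (Fin n → ℝ) → Fin (k + p + 1) → ℝ, IsLeastSquares t p k n cHat →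
        (Measure.pi fun _ : Fin n => μ)
            {x | ¬ (StableDesign t p k τ x ∧ ∀ ψ ∈ sobolevBall r R,
                BiasVarianceBound (givenDesign ν x) (lse t p k cHat) ψ
                  (C * ((k : ℝ) ^ (2 * r))⁻¹) (C * ((k : ℝ) / n)))}
          ≤ ENNReal.ofReal (1 / (n : ℝ)) ∧
        ∀ ψ ∈ sobolevBall r R,
          BiasVarianceBound (sampleLaw μ ν n) (stableLse t p k τ cHat) ψ
            (C * ((k : ℝ) ^ (2 * r))⁻¹) (C * ((k : ℝ) / n)) := by
  have hb : 1 ≤ b := one_le_of_le hμb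
  have hΛ0 : 0 < Λ := by linarith
  obtain ⟨lam, hlam0, hlam⟩ := exists_monomial_lower_bound p
  obtain ⟨K, hK0, hK⟩ := exists_spline_approx r p hr hp Λ hΛ
  -- The largest tolerance for which a regular design is stable.
  set δ : ℝ := (a - τ) * lam / (p + 1) with hδ
  have hδ0 : 0 < δ := by have : 0 < a - τ := by linarith
                         positivity
  have hδ' : δ * (p + 1) ≤ (a - τ) * lam := by rw [hδ, div_mul_cancel₀]; positivity
  -- The Chernoff parameter must be at most `1` for the quadratic bound of the exponential, and at
  -- most `δ / (2 b)` for the variance term to be absorbed.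
  set θ : ℝ := min 1 (δ / (2 * b)) with hθ
  have hθ0 : 0 < θ := lt_min one_pos (by positivity)
  have hθb : 2 * b * θ ≤ δ := by
    have : θ ≤ δ / (2 * b) := min_le_right _ _
    rwa [le_div_iff₀' (by positivity)] at this
  set κ : ℝ := θ * δ / (2 * Λ) with hκ
  have hκ0 : 0 < κ := by positivity
  set S : ℝ := K * R ^ 2 with hS
  set σ2 : ℝ := ∫ e, e ^ 2 ∂ν with hσ2
  have hσ0 : 0 ≤ σ2 := integral_nonneg fun _ => sq_nonneg _
  set W : ℝ := (τ ^ 2 * lam)⁻¹ * Λ with hW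
  have hW0 : 0 < W := by positivity
  have hS0 : 0 ≤ S := by positivity
  set C₁ : ℝ := 6 * (τ⁻¹ * (b + δ) + 1) * (Λ * S) with hC₁
  set C₂ : ℝ := 6 * (W * (σ2 * (p + 1))) with hC₂
  set C₃ : ℝ := 3 * (2 * W * ((p + 1) * (b * (Λ * S))) + a⁻¹ * (b * R ^ 2) +
    a⁻¹ * (b * (Λ * S))) with hC₃
  have hC₁0 : 0 ≤ C₁ := by positivity
  have hC₂0 : 0 ≤ C₂ := by positivity
  have hC₃0 : 0 ≤ C₃ := by positivity
  refine ⟨1 + C₁ + C₂ + C₃, min (Real.log 2) (κ / (2 * (2 * p + 3 + r))), by linarith,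
    lt_min (Real.log_pos (by norm_num)) (by positivity), ?_⟩
  intro n k hn hk hkn t ht cHat hc
  have hkn1 : k ≤ n := le_of_mul_log_le hn (min_le_left _ _) hkn
  have hn0 : 0 < n := by omega
  have hn' : (0 : ℝ) < n := by exact_mod_cast hn0
  have hn1 : (1 : ℝ) ≤ n := by exact_mod_cast hn0
  have hk' : (1 : ℝ) ≤ k := by exact_mod_cast hk
  have hkn2 : (k : ℝ) ≤ n := by exact_mod_cast hkn1
  have hρ := irregular_bound_le_inv_pow p r hn hk hkn1
    (hkn.trans (mul_le_mul_of_nonneg_right (min_le_right _ _) hn'.le))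
  have hirr : (Measure.pi fun _ : Fin n => μ) (irregularDesign μ t p k δ n) ≤
      ENNReal.ofReal ((n : ℝ) ^ r)⁻¹ :=
    (measure_irregularDesign_le hμb hΛ ht hδ0 hθ0 (min_le_left _ _) hθb hn0).trans
      (ENNReal.ofReal_le_ofReal hρ)
  have hq1 := inv_succ_pow_le r hk
  have hq0 : 0 ≤ ((k + 1 : ℝ) ^ (2 * r))⁻¹ := by positivity
  have hqle1 : ((k + 1 : ℝ) ^ (2 * r))⁻¹ ≤ 1 := inv_le_one_of_one_le₀ (one_le_pow₀ (by linarith))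
  have hkk : ((k : ℝ) + 1) * (n : ℝ)⁻¹ ≤ 2 * (k / n) := by
    rw [div_eq_mul_inv, ← mul_assoc]; gcongr; linarith
  have hkn3 : (k : ℝ) / n ≤ 1 := (div_le_one hn').2 hkn2
  have hkn0 : 0 ≤ (k : ℝ) / n := by positivity
  have hae := ae_pi_mem (ae_mem_Ico_of_le hμb) n
  have happrox : ∀ ψ ∈ sobolevBall r R, ∃ D, HasSobolevDerivs r ψ D ∧
      ∑ j ∈ Finset.range (r + 1), (∫ x in (0 : ℝ)..1, (D j x) ^ 2) ≤ R ^ 2 ∧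
      ∃ (c : Fin (k + p + 1) → ℝ) (E : ℕ → ℝ), (∀ j ≤ k, 0 ≤ E j) ∧
        ∑ j ∈ Finset.range (k + 1), E j ≤ S ∧
        ∀ j ≤ k, ∀ x ∈ Ico (t (p + j)) (t (p + j + 1)),
          (ψ x - spline t p k c x) ^ 2 ≤ ((k + 1 : ℝ) ^ (2 * r - 1))⁻¹ * E j := by
    rintro ψ ⟨D, hD, hDR⟩
    obtain ⟨c, E, hE, hES, happ⟩ := hK k t ψ D ht hD
    exact ⟨D, hD, hDR, c, E, hE,
      hES.trans (mul_le_mul_of_nonneg_left (integral_sq_le_of_mem_ball hDR le_rfl) hK0.le), happ⟩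
  have hunst : (Measure.pi fun _ : Fin n => μ) {x | ¬ StableDesign t p k τ x} ≤
      ENNReal.ofReal ((n : ℝ) ^ r)⁻¹ := by
    refine (measure_mono_ae ?_).trans hirr
    filter_upwards [hae] with x hx01 hx
    by_contra hreg
    exact hx (stableDesign_of_notMem ha.le hμa hμb hΛ ht hlam0 hlam hδ0.le hδ' hreg hx01)
  constructor
  · refine (measure_mono_ae ?_).trans (hirr.trans (ENNReal.ofReal_le_ofReal ?_))
    · filter_upwards [hae] with x hx01 hx
      by_contra hreg
      have hst := stableDesign_of_notMem ha.le hμa hμb hΛ ht hlam0 hlam hδ0.le hδ' hreg hx01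
      refine hx ⟨hst, fun ψ hψ => ?_⟩
      obtain ⟨D, hD, hDR, c, E, hE, hES, happ⟩ := happrox ψ hψ
      refine (biasVarianceBound_givenDesign hν hν0 hδ0.le hμb hΛ ht hτ0 hlam0 hlam hn0 hx01 hst hreg
        hc hr hD hE hES happ).mono ?_ ?_
      · gcongr
        linarith
      · calc _ = 3 * (W * (σ2 * (p + 1))) * ((k + 1) * (n : ℝ)⁻¹) := by rw [hW]; ring
          _ ≤ 3 * (W * (σ2 * (p + 1))) * (2 * (k / n)) := by gcongr
          _ = C₂ * (k / n) := by rw [hC₂]; ring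
          _ ≤ _ := by gcongr; linarith
    · rw [one_div]
      exact inv_anti₀ hn' (le_self_pow₀ hn1 (by omega))
  · intro ψ hψ
    obtain ⟨D, hD, hDR, d, E, hE, hES, happ⟩ := happrox ψ hψ
    obtain ⟨c, hco⟩ := exists_projection ha hμa hμb hΛ ht (memLp_of_le hμb hD.memLp_self)
    obtain ⟨hG, hβ, hM⟩ := projection_bounds ha hμa hμb hΛ ht hr hD hDR hE hES happ hco
    -- The bias sees the square of the probability of instability, so `n ^ (-r)` is just enough
    -- here, as `k ≤ n`; the variance sees the probability itself, where `1 / n` suffices.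
    have hρk : (((n : ℝ) ^ r)⁻¹) ^ 2 ≤ ((k : ℝ) ^ (2 * r))⁻¹ := by
      rw [inv_pow, ← pow_mul, mul_comm r 2]
      exact inv_anti₀ (by positivity) (pow_le_pow_left₀ (by positivity) hkn2 _)
    have hρ1 : ((n : ℝ) ^ r)⁻¹ ≤ k / n := by
      calc ((n : ℝ) ^ r)⁻¹ ≤ (n : ℝ)⁻¹ := inv_anti₀ hn' (le_self_pow₀ hn1 (by omega))
        _ = 1 / n := by rw [one_div]
        _ ≤ k / n := by gcongr
    have hkk2 : ((k : ℝ) + 1) * (n : ℝ)⁻¹ ≤ 2 := by linarith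
    refine (biasVarianceBound_sampleLaw hν hν0 hμb hΛ ht hτ0 hlam0 hlam hn0 hc hD.memLp_self hco hG
      hunst (by positivity) hM hβ).mono ?_ ?_
    · calc _ = 3 * (W * ((p + 1) * (b * (Λ * S))) * ((k + 1) * (n : ℝ)⁻¹) *
            ((k + 1 : ℝ) ^ (2 * r))⁻¹ + a⁻¹ * (b * R ^ 2) * (((n : ℝ) ^ r)⁻¹) ^ 2 +
            a⁻¹ * (b * (Λ * S)) * ((k + 1 : ℝ) ^ (2 * r))⁻¹) := by rw [hW]; ring
        _ ≤ 3 * (W * ((p + 1) * (b * (Λ * S))) * 2 * ((k : ℝ) ^ (2 * r))⁻¹ +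
            a⁻¹ * (b * R ^ 2) * ((k : ℝ) ^ (2 * r))⁻¹ +
            a⁻¹ * (b * (Λ * S)) * ((k : ℝ) ^ (2 * r))⁻¹) := by gcongr
        _ = C₃ * ((k : ℝ) ^ (2 * r))⁻¹ := by rw [hC₃]; ring
        _ ≤ _ := by gcongr; linarith
    · calc _ = 3 * (W * ((p + 1) * (b * (Λ * S))) * ((k + 1) * (n : ℝ)⁻¹) *
            ((k + 1 : ℝ) ^ (2 * r))⁻¹ + W * (σ2 * (p + 1)) * ((k + 1) * (n : ℝ)⁻¹) +
            a⁻¹ * (b * R ^ 2) * ((n : ℝ) ^ r)⁻¹) := by rw [hW]; ring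
        _ ≤ 3 * (W * ((p + 1) * (b * (Λ * S))) * (2 * (k / n)) * 1 +
            W * (σ2 * (p + 1)) * (2 * (k / n)) + a⁻¹ * (b * R ^ 2) * (k / n)) := by gcongr
        _ = (C₂ + 3 * (2 * W * ((p + 1) * (b * (Λ * S))) + a⁻¹ * (b * R ^ 2))) * (k / n) := by
            rw [hC₂]; ring
        _ ≤ _ := by
            refine mul_le_mul_of_nonneg_right ?_ hkn0
            have : 0 ≤ a⁻¹ * (b * (Λ * S)) := by positivity
            linarith

/-! ### The balance of squared bias and variance -/

theorem isTheta_pow_iff_isTheta_rpow (r : ℕ) (k : ℕ → ℕ) :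
    (fun n => (k n : ℝ) ^ (2 * r + 1)) =Θ[atTop] (fun n : ℕ => (n : ℝ)) ↔
      (fun n => (k n : ℝ)) =Θ[atTop] (fun n : ℕ => (n : ℝ) ^ (1 / (2 * (r : ℝ) + 1))) := by
  constructor
  · intro h
    have h1 := h.rpow (r := 1 / (2 * (r : ℝ) + 1))
      (Eventually.of_forall fun n => by positivity) (Eventually.of_forall fun n => by positivity)
    refine IsTheta.trans_eventuallyEq ?_ (EventuallyEq.rfl) |>.trans h1
    refine IsTheta.of_norm_eventuallyEq_norm (Eventually.of_forall fun n => ?_)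
    have : ((k n : ℝ) ^ (2 * r + 1)) ^ (1 / (2 * (r : ℝ) + 1)) = k n := by
      rw [one_div]
      have := Real.pow_rpow_inv_natCast (Nat.cast_nonneg (α := ℝ) (k n)) (n := 2 * r + 1) (by omega)
      push_cast at this
      exact this
    simp only [this]
  · intro h
    have h1 := h.pow (2 * r + 1)
    refine h1.trans (IsTheta.of_norm_eventuallyEq_norm (Eventually.of_forall fun n => ?_))
    have : ((n : ℝ) ^ (1 / (2 * (r : ℝ) + 1))) ^ (2 * r + 1) = n := by
      rw [one_div]
      have := Real.rpow_inv_natCast_pow (Nat.cast_nonneg (α := ℝ) n) (n := 2 * r + 1) (by omega)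
      push_cast at this
      exact this
    simp only [this]

/-- Multiplying both sides by `n k^(2r)` turns the balance into `n ≍ k^(2r+1)`. -/
theorem isTheta_bias_variance_iff (r : ℕ) (k : ℕ → ℕ) (hk : ∀ n, 1 ≤ k n) :
    ((fun n => ((k n : ℝ) ^ (2 * r))⁻¹) =Θ[atTop] (fun n : ℕ => (k n : ℝ) / (n : ℝ)) ↔
        (fun n => (k n : ℝ)) =Θ[atTop] (fun n : ℕ => (n : ℝ) ^ (1 / (2 * (r : ℝ) + 1)))) := by
  rw [← isTheta_pow_iff_isTheta_rpow]
  have hk0 : ∀ n, (k n : ℝ) ≠ 0 := fun n => by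
    have := hk n
    exact_mod_cast (by omega : k n ≠ 0)
  constructor
  · intro h
    have h1 := h.mul (isTheta_refl (fun n : ℕ => (n : ℝ) * (k n : ℝ) ^ (2 * r)) atTop)
    have e1 : (fun n : ℕ => ((k n : ℝ) ^ (2 * r))⁻¹ * ((n : ℝ) * (k n : ℝ) ^ (2 * r))) =ᶠ[atTop]
        fun n : ℕ => (n : ℝ) := Eventually.of_forall fun n => by
      have := hk0 n
      dsimp only
      field_simp
    have e2 : (fun n : ℕ => (k n : ℝ) / (n : ℝ) * ((n : ℝ) * (k n : ℝ) ^ (2 * r))) =ᶠ[atTop]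
        fun n : ℕ => (k n : ℝ) ^ (2 * r + 1) := by
      filter_upwards [eventually_gt_atTop 0] with n hn
      have : (n : ℝ) ≠ 0 := by exact_mod_cast hn.ne'
      field_simp
      rw [pow_succ']
    exact ((e1.symm.trans_isTheta h1).trans_eventuallyEq e2).symm
  · intro h
    have h1 := h.mul (isTheta_refl (fun n : ℕ => (n : ℝ)⁻¹ * ((k n : ℝ) ^ (2 * r))⁻¹) atTop)
    have e1 : (fun n : ℕ => (k n : ℝ) ^ (2 * r + 1) * ((n : ℝ)⁻¹ * ((k n : ℝ) ^ (2 * r))⁻¹))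
        =ᶠ[atTop] fun n : ℕ => (k n : ℝ) / (n : ℝ) := Eventually.of_forall fun n => by
      have := hk0 n
      dsimp only
      field_simp
      rw [pow_succ]
    have e2 : (fun n : ℕ => (n : ℝ) * ((n : ℝ)⁻¹ * ((k n : ℝ) ^ (2 * r))⁻¹)) =ᶠ[atTop]
        fun n : ℕ => ((k n : ℝ) ^ (2 * r))⁻¹ := by
      filter_upwards [eventually_gt_atTop 0] with n hn
      have : (n : ℝ) ≠ 0 := by exact_mod_cast hn.ne'
      field_simp
    exact ((e1.symm.trans_isTheta h1).trans_eventuallyEq e2).symm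

theorem rpow_root_div (r : ℕ) {n : ℕ} (hn : 0 < n) :
    (n : ℝ) ^ (1 / (2 * (r : ℝ) + 1)) / n = (n : ℝ) ^ (-(2 * (r : ℝ)) / (2 * (r : ℝ) + 1)) := by
  have hn' : (0 : ℝ) < n := by exact_mod_cast hn
  have hm : (2 * (r : ℝ) + 1) ≠ 0 := by positivity
  rw [div_eq_mul_inv, ← Real.rpow_neg_one, ← Real.rpow_add hn']
  congr 1
  field_simp
  ring

theorem inv_rpow_root_pow (r n : ℕ) :
    (((n : ℝ) ^ (1 / (2 * (r : ℝ) + 1))) ^ (2 * r))⁻¹ =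
      (n : ℝ) ^ (-(2 * (r : ℝ)) / (2 * (r : ℝ) + 1)) := by
  have hn' : (0 : ℝ) ≤ n := n.cast_nonneg
  rw [← Real.rpow_natCast, ← Real.rpow_mul hn', ← Real.rpow_neg hn']
  congr 1
  push_cast
  ring

/-- The exponent `1 / (2r + 1)` is less than `1` for `r ≥ 1`, and the remaining positive power of
`n` beats the logarithm. -/
theorem eventually_mul_log_le (r : ℕ) (hr : 1 ≤ r) (k : ℕ → ℕ)
    (h : (fun n => (k n : ℝ)) =O[atTop] (fun n : ℕ => (n : ℝ) ^ (1 / (2 * (r : ℝ) + 1)))) {c : ℝ}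
    (hc : 0 < c) : ∀ᶠ n : ℕ in atTop, (k n : ℝ) * Real.log n ≤ c * n := by
  have hr' : (1 : ℝ) ≤ r := by exact_mod_cast hr
  have hs : (0 : ℝ) < 1 - 1 / (2 * (r : ℝ) + 1) := by
    rw [sub_pos, div_lt_one (by positivity)]
    linarith
  have h1 : (fun n : ℕ => Real.log n) =o[atTop] fun n : ℕ =>
      (n : ℝ) ^ (1 - 1 / (2 * (r : ℝ) + 1)) :=
    (isLittleO_log_rpow_atTop hs).comp_tendsto tendsto_natCast_atTop_atTop
  have h2 := h.mul_isLittleO h1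
  filter_upwards [h2.bound hc, eventually_gt_atTop 0] with n hn hn0
  have hn' : (0 : ℝ) < n := by exact_mod_cast hn0
  rw [← Real.rpow_add hn', add_sub_cancel, Real.rpow_one, Real.norm_natCast] at hn
  exact (le_abs_self _).trans hn

theorem isBigO_bias_add_variance (r : ℕ) (k : ℕ → ℕ)
    (h : (fun n => (k n : ℝ)) =Θ[atTop] (fun n : ℕ => (n : ℝ) ^ (1 / (2 * (r : ℝ) + 1)))) :
    (fun n : ℕ => ((k n : ℝ) ^ (2 * r))⁻¹ + (k n : ℝ) / n) =O[atTop]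
      fun n : ℕ => (n : ℝ) ^ (-(2 * (r : ℝ)) / (2 * (r : ℝ) + 1)) := by
  refine IsBigO.add ?_ ?_
  · have h1 := (h.pow (2 * r)).inv.isBigO
    simpa only [inv_rpow_root_pow] using h1
  · have h1 := (h.div (isTheta_refl (fun n : ℕ => (n : ℝ)) atTop)).isBigO
    refine h1.trans_eventuallyEq ?_
    filter_upwards [eventually_gt_atTop 0] with n hn
    exact rpow_root_div r hn

/-! ### Bump families in the Sobolev ball -/

/-- `G 0, G 1, …` are a smooth function and its derivatives, and vanish outside `(0, 1)`. -/
structure IsBump (G : ℕ → ℝ → ℝ) : Prop where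
  hasDerivAt : ∀ l x, HasDerivAt (G l) (G (l + 1) x) x
  eq_zero : ∀ l x, x ∉ Ioo (0 : ℝ) 1 → G l x = 0
  integral_pos : 0 < ∫ x in (0 : ℝ)..1, G 0 x ^ 2

/-- A smooth bump centred at `1/2` with radius `1/4`; all derivatives vanish off its support. -/
theorem exists_isBump : ∃ G : ℕ → ℝ → ℝ, IsBump G := by
  let f : ContDiffBump (1 / 2 : ℝ) := ⟨1 / 8, 1 / 4, by norm_num, by norm_num⟩
  refine ⟨fun l => iteratedDeriv l f, fun l x => ?_, fun l x hx => ?_, ?_⟩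
  · have h1 : Differentiable ℝ (iteratedDeriv l f) :=
      (f.contDiff (n := ⊤)).differentiable_iteratedDeriv l (by exact_mod_cast WithTop.coe_lt_top l)
    change HasDerivAt (iteratedDeriv l f) (iteratedDeriv (l + 1) f x) x
    rw [iteratedDeriv_succ]
    exact (h1 x).hasDerivAt
  · by_contra h
    have h1 : x ∈ Function.support (iteratedFDeriv ℝ l f) := by
      intro h2
      refine h ?_
      rw [iteratedDeriv_eq_iteratedFDeriv, h2]
      rfl
    have h2 := support_iteratedFDeriv_subset l h1
    rw [f.tsupport_eq, Real.closedBall_eq_Icc] at h2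
    refine hx ⟨?_, ?_⟩
    · have := h2.1; simp only [f] at this; linarith
    · have := h2.2; simp only [f] at this; linarith
  · simp only [iteratedDeriv_zero]
    refine intervalIntegral.integral_pos one_pos (f.continuous.pow 2).continuousOn
      (fun _ _ => sq_nonneg _) ⟨1 / 2, by norm_num, ?_⟩
    rw [f.one_of_mem_closedBall (Metric.mem_closedBall_self f.rIn_pos.le)]
    norm_num

/-- The derivative of order `l` of `ρ ∑_j α_j G(m x - j)`, where `G` has the derivatives `G 0, G 1, …`. -/
noncomputable def bumpSum (G : ℕ → ℝ → ℝ) (ρ : ℝ) (m : ℕ) (α : Fin m → ℝ) (l : ℕ) (x : ℝ) : ℝ :=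
  ρ * (m : ℝ) ^ l * ∑ j, α j * G l (m * x - (j : ℕ))

section BumpSum

variable {G : ℕ → ℝ → ℝ} {ρ : ℝ} {m : ℕ} {α : Fin m → ℝ}

theorem IsBump.continuous (hG : IsBump G) (l : ℕ) : Continuous (G l) :=
  continuous_iff_continuousAt.2 fun x => (hG.hasDerivAt l x).continuousAt

/-- Unit translates have disjoint supports, so squares of bump sums have no mixed terms. -/
theorem IsBump.mul_eq_zero (hG : IsBump G) (l : ℕ) {i j : ℕ} (hij : i ≠ j) (y : ℝ) :
    G l (y - i) * G l (y - j) = 0 := by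
  by_contra h
  have hi : y - i ∈ Ioo (0 : ℝ) 1 := by
    by_contra h1
    exact h (by rw [hG.eq_zero l _ h1, zero_mul])
  have hj : y - j ∈ Ioo (0 : ℝ) 1 := by
    by_contra h1
    exact h (by rw [hG.eq_zero l _ h1, mul_zero])
  have h1 : (i : ℝ) < j + 1 := by linarith [hi.1, hj.2]
  have h2 : (j : ℝ) < i + 1 := by linarith [hj.1, hi.2]
  have h3 : i < j + 1 := by exact_mod_cast h1
  have h4 : j < i + 1 := by exact_mod_cast h2
  omega

theorem IsBump.bumpSum_sq (hG : IsBump G) (l : ℕ) (x : ℝ) :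
    bumpSum G ρ m α l x ^ 2 =
      ρ ^ 2 * (m : ℝ) ^ (2 * l) * ∑ j, α j ^ 2 * G l (m * x - (j : ℕ)) ^ 2 := by
  rw [bumpSum, mul_pow, mul_pow, ← pow_mul, mul_comm l 2]
  congr 1
  rw [sq, Finset.sum_mul_sum]
  refine Finset.sum_congr rfl fun i _ => ?_
  rw [Finset.sum_eq_single i]
  · ring
  · intro j _ hj
    have := hG.mul_eq_zero l (i := i) (j := j) (fun h => hj (Fin.ext h.symm)) (m * x)
    linear_combination α i * α j * this
  · simp

theorem IsBump.continuous_bumpSum (hG : IsBump G) (l : ℕ) : Continuous (bumpSum G ρ m α l) := by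
  unfold bumpSum
  refine continuous_const.mul (continuous_finsetSum _ fun j _ => continuous_const.mul ?_)
  exact (hG.continuous l).comp (by fun_prop)

theorem IsBump.hasDerivAt_bumpSum (hG : IsBump G) (l : ℕ) (x : ℝ) :
    HasDerivAt (bumpSum G ρ m α l) (bumpSum G ρ m α (l + 1) x) x := by
  have h1 : ∀ j : Fin m, HasDerivAt (fun x : ℝ => α j * G l (m * x - (j : ℕ)))
      (α j * (G (l + 1) (m * x - (j : ℕ)) * m)) x := by
    intro j
    have h2 : HasDerivAt (fun x : ℝ => (m : ℝ) * x - (j : ℕ)) (m : ℝ) x := by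
      simpa using ((hasDerivAt_id x).const_mul (m : ℝ)).sub_const ((j : ℕ) : ℝ)
    exact ((hG.hasDerivAt l _).comp x h2).const_mul _
  have h3 := (HasDerivAt.fun_sum (u := Finset.univ) fun j _ => h1 j).const_mul (ρ * (m : ℝ) ^ l)
  refine h3.congr_deriv ?_
  rw [bumpSum, pow_succ, Finset.mul_sum, Finset.mul_sum]
  exact Finset.sum_congr rfl fun j _ => by ring

theorem IsBump.hasSobolevDerivs (hG : IsBump G) (r : ℕ) :
    HasSobolevDerivs r (bumpSum G ρ m α 0) (bumpSum G ρ m α) where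
  zero _ _ := rfl
  memLp l _ := by
    obtain ⟨C, hC⟩ := isCompact_Icc.exists_bound_of_continuousOn
      (hG.continuous_bumpSum (ρ := ρ) (α := α) l).continuousOn (s := Icc (0 : ℝ) 1)
    exact MemLp.of_bound (hG.continuous_bumpSum l).aestronglyMeasurable C
      ((ae_restrict_mem measurableSet_Icc).mono hC)
  ftc l _ x _ := by
    rw [intervalIntegral.integral_eq_sub_of_hasDerivAt (fun y _ => hG.hasDerivAt_bumpSum l y)
      ((hG.continuous_bumpSum (l + 1)).intervalIntegrable _ _)]
    ring

theorem IsBump.integral_comp_sq (hG : IsBump G) (l : ℕ) {j : ℕ} (hj : j < m) :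
    ∫ x in (0 : ℝ)..1, G l (m * x - j) ^ 2 = (m : ℝ)⁻¹ * ∫ x in (0 : ℝ)..1, G l x ^ 2 := by
  have hm : (m : ℝ) ≠ 0 := by exact_mod_cast (by omega : m ≠ 0)
  have hjm : (j : ℝ) + 1 ≤ m := by exact_mod_cast hj
  rw [intervalIntegral.integral_comp_mul_sub (fun x => G l x ^ 2) hm, smul_eq_mul]
  congr 1
  have hi : ∀ c d : ℝ, IntervalIntegrable (fun x => G l x ^ 2) volume c d :=
    fun c d => ((hG.continuous l).pow 2).intervalIntegrable _ _
  rw [← intervalIntegral.integral_add_adjacent_intervals (hi _ 0) (hi 0 _),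
    ← intervalIntegral.integral_add_adjacent_intervals (hi 0 1) (hi 1 _)]
  have h1 : ∫ x in (m * 0 - j : ℝ)..0, G l x ^ 2 = 0 := by
    rw [intervalIntegral.integral_congr (g := fun _ => (0 : ℝ)), intervalIntegral.integral_zero]
    intro x hx
    rw [uIcc_of_le (by simp)] at hx
    have : G l x = 0 := hG.eq_zero l x fun h => by linarith [hx.2, h.1]
    simp [this]
  have h2 : ∫ x in (1 : ℝ)..(m * 1 - j), G l x ^ 2 = 0 := by
    rw [intervalIntegral.integral_congr (g := fun _ => (0 : ℝ)), intervalIntegral.integral_zero]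
    intro x hx
    rw [uIcc_of_le (by linarith)] at hx
    have : G l x = 0 := hG.eq_zero l x fun h => by linarith [hx.1, h.2]
    simp [this]
  rw [h1, h2]
  ring

theorem IsBump.integral_bumpSum_sq (hG : IsBump G) (l : ℕ) :
    ∫ x in (0 : ℝ)..1, bumpSum G ρ m α l x ^ 2 =
      ρ ^ 2 * (m : ℝ) ^ (2 * l) * ((m : ℝ)⁻¹ * ∑ j, α j ^ 2) * ∫ x in (0 : ℝ)..1, G l x ^ 2 := by
  simp only [hG.bumpSum_sq]
  rw [intervalIntegral.integral_const_mul, intervalIntegral.integral_finsetSum]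
  · simp only [intervalIntegral.integral_const_mul]
    have h1 : ∀ j : Fin m, ∫ x in (0 : ℝ)..1, G l (m * x - (j : ℕ)) ^ 2 =
        (m : ℝ)⁻¹ * ∫ x in (0 : ℝ)..1, G l x ^ 2 := fun j => hG.integral_comp_sq l j.2
    simp only [h1, ← Finset.sum_mul]
    ring
  · intro j _
    refine Continuous.intervalIntegrable ?_ _ _
    exact continuous_const.mul (((hG.continuous l).comp (by fun_prop)).pow 2)

/-- Scaled by `δ m^{-r}` with `δ` small, bump sums with coefficients of mean square at most `1` lie
in the Sobolev ball. -/
theorem IsBump.mem_sobolevBall (hG : IsBump G) {r : ℕ} {R δ : ℝ}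
    (hδ : δ ^ 2 * ∑ l ∈ Finset.range (r + 1), ∫ x in (0 : ℝ)..1, G l x ^ 2 ≤ R ^ 2)
    (hm : 0 < m) (hα : ∑ j, α j ^ 2 ≤ m) :
    bumpSum G (δ * ((m : ℝ) ^ r)⁻¹) m α 0 ∈ sobolevBall r R := by
  refine ⟨_, hG.hasSobolevDerivs r, ?_⟩
  have hm' : (1 : ℝ) ≤ m := by exact_mod_cast hm
  have hm0 : (0 : ℝ) < m := by linarith
  refine le_trans ?_ hδ
  rw [Finset.mul_sum]
  refine Finset.sum_le_sum fun l hl => ?_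
  rw [hG.integral_bumpSum_sq]
  have hl' : l ≤ r := by have := Finset.mem_range.1 hl; omega
  refine mul_le_mul_of_nonneg_right ?_
    (intervalIntegral.integral_nonneg zero_le_one fun _ _ => sq_nonneg _)
  have h1 : (m : ℝ)⁻¹ * ∑ j, α j ^ 2 ≤ 1 := by
    rw [inv_mul_eq_div]
    exact (div_le_one hm0).2 hα
  have h1' : 0 ≤ (m : ℝ)⁻¹ * ∑ j, α j ^ 2 :=
    mul_nonneg (by positivity) (Finset.sum_nonneg fun _ _ => sq_nonneg _)
  -- A derivative of order `l ≤ r` costs `m ^ l`, and the amplitude `m ^ (-r)` pays for it.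
  have h2 : (((m : ℝ) ^ r)⁻¹) ^ 2 * (m : ℝ) ^ (2 * l) ≤ 1 := by
    rw [inv_pow, ← pow_mul, inv_mul_eq_div]
    refine (div_le_one (by positivity)).2 (pow_le_pow_right₀ hm' (by omega))
  calc (δ * ((m : ℝ) ^ r)⁻¹) ^ 2 * (m : ℝ) ^ (2 * l) * ((m : ℝ)⁻¹ * ∑ j, α j ^ 2)
      = δ ^ 2 * ((((m : ℝ) ^ r)⁻¹) ^ 2 * (m : ℝ) ^ (2 * l)) * ((m : ℝ)⁻¹ * ∑ j, α j ^ 2) := by ring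
    _ ≤ δ ^ 2 * 1 * 1 := by gcongr
    _ = δ ^ 2 := by ring

end BumpSum

/-- Constants are in the Sobolev ball. -/
theorem const_mem_sobolevBall (r : ℕ) {R s : ℝ} (hs : s ^ 2 ≤ R ^ 2) :
    (fun _ => s) ∈ sobolevBall r R := by
  refine ⟨fun l _ => if l = 0 then s else 0, ⟨fun _ _ => by simp, fun l _ => memLp_const _,
    fun l _ x _ => by simp⟩, ?_⟩
  rw [Finset.sum_eq_single 0]
  · simpa using hs
  · intro l _ hl
    simp [hl]
  · simp

/-! ### Lower bounds for spline estimators -/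

section Orthogonal

variable {G : ℕ → ℝ → ℝ} {Λ R : ℝ} {p k r m : ℕ} {t : ℕ → ℝ}

/-- Dimension count: `m` bumps outnumber the `k + p + 1` B-splines, so orthogonality to all splines
has a nontrivial solution. It is normalized to mean square `1`, the size admitted in the Sobolev
ball. -/
theorem IsBump.exists_orthogonal (hG : IsBump G) (ht : QuasiUniformKnots Λ p k t)
    (hm : k + p + 1 < m) (ρ : ℝ) :
    ∃ α : Fin m → ℝ, ∑ j, α j ^ 2 = m ∧ ∀ c : Fin (k + p + 1) → ℝ,
      ∫ u in Icc (0 : ℝ) 1, spline t p k c u * bumpSum G ρ m α 0 u = 0 := by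
  let A : Matrix (Fin (k + p + 1)) (Fin m) ℝ :=
    Matrix.of fun i j => ∫ u in Icc (0 : ℝ) 1, bspline t p i u * G 0 (m * u - (j : ℕ))
  have hker : LinearMap.ker A.mulVecLin ≠ ⊥ :=
    LinearMap.ker_ne_bot_of_finrank_lt (by simpa using hm)
  obtain ⟨β, hβ, hβ0⟩ := (Submodule.ne_bot_iff _).1 hker
  have hpos : 0 < ∑ j, β j ^ 2 := by
    obtain ⟨j, hj⟩ := Function.ne_iff.1 hβ0
    exact Finset.sum_pos' (fun _ _ => sq_nonneg _) ⟨j, Finset.mem_univ _, sq_pos_of_ne_zero hj⟩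
  set s : ℝ := Real.sqrt (m / ∑ j, β j ^ 2) with hs
  have hs2 : s ^ 2 = m / ∑ j, β j ^ 2 := Real.sq_sqrt (by positivity)
  refine ⟨fun j => s * β j, ?_, fun c => ?_⟩
  · simp only [mul_pow, ← Finset.mul_sum, hs2]
    field_simp
  · have hB : ∀ i : Fin (k + p + 1),
        MemLp (bspline t p i) 2 (volume.restrict (Icc (0 : ℝ) 1)) := fun i => ht.memLp_bspline i.2
    have hg : ∀ j : Fin m, MemLp (fun u => G 0 (m * u - (j : ℕ))) 2
        (volume.restrict (Icc (0 : ℝ) 1)) := by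
      intro j
      have hcont : Continuous fun u : ℝ => G 0 (m * u - (j : ℕ)) :=
        (hG.continuous 0).comp (by fun_prop)
      obtain ⟨C, hC⟩ := isCompact_Icc.exists_bound_of_continuousOn hcont.continuousOn
        (s := Icc (0 : ℝ) 1)
      exact MemLp.of_bound hcont.aestronglyMeasurable C ((ae_restrict_mem measurableSet_Icc).mono hC)
    have hBg : ∀ (i : Fin (k + p + 1)) (j : Fin m), Integrable
        (fun u => bspline t p i u * G 0 (m * u - (j : ℕ))) (volume.restrict (Icc (0 : ℝ) 1)) :=
      fun i j => (hB i).integrable_mul (hg j)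
    have h1 : ∀ u, spline t p k c u * bumpSum G ρ m (fun j => s * β j) 0 u =
        ∑ i : Fin (k + p + 1), ∑ j : Fin m,
          c i * ρ * s * (bspline t p i u * G 0 (m * u - (j : ℕ)) * β j) := by
      intro u
      rw [spline, bumpSum, pow_zero, mul_one, ← mul_assoc, mul_comm _ ρ, mul_assoc,
        Finset.sum_mul_sum, Finset.mul_sum]
      refine Finset.sum_congr rfl fun i _ => ?_
      rw [Finset.mul_sum]
      exact Finset.sum_congr rfl fun j _ => by ring
    simp only [h1]
    rw [integral_finsetSum _ fun i _ => integrable_finsetSum _ fun j _ =>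
      ((hBg i j).mul_const _).const_mul _]
    refine Finset.sum_eq_zero fun i _ => ?_
    rw [integral_finsetSum _ fun j _ => ((hBg i j).mul_const _).const_mul _]
    simp only [integral_const_mul, integral_mul_const, ← Finset.mul_sum]
    have h2 : ∑ j, A i j * β j = 0 := congrFun (LinearMap.mem_ker.1 hβ) i
    simp only [A, Matrix.of_apply] at h2
    rw [h2, mul_zero]

theorem lintegral_sq_sub_ge_of_orthogonal {s ψ : ℝ → ℝ}
    (hs : MemLp s 2 (volume.restrict (Icc (0 : ℝ) 1)))
    (hψ : MemLp ψ 2 (volume.restrict (Icc (0 : ℝ) 1)))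
    (h : ∫ u in Icc (0 : ℝ) 1, s u * ψ u = 0) :
    ENNReal.ofReal (∫ u in (0 : ℝ)..1, ψ u ^ 2) ≤
      ∫⁻ u in Icc (0 : ℝ) 1, ENNReal.ofReal ((s u - ψ u) ^ 2) := by
  have h0 : MemLp (fun u => s u - ψ u) 2 (volume.restrict (Icc (0 : ℝ) 1)) := hs.sub hψ
  rw [← lintegral_unit_sq_eq_ofReal hψ, lintegral_sq_eq_ofReal hψ, lintegral_sq_eq_ofReal h0]
  refine ENNReal.ofReal_le_ofReal ?_
  have i1 : Integrable (fun u => s u * ψ u) (volume.restrict (Icc (0 : ℝ) 1)) := hs.integrable_mul hψ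
  have h1 : ∀ u, (s u - ψ u) ^ 2 = s u ^ 2 + ψ u ^ 2 - 2 * (s u * ψ u) := fun u => by ring
  have i2 : Integrable (fun u => s u ^ 2 + ψ u ^ 2) (volume.restrict (Icc (0 : ℝ) 1)) :=
    hs.integrable_sq.add hψ.integrable_sq
  simp only [h1]
  rw [integral_sub i2 (i1.const_mul 2), integral_const_mul, h,
    integral_add hs.integrable_sq hψ.integrable_sq]
  have : 0 ≤ ∫ u in Icc (0 : ℝ) 1, s u ^ 2 := integral_nonneg fun _ => sq_nonneg _
  linarith

/-- Any spline-valued estimator has a squared error of order at least `k^{-2r}` at some function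
of the Sobolev ball. -/
theorem exists_mse_ge_of_spline (r p : ℕ) (hR : 0 < R) :
    ∃ c : ℝ, 0 < c ∧ ∀ (k n : ℕ) (t : ℕ → ℝ), 1 ≤ k → QuasiUniformKnots Λ p k t →
      ∀ T : (Fin n → ℝ) → (Fin n → ℝ) → ℝ → ℝ,
        (∀ x y, ∃ c : Fin (k + p + 1) → ℝ, T x y = spline t p k c) →
      ∃ ψ ∈ sobolevBall r R, ∀ P : Measure ((Fin n → ℝ) × (Fin n → ℝ)), IsProbabilityMeasure P →
        ENNReal.ofReal (c * ((k : ℝ) ^ (2 * r))⁻¹) ≤ mse P T ψ := by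
  obtain ⟨G, hG⟩ := exists_isBump
  set s := ∑ l ∈ Finset.range (r + 1), ∫ x in (0 : ℝ)..1, G l x ^ 2 with hs
  have hs0 : 0 ≤ s := Finset.sum_nonneg fun l _ =>
    intervalIntegral.integral_nonneg zero_le_one fun _ _ => sq_nonneg _
  obtain ⟨δ, hδ0, hδ⟩ : ∃ δ : ℝ, 0 < δ ∧ δ ^ 2 * s ≤ R ^ 2 := by
    refine ⟨R / (1 + s), by positivity, ?_⟩
    rw [div_pow, div_mul_eq_mul_div, div_le_iff₀ (by positivity)]
    refine mul_le_mul_of_nonneg_left ?_ (sq_nonneg _)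
    nlinarith
  set β := ∫ x in (0 : ℝ)..1, G 0 x ^ 2 with hβ
  have hβ0 : 0 < β := hG.integral_pos
  refine ⟨δ ^ 2 * β * (((p : ℝ) + 3) ^ (2 * r))⁻¹, by positivity, ?_⟩
  intro k n t hk ht T hT
  -- The smallest number of bumps that exceeds the dimension of the spline space; it is at most `(p
  -- + 3) k`.
  set m : ℕ := k + p + 2 with hm
  have hk' : (1 : ℝ) ≤ k := by exact_mod_cast hk
  have hmk : (m : ℝ) ≤ (p + 3) * k := by
    rw [hm]; push_cast
    nlinarith [(Nat.cast_nonneg p : (0 : ℝ) ≤ p)]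
  have hm0 : (0 : ℝ) < m := by rw [hm]; positivity
  obtain ⟨α, hα, hort⟩ := hG.exists_orthogonal ht (m := m) (by omega) (δ * ((m : ℝ) ^ r)⁻¹)
  refine ⟨_, hG.mem_sobolevBall hδ (by omega) hα.le, fun P _ => ?_⟩
  have hψL := (hG.hasSobolevDerivs (ρ := δ * ((m : ℝ) ^ r)⁻¹) (α := α) r).memLp_self
  have hnorm : δ ^ 2 * β * (((p : ℝ) + 3) ^ (2 * r))⁻¹ * ((k : ℝ) ^ (2 * r))⁻¹ ≤
      ∫ u in (0 : ℝ)..1, bumpSum G (δ * ((m : ℝ) ^ r)⁻¹) m α 0 u ^ 2 := by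
    rw [hG.integral_bumpSum_sq, hα, inv_mul_cancel₀ hm0.ne', mul_zero, pow_zero, mul_one, mul_one,
      mul_pow, inv_pow, ← pow_mul, mul_comm r 2]
    calc _ = δ ^ 2 * ((((p : ℝ) + 3) * k) ^ (2 * r))⁻¹ * β := by rw [mul_pow, mul_inv]; ring
      _ ≤ _ := by gcongr
  calc _ ≤ ∫⁻ _, ENNReal.ofReal (δ ^ 2 * β * (((p : ℝ) + 3) ^ (2 * r))⁻¹ * ((k : ℝ) ^ (2 * r))⁻¹) ∂P := by
        simp
    _ ≤ _ := by
        refine lintegral_mono fun z => (ENNReal.ofReal_le_ofReal hnorm).trans ?_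
        obtain ⟨c, hc⟩ := hT z.1 fun i => bumpSum G (δ * ((m : ℝ) ^ r)⁻¹) m α 0 (z.1 i) + z.2 i
        simp only [estimate, hc]
        exact lintegral_sq_sub_ge_of_orthogonal (ht.memLp_spline c) hψL (hort c)

end Orthogonal

theorem stableLse_eq_spline (t : ℕ → ℝ) (p k : ℕ) (τ : ℝ) {n : ℕ}
    (cHat : (Fin n → ℝ) → (Fin n → ℝ) → Fin (k + p + 1) → ℝ) (x y : Fin n → ℝ) :
    ∃ c : Fin (k + p + 1) → ℝ, stableLse t p k τ cHat x y = spline t p k c := by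
  by_cases h : StableDesign t p k τ x
  · exact ⟨cHat x y, by simp [stableLse, h]⟩
  · exact ⟨0, by ext u; simp [stableLse, h, spline]⟩

/-- The truncated estimator of a constant pays for unstable designs. -/
theorem measure_unstable_le_mse {Λ τ : ℝ} {p k n : ℕ} {t : ℕ → ℝ} {μ ν : Measure ℝ}
    [IsProbabilityMeasure μ] [IsProbabilityMeasure ν] (ht : QuasiUniformKnots Λ p k t)
    (cHat : (Fin n → ℝ) → (Fin n → ℝ) → Fin (k + p + 1) → ℝ) (R : ℝ) :
    ENNReal.ofReal (R ^ 2) * (Measure.pi fun _ : Fin n => μ) {x | ¬ StableDesign t p k τ x} ≤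
      mse (sampleLaw μ ν n) (stableLse t p k τ cHat) fun _ => R := by
  have hmp1 : MeasurePreserving (Prod.fst : (Fin n → ℝ) × (Fin n → ℝ) → (Fin n → ℝ))
      (sampleLaw μ ν n) (Measure.pi fun _ : Fin n => μ) := measurePreserving_fst
  have hm : MeasurableSet {x : Fin n → ℝ | ¬ StableDesign t p k τ x} :=
    (measurableSet_stableDesign t ht n τ).compl
  rw [← hmp1.measure_preimage hm.nullMeasurableSet, ← lintegral_indicator_const (measurable_fst hm)]
  refine lintegral_mono fun z => ?_
  by_cases hz : StableDesign t p k τ z.1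
  · rw [indicator_of_notMem (by simpa using hz)]
    exact zero_le
  · rw [indicator_of_mem (by simpa using hz)]
    simp [estimate, stableLse, hz]

/-! ### A lower bound for the variance -/

section VarianceLower

variable {Λ τ b : ℝ} {p k n : ℕ} {t : ℕ → ℝ} {μ ν : Measure ℝ}

/-- A B-spline spans `p + 1` knot intervals, so indices spaced by `p + 1` give disjoint supports. -/
theorem disjoint_bspline (ht : QuasiUniformKnots Λ p k t) {i j : ℕ} (hij : i ≠ j)
    (hi : i * (p + 1) < k + p + 1) (hj : j * (p + 1) < k + p + 1) {u : ℝ}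
    (h : bspline t p (i * (p + 1)) u ≠ 0) : bspline t p (j * (p + 1)) u = 0 := by
  have hmem : u ∈ Ico (t (i * (p + 1))) (t (i * (p + 1) + p + 1)) := by
    by_contra h1
    exact h (bspline_eq_zero ht.mono (by omega) h1)
  refine bspline_eq_zero ht.mono (by omega) fun h1 => ?_
  rcases lt_or_gt_of_ne hij with hlt | hlt
  · have h2 : i * (p + 1) + p + 1 ≤ j * (p + 1) := by nlinarith
    have h3 := ht.mono (mem_Iic.2 (by omega)) (mem_Iic.2 (by omega)) h2
    exact absurd h1.1 (not_le.2 (hmem.2.trans_le h3))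
  · have h2 : j * (p + 1) + p + 1 ≤ i * (p + 1) := by nlinarith
    have h3 := ht.mono (mem_Iic.2 (by omega)) (mem_Iic.2 (by omega)) h2
    exact absurd hmem.1 (not_le.2 (h1.2.trans_le h3))

/-- The disjointly supported B-splines are reproduced by the fit, so the weights cannot be small. -/
theorem StableDesign.sum_bspline_sq_le (hΛ : 1 ≤ Λ) (ht : QuasiUniformKnots Λ p k t) (hτ : 0 < τ)
    {x : Fin n → ℝ} (hx : StableDesign t p k τ x) {J : ℕ}
    (hJ : ∀ j < J, j * (p + 1) < k + p + 1) (κ : ℕ → ℝ) (u : ℝ) :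
    ∑ j ∈ Finset.range J, bspline t p (j * (p + 1)) u ^ 2 *
      (2 * κ j - κ j ^ 2 * ∑ i, bspline t p (j * (p + 1)) (x i) ^ 2) ≤
      ∑ i, lsWeight t p k x i u ^ 2 := by
  have hY : 0 ≤ ∑ i, lsWeight t p k x i u ^ 2 := Finset.sum_nonneg fun _ _ => sq_nonneg _
  by_cases h : ∃ j < J, bspline t p (j * (p + 1)) u ≠ 0
  · obtain ⟨j, hj, hju⟩ := h
    rw [Finset.sum_eq_single_of_mem j (Finset.mem_range.2 hj)]
    · set N := bspline t p (j * (p + 1)) u with hN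
      set Z := ∑ i, bspline t p (j * (p + 1)) (x i) ^ 2 with hZ
      set Y := ∑ i, lsWeight t p k x i u ^ 2 with hYd
      -- The fit to the values of a B-spline is the B-spline itself; Cauchy–Schwarz then bounds the
      -- weights from below by `N ^ 2 / Z`.
      have h1 : N = ∑ i, bspline t p (j * (p + 1)) (x i) * lsWeight t p k x i u := by
        rw [← spline_lsCoeff_eq_sum, ← spline_single t p k (hJ j hj),
          hx.lsCoeff_spline hΛ ht hτ, spline_single]
      have h2 : N ^ 2 ≤ Z * Y := by
        rw [h1]
        exact Finset.sum_mul_sq_le_sq_mul_sq _ _ _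
      have hN2 : 0 < N ^ 2 := sq_pos_of_ne_zero hju
      have hZ0 : 0 ≤ Z := Finset.sum_nonneg fun _ _ => sq_nonneg _
      have hZ1 : 0 < Z := by
        rcases hZ0.eq_or_lt with h3 | h3
        · rw [← h3, zero_mul] at h2
          linarith
        · exact h3
      -- The tangent bound `2 κ - κ² Z ≤ 1 / Z` makes the lower bound affine in `Z`, so that its
      -- expectation over the design needs only the mean of `Z`.
      have h4 : (2 * κ j - κ j ^ 2 * Z) * Z ≤ 1 := by nlinarith [sq_nonneg (κ j * Z - 1)]
      have h5 : N ^ 2 * (2 * κ j - κ j ^ 2 * Z) * Z ≤ Y * Z := by nlinarith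
      exact le_of_mul_le_mul_right h5 hZ1
    · intro i hi hij
      rw [disjoint_bspline ht hij.symm (hJ j hj) (hJ i (Finset.mem_range.1 hi)) hju]
      ring
  · push Not at h
    rw [Finset.sum_eq_zero fun j hj => by rw [h j (Finset.mem_range.1 hj)]; ring]
    exact hY

/-- The choice `κ / q j`, with `q j` the squared norm of the B-spline, makes every B-spline
contribute the same amount `2 κ`, regardless of its scale. -/
theorem StableDesign.sum_le_integral_weights (hΛ : 1 ≤ Λ) (ht : QuasiUniformKnots Λ p k t)
    (hτ : 0 < τ) {x : Fin n → ℝ} (hx : StableDesign t p k τ x) {J : ℕ}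
    (hJ : ∀ j < J, j * (p + 1) < k + p + 1) (κ : ℝ) :
    2 * κ * J - κ ^ 2 * ∑ j ∈ Finset.range J,
      (∫ u in (0 : ℝ)..1, bspline t p (j * (p + 1)) u ^ 2)⁻¹ *
        ∑ i, bspline t p (j * (p + 1)) (x i) ^ 2 ≤
      ∫ u in (0 : ℝ)..1, ∑ i, lsWeight t p k x i u ^ 2 := by
  set q : ℕ → ℝ := fun j => ∫ u in (0 : ℝ)..1, bspline t p (j * (p + 1)) u ^ 2 with hq
  have hq0 : ∀ j < J, 0 < q j := fun j hj => ht.integral_bspline_sq_pos hΛ (hJ j hj)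
  have hi1 : ∀ j ∈ Finset.range J, IntervalIntegrable (fun u => bspline t p (j * (p + 1)) u ^ 2 *
      (2 * (κ / q j) - (κ / q j) ^ 2 * ∑ i, bspline t p (j * (p + 1)) (x i) ^ 2)) volume 0 1 := by
    intro j hj
    rw [intervalIntegrable_iff_integrableOn_Icc_of_le zero_le_one]
    exact (ht.memLp_bspline (hJ j (Finset.mem_range.1 hj))).integrable_sq.mul_const _
  have hi2 : IntervalIntegrable (fun u => ∑ i, lsWeight t p k x i u ^ 2) volume 0 1 := by
    rw [intervalIntegrable_iff_integrableOn_Icc_of_le zero_le_one]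
    exact integrable_finsetSum _ fun i _ => (ht.memLp_spline _).integrable_sq
  have hi3 : IntervalIntegrable (fun u => ∑ j ∈ Finset.range J, bspline t p (j * (p + 1)) u ^ 2 *
      (2 * (κ / q j) - (κ / q j) ^ 2 * ∑ i, bspline t p (j * (p + 1)) (x i) ^ 2)) volume 0 1 := by
    rw [intervalIntegrable_iff_integrableOn_Icc_of_le zero_le_one]
    exact integrable_finsetSum _ fun j hj =>
      (ht.memLp_bspline (hJ j (Finset.mem_range.1 hj))).integrable_sq.mul_const _
  have h1 := intervalIntegral.integral_mono_on zero_le_one hi3 hi2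
    fun u _ => hx.sum_bspline_sq_le hΛ ht hτ hJ (fun j => κ / q j) u
  refine le_trans (le_of_eq ?_) h1
  rw [intervalIntegral.integral_finsetSum hi1]
  simp only [intervalIntegral.integral_mul_const]
  rw [Finset.mul_sum]
  have h2 : 2 * κ * J = ∑ _j ∈ Finset.range J, 2 * κ := by simp; ring
  rw [h2, ← Finset.sum_sub_distrib]
  refine Finset.sum_congr rfl fun j hj => ?_
  have h3 := (hq0 j (Finset.mem_range.1 hj)).ne'
  have h4 : ∀ q z : ℝ, q ≠ 0 →
      2 * κ - κ ^ 2 * (q⁻¹ * z) = q * (2 * (κ / q) - (κ / q) ^ 2 * z) := by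
    intro q z hq
    field_simp
  exact h4 _ _ h3

/-- The exact conditional variance: the noise variance times the integrated sum of squared weights.
-/
theorem lintegral_noise_eq [IsProbabilityMeasure ν] (hν : MemLp id 2 ν) (hν0 : ∫ e, e ∂ν = 0)
    (ht : QuasiUniformKnots Λ p k t) (x : Fin n → ℝ) :
    ∫⁻ ε, (∫⁻ u in Icc (0 : ℝ) 1, ENNReal.ofReal (spline t p k (lsCoeff t p k x ε) u ^ 2))
        ∂(Measure.pi fun _ : Fin n => ν) =
      ENNReal.ofReal ((∫ e, e ^ 2 ∂ν) * ∫ u in (0 : ℝ)..1, ∑ i, lsWeight t p k x i u ^ 2) := by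
  have hm := (measurable_spline_lsCoeff t p k n).comp
    (show Measurable fun q : (Fin n → ℝ) × ℝ => ((x, q.1), q.2) by fun_prop)
  have hsq : Measurable fun q : (Fin n → ℝ) × ℝ =>
      ENNReal.ofReal (spline t p k (lsCoeff t p k x q.1) q.2 ^ 2) :=
    (hm.pow_const 2).ennreal_ofReal
  have hsw := lintegral_lintegral_swap (μ := Measure.pi fun _ : Fin n => ν)
    (ν := volume.restrict (Icc (0 : ℝ) 1))
    (f := fun ε u => ENNReal.ofReal (spline t p k (lsCoeff t p k x ε) u ^ 2)) hsq.aemeasurable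
  refine hsw.trans ?_
  have h1 : ∀ u, ∫⁻ ε, ENNReal.ofReal (spline t p k (lsCoeff t p k x ε) u ^ 2)
      ∂(Measure.pi fun _ : Fin n => ν) =
      ENNReal.ofReal ((∫ e, e ^ 2 ∂ν) * ∑ i, lsWeight t p k x i u ^ 2) := by
    intro u
    have h2 := lintegral_sq_eq_ofReal (memLp_spline_lsCoeff_noise hν t p k x u)
    have h3 := integral_sq_linear_noise hν hν0 fun i => lsWeight t p k x i u
    simp only [← spline_lsCoeff_eq_sum] at h3
    rw [← h3]
    exact h2
  simp only [h1]
  have hint : Integrable (fun u => (∫ e, e ^ 2 ∂ν) * ∑ i, lsWeight t p k x i u ^ 2)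
      (volume.restrict (Icc (0 : ℝ) 1)) :=
    (integrable_finsetSum _ fun i _ => (ht.memLp_spline _).integrable_sq).const_mul _
  rw [← ofReal_integral_eq_lintegral_ofReal hint (Eventually.of_forall fun u =>
    mul_nonneg (integral_nonneg fun _ => sq_nonneg _) (Finset.sum_nonneg fun _ _ => sq_nonneg _)),
    integral_const_mul, intervalIntegral.integral_of_le zero_le_one, integral_Icc_eq_integral_Ioc]

theorem mse_zero_eq [IsProbabilityMeasure μ] [IsProbabilityMeasure ν]
    (hΛ : 1 ≤ Λ) (ht : QuasiUniformKnots Λ p k t)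
    (hτ : 0 < τ) {cHat : (Fin n → ℝ) → (Fin n → ℝ) → Fin (k + p + 1) → ℝ}
    (hc : IsLeastSquares t p k n cHat) :
    mse (sampleLaw μ ν n) (stableLse t p k τ cHat) (fun _ => 0) =
      ∫⁻ x, (∫⁻ ε, (∫⁻ u in Icc (0 : ℝ) 1,
        ENNReal.ofReal (stableFit t p k τ (fun z => z.2) (x, ε) u ^ 2))
        ∂(Measure.pi fun _ : Fin n => ν)) ∂(Measure.pi fun _ : Fin n => μ) := by
  have hm := measurable_stableFit (τ := τ) (n := n) ht
    (w := fun z : (Fin n → ℝ) × (Fin n → ℝ) => z.2) measurable_snd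
  have h1 : ∀ z u, estimate (stableLse t p k τ cHat) (fun _ => 0) z u =
      stableFit t p k τ (fun z : (Fin n → ℝ) × (Fin n → ℝ) => z.2) z u := by
    intro z u
    by_cases hz : StableDesign t p k τ z.1
    · rw [stableFit_of_stable hz, estimate, stableLse, if_pos hz, hz.leastSquares_eq hΛ ht hτ hc]
      simp only [zero_add]
    · rw [stableFit_of_not_stable hz, estimate, stableLse, if_neg hz, Pi.zero_apply]
  simp only [mse, h1, sub_zero]
  rw [sampleLaw, lintegral_prod _ (Measurable.aemeasurable (Measurable.lintegral_prod_right'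
    (f := fun q : ((Fin n → ℝ) × (Fin n → ℝ)) × ℝ =>
      ENNReal.ofReal (stableFit t p k τ (fun z => z.2) q.1 q.2 ^ 2))
    ((hm.pow_const 2).ennreal_ofReal)))]

/-- The variance of the truncated estimator is at least of order `k / n`, unless unstable designs
are likely. -/
theorem noise_le_mse_zero [IsProbabilityMeasure μ] [IsProbabilityMeasure ν]
    (hμb : μ ≤ ENNReal.ofReal b • volume.restrict (Icc (0 : ℝ) 1))
    (hν : MemLp id 2 ν) (hν0 : ∫ e, e ∂ν = 0)
    (hΛ : 1 ≤ Λ) (ht : QuasiUniformKnots Λ p k t) (hτ : 0 < τ) (hn : 0 < n)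
    {cHat : (Fin n → ℝ) → (Fin n → ℝ) → Fin (k + p + 1) → ℝ}
    (hc : IsLeastSquares t p k n cHat) {E : ℝ} (hE : 0 ≤ E)
    (hmse : mse (sampleLaw μ ν n) (stableLse t p k τ cHat) (fun _ => 0) ≤ ENNReal.ofReal E)
    (hunst : (Measure.pi fun _ : Fin n => μ) {x | ¬ StableDesign t p k τ x} ≤
      ENNReal.ofReal (1 / 4)) :
    (∫ e, e ^ 2 ∂ν) * k / (2 * (p + 1) * (n * b)) ≤ E := by
  have hb : 1 ≤ b := one_le_of_le hμb
  have hn' : (0 : ℝ) < n := by exact_mod_cast hn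
  set σ2 : ℝ := ∫ e, e ^ 2 ∂ν with hσ2
  have hσ0 : 0 ≤ σ2 := integral_nonneg fun _ => sq_nonneg _
  -- The number of B-splines with disjoint supports that are used, at least `k / (p + 1)`.
  set J : ℕ := k / (p + 1) + 1 with hJd
  have hJ : ∀ j < J, j * (p + 1) < k + p + 1 := by
    intro j hj
    have h1 : j ≤ k / (p + 1) := by omega
    have h2 := (Nat.mul_le_mul_right (p + 1) h1).trans (Nat.div_mul_le_self k (p + 1))
    omega
  have hJk : (k : ℝ) ≤ J * (p + 1) := by
    have h1 : k < (p + 1) * (k / (p + 1) + 1) := Nat.lt_mul_div_succ k (by omega)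
    have h2 : k ≤ J * (p + 1) := by rw [hJd, mul_comm]; exact h1.le
    exact_mod_cast h2
  -- The normalized empirical moment of a B-spline has mean at most `n b`, and this `κ` maximizes `2
  -- κ - κ² n b`.
  set κ : ℝ := (n * b)⁻¹ with hκ
  have hκ0 : 0 < κ := by positivity
  set q : ℕ → ℝ := fun j => ∫ u in (0 : ℝ)..1, bspline t p (j * (p + 1)) u ^ 2 with hq
  have hq0 : ∀ j < J, 0 < q j := fun j hj => ht.integral_bspline_sq_pos hΛ (hJ j hj)
  set Q : (Fin n → ℝ) → ℝ := fun x => ∑ j ∈ Finset.range J, (q j)⁻¹ *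
    ∑ i, bspline t p (j * (p + 1)) (x i) ^ 2 with hQ
  have hQ0 : ∀ x, 0 ≤ Q x := fun x => Finset.sum_nonneg fun j hj =>
    mul_nonneg (inv_nonneg.2 (hq0 j (Finset.mem_range.1 hj)).le)
      (Finset.sum_nonneg fun _ _ => sq_nonneg _)
  have hNL : ∀ j < J, MemLp (bspline t p (j * (p + 1))) 2 μ := fun j hj =>
    memLp_of_le hμb (ht.memLp_bspline (hJ j hj))
  have hQi : Integrable Q (Measure.pi fun _ : Fin n => μ) :=
    integrable_finsetSum _ fun j hj => (integrable_finsetSum _ fun i _ =>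
      (memLp_comp_eval (hNL j (Finset.mem_range.1 hj)) i).integrable_sq).const_mul _
  have hQint : ∫ x, Q x ∂(Measure.pi fun _ : Fin n => μ) ≤ J * (n * b) := by
    simp only [hQ]
    rw [integral_finsetSum _ fun j hj => (integrable_finsetSum _ fun i _ =>
      (memLp_comp_eval (hNL j (Finset.mem_range.1 hj)) i).integrable_sq).const_mul _]
    calc _ ≤ ∑ j ∈ Finset.range J, (n * b : ℝ) := by
          refine Finset.sum_le_sum fun j hj => ?_
          have hj' := Finset.mem_range.1 hj
          rw [integral_const_mul, integral_finsetSum _ fun i _ =>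
            (memLp_comp_eval (hNL j hj') i).integrable_sq]
          have h1 : ∀ i : Fin n, ∫ x, bspline t p (j * (p + 1)) (x i) ^ 2
              ∂(Measure.pi fun _ : Fin n => μ) = ∫ u, bspline t p (j * (p + 1)) u ^ 2 ∂μ :=
            fun i => integral_comp_eval_eq (f := fun u => bspline t p (j * (p + 1)) u ^ 2)
              (hNL j hj').integrable_sq.1 i
          simp only [h1, Finset.sum_const, Finset.card_univ, Fintype.card_fin, nsmul_eq_mul]
          have h2 := integral_le_of_le (by linarith : 0 ≤ b) hμb
            (f := fun u => bspline t p (j * (p + 1)) u ^ 2) (fun _ => sq_nonneg _)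
            (ht.memLp_bspline (hJ j hj')).integrable_sq
          rw [inv_mul_le_iff₀ (hq0 j hj')]
          calc _ ≤ (n : ℝ) * (b * q j) := by gcongr
            _ = _ := by ring
      _ = _ := by simp
  set S : Set (Fin n → ℝ) := {x | ¬ StableDesign t p k τ x} with hS
  have hSm : MeasurableSet S := (measurableSet_stableDesign t ht n τ).compl
  -- Subtractions are moved to the other side to stay within `ENNReal`; on unstable designs the
  -- indicator alone suffices.
  have hpt : ∀ x : Fin n → ℝ, ENNReal.ofReal (σ2 * (2 * κ * J)) ≤
      ((∫⁻ ε, (∫⁻ u in Icc (0 : ℝ) 1,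
        ENNReal.ofReal (stableFit t p k τ (fun z => z.2) (x, ε) u ^ 2))
        ∂(Measure.pi fun _ : Fin n => ν)) +
      S.indicator (fun _ => ENNReal.ofReal (σ2 * (2 * κ * J))) x) +
      ENNReal.ofReal (σ2 * κ ^ 2 * Q x) := by
    intro x
    by_cases hx : StableDesign t p k τ x
    · have h1 : ∀ ε u, stableFit t p k τ (fun z => z.2) (x, ε) u =
          spline t p k (lsCoeff t p k x ε) u := fun ε u => stableFit_of_stable (z := (x, ε)) hx u
      rw [indicator_of_notMem (by simpa [hS] using hx), add_zero]
      simp only [h1]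
      rw [lintegral_noise_eq hν hν0 ht x, ← ENNReal.ofReal_add (mul_nonneg hσ0
        (intervalIntegral.integral_nonneg zero_le_one fun _ _ =>
          Finset.sum_nonneg fun _ _ => sq_nonneg _)) (mul_nonneg (by positivity) (hQ0 x))]
      refine ENNReal.ofReal_le_ofReal ?_
      have h2 := hx.sum_le_integral_weights hΛ ht hτ hJ κ
      have h3 := mul_le_mul_of_nonneg_left h2 hσ0
      have h4 : σ2 * (2 * κ * J - κ ^ 2 * Q x) ≤
        σ2 * ∫ u in (0 : ℝ)..1, ∑ i, lsWeight t p k x i u ^ 2 := h3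
      linarith
    · rw [indicator_of_mem (show x ∈ S from hx)]
      exact le_add_right le_add_self
  have h1 := lintegral_mono (μ := Measure.pi fun _ : Fin n => μ) hpt
  rw [lintegral_const, measure_univ, mul_one, lintegral_add_right' _
    ((hQi.1.aemeasurable.const_mul _).ennreal_ofReal),
    lintegral_add_right _ (measurable_const.indicator hSm), ← mse_zero_eq hΛ ht hτ hc,
    lintegral_indicator_const hSm, ← ofReal_integral_eq_lintegral_ofReal (hQi.const_mul _)
      (Eventually.of_forall fun x => mul_nonneg (by positivity) (hQ0 x)), integral_const_mul] at h1
  have h2 : ENNReal.ofReal (σ2 * (2 * κ * J)) ≤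
      ENNReal.ofReal (E + σ2 * (2 * κ * J) * (1 / 4) + σ2 * κ ^ 2 * (J * (n * b))) := by
    rw [ENNReal.ofReal_add (by positivity) (by positivity),
      ENNReal.ofReal_add (by positivity) (by positivity),
      ENNReal.ofReal_mul (p := σ2 * (2 * κ * J)) (by positivity)]
    refine h1.trans (add_le_add (add_le_add hmse (mul_le_mul_right hunst _)) ?_)
    exact ENNReal.ofReal_le_ofReal (by gcongr)
  have h3 := (ENNReal.ofReal_le_ofReal_iff (by positivity)).1 h2
  have h4 : σ2 * κ ^ 2 * (J * (n * b)) = σ2 * κ * J := by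
    rw [hκ]
    field_simp
  rw [h4] at h3
  -- In units of `σ2 * κ * J`: of the gain `2`, unstable designs cost `1/2` and the quadratic term
  -- costs `1`.
  have h5 : σ2 * κ * J / 2 ≤ E := by linarith
  refine le_trans ?_ h5
  calc σ2 * k / (2 * (p + 1) * (n * b)) ≤ σ2 * (J * (p + 1)) / (2 * (p + 1) * (n * b)) := by gcongr
    _ = _ := by rw [hκ]; field_simp

end VarianceLower

/-! ### The optimal number of knots -/

theorem tendsto_rate (r : ℕ) (hr : 1 ≤ r) :
    Tendsto (fun n : ℕ => (n : ℝ) ^ (-(2 * (r : ℝ)) / (2 * (r : ℝ) + 1))) atTop (nhds 0) := by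
  have hr' : (1 : ℝ) ≤ r := by exact_mod_cast hr
  have h1 := (tendsto_rpow_neg_atTop (y := 2 * (r : ℝ) / (2 * r + 1)) (by positivity)).comp
    (tendsto_natCast_atTop_atTop (R := ℝ))
  refine h1.congr fun n => ?_
  simp [neg_div]

section Optimal

variable {r p : ℕ} {R Λ a b τ : ℝ} {μ ν : Measure ℝ} [IsProbabilityMeasure μ]
  [IsProbabilityMeasure ν]

theorem exists_mse_le_rate (hr : 1 ≤ r) (hp : r ≤ p + 1) (hΛ : 1 ≤ Λ) (ha : 0 < a)
    (hμa : ENNReal.ofReal a • volume.restrict (Icc (0 : ℝ) 1) ≤ μ)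
    (hμb : μ ≤ ENNReal.ofReal b • volume.restrict (Icc (0 : ℝ) 1))
    (hν : MemLp id 2 ν) (hν0 : ∫ e, e ∂ν = 0) (hτ0 : 0 < τ) (hτa : τ < a)
    {k : ℕ → ℕ} {t : ℕ → ℕ → ℝ}
    {cHat : ∀ n, (Fin n → ℝ) → (Fin n → ℝ) → Fin (k n + p + 1) → ℝ}
    (hk : ∀ n, 1 ≤ k n) (ht : ∀ n, QuasiUniformKnots Λ p (k n) (t n))
    (hc : ∀ n, IsLeastSquares (t n) p (k n) n (cHat n))
    (hθ : (fun n => (k n : ℝ)) =Θ[atTop] (fun n : ℕ => (n : ℝ) ^ (1 / (2 * (r : ℝ) + 1)))) :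
    ∃ C : ℝ, ∀ᶠ n : ℕ in atTop, ∀ ψ ∈ sobolevBall r R,
      mse (sampleLaw μ ν n) (stableLse (t n) p (k n) τ (cHat n)) ψ ≤
        ENNReal.ofReal (C * (n : ℝ) ^ (-(2 * (r : ℝ)) / (2 * (r : ℝ) + 1))) := by
  obtain ⟨C, c, hC0, hc0, hCc⟩ :=
    exists_biasVariance_const r p hr hp R Λ hΛ μ a b ha hμa hμb ν hν hν0 τ hτ0 hτa
  obtain ⟨C', hC'⟩ := (isBigO_bias_add_variance r k hθ).bound
  refine ⟨C * C', ?_⟩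
  filter_upwards [hC', eventually_mul_log_le r hr k hθ.isBigO hc0, eventually_ge_atTop 2]
    with n hn hlog hn2 ψ hψ
  have h1 := ((hCc n (k n) hn2 (hk n) hlog (t n) (ht n) (cHat n) (hc n)).2 ψ hψ).mse_le
    (by positivity) (by positivity)
  refine h1.trans (ENNReal.ofReal_le_ofReal ?_)
  rw [Real.norm_of_nonneg (by positivity), Real.norm_of_nonneg (by positivity)] at hn
  calc _ = C * (((k n : ℝ) ^ (2 * r))⁻¹ + (k n : ℝ) / n) := by ring
    _ ≤ C * (C' * (n : ℝ) ^ (-(2 * (r : ℝ)) / (2 * (r : ℝ) + 1))) := by gcongr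
    _ = _ := by ring

/-- No upper bound on `k` is assumed, so stability cannot come from concentration. It comes from the
error bound itself: the truncated estimator fails at the constant `R` with at least the probability
of instability. The zero function then bounds `k` from above, and a bump sum orthogonal to the
splines bounds it from below. -/
theorem isTheta_of_mse_le_rate (hr : 1 ≤ r) (hR : 0 < R) (hΛ : 1 ≤ Λ)
    (hμb : μ ≤ ENNReal.ofReal b • volume.restrict (Icc (0 : ℝ) 1))
    (hν : MemLp id 2 ν) (hν0 : ∫ e, e ∂ν = 0) (hτ0 : 0 < τ)
    {k : ℕ → ℕ} {t : ℕ → ℕ → ℝ}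
    {cHat : ∀ n, (Fin n → ℝ) → (Fin n → ℝ) → Fin (k n + p + 1) → ℝ}
    (hk : ∀ n, 1 ≤ k n) (ht : ∀ n, QuasiUniformKnots Λ p (k n) (t n))
    (hc : ∀ n, IsLeastSquares (t n) p (k n) n (cHat n)) (hσ : 0 < ∫ e, e ^ 2 ∂ν)
    (h : ∃ C : ℝ, ∀ᶠ n : ℕ in atTop, ∀ ψ ∈ sobolevBall r R,
      mse (sampleLaw μ ν n) (stableLse (t n) p (k n) τ (cHat n)) ψ ≤
        ENNReal.ofReal (C * (n : ℝ) ^ (-(2 * (r : ℝ)) / (2 * (r : ℝ) + 1)))) :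
    (fun n => (k n : ℝ)) =Θ[atTop] (fun n : ℕ => (n : ℝ) ^ (1 / (2 * (r : ℝ) + 1))) := by
  have hb : 1 ≤ b := one_le_of_le hμb
  obtain ⟨C, hC0, hC⟩ : ∃ C : ℝ, 0 < C ∧ ∀ᶠ n : ℕ in atTop, ∀ ψ ∈ sobolevBall r R,
      mse (sampleLaw μ ν n) (stableLse (t n) p (k n) τ (cHat n)) ψ ≤
        ENNReal.ofReal (C * (n : ℝ) ^ (-(2 * (r : ℝ)) / (2 * (r : ℝ) + 1))) := by
    obtain ⟨C, hC⟩ := h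
    refine ⟨max C 1, by positivity, hC.mono fun n hn ψ hψ => (hn ψ hψ).trans
      (ENNReal.ofReal_le_ofReal ?_)⟩
    gcongr
    exact le_max_left _ _
  constructor
  -- The rate tends to zero, so eventually the error at the constant `R` permits probability at most
  -- `1/4` of instability.
  · have hsmall : ∀ᶠ n : ℕ in atTop,
        C * (n : ℝ) ^ (-(2 * (r : ℝ)) / (2 * (r : ℝ) + 1)) < R ^ 2 * (1 / 4) := by
      have h1 := (tendsto_rate r hr).const_mul C
      rw [mul_zero] at h1
      exact h1.eventually_lt_const (by positivity)
    refine IsBigO.of_bound (C * (2 * (p + 1) * b) / ∫ e, e ^ 2 ∂ν) ?_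
    filter_upwards [hC, hsmall, eventually_gt_atTop 0] with n hn hs hn0
    have hn' : (0 : ℝ) < n := by exact_mod_cast hn0
    have h1 := (measure_unstable_le_mse (μ := μ) (ν := ν) (τ := τ) (ht n) (cHat n) R).trans
      (hn _ (const_mem_sobolevBall r le_rfl))
    have h2 : (Measure.pi fun _ : Fin n => μ) {x | ¬ StableDesign (t n) p (k n) τ x} ≤
        ENNReal.ofReal (1 / 4) := by
      have h3 := h1.trans (ENNReal.ofReal_le_ofReal hs.le)
      rw [ENNReal.ofReal_mul (by positivity)] at h3
      exact (ENNReal.mul_le_mul_iff_right (by simp [hR.ne']) ENNReal.ofReal_ne_top).1 h3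
    have h4 := noise_le_mse_zero hμb hν hν0 hΛ (ht n) hτ0 hn0 (hc n) (by positivity)
      (hn _ (const_mem_sobolevBall r (s := 0) (by simpa using sq_nonneg R))) h2
    rw [← rpow_root_div r hn0, div_le_iff₀ (by positivity)] at h4
    rw [Real.norm_natCast, Real.norm_of_nonneg (by positivity), div_mul_eq_mul_div,
      le_div_iff₀ hσ]
    calc _ = (∫ e, e ^ 2 ∂ν) * k n := by ring
      _ ≤ _ := h4
      _ = _ := by field_simp
  -- The approximation error gives `k^(-2r) ≤ C n^(-2r/(2r+1))` up to constants; comparison is made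
  -- between powers of order `2 r`.
  · obtain ⟨c, hc0, hcb⟩ := exists_mse_ge_of_spline r p hR
    have h2r : 2 * r ≠ 0 := by omega
    refine IsBigO.of_pow (n := 2 * r) h2r (IsBigO.of_bound (C / c) ?_)
    filter_upwards [hC, eventually_gt_atTop 0] with n hn hn0
    have hn' : (0 : ℝ) < n := by exact_mod_cast hn0
    have hk' : (0 : ℝ) < k n := by exact_mod_cast hk n
    obtain ⟨ψ, hψ, hmse⟩ := hcb (k n) n (t n) (hk n) (ht n) _
      (stableLse_eq_spline (t n) p (k n) τ (cHat n))
    have h1 := (hmse (sampleLaw μ ν n) inferInstance).trans (hn ψ hψ)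
    rw [ENNReal.ofReal_le_ofReal_iff (by positivity), ← inv_rpow_root_pow] at h1
    simp only [Pi.pow_apply]
    rw [Real.norm_of_nonneg (by positivity), Real.norm_of_nonneg (by positivity),
      div_mul_eq_mul_div, le_div_iff₀ hc0]
    have hN : (0 : ℝ) < ((n : ℝ) ^ (1 / (2 * (r : ℝ) + 1))) ^ (2 * r) := by positivity
    have hK : (0 : ℝ) < (k n : ℝ) ^ (2 * r) := by positivity
    rw [← div_eq_mul_inv, ← div_eq_mul_inv, div_le_div_iff₀ hK hN] at h1
    linarith

end Optimal

/-! ### Shifted Gaussian noise -/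

section GaussianShift

open ProbabilityTheory
open scoped NNReal

/-- The density of `N(m, v I)` with respect to `N(0, v I)`. -/
noncomputable def gaussianShiftDensity (v : ℝ≥0) {n : ℕ} (m e : Fin n → ℝ) : ℝ :=
  Real.exp (∑ i, (m i * e i / v - m i ^ 2 / (2 * v)))

theorem gaussianReal_map_add_eq_withDensity {v : ℝ≥0} (hv : v ≠ 0) (m : ℝ) :
    (gaussianReal 0 v).map (fun e => m + e) = (gaussianReal 0 v).withDensity fun e =>
      ENNReal.ofReal (Real.exp (m * e / v - m ^ 2 / (2 * v))) := by
  have hv' : (0 : ℝ) < v := by positivity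
  rw [gaussianReal_map_const_add, zero_add, gaussianReal_of_var_ne_zero _ hv,
    gaussianReal_of_var_ne_zero _ hv, ← withDensity_mul _ (measurable_gaussianPDF 0 v)
      (by fun_prop)]
  congr 1
  ext e
  rw [Pi.mul_apply, gaussianPDF, gaussianPDF, ← ENNReal.ofReal_mul (gaussianPDFReal_nonneg _ _ _),
    gaussianPDFReal, gaussianPDFReal, mul_assoc (_⁻¹), ← Real.exp_add]
  congr 3
  field_simp
  ring

theorem lintegral_pi_prod {n : ℕ} {γ : Measure ℝ} [IsProbabilityMeasure γ]
    {f : Fin n → ℝ → ENNReal} (hf : ∀ i, Measurable (f i)) :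
    ∫⁻ e, ∏ i, f i (e i) ∂(Measure.pi fun _ : Fin n => γ) = ∏ i, ∫⁻ e, f i e ∂γ := by
  have hind : iIndepFun (fun (i : Fin n) (e : Fin n → ℝ) => f i (e i))
      (Measure.pi fun _ : Fin n => γ) := iIndepFun_pi fun i => (hf i).aemeasurable
  rw [lintegral_prod_eq_prod_lintegral_of_indepFun Finset.univ _ hind
    fun i => (hf i).comp (measurable_pi_apply i)]
  exact Finset.prod_congr rfl fun i _ =>
    (measurePreserving_eval (fun _ : Fin n => γ) i).lintegral_comp (hf i)

theorem pi_gaussianReal_map_add {v : ℝ≥0} (hv : v ≠ 0) {n : ℕ} (m : Fin n → ℝ) :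
    (Measure.pi fun _ : Fin n => gaussianReal 0 v).map (fun e => m + e) =
      (Measure.pi fun _ : Fin n => gaussianReal 0 v).withDensity fun e =>
        ENNReal.ofReal (gaussianShiftDensity v m e) := by
  have h1 : (Measure.pi fun _ : Fin n => gaussianReal 0 v).map (fun e => m + e) =
      Measure.pi fun i => (gaussianReal 0 v).map (fun e => m i + e) :=
    Measure.pi_map_pi (f := fun i e => m i + e) fun i => by fun_prop
  have : ∀ i, IsProbabilityMeasure ((gaussianReal 0 v).map (fun e => m i + e)) := fun i =>
    Measure.isProbabilityMeasure_map (by fun_prop)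
  rw [h1]
  refine Measure.pi_eq fun s hs => ?_
  rw [withDensity_apply _ (MeasurableSet.univ_pi hs), ← lintegral_indicator (MeasurableSet.univ_pi hs)]
  have h2 : ∀ e : Fin n → ℝ, (univ.pi s).indicator
      (fun e => ENNReal.ofReal (gaussianShiftDensity v m e)) e =
      ∏ i, (s i).indicator (fun e => ENNReal.ofReal
        (Real.exp (m i * e / v - m i ^ 2 / (2 * v)))) (e i) := by
    intro e
    by_cases he : e ∈ univ.pi s
    · rw [indicator_of_mem he, gaussianShiftDensity, Real.exp_sum,
        ENNReal.ofReal_prod_of_nonneg fun _ _ => (Real.exp_pos _).le]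
      exact Finset.prod_congr rfl fun i _ => by rw [indicator_of_mem (he i (mem_univ i))]
    · rw [indicator_of_notMem he]
      simp only [Set.mem_pi, mem_univ, true_implies, not_forall] at he
      obtain ⟨i, hi⟩ := he
      exact (Finset.prod_eq_zero (Finset.mem_univ i) (indicator_of_notMem hi _)).symm
  simp only [h2]
  rw [lintegral_pi_prod fun i => Measurable.indicator (by fun_prop) (hs i)]
  refine Finset.prod_congr rfl fun i _ => ?_
  rw [gaussianReal_map_add_eq_withDensity hv, withDensity_apply _ (hs i),
    lintegral_indicator (hs i)]

theorem measurable_gaussianShiftDensity (v : ℝ≥0) {n : ℕ} (m : Fin n → ℝ) :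
    Measurable (gaussianShiftDensity v m) := by
  unfold gaussianShiftDensity
  fun_prop

theorem lintegral_gaussian_add {v : ℝ≥0} (hv : v ≠ 0) {n : ℕ} (m : Fin n → ℝ)
    {Φ : (Fin n → ℝ) → ENNReal} (hΦ : Measurable Φ) :
    ∫⁻ e, Φ (m + e) ∂(Measure.pi fun _ : Fin n => gaussianReal 0 v) =
      ∫⁻ e, ENNReal.ofReal (gaussianShiftDensity v m e) * Φ e
        ∂(Measure.pi fun _ : Fin n => gaussianReal 0 v) := by
  rw [← lintegral_map hΦ (by fun_prop), pi_gaussianReal_map_add hv,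
    lintegral_withDensity_eq_lintegral_mul _ (measurable_gaussianShiftDensity v m).ennreal_ofReal hΦ]
  rfl

theorem lintegral_gaussianShiftDensity {v : ℝ≥0} (hv : v ≠ 0) {n : ℕ} (m : Fin n → ℝ) :
    ∫⁻ e, ENNReal.ofReal (gaussianShiftDensity v m e)
      ∂(Measure.pi fun _ : Fin n => gaussianReal 0 v) = 1 := by
  have h := lintegral_gaussian_add hv m (Φ := fun _ => 1) measurable_const
  simpa using h.symm

/-- The terms linear in `e` cancel, so the product of opposite likelihood ratios is deterministic.
This is why the alternatives are placed symmetrically. -/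
theorem gaussianShiftDensity_mul_neg (v : ℝ≥0) {n : ℕ} (m e : Fin n → ℝ) :
    gaussianShiftDensity v m e * gaussianShiftDensity v (-m) e =
      Real.exp (-∑ i, m i ^ 2 / (2 * v)) ^ 2 := by
  rw [gaussianShiftDensity, gaussianShiftDensity, ← Real.exp_add, ← Real.exp_nat_mul,
    ← Finset.sum_add_distrib]
  congr 1
  rw [← Finset.sum_neg_distrib, Finset.mul_sum]
  exact Finset.sum_congr rfl fun i _ => by push_cast [Pi.neg_apply]; ring

/-- After multiplication by `P + Q`, the weighted squares equal a square plus `4 H² P Q`, and the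
rest is the square of `2 s - (P + Q) / 2`. As `P` and `Q` are likelihood ratios of mean `1`, the
correction integrates to the constant `H² / 2`, so no testing argument is needed. -/
theorem two_point_le {P Q s y H : ℝ} (hP : 0 < P) (hQ : 0 < Q) (hs : P * Q = s ^ 2) :
    2 * H ^ 2 * s ≤ (P * (y - H) ^ 2 + Q * (y + H) ^ 2) + H ^ 2 / 4 * (P + Q) := by
  have h1 : 2 * H ^ 2 * s * (P + Q) ≤
      ((P * (y - H) ^ 2 + Q * (y + H) ^ 2) + H ^ 2 / 4 * (P + Q)) * (P + Q) := by
    have h2 : (P * (y - H) ^ 2 + Q * (y + H) ^ 2) * (P + Q) =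
        (P * (y - H) + Q * (y + H)) ^ 2 + 4 * H ^ 2 * s ^ 2 := by rw [← hs]; ring
    have h3 : 0 ≤ H ^ 2 * (2 * s - (P + Q) / 2) ^ 2 := by positivity
    rw [add_mul, h2]
    nlinarith [sq_nonneg (P * (y - H) + Q * (y + H))]
  exact le_of_mul_le_mul_right h1 (by positivity)

/-- Le Cam's two-point bound for a fixed design. -/
theorem two_point_design {v : ℝ≥0} (hv : v ≠ 0) {n : ℕ} (c m : Fin n → ℝ) {g : (Fin n → ℝ) → ℝ}
    (hg : Measurable g) (H : ℝ) :
    ENNReal.ofReal (2 * H ^ 2 * Real.exp (-∑ i, m i ^ 2 / (2 * v))) ≤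
      (∫⁻ e, ENNReal.ofReal ((g (c + m + e) - H) ^ 2)
          ∂(Measure.pi fun _ : Fin n => gaussianReal 0 v) +
        ∫⁻ e, ENNReal.ofReal ((g (c + -m + e) + H) ^ 2)
          ∂(Measure.pi fun _ : Fin n => gaussianReal 0 v)) + ENNReal.ofReal (H ^ 2 / 2) := by
  have hgc : Measurable fun e => g (c + e) := hg.comp (by fun_prop)
  have hm1 : Measurable fun e => ENNReal.ofReal ((g (c + e) - H) ^ 2) :=
    ((hgc.sub_const H).pow_const 2).ennreal_ofReal
  have hm2 : Measurable fun e => ENNReal.ofReal ((g (c + e) + H) ^ 2) :=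
    ((hgc.add_const H).pow_const 2).ennreal_ofReal
  have hd : ∀ m : Fin n → ℝ, Measurable fun e => ENNReal.ofReal (gaussianShiftDensity v m e) :=
    fun m => (measurable_gaussianShiftDensity v m).ennreal_ofReal
  have e1 := lintegral_gaussian_add hv m hm1
  have e2 := lintegral_gaussian_add hv (-m) hm2
  simp only [← add_assoc] at e1 e2
  rw [e1, e2]
  have e3 : ENNReal.ofReal (H ^ 2 / 2) = ∫⁻ e, ENNReal.ofReal (H ^ 2 / 4) *
      (ENNReal.ofReal (gaussianShiftDensity v m e) + ENNReal.ofReal (gaussianShiftDensity v (-m) e))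
      ∂(Measure.pi fun _ : Fin n => gaussianReal 0 v) := by
    have h1 : Measurable fun e => ENNReal.ofReal (gaussianShiftDensity v m e) +
        ENNReal.ofReal (gaussianShiftDensity v (-m) e) := (hd m).add (hd (-m))
    rw [lintegral_const_mul _ h1, lintegral_add_left (hd m),
      lintegral_gaussianShiftDensity hv, lintegral_gaussianShiftDensity hv, mul_add, mul_one,
      ← ENNReal.ofReal_add (by positivity) (by positivity)]
    congr 1
    ring
  have q1 : Measurable fun e => ENNReal.ofReal (gaussianShiftDensity v m e) *
      ENNReal.ofReal ((g (c + e) - H) ^ 2) := (hd m).mul hm1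
  have q2 : Measurable fun e => ENNReal.ofReal (gaussianShiftDensity v m e) *
      ENNReal.ofReal ((g (c + e) - H) ^ 2) + ENNReal.ofReal (gaussianShiftDensity v (-m) e) *
      ENNReal.ofReal ((g (c + e) + H) ^ 2) := q1.add ((hd (-m)).mul hm2)
  rw [e3, ← lintegral_add_left q1, ← lintegral_add_left q2]
  calc _ = ∫⁻ _, ENNReal.ofReal (2 * H ^ 2 * Real.exp (-∑ i, m i ^ 2 / (2 * v)))
        ∂(Measure.pi fun _ : Fin n => gaussianReal 0 v) := by simp
    _ ≤ _ := by
        refine lintegral_mono fun e => ?_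
        have hP : 0 < gaussianShiftDensity v m e := Real.exp_pos _
        have hQ : 0 < gaussianShiftDensity v (-m) e := Real.exp_pos _
        have h1 := two_point_le (y := g (c + e)) (H := H) hP hQ (gaussianShiftDensity_mul_neg v m e)
        refine (ENNReal.ofReal_le_ofReal h1).trans (le_of_eq ?_)
        rw [ENNReal.ofReal_add (by positivity) (by positivity),
          ENNReal.ofReal_add (by positivity) (by positivity), ENNReal.ofReal_mul hP.le,
          ENNReal.ofReal_mul hQ.le, ENNReal.ofReal_mul (by positivity),
          ENNReal.ofReal_add hP.le hQ.le]

/-- Le Cam's two-point bound for the random design. -/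
theorem two_point_sample {v : ℝ≥0} (hv : v ≠ 0) {n : ℕ} {μ : Measure ℝ} [IsProbabilityMeasure μ]
    {c φ : ℝ → ℝ} (hc : Measurable c) (hφ : Measurable φ) (hφL : MemLp φ 2 μ)
    {T : (Fin n → ℝ) → (Fin n → ℝ) → ℝ} (hT : Measurable fun q : (Fin n → ℝ) × (Fin n → ℝ) => T q.1 q.2)
    (H : ℝ) :
    ENNReal.ofReal (2 * H ^ 2) ≤
      (∫⁻ z, ENNReal.ofReal ((T z.1 (fun i => c (z.1 i) + φ (z.1 i) + z.2 i) - H) ^ 2)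
          ∂(sampleLaw μ (gaussianReal 0 v) n) +
        ∫⁻ z, ENNReal.ofReal ((T z.1 (fun i => c (z.1 i) + -φ (z.1 i) + z.2 i) + H) ^ 2)
          ∂(sampleLaw μ (gaussianReal 0 v) n)) + ENNReal.ofReal (H ^ 2 / 2) +
      ENNReal.ofReal (H ^ 2 * (n * (∫ x, φ x ^ 2 ∂μ) / v)) := by
  have hv' : (0 : ℝ) < v := by positivity
  have m1 : Measurable fun z : (Fin n → ℝ) × (Fin n → ℝ) =>
      ENNReal.ofReal ((T z.1 (fun i => c (z.1 i) + φ (z.1 i) + z.2 i) - H) ^ 2) := by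
    have h1 : Measurable fun z : (Fin n → ℝ) × (Fin n → ℝ) =>
        (z.1, fun i => c (z.1 i) + φ (z.1 i) + z.2 i) := by fun_prop
    exact (((hT.comp h1).sub_const H).pow_const 2).ennreal_ofReal
  have m2 : Measurable fun z : (Fin n → ℝ) × (Fin n → ℝ) =>
      ENNReal.ofReal ((T z.1 (fun i => c (z.1 i) + -φ (z.1 i) + z.2 i) + H) ^ 2) := by
    have h1 : Measurable fun z : (Fin n → ℝ) × (Fin n → ℝ) =>
        (z.1, fun i => c (z.1 i) + -φ (z.1 i) + z.2 i) := by fun_prop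
    exact (((hT.comp h1).add_const H).pow_const 2).ennreal_ofReal
  set d : (Fin n → ℝ) → ℝ := fun x => ∑ i, φ (x i) ^ 2 / (2 * v) with hd
  have hd0 : ∀ x, 0 ≤ d x := fun x => Finset.sum_nonneg fun _ _ => by positivity
  have hdm : Measurable d := by fun_prop
  have hdi : ∀ i : Fin n, Integrable (fun x : Fin n → ℝ => φ (x i) ^ 2)
      (Measure.pi fun _ : Fin n => μ) := fun i => (memLp_comp_eval hφL i).integrable_sq
  have hdint : ∫⁻ x, ENNReal.ofReal (2 * H ^ 2 * d x) ∂(Measure.pi fun _ : Fin n => μ) =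
      ENNReal.ofReal (H ^ 2 * (n * (∫ x, φ x ^ 2 ∂μ) / v)) := by
    rw [← ofReal_integral_eq_lintegral_ofReal ((integrable_finsetSum _ fun i _ =>
      (hdi i).div_const _).const_mul _) (Eventually.of_forall fun x => mul_nonneg (by positivity) (hd0 x)),
      integral_const_mul]
    rw [integral_finsetSum _ fun i _ => (hdi i).div_const _]
    simp only [integral_div]
    have h1 : ∀ i : Fin n, ∫ x, φ (x i) ^ 2 ∂(Measure.pi fun _ : Fin n => μ) = ∫ x, φ x ^ 2 ∂μ :=
      fun i => integral_comp_eval_eq (f := fun x => φ x ^ 2) hφL.integrable_sq.1 i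
    simp only [h1, Finset.sum_const, Finset.card_univ, Fintype.card_fin, nsmul_eq_mul]
    congr 1
    field_simp
  rw [← hdint, sampleLaw, lintegral_prod _ m1.aemeasurable, lintegral_prod _ m2.aemeasurable,
    ← lintegral_add_left m1.lintegral_prod_right']
  calc _ = ∫⁻ _, ENNReal.ofReal (2 * H ^ 2) ∂(Measure.pi fun _ : Fin n => μ) := by simp
    _ ≤ ∫⁻ x, ((∫⁻ e, ENNReal.ofReal ((T x (fun i => c (x i) + φ (x i) + e i) - H) ^ 2)
          ∂(Measure.pi fun _ : Fin n => gaussianReal 0 v) +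
        ∫⁻ e, ENNReal.ofReal ((T x (fun i => c (x i) + -φ (x i) + e i) + H) ^ 2)
          ∂(Measure.pi fun _ : Fin n => gaussianReal 0 v)) + ENNReal.ofReal (H ^ 2 / 2) +
        ENNReal.ofReal (2 * H ^ 2 * d x)) ∂(Measure.pi fun _ : Fin n => μ) := by
        refine lintegral_mono fun x => ?_
        have h1 := two_point_design hv (fun i => c (x i)) (fun i => φ (x i)) (g := T x)
          (hT.comp measurable_prodMk_left) H
        -- The bound `exp (-d) ≥ 1 - d` makes the loss linear in the design, so only its mean
        -- enters.
        have h2 : 2 * H ^ 2 ≤ 2 * H ^ 2 * Real.exp (-d x) + 2 * H ^ 2 * d x := by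
          have := Real.add_one_le_exp (-d x)
          nlinarith [sq_nonneg H]
        refine (ENNReal.ofReal_le_ofReal h2).trans ?_
        rw [ENNReal.ofReal_add (by positivity) (mul_nonneg (by positivity) (hd0 x))]
        exact add_le_add h1 le_rfl
    _ = _ := by
        rw [lintegral_add_right _ ((hdm.const_mul _).ennreal_ofReal),
          lintegral_add_right _ measurable_const]
        simp

end GaussianShift

/-! ### The minimax lower bound -/

section Minimax

open ProbabilityTheory
open scoped NNReal

variable {G : ℕ → ℝ → ℝ} {ρ b : ℝ} {m n : ℕ} {μ : Measure ℝ} {v : ℝ≥0}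

/-- The vector of signs that corresponds to a vertex of the hypercube. -/
noncomputable def signs (θ : Fin m → Bool) (j : Fin m) : ℝ := if θ j then 1 else -1

theorem signs_sq (θ : Fin m → Bool) (j : Fin m) : signs θ j ^ 2 = 1 := by
  unfold signs
  split_ifs <;> norm_num

theorem signs_update_not (θ : Fin m → Bool) (j : Fin m) :
    signs (Function.update θ j (!θ j)) = Function.update (signs θ) j (-signs θ j) := by
  ext i
  by_cases h : i = j
  · subst h
    simp only [signs, Function.update_self]
    cases θ i <;> simp
  · simp [signs, Function.update_of_ne h]

theorem bumpSum_update (α : Fin m → ℝ) (j : Fin m) (s y : ℝ) :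
    bumpSum G ρ m (Function.update α j s) 0 y =
      bumpSum G ρ m (Function.update α j 0) 0 y + ρ * s * G 0 (m * y - (j : ℕ)) := by
  have h1 : ∑ i, Function.update α j s i * G 0 (m * y - (i : ℕ)) -
      ∑ i, Function.update α j 0 i * G 0 (m * y - (i : ℕ)) = s * G 0 (m * y - (j : ℕ)) := by
    rw [← Finset.sum_sub_distrib, Finset.sum_eq_single j]
    · simp
    · intro i _ hi
      simp [Function.update_of_ne hi]
    · simp
  simp only [bumpSum, pow_zero, mul_one]
  linear_combination ρ * h1

theorem IsBump.bumpSum_eq_of_ne_zero (hG : IsBump G) (α : Fin m → ℝ) {j : Fin m} {u : ℝ}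
    (hu : G 0 (m * u - (j : ℕ)) ≠ 0) :
    bumpSum G ρ m α 0 u = ρ * α j * G 0 (m * u - (j : ℕ)) := by
  rw [bumpSum, pow_zero, mul_one, Finset.sum_eq_single j]
  · ring
  · intro i _ hi
    have h := hG.mul_eq_zero 0 (i := i) (j := j) (fun h => hi (Fin.ext h)) (m * u)
    rw [(_root_.mul_eq_zero.1 h).resolve_right hu, mul_zero]
  · simp

/-- The mean squared error at the point `u`. -/
noncomputable def pointMse (P : Measure ((Fin n → ℝ) × (Fin n → ℝ)))
    (T : (Fin n → ℝ) → (Fin n → ℝ) → ℝ → ℝ) (ψ : ℝ → ℝ) (u : ℝ) : ENNReal :=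
  ∫⁻ z, ENNReal.ofReal ((estimate T ψ z u - ψ u) ^ 2) ∂P

theorem measurable_estimate_sub_sq {T : (Fin n → ℝ) → (Fin n → ℝ) → ℝ → ℝ}
    (hT : Measurable (fun q : (Fin n → ℝ) × (Fin n → ℝ) × ℝ => T q.1 q.2.1 q.2.2)) {ψ : ℝ → ℝ}
    (hψ : Measurable ψ) :
    Measurable fun q : ((Fin n → ℝ) × (Fin n → ℝ)) × ℝ =>
      ENNReal.ofReal ((estimate T ψ q.1 q.2 - ψ q.2) ^ 2) := by
  have h1 : Measurable fun q : ((Fin n → ℝ) × (Fin n → ℝ)) × ℝ =>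
      (q.1.1, (fun i => ψ (q.1.1 i) + q.1.2 i), q.2) := by fun_prop
  exact (((hT.comp h1).sub (hψ.comp measurable_snd)).pow_const 2).ennreal_ofReal

theorem mse_eq_lintegral_pointMse {P : Measure ((Fin n → ℝ) × (Fin n → ℝ))} [SFinite P]
    {T : (Fin n → ℝ) → (Fin n → ℝ) → ℝ → ℝ}
    (hT : Measurable (fun q : (Fin n → ℝ) × (Fin n → ℝ) × ℝ => T q.1 q.2.1 q.2.2)) {ψ : ℝ → ℝ}
    (hψ : Measurable ψ) : mse P T ψ = ∫⁻ u in Icc (0 : ℝ) 1, pointMse P T ψ u :=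
  lintegral_lintegral_swap (measurable_estimate_sub_sq hT hψ).aemeasurable

theorem measurable_pointMse {P : Measure ((Fin n → ℝ) × (Fin n → ℝ))} [SFinite P]
    {T : (Fin n → ℝ) → (Fin n → ℝ) → ℝ → ℝ}
    (hT : Measurable (fun q : (Fin n → ℝ) × (Fin n → ℝ) × ℝ => T q.1 q.2.1 q.2.2)) {ψ : ℝ → ℝ}
    (hψ : Measurable ψ) : Measurable (pointMse P T ψ) :=
  (measurable_estimate_sub_sq hT hψ).lintegral_prod_left'

/-- Two neighbouring vertices of the hypercube cannot both be estimated well. -/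
theorem IsBump.le_pointMse_add (hG : IsBump G) (hv : v ≠ 0) [IsProbabilityMeasure μ]
    (hμb : μ ≤ ENNReal.ofReal b • volume.restrict (Icc (0 : ℝ) 1))
    (hρ : n * (b * (ρ ^ 2 * ((m : ℝ)⁻¹ * ∫ x in (0 : ℝ)..1, G 0 x ^ 2))) ≤ v)
    {T : (Fin n → ℝ) → (Fin n → ℝ) → ℝ → ℝ}
    (hT : Measurable (fun q : (Fin n → ℝ) × (Fin n → ℝ) × ℝ => T q.1 q.2.1 q.2.2))
    (θ : Fin m → Bool) {j : Fin m} {u : ℝ} (hu : G 0 (m * u - (j : ℕ)) ≠ 0) :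
    ENNReal.ofReal (bumpSum G ρ m (fun _ => 1) 0 u ^ 2 / 2) ≤
      pointMse (sampleLaw μ (gaussianReal 0 v) n) T (bumpSum G ρ m (signs θ) 0) u +
      pointMse (sampleLaw μ (gaussianReal 0 v) n) T
        (bumpSum G ρ m (signs (Function.update θ j (!θ j))) 0) u := by
  have hb : 1 ≤ b := one_le_of_le hμb
  have hv' : (0 : ℝ) < v := by positivity
  set s := signs θ j with hs
  have hs2 : s ^ 2 = 1 := signs_sq θ j
  set c : ℝ → ℝ := bumpSum G ρ m (Function.update (signs θ) j 0) 0 with hc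
  set φ : ℝ → ℝ := fun y => ρ * s * G 0 (m * y - (j : ℕ)) with hφ
  have hφc : Continuous φ := continuous_const.mul ((hG.continuous 0).comp (by fun_prop))
  have h1 : ∀ y, bumpSum G ρ m (signs θ) 0 y = c y + φ y := by
    intro y
    have := bumpSum_update (G := G) (ρ := ρ) (signs θ) j (signs θ j) y
    rwa [Function.update_eq_self] at this
  have h2 : ∀ y, bumpSum G ρ m (signs (Function.update θ j (!θ j))) 0 y = c y + -φ y := by
    intro y
    rw [signs_update_not, bumpSum_update]
    simp only [hφ, hs]
    ring
  have hcu : c u = 0 := by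
    rw [hc, hG.bumpSum_eq_of_ne_zero _ hu, Function.update_self]
    ring
  have hφL : MemLp φ 2 (volume.restrict (Icc (0 : ℝ) 1)) := by
    obtain ⟨C, hC⟩ := isCompact_Icc.exists_bound_of_continuousOn hφc.continuousOn
      (s := Icc (0 : ℝ) 1)
    exact MemLp.of_bound hφc.aestronglyMeasurable C ((ae_restrict_mem measurableSet_Icc).mono hC)
  have hTu : Measurable fun q : (Fin n → ℝ) × (Fin n → ℝ) => T q.1 q.2 u :=
    hT.comp (show Measurable fun q : (Fin n → ℝ) × (Fin n → ℝ) => (q.1, q.2, u) by fun_prop)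
  have key := two_point_sample hv (hG.continuous_bumpSum 0).measurable hφc.measurable
    (memLp_of_le hμb hφL) (c := c) (T := fun x y => T x y u) hTu (φ u)
  have e1 : pointMse (sampleLaw μ (gaussianReal 0 v) n) T (bumpSum G ρ m (signs θ) 0) u =
      ∫⁻ z, ENNReal.ofReal ((T z.1 (fun i => c (z.1 i) + φ (z.1 i) + z.2 i) u - φ u) ^ 2)
          ∂(sampleLaw μ (gaussianReal 0 v) n) := by
    simp only [pointMse, estimate, h1, hcu, zero_add]
  have e2 : pointMse (sampleLaw μ (gaussianReal 0 v) n) T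
        (bumpSum G ρ m (signs (Function.update θ j (!θ j))) 0) u =
      ∫⁻ z, ENNReal.ofReal ((T z.1 (fun i => c (z.1 i) + -φ (z.1 i) + z.2 i) u + φ u) ^ 2)
          ∂(sampleLaw μ (gaussianReal 0 v) n) := by
    simp only [pointMse, estimate, h2, hcu, zero_add, sub_neg_eq_add]
  rw [← e1, ← e2] at key
  have hnorm : bumpSum G ρ m (fun _ => 1) 0 u ^ 2 = φ u ^ 2 := by
    rw [hG.bumpSum_eq_of_ne_zero _ hu]
    simp only [hφ]
    linear_combination (-(ρ ^ 2 * G 0 (m * u - (j : ℕ)) ^ 2)) * hs2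
  -- The signal-to-noise ratio of a single bump is at most `1`; this is the meaning of `hρ`.
  have hint : n * (∫ x, φ x ^ 2 ∂μ) / v ≤ 1 := by
    rw [div_le_one hv']
    refine le_trans (mul_le_mul_of_nonneg_left ?_ n.cast_nonneg) hρ
    refine (integral_le_of_le (by linarith) hμb (f := fun x => φ x ^ 2) (fun _ => sq_nonneg _)
      hφL.integrable_sq).trans (le_of_eq ?_)
    simp only [hφ, mul_pow, hs2, mul_one]
    rw [intervalIntegral.integral_const_mul, hG.integral_comp_sq 0 j.2]
  have h3 : ENNReal.ofReal (φ u ^ 2 * (n * (∫ x, φ x ^ 2 ∂μ) / v)) ≤ ENNReal.ofReal (φ u ^ 2) :=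
    ENNReal.ofReal_le_ofReal (mul_le_of_le_one_right (sq_nonneg _) hint)
  rw [hnorm]
  have h4 := key.trans (add_le_add le_rfl h3)
  -- Of the main term `2 φ²`, the overlap correction takes `φ² / 2` and the information loss at most
  -- `φ²`, which leaves `φ² / 2`.
  have h5 : ENNReal.ofReal (2 * φ u ^ 2) = ENNReal.ofReal (φ u ^ 2 / 2) +
      (ENNReal.ofReal (φ u ^ 2 / 2) + ENNReal.ofReal (φ u ^ 2)) := by
    rw [← ENNReal.ofReal_add (by positivity) (by positivity),
      ← ENNReal.ofReal_add (by positivity) (by positivity)]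
    congr 1
    ring
  rw [h5, add_assoc] at h4
  exact (ENNReal.add_le_add_iff_right (by simp)).1 h4

/-- At most one bump is alive at `u`. Flipping its sign is an involution of the hypercube, so
summing the two-point bound over all vertices counts every vertex twice. Where no bump is alive the
left side is zero. -/
theorem IsBump.le_sum_pointMse (hG : IsBump G) (hv : v ≠ 0) [IsProbabilityMeasure μ]
    (hμb : μ ≤ ENNReal.ofReal b • volume.restrict (Icc (0 : ℝ) 1))
    (hρ : n * (b * (ρ ^ 2 * ((m : ℝ)⁻¹ * ∫ x in (0 : ℝ)..1, G 0 x ^ 2))) ≤ v)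
    {T : (Fin n → ℝ) → (Fin n → ℝ) → ℝ → ℝ}
    (hT : Measurable (fun q : (Fin n → ℝ) × (Fin n → ℝ) × ℝ => T q.1 q.2.1 q.2.2)) (u : ℝ) :
    (Fintype.card (Fin m → Bool) : ENNReal) *
        ENNReal.ofReal (bumpSum G ρ m (fun _ => 1) 0 u ^ 2 / 2) ≤
      2 * ∑ θ : Fin m → Bool,
        pointMse (sampleLaw μ (gaussianReal 0 v) n) T (bumpSum G ρ m (signs θ) 0) u := by
  by_cases h : ∃ j : Fin m, G 0 (m * u - (j : ℕ)) ≠ 0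
  · obtain ⟨j, hj⟩ := h
    have hinv : Function.Involutive fun θ : Fin m → Bool => Function.update θ j (!θ j) := by
      intro θ
      simp
    have h1 : ∑ θ : Fin m → Bool, pointMse (sampleLaw μ (gaussianReal 0 v) n) T
        (bumpSum G ρ m (signs (Function.update θ j (!θ j))) 0) u = ∑ θ : Fin m → Bool,
        pointMse (sampleLaw μ (gaussianReal 0 v) n) T (bumpSum G ρ m (signs θ) 0) u :=
      Equiv.sum_comp hinv.toPerm fun θ =>
        pointMse (sampleLaw μ (gaussianReal 0 v) n) T (bumpSum G ρ m (signs θ) 0) u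
    calc _ = ∑ _θ : Fin m → Bool, ENNReal.ofReal (bumpSum G ρ m (fun _ => 1) 0 u ^ 2 / 2) := by
          rw [Finset.sum_const, Finset.card_univ, nsmul_eq_mul]
      _ ≤ _ := Finset.sum_le_sum fun θ _ => hG.le_pointMse_add hv hμb hρ hT θ hj
      _ = _ := by rw [Finset.sum_add_distrib, h1, two_mul]
  · push Not at h
    have h1 : bumpSum G ρ m (fun _ => 1) 0 u = 0 := by
      simp [bumpSum, h]
    simp [h1]

/-- Assouad's lower bound over the hypercube of bump sums. -/
theorem IsBump.exists_le_mse (hG : IsBump G) (hv : v ≠ 0) [IsProbabilityMeasure μ]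
    (hμb : μ ≤ ENNReal.ofReal b • volume.restrict (Icc (0 : ℝ) 1))
    (hρ : n * (b * (ρ ^ 2 * ((m : ℝ)⁻¹ * ∫ x in (0 : ℝ)..1, G 0 x ^ 2))) ≤ v)
    {T : (Fin n → ℝ) → (Fin n → ℝ) → ℝ → ℝ}
    (hT : Measurable (fun q : (Fin n → ℝ) × (Fin n → ℝ) × ℝ => T q.1 q.2.1 q.2.2)) :
    ∃ θ : Fin m → Bool, ENNReal.ofReal ((∫ u in (0 : ℝ)..1, bumpSum G ρ m (fun _ => 1) 0 u ^ 2) / 4) ≤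
      mse (sampleLaw μ (gaussianReal 0 v) n) T (bumpSum G ρ m (signs θ) 0) := by
  set P := sampleLaw μ (gaussianReal 0 v) n with hP
  set N := ∫ u in (0 : ℝ)..1, bumpSum G ρ m (fun _ => 1) 0 u ^ 2 with hN
  -- The worst vertex is at least as bad as the average one.
  obtain ⟨θ, -, hθ⟩ := Finset.exists_max_image Finset.univ
    (fun θ : Fin m → Bool => mse P T (bumpSum G ρ m (signs θ) 0)) Finset.univ_nonempty
  refine ⟨θ, ?_⟩
  have hm : ∀ θ : Fin m → Bool, Measurable (bumpSum G ρ m (signs θ) 0) := fun θ =>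
    (hG.continuous_bumpSum 0).measurable
  have hL := (hG.hasSobolevDerivs (ρ := ρ) (α := fun _ : Fin m => (1 : ℝ)) 0).memLp_self
  have hcard : (Fintype.card (Fin m → Bool) : ENNReal) ≠ 0 := by
    exact_mod_cast Fintype.card_ne_zero
  have h1 : (Fintype.card (Fin m → Bool) : ENNReal) * ENNReal.ofReal (N / 2) ≤
      (Fintype.card (Fin m → Bool) : ENNReal) * (2 * mse P T (bumpSum G ρ m (signs θ) 0)) := by
    calc _ = ∫⁻ u in Icc (0 : ℝ) 1, (Fintype.card (Fin m → Bool) : ENNReal) *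
          ENNReal.ofReal (bumpSum G ρ m (fun _ => 1) 0 u ^ 2 / 2) := by
          rw [lintegral_const_mul' _ _ (ENNReal.natCast_ne_top _),
            ← ofReal_integral_eq_lintegral_ofReal (hL.integrable_sq.div_const 2)
              (Eventually.of_forall fun _ => by positivity), integral_div, hN,
            intervalIntegral.integral_of_le zero_le_one, integral_Icc_eq_integral_Ioc]
      _ ≤ ∫⁻ u in Icc (0 : ℝ) 1, 2 * ∑ θ : Fin m → Bool,
          pointMse P T (bumpSum G ρ m (signs θ) 0) u :=
          lintegral_mono fun u => hG.le_sum_pointMse hv hμb hρ hT u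
      _ = 2 * ∑ θ : Fin m → Bool, mse P T (bumpSum G ρ m (signs θ) 0) := by
          rw [lintegral_const_mul' _ _ (by simp),
            lintegral_finsetSum _ fun θ _ => measurable_pointMse hT (hm θ)]
          simp only [mse_eq_lintegral_pointMse hT (hm _)]
      _ ≤ 2 * ((Fintype.card (Fin m → Bool) : ENNReal) * mse P T (bumpSum G ρ m (signs θ) 0)) := by
          gcongr
          refine (Finset.sum_le_card_nsmul _ _ _ hθ).trans (le_of_eq ?_)
          rw [Finset.card_univ, nsmul_eq_mul]
      _ = _ := by ring
  have h2 := (ENNReal.mul_le_mul_iff_right hcard (ENNReal.natCast_ne_top _)).1 h1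
  have h3 : ENNReal.ofReal (N / 2) = 2 * ENNReal.ofReal (N / 4) := by
    rw [show N / 2 = 2 * (N / 4) by ring, ENNReal.ofReal_mul (by norm_num)]
    simp
  rw [h3] at h2
  exact (ENNReal.mul_le_mul_iff_right (by simp) (by simp)).1 h2

/-- With `m` bumps of amplitude of order `m^(-r)` the ball condition holds, the information in one
bump is of order `n / m^(2r+1)`, and the separation is of order `m^(-2r)`. The number of bumps is
taken as small as the information bound allows; `δ` is fixed by the radius and the noise level. -/
theorem exists_minimax_const (r : ℕ) {R : ℝ} (hR : 0 < R) [IsProbabilityMeasure μ]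
    (hμb : μ ≤ ENNReal.ofReal b • volume.restrict (Icc (0 : ℝ) 1)) {σ : ℝ} (hσ : 0 < σ) :
    ∃ c : ℝ, 0 < c ∧ ∀ n : ℕ, 1 ≤ n →
      ∀ T : (Fin n → ℝ) → (Fin n → ℝ) → ℝ → ℝ,
        Measurable (fun q : (Fin n → ℝ) × (Fin n → ℝ) × ℝ => T q.1 q.2.1 q.2.2) →
        ∃ ψ ∈ sobolevBall r R,
          ENNReal.ofReal (c * (n : ℝ) ^ (-(2 * (r : ℝ)) / (2 * (r : ℝ) + 1))) ≤
            mse (sampleLaw μ (gaussianReal 0 (σ ^ 2).toNNReal) n) T ψ := by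
  have hb : 1 ≤ b := one_le_of_le hμb
  have hv : (σ ^ 2).toNNReal ≠ 0 := by
    rw [ne_eq, Real.toNNReal_eq_zero, not_le]
    positivity
  obtain ⟨G, hG⟩ := exists_isBump
  set s := ∑ l ∈ Finset.range (r + 1), ∫ x in (0 : ℝ)..1, G l x ^ 2 with hs
  have hs0 : 0 ≤ s := Finset.sum_nonneg fun l _ =>
    intervalIntegral.integral_nonneg zero_le_one fun _ _ => sq_nonneg _
  set β := ∫ x in (0 : ℝ)..1, G 0 x ^ 2 with hβ
  have hβ0 : 0 < β := hG.integral_pos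
  obtain ⟨δ, hδ0, hδ, hδ'⟩ : ∃ δ : ℝ, 0 < δ ∧ δ ^ 2 * s ≤ R ^ 2 ∧ δ ^ 2 * (b * β) ≤ σ ^ 2 := by
    have h1 : ∀ q y : ℝ, 0 ≤ q → 0 < y → ∀ δ : ℝ, 0 < δ → δ ≤ y / (1 + q) → δ ^ 2 * q ≤ y ^ 2 := by
      intro q y hq hy δ hδ hle
      rw [le_div_iff₀ (by positivity)] at hle
      calc δ ^ 2 * q ≤ δ ^ 2 * (1 + q) ^ 2 := by gcongr; nlinarith
        _ = (δ * (1 + q)) ^ 2 := by ring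
        _ ≤ y ^ 2 := by gcongr
    have hq : 0 ≤ b * β := by positivity
    have hδ0 : 0 < min (R / (1 + s)) (σ / (1 + b * β)) := lt_min (by positivity) (by positivity)
    exact ⟨_, hδ0, h1 s R hs0 hR _ hδ0 (min_le_left _ _),
      h1 _ σ hq hσ _ hδ0 (min_le_right _ _)⟩
  refine ⟨δ ^ 2 * β * ((2 : ℝ) ^ (2 * r))⁻¹ / 4, by positivity, fun n hn T hT => ?_⟩
  have hn1 : (1 : ℝ) ≤ n := by exact_mod_cast hn
  set x : ℝ := (n : ℝ) ^ (1 / (2 * (r : ℝ) + 1)) with hx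
  have hx1 : 1 ≤ x := Real.one_le_rpow hn1 (by positivity)
  -- Rounding up keeps `n ≤ m^(2r+1)`, while `m ≤ 2 x` preserves the rate.
  set m : ℕ := ⌈x⌉₊ with hm
  have hxm : x ≤ m := Nat.le_ceil x
  have hm0 : 0 < m := Nat.ceil_pos.2 (by linarith)
  have hm' : (0 : ℝ) < m := by exact_mod_cast hm0
  have hm2 : (m : ℝ) ≤ 2 * x := by
    have := Nat.ceil_lt_add_one (show 0 ≤ x by linarith)
    linarith
  have hxn : x ^ (2 * r + 1) = n := by
    rw [hx, one_div]
    have := Real.rpow_inv_natCast_pow (Nat.cast_nonneg (α := ℝ) n) (n := 2 * r + 1) (by omega)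
    push_cast at this
    exact this
  have hnm : (n : ℝ) ≤ (m : ℝ) ^ (2 * r + 1) := by
    rw [← hxn]
    gcongr
  have hsep : n * (b * ((δ * ((m : ℝ) ^ r)⁻¹) ^ 2 * ((m : ℝ)⁻¹ * β))) ≤
      ((σ ^ 2).toNNReal : ℝ) := by
    rw [Real.coe_toNNReal _ (sq_nonneg _)]
    calc _ = δ ^ 2 * (b * β) * (n / (m : ℝ) ^ (2 * r + 1)) := by
          field_simp
          ring
      _ ≤ δ ^ 2 * (b * β) * 1 := by
          gcongr
          exact (div_le_one (by positivity)).2 hnm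
      _ ≤ _ := by rw [mul_one]; exact hδ'
  obtain ⟨θ, hθ⟩ := hG.exists_le_mse hv hμb hsep hT
  refine ⟨_, hG.mem_sobolevBall hδ hm0 (α := signs θ) (by simp [signs_sq]), ?_⟩
  refine (ENNReal.ofReal_le_ofReal ?_).trans hθ
  have hone : ∑ _j : Fin m, (1 : ℝ) ^ 2 = m := by simp
  rw [hG.integral_bumpSum_sq, hone, inv_mul_cancel₀ hm'.ne', mul_zero, pow_zero, mul_one, mul_one,
    ← inv_rpow_root_pow, mul_pow, inv_pow, ← pow_mul, mul_comm r 2]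
  calc _ = δ ^ 2 * ((2 * x) ^ (2 * r))⁻¹ * β / 4 := by
        rw [mul_pow 2 x, mul_inv]
        ring
    _ ≤ _ := by gcongr

end Minimax

end SplineReg

theorem corollary2
    -- smoothness `r ≥ 1`, splines of degree `p`, that is, of order `p + 1 ≥ r`
    (r p : ℕ) (hr : 1 ≤ r) (hp : r ≤ p + 1)
    -- radius of the Sobolev ball and mesh ratio of the knots
    (R Λ : ℝ) (hR : 0 < R) (hΛ : 1 ≤ Λ)
    -- the design law has a density on `[0,1]` with values in `[a, b]`
    (μ : Measure ℝ) [IsProbabilityMeasure μ] (a b : ℝ) (ha : 0 < a)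
    (hμa : ENNReal.ofReal a • volume.restrict (Icc (0 : ℝ) 1) ≤ μ)
    (hμb : μ ≤ ENNReal.ofReal b • volume.restrict (Icc (0 : ℝ) 1))
    -- the noise has mean zero and finite variance
    (ν : Measure ℝ) [IsProbabilityMeasure ν] (hν : MemLp id 2 ν) (hν0 : ∫ e, e ∂ν = 0)
    -- threshold of the stability check
    (τ : ℝ) (hτ0 : 0 < τ) (hτa : τ < a) :
    -- squared bias `O(k^{-2r})` and variance `O(k/n)`, uniformly over the Sobolev ball
    (∃ C c : ℝ, 0 < C ∧ 0 < c ∧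
      ∀ n k : ℕ, 2 ≤ n → 1 ≤ k → (k : ℝ) * Real.log n ≤ c * n →
      ∀ t : ℕ → ℝ, SplineReg.QuasiUniformKnots Λ p k t →
      ∀ cHat : (Fin n → ℝ) → (Fin n → ℝ) → Fin (k + p + 1) → ℝ,
        SplineReg.IsLeastSquares t p k n cHat →
        -- least squares conditionally on the design, except for designs of probability `≤ 1/n`
        (Measure.pi fun _ : Fin n => μ)
            {x | ¬ (SplineReg.StableDesign t p k τ x ∧
              ∀ ψ ∈ SplineReg.sobolevBall r R,
                SplineReg.BiasVarianceBound (SplineReg.givenDesign ν x)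
                  (SplineReg.lse t p k cHat) ψ
                  (C * ((k : ℝ) ^ (2 * r))⁻¹) (C * ((k : ℝ) / n)))}
          ≤ ENNReal.ofReal (1 / (n : ℝ)) ∧
        -- unconditionally
        ∀ ψ ∈ SplineReg.sobolevBall r R,
          SplineReg.BiasVarianceBound (SplineReg.sampleLaw μ ν n)
            (SplineReg.stableLse t p k τ cHat) ψ
            (C * ((k : ℝ) ^ (2 * r))⁻¹) (C * ((k : ℝ) / n))) ∧
    -- the two bounds balance exactly for `k ≍ n^{1/(2r+1)}`
    (∀ k : ℕ → ℕ, (∀ n, 1 ≤ k n) →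
      ((fun n => ((k n : ℝ) ^ (2 * r))⁻¹) =Θ[atTop] (fun n => (k n : ℝ) / (n : ℝ)) ↔
        (fun n => (k n : ℝ)) =Θ[atTop] (fun n => (n : ℝ) ^ (1 / (2 * (r : ℝ) + 1))))) ∧
    -- the choice `k ≍ n^{1/(2r+1)}` yields the rate `n^{-2r/(2r+1)}` and, if there is noise,
    -- no other choice does
    (∀ (k : ℕ → ℕ) (t : ℕ → ℕ → ℝ)
        (cHat : ∀ n, (Fin n → ℝ) → (Fin n → ℝ) → Fin (k n + p + 1) → ℝ),
      (∀ n, 1 ≤ k n) → (∀ n, SplineReg.QuasiUniformKnots Λ p (k n) (t n)) →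
      (∀ n, SplineReg.IsLeastSquares (t n) p (k n) n (cHat n)) →
      ((fun n => (k n : ℝ)) =Θ[atTop] (fun n => (n : ℝ) ^ (1 / (2 * (r : ℝ) + 1))) →
        ∃ C : ℝ, ∀ᶠ n : ℕ in atTop, ∀ ψ ∈ SplineReg.sobolevBall r R,
          SplineReg.mse (SplineReg.sampleLaw μ ν n)
              (SplineReg.stableLse (t n) p (k n) τ (cHat n)) ψ
            ≤ ENNReal.ofReal (C * (n : ℝ) ^ (-(2 * (r : ℝ)) / (2 * (r : ℝ) + 1)))) ∧
      (0 < ∫ e, e ^ 2 ∂ν →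
        (∃ C : ℝ, ∀ᶠ n : ℕ in atTop, ∀ ψ ∈ SplineReg.sobolevBall r R,
          SplineReg.mse (SplineReg.sampleLaw μ ν n)
              (SplineReg.stableLse (t n) p (k n) τ (cHat n)) ψ
            ≤ ENNReal.ofReal (C * (n : ℝ) ^ (-(2 * (r : ℝ)) / (2 * (r : ℝ) + 1)))) →
        (fun n => (k n : ℝ)) =Θ[atTop] (fun n => (n : ℝ) ^ (1 / (2 * (r : ℝ) + 1))))) ∧
    -- the rate is minimax optimal: for Gaussian noise no estimator beats it over the Sobolev ball
    (∀ σ : ℝ, 0 < σ → ∃ c : ℝ, 0 < c ∧ ∀ n : ℕ, 1 ≤ n →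
      ∀ T : (Fin n → ℝ) → (Fin n → ℝ) → ℝ → ℝ,
        Measurable (fun q : (Fin n → ℝ) × (Fin n → ℝ) × ℝ => T q.1 q.2.1 q.2.2) →
        ∃ ψ ∈ SplineReg.sobolevBall r R,
          ENNReal.ofReal (c * (n : ℝ) ^ (-(2 * (r : ℝ)) / (2 * (r : ℝ) + 1))) ≤
            SplineReg.mse
              (SplineReg.sampleLaw μ (ProbabilityTheory.gaussianReal 0 (σ ^ 2).toNNReal) n) T ψ) := by
  refine ⟨SplineReg.exists_biasVariance_const r p hr hp R Λ hΛ μ a b ha hμa hμb ν hν hν0 τ hτ0 hτa,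
    fun k hk => SplineReg.isTheta_bias_variance_iff r k hk, fun k t cHat hk ht hc => ⟨?_, ?_⟩,
    fun σ hσ => SplineReg.exists_minimax_const r hR hμb hσ⟩
  · exact SplineReg.exists_mse_le_rate hr hp hΛ ha hμa hμb hν hν0 hτ0 hτa hk ht hc
  · exact SplineReg.isTheta_of_mse_le_rate hr hR hΛ hμb hν hν0 hτ0 hk ht hc
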